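/- Let $d\in\{2,3\}$ and let $\Omega\subset\mathbb R^d$ be a bounded, connected, open polygonal ($d=2$) or polyhedral ($d=3$) domain with $\operatorname{int}\overline\Omega=\Omega$. Let $\partial\Omega=\Gamma_D^{displ}\cup\Gamma_N^{stress}=\Gamma_D^{pres}\cup\Gamma_N^{vel}$ be two splittings into closed sets which overlap only in sets of zero $(d-1)$-dimensional measure, with $|\Gamma_D^{displ}|>0$ and $|\Gamma_D^{pres}|>0$. Let $\mathbb M$ be the space of real $d\times d$ matrices. **Meshes.** Let $\mathcal T_h$ be a conforming partition of $\Omega$ into triangles and/or strictly convex quadrilaterals ($d=2$) or tetrahedra ($d=3$), of mesh size $h=\max_E\operatorname{diam}E$, shape regular with constant $\kappa$ (every simplex spanned by $d+1$ vertices of an element $E$ contains a ball of radius $\operatorname{diam}(E)/\kappa$), such that each boundary facet lies in one part of each of the two splittings and each element has at most one facet on $\Gamma_N^{stress}$. For $E\in\mathcal T_h$ let $F_E:\hat E\to E$ be the affine or bilinear bijection from the unit simplex or the unit square, and $J_E=|\det DF_E|$. **Spaces.** On the unit simplex let $\mathcal{BDM}_1=\mathcal P_1^d$, and on the unit square let $\mathcal{BDM}_1=\mathcal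 P_1^2+\operatorname{span}\{\operatorname{curl}(\hat x^2\hat y),\operatorname{curl}(\hat x\hat y^2)\}$, where $\operatorname{curl}\phi=(\partial_2\phi,-\partial_1\phi)$. Let $Z_h$ be the space of all $\zeta\in H(\operatorname{div};\Omega)$ with $\zeta\cdot n=0$ on $\Gamma_N^{vel}$ whose restriction to each $E$ is $J_E^{-1}DF_E\hat\zeta\circ F_E^{-1}$ with $\hat\zeta\in\mathcal{BDM}_1$. Let $\mathbb X_h$ be the space of all $\mathbb M$-valued fields $\tau$ whose rows satisfy the same condition, with $\tau n=0$ on $\Gamma_N^{stress}$ in place of the condition on $\Gamma_N^{vel}$. Let $V_h$ and $W_h$ be the spaces of piecewise constant $\mathbb R^d$-valued and scalar functions, and let $\mathbb Q_h$ be the space of continuous skew-symmetric matrix fields whose entries on each $E$ have the form $\hat\xi\circ F_E^{-1}$ with $\hat\xi\in\mathcal P_1$ (simplices) or $\hat\xi\in\mathcal Q_1$ (quadrilaterals). Let $(\cdot,\cdot)$ be the $L^2(\Omega)$ inner product, and for elementwise continuous $\varphi,\psi$ let $$(\varphi,\psi)_Q=\sum_{E\in\mathcal T_h}\frac{|\hat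 E|}{s_E}\sum_{i=1}^{s_E}\varphi|_E(\mathbf r_i)\cdot\psi|_E(\mathbf r_i)\,J_E(\hat{\mathbf r}_i),$$ where $\mathbf r_i=F_E(\hat{\mathbf r}_i)$, $i=1,\dots,s_E$, are the vertices of $E$ and $\hat{\mathbf r}_i$ those of $\hat E$. **Data.** Let $0<\alpha\le1$ and $c_0\ge0$. Let $A(x):\mathbb M\to\mathbb M$ and $K(x)\in\mathbb M$ be symmetric and positive definite, continuous on each closed element (so that the bounds are uniform). Let $0=t_0<t_1<\dots<t_N=T$, $\Delta t_n=t_n-t_{n-1}$, and let $f(t)\in L^2(\Omega)^d$, $q(t)\in L^2(\Omega)$ for $t\in[0,T]$. Write $\varphi^n=\varphi(t_n)$ and $\partial_t^n\varphi=(\varphi^n-\varphi^{n-1})/\Delta t_n$. **Claim.** There is $h_0>0$, depending only on $\Omega$, on the splitting $\Gamma_D^{displ},\Gamma_N^{stress}$ and on $\kappa$, such that the following holds for every mesh as above that consists of simplices only, or that satisfies $h\le h_0$, and for all data as above. For every initial state $(\sigma_h^0,u_h^0,\gamma_h^0,z_h^0,p_h^0)\in\mathbb X_h\times V_h\times\mathbb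 Q_h\times Z_h\times W_h$ there are unique $(\sigma_h^n,u_h^n,\gamma_h^n,z_h^n,p_h^n)\in\mathbb X_h\times V_h\times\mathbb Q_h\times Z_h\times W_h$, $n=1,\dots,N$, such that for all $n=1,\dots,N$ $$\begin{aligned} &(A(\sigma_h^n+\alpha p_h^nI),\tau)_Q+(u_h^n,\operatorname{div}\tau)+(\gamma_h^n,\tau)_Q=0&&\forall\tau\in\mathbb X_h,\\ &-(\operatorname{div}\sigma_h^n,v)=(f^n,v)&&\forall v\in V_h,\\ &(\sigma_h^n,\xi)_Q=0&&\forall\xi\in\mathbb Q_h,\\ &(K^{-1}z_h^n,\zeta)_Q-(p_h^n,\operatorname{div}\zeta)=0&&\forall\zeta\in Z_h,\\ &(c_0\partial_t^np_h,w)+\alpha(\partial_t^nA(\sigma_h+\alpha p_hI),wI)_Q+(\operatorname{div}z_h^n,w)=(q^n,w)&&\forall w\in W_h. \end{aligned}$$ -/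

import Mathlib

open scoped BigOperators
open MeasureTheory

noncomputable section

namespace MSMFE

/-- Points of `ℝ^d`, and vectors in `ℝ^d`. -/
abbrev Pt (d : ℕ) : Type := Fin d → ℝ

/-- The space of real `d × d` matrices. -/
abbrev Mat (d : ℕ) : Type := Matrix (Fin d) (Fin d) ℝ

/-- The inner product `σ : τ = ∑ σ_ij τ_ij` of matrices. -/
def frob {d : ℕ} (σ τ : Mat d) : ℝ := ∑ i, ∑ j, σ i j * τ i j

/-- Euclidean diameter of a subset of `ℝ^d`. -/
def eDiam {d : ℕ} (s : Set (Pt d)) : ℝ :=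
  Metric.diam ((fun x : Pt d => (WithLp.toLp 2 x : EuclideanSpace ℝ (Fin d))) '' s)

/-- Closed Euclidean ball in `ℝ^d`. -/
def eBall {d : ℕ} (c : Pt d) (r : ℝ) : Set (Pt d) :=
  {x | dist (WithLp.toLp 2 x : EuclideanSpace ℝ (Fin d)) (WithLp.toLp 2 c) ≤ r}

/-- `i`-th partial derivative of a scalar function. -/
def pderiv {d : ℕ} (i : Fin d) (φ : Pt d → ℝ) (x : Pt d) : ℝ :=
  fderiv ℝ φ x (Pi.single i 1)

/-- Classical divergence of a vector field. -/
def divg {d : ℕ} (ζ : Pt d → Pt d) (x : Pt d) : ℝ :=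
  ∑ i, pderiv i (fun y => ζ y i) x

/-- Row-wise classical divergence of a matrix field. -/
def divRow {d : ℕ} (τ : Pt d → Mat d) (x : Pt d) : Pt d :=
  fun k => divg (fun y => τ y k) x

/-! ### Reference elements -/

/-- Shapes of the elements: simplices in any dimension, quadrilaterals in dimension two. -/
inductive Shape : ℕ → Type
  | simplex (d : ℕ) : Shape d
  | quad : Shape 2

/-- Number of vertices. -/
def Shape.nv : {d : ℕ} → Shape d → ℕ
  | d, .simplex _ => d + 1
  | _, .quad => 4

/-- The reference element: the unit simplex, or the unit square. -/
def Shape.ref : {d : ℕ} → Shape d → Set (Pt d)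
  | _, .simplex _ => {x | (∀ i, 0 ≤ x i) ∧ ∑ i, x i ≤ 1}
  | _, .quad => Set.Icc 0 1

/-- Vertices of the reference element (counterclockwise for the square). -/
def Shape.refVert : {d : ℕ} → (s : Shape d) → Fin s.nv → Pt d
  | d, .simplex _ => fun k : Fin (d + 1) =>
      Fin.cases (motive := fun _ => Pt d) 0 (fun i => Pi.single i 1) k
  | _, .quad => fun k : Fin 4 =>
      (![![0, 0], ![1, 0], ![1, 1], ![0, 1]] : Fin 4 → Pt 2) k

/-- Nodal (barycentric, respectively bilinear) functions on the reference element. -/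
def Shape.nodal : {d : ℕ} → (s : Shape d) → Fin s.nv → Pt d → ℝ
  | d, .simplex _ => fun (k : Fin (d + 1)) x =>
      Fin.cases (motive := fun _ => ℝ) (1 - ∑ i, x i) (fun i => x i) k
  | _, .quad => fun (k : Fin 4) x =>
      (![(1 - x 0) * (1 - x 1), x 0 * (1 - x 1), x 0 * x 1, (1 - x 0) * x 1] : Fin 4 → ℝ) k

/-- Vertex sets of the proper faces of an element (including the empty face). -/
def Shape.IsFace : {d : ℕ} → (s : Shape d) → Finset (Fin s.nv) → Prop
  | _, .simplex _ => fun S => S ≠ Finset.univ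
  | _, .quad => fun S : Finset (Fin 4) => S.card ≤ 1 ∨ ∃ k : Fin 4, S = {k, k + 1}

/-- Vertex sets of the facets of an element (edges if `d = 2`, faces if `d = 3`). -/
def Shape.IsFacet : {d : ℕ} → (s : Shape d) → Finset (Fin s.nv) → Prop
  | d, .simplex _ => fun S => S.card = d
  | _, .quad => fun S : Finset (Fin 4) => ∃ k : Fin 4, S = {k, k + 1}

/-- Constants. -/
def P0 (d : ℕ) : Submodule ℝ (Pt d → ℝ) := Submodule.span ℝ {fun _ => 1}

/-- Polynomials of total degree at most one. -/
def P1 (d : ℕ) : Submodule ℝ (Pt d → ℝ) :=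
  Submodule.span ℝ ({fun _ => 1} ∪ Set.range (fun (i : Fin d) (x : Pt d) => x i))

/-- Polynomials in two variables of degree at most one in each variable. -/
def Q1 : Submodule ℝ (Pt 2 → ℝ) :=
  P1 2 ⊔ Submodule.span ℝ {fun x => x 0 * x 1}

/-- Vector fields with components of total degree at most one. -/
def P1vec (d : ℕ) : Submodule ℝ (Pt d → Pt d) where
  carrier := {ζ | ∀ i, (fun x => ζ x i) ∈ P1 d}
  add_mem' := fun ha hb i => (P1 d).add_mem (ha i) (hb i)
  zero_mem' := fun _ => (P1 d).zero_mem
  smul_mem' := fun c _ ha i => (P1 d).smul_mem c (ha i)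

/-- The space `BDM₁` on the reference element: `P₁^d` on the simplex, and
`P₁² + span {curl (x² y), curl (x y²)}` on the square, where `curl φ = (∂₂ φ, -∂₁ φ)`. -/
def Shape.bdm : {d : ℕ} → Shape d → Submodule ℝ (Pt d → Pt d)
  | d, .simplex _ => P1vec d
  | _, .quad => P1vec 2 ⊔ Submodule.span ℝ
      {(fun x => ![x 0 ^ 2, -(2 * x 0 * x 1)]), (fun x => ![2 * x 0 * x 1, -(x 1 ^ 2)])}

/-- Scalar functions used for the entries of the rotation: `P₁` on the simplex,
`Q₁` on the square. -/
def Shape.rot : {d : ℕ} → Shape d → Submodule ℝ (Pt d → ℝ)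
  | d, .simplex _ => P1 d
  | _, .quad => Q1

/-! ### Physical elements -/

/-- The map `F` from the reference element that is determined by the positions of the vertices:
affine on simplices and bilinear on quadrilaterals. -/
def Shape.map {d : ℕ} (s : Shape d) (vert : Fin s.nv → Pt d) (x : Pt d) : Pt d :=
  ∑ k, s.nodal k x • vert k

/-- A nondegenerate element: `F` is injective on the reference element, with nonvanishing Jacobian.
This means that a simplex has affinely independent vertices, and that a quadrilateral is strictly
convex with its vertices listed in cyclic order. -/
structure Element (d : ℕ) where
  shape : Shape d
  vert : Fin shape.nv → Pt d
  injOn : Set.InjOn (shape.map vert) shape.ref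
  det_ne : ∀ x ∈ shape.ref, (fderiv ℝ (shape.map vert) x).det ≠ 0

namespace Element

variable {d : ℕ} (E : Element d)

/-- `F_E` -/
def map : Pt d → Pt d := E.shape.map E.vert

/-- The closed element `E = F_E (Ê)`. -/
def body : Set (Pt d) := E.map '' E.shape.ref

/-- `F_E⁻¹` -/
def inv : Pt d → Pt d := Function.invFunOn E.map E.shape.ref

/-- `J_E = |det DF_E|`, a function on the reference element. -/
def J (y : Pt d) : ℝ := |(fderiv ℝ E.map y).det|

/-- Convex hull of some of the vertices. -/
def hull (S : Finset (Fin E.shape.nv)) : Set (Pt d) := convexHull ℝ (E.vert '' S)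

/-- The change of variables `w = ŵ ∘ F_E⁻¹`. -/
def push {α : Type} (w : Pt d → α) (x : Pt d) : α := w (E.inv x)

/-- The Piola transformation `ζ = (1 / J_E) DF_E ζ̂ ∘ F_E⁻¹`. -/
def piola (ζ : Pt d → Pt d) (x : Pt d) : Pt d :=
  (E.J (E.inv x))⁻¹ • fderiv ℝ E.map (E.inv x) (ζ (E.inv x))

/-- The Piola transformation applied to the rows of a matrix field. -/
def piolaMat (τ : Pt d → Mat d) (x : Pt d) : Mat d :=
  Matrix.of fun k => E.piola (fun y => τ y k) x

end Element

/-! ### Domain, boundary parts, meshes -/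

/-- A splitting of `∂Ω` into a Dirichlet part of positive `(d-1)`-dimensional measure and a
(possibly empty) Neumann part, both closed, which overlap in a null set only. -/
structure BoundarySplit {d : ℕ} (Ω : Set (Pt d)) where
  ΓD : Set (Pt d)
  ΓN : Set (Pt d)
  closedD : IsClosed ΓD
  closedN : IsClosed ΓN
  union_eq : ΓD ∪ ΓN = frontier Ω
  overlap : Measure.hausdorffMeasure ((d : ℝ) - 1) (ΓD ∩ ΓN) = 0
  posD : 0 < Measure.hausdorffMeasure ((d : ℝ) - 1) ΓD

/-- A conforming partition of `Ω` into finitely many elements: the closed elements cover the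
closure of `Ω`, and two different elements meet in a common (possibly empty) proper face. -/
structure Mesh {d : ℕ} (Ω : Set (Pt d)) where
  n : ℕ
  elem : Fin n → Element d
  cover : ⋃ i, (elem i).body = closure Ω
  conform : ∀ i j, i ≠ j → ∃ S T, (elem i).shape.IsFace S ∧ (elem j).shape.IsFace T ∧
    (elem i).body ∩ (elem j).body = (elem i).hull S ∧
    (elem i).body ∩ (elem j).body = (elem j).hull T

/-- The vector field `ζ` belongs to `{ζ ∈ H(div; Ω) : ζ · n = 0 on ∂Ω \ ΓD}`: it is square
integrable and has a square integrable weak divergence `g`, with the vanishing normal trace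
expressed by Green's formula for test functions that need to vanish near `ΓD` only. -/
def MemHdiv {d : ℕ} (Ω ΓD : Set (Pt d)) (ζ : Pt d → Pt d) : Prop :=
  MemLp ζ 2 (volume.restrict Ω) ∧
  ∃ g : Pt d → ℝ, MemLp g 2 (volume.restrict Ω) ∧
    ∀ φ : Pt d → ℝ, ContDiff ℝ (⊤ : ℕ∞) φ → HasCompactSupport φ → Disjoint (tsupport φ) ΓD →
      ∫ x in Ω, ∑ i, ζ x i * pderiv i φ x = -∫ x in Ω, g x * φ x

namespace Mesh

variable {d : ℕ} {Ω : Set (Pt d)} (M : Mesh Ω)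

/-- The mesh size `h`. -/
def size : ℝ := ⨆ i, eDiam (M.elem i).body

/-- All elements are simplices. -/
def IsSimplicial : Prop := ∀ i, (M.elem i).shape = Shape.simplex d

/-- Shape regularity: each simplex spanned by `d + 1` vertices of an element `E` (that is `E`
itself if `E` is a simplex, and the four corner triangles of a quadrilateral) contains a ball
of radius `diam E / κ`. -/
def ShapeRegular (κ : ℝ) : Prop :=
  ∀ i, ∀ S : Finset (Fin (M.elem i).shape.nv), S.card = d + 1 →
    ∃ c, eBall c (eDiam (M.elem i).body / κ) ⊆ (M.elem i).hull S

/-- Each boundary facet lies in the Dirichlet part or in the Neumann part. -/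
def Resolves (Γ : BoundarySplit Ω) : Prop :=
  ∀ i S, (M.elem i).shape.IsFacet S → (M.elem i).hull S ⊆ frontier Ω →
    (M.elem i).hull S ⊆ Γ.ΓD ∨ (M.elem i).hull S ⊆ Γ.ΓN

/-- Each element has at most one facet on the Neumann part. -/
def AtMostOneNeumannFacet (Γ : BoundarySplit Ω) : Prop :=
  ∀ i S T, (M.elem i).shape.IsFacet S → (M.elem i).shape.IsFacet T →
    (M.elem i).hull S ⊆ Γ.ΓN → (M.elem i).hull T ⊆ Γ.ΓN → S = T

/-- The vector field on `Ω` which agrees with `ζ i` inside the `i`-th element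
(and has the irrelevant value zero on the null set of all facets). -/
def glue (ζ : Fin M.n → Pt d → Pt d) (x : Pt d) : Pt d :=
  ∑ i, (interior (M.elem i).body).indicator (ζ i) x

/-! A finite element function is represented by the family of its pull-backs to the reference
elements; since these are polynomials, the family is determined by the function. -/

/-- Elementwise physical vector field of a family of reference vector fields. -/
def vecField (ζ : Fin M.n → Pt d → Pt d) (i : Fin M.n) : Pt d → Pt d := (M.elem i).piola (ζ i)

/-- Elementwise physical matrix field of a family of reference matrix fields (stress). -/
def matField (τ : Fin M.n → Pt d → Mat d) (i : Fin M.n) : Pt d → Mat d :=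
  (M.elem i).piolaMat (τ i)

/-- Elementwise physical function of a family of reference functions
(displacement, rotation, pressure). -/
def funField {α : Type} (w : Fin M.n → Pt d → α) (i : Fin M.n) : Pt d → α :=
  (M.elem i).push (w i)

/-- Stress space `𝕏_h`: row-wise `BDM₁`, in `H(div; Ω, 𝕄)`, with `τ n = 0` on the Neumann part. -/
def Xh (Γ : BoundarySplit Ω) : Set (Fin M.n → Pt d → Mat d) :=
  {τ | (∀ i k, (fun y => τ i y k) ∈ (M.elem i).shape.bdm) ∧
    ∀ k, MemHdiv Ω Γ.ΓD (M.glue fun i x => M.matField τ i x k)}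

/-- Displacement space `V_h`: piecewise constant vectors. -/
def Vh : Set (Fin M.n → Pt d → Pt d) := {v | ∀ i k, (fun y => v i y k) ∈ P0 d}

/-- Rotation space `ℚ_h`: continuous skew-symmetric matrix fields with entries which are
mapped `P₁` functions on simplices and mapped `Q₁` functions on quadrilaterals. -/
def Qh : Set (Fin M.n → Pt d → Mat d) :=
  {ξ | (∀ i k l, (fun y => ξ i y k l) ∈ (M.elem i).shape.rot) ∧
    (∀ i y, (ξ i y).transpose = -(ξ i y)) ∧
    ∃ g : Pt d → Mat d, ContinuousOn g Ω ∧
      ∀ i, ∀ x ∈ (M.elem i).body ∩ Ω, M.funField ξ i x = g x}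

/-- Velocity space `Z_h`: `BDM₁`, in `H(div; Ω)`, with `ζ · n = 0` on the Neumann part. -/
def Zh (Γ : BoundarySplit Ω) : Set (Fin M.n → Pt d → Pt d) :=
  {ζ | (∀ i, ζ i ∈ (M.elem i).shape.bdm) ∧ MemHdiv Ω Γ.ΓD (M.glue (M.vecField ζ))}

/-- Pressure space `W_h`: piecewise constants. -/
def Wh : Set (Fin M.n → Pt d → ℝ) := {w | ∀ i, w i ∈ P0 d}

/-- `L²(Ω)` inner product of elementwise defined scalar functions. -/
def l2 (φ ψ : Fin M.n → Pt d → ℝ) : ℝ := ∑ i, ∫ x in (M.elem i).body, φ i x * ψ i x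

/-- `L²(Ω)` inner product of elementwise defined vector fields. -/
def l2v (φ ψ : Fin M.n → Pt d → Pt d) : ℝ := ∑ i, ∫ x in (M.elem i).body, φ i x ⬝ᵥ ψ i x

/-- The elementwise vertex quadrature rule `(φ, ψ)_Q`, with the pointwise inner product `ip`. -/
def quadr {α : Type} (ip : α → α → ℝ) (φ ψ : Fin M.n → Pt d → α) : ℝ :=
  ∑ i, (volume.real (M.elem i).shape.ref / (M.elem i).shape.nv) *
    ∑ k, ip (φ i ((M.elem i).vert k)) (ψ i ((M.elem i).vert k)) *
      (M.elem i).J ((M.elem i).shape.refVert k)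

/-- Material data. The compliance tensor `A` and the permeability `K` are elementwise continuous
(`A i`, `K i` stand for the restrictions to the closed `i`-th element), symmetric and positive
definite; by compactness they are then bounded and uniformly positive definite. -/
structure Material where
  A : Fin M.n → Pt d → Mat d →ₗ[ℝ] Mat d
  K : Fin M.n → Pt d → Mat d
  α : ℝ
  c₀ : ℝ
  contA : ∀ i τ, ContinuousOn (fun x => A i x τ) (M.elem i).body
  symmA : ∀ i, ∀ x ∈ (M.elem i).body, ∀ σ τ, frob (A i x σ) τ = frob σ (A i x τ)
  posA : ∀ i, ∀ x ∈ (M.elem i).body, ∀ τ, τ ≠ 0 → 0 < frob (A i x τ) τ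
  contK : ∀ i, ContinuousOn (K i) (M.elem i).body
  posK : ∀ i, ∀ x ∈ (M.elem i).body, (K i x).PosDef
  α_pos : 0 < α
  α_le : α ≤ 1
  c₀_nonneg : 0 ≤ c₀

/-- A tuple `(σ_h, u_h, γ_h, z_h, p_h)` of families of reference functions. -/
@[ext] structure State where
  σ : Fin M.n → Pt d → Mat d
  u : Fin M.n → Pt d → Pt d
  γ : Fin M.n → Pt d → Mat d
  z : Fin M.n → Pt d → Pt d
  p : Fin M.n → Pt d → ℝ

/-- `(σ_h, u_h, γ_h, z_h, p_h) ∈ 𝕏_h × V_h × ℚ_h × Z_h × W_h`. -/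
def Admissible (disp pres : BoundarySplit Ω) (s : M.State) : Prop :=
  s.σ ∈ M.Xh disp ∧ s.u ∈ M.Vh ∧ s.γ ∈ M.Qh ∧ s.z ∈ M.Zh pres ∧ s.p ∈ M.Wh

variable {M}

/-- The elementwise field `A (σ_h + α p_h I)`. -/
def Material.strain (D : M.Material) (s : M.State) (i : Fin M.n) (x : Pt d) : Mat d :=
  D.A i x (M.matField s.σ i x + (D.α * M.funField s.p i x) • (1 : Mat d))

/-- One step of the backward Euler scheme, from the state `s'` to the state `s`, with time step
`Δt` and with the source terms `f`, `q` at the new time. -/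
def Material.Step (D : M.Material) (disp pres : BoundarySplit Ω) (Δt : ℝ)
    (f : Pt d → Pt d) (q : Pt d → ℝ) (s' s : M.State) : Prop :=
  (∀ τ ∈ M.Xh disp,
    M.quadr frob (D.strain s) (M.matField τ)
      + M.l2v (M.funField s.u) (fun i => divRow (M.matField τ i))
      + M.quadr frob (M.funField s.γ) (M.matField τ) = 0) ∧
  (∀ v ∈ M.Vh,
    -M.l2v (fun i => divRow (M.matField s.σ i)) (M.funField v)
      = M.l2v (fun _ => f) (M.funField v)) ∧
  (∀ ξ ∈ M.Qh, M.quadr frob (M.matField s.σ) (M.funField ξ) = 0) ∧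
  (∀ ζ ∈ M.Zh pres,
    M.quadr (fun a b => a ⬝ᵥ b)
        (fun i x => (D.K i x)⁻¹.mulVec (M.vecField s.z i x)) (M.vecField ζ)
      - M.l2 (M.funField s.p) (fun i => divg (M.vecField ζ i)) = 0) ∧
  (∀ w ∈ M.Wh,
    M.l2 (fun i x => D.c₀ * ((M.funField s.p i x - M.funField s'.p i x) / Δt)) (M.funField w)
      + D.α * M.quadr frob (fun i x => Δt⁻¹ • (D.strain s i x - D.strain s' i x))
          (fun i x => M.funField w i x • (1 : Mat d))
      + M.l2 (fun i => divg (M.vecField s.z i)) (M.funField w)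
      = M.l2 (fun _ => q) (M.funField w))

end Mesh

end MSMFE

end

/-! Each time step is a linear system on finite-dimensional spaces in which test and trial spaces
coincide, so it is enough that the homogeneous system has only the zero solution
(`Mesh.Material.eq_zero_of_homogeneous`). Testing every equation with its own unknown and adding,
all coupling terms cancel. What remains is a vanishing sum of three nonnegative terms: the energies
of `σ + α p I` and of `z` in the vertex quadrature, and a term with `c₀ p²`. A `BDM₁` field is
determined by its values at the vertices, so the quadrature is definite: `z = 0`, and `σ + α p I =
0` at all vertices. Since `c₀` may vanish, `p = 0` is deduced from surjectivity of the discrete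
divergence (`Mesh.pressure_eq_zero`). Then `σ = 0`, and `u`, `γ` satisfy `(u, div τ) + (γ, τ)_Q = 0`
for all stresses `τ`. The heart of the proof is that this forces `u = 0` and `γ = 0`.

To exploit the last equation, fix a facet and one of its vertices `k`. There is a `BDM₁` field on
the element which vanishes at the other vertices, equals at `k` the edge leaving the facet, and has
a normal trace carried by that facet only. By Green's formula (`Element.green_corner`) the trace, as
a functional, depends on the vertices of the facet but not on the element. Hence such a corner
function on a Dirichlet facet, and the difference of two of them across a shared facet, belong to
the discrete space. Testing with their vector multiples yields the local relations `Mesh.Kernel`.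
With `b` the edge leaving the facet at `k` and `q` the quadrature weight, they read `m u = q γ_k b`
on a Dirichlet facet and `m (u' - u) = γ_k (q' b' - q b)` across a shared one. The mass `m` is
common to all elements. If `γ = 0`, these relations propagate `u = 0` from a Dirichlet facet through
the connected mesh.

In the plane `γ` is a scalar times a fixed rotation. A zero at one vertex spreads along every facet
which is not Neumann, and each element has at most one Neumann facet, so `γ` vanishes everywhere or
nowhere (`Mesh.Kernel.eq_zero_of_exists_zero`). On a triangle with a Dirichlet edge, the relations
at the two ends share the opposite vertex and force a zero. With quadrilaterals, suppose that `γ`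
vanishes nowhere and follow a straight piece of the Dirichlet boundary. The two lateral edges of
each element on it are parallel, while from one element to the next their slope grows by at least `2
/ κ` (`Mesh.Kernel.exists_next`). Shape regularity bounds slopes by `κ / 2`, so only boundedly many
elements fit, which is impossible on a fine mesh. The straight piece is chosen once from `Ω` and the
splitting, whence a threshold independent of the mesh.

In space let `w` be the axial vector of `γ`. Across a shared face the differences of `w` between
vertices of that face are parallel to the vector joining the two opposite vertices. If `w` is not
constant on some tetrahedron, with a difference `e`, then a neighbour is again nonconstant in
direction `e` and has its new vertex displaced by a positive multiple of `e`
(`Mesh.Kernel.exists_up`). An element maximizing `e · (sum of vertices)` contradicts this. So `w` is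
constant on each tetrahedron; at a Dirichlet face it is parallel to two different edges, hence zero.
-/

noncomputable section

namespace MSMFE

/-! ### Reference elements: nodal functions, bounding half-spaces, the open element. -/

namespace Shape

/-- Vertex set of the facet number `f`. -/
def facet : {d : ℕ} → (s : Shape d) → Fin s.nv → Finset (Fin s.nv)
  | d, .simplex _ => fun f : Fin (d + 1) => Finset.univ.erase f
  | _, .quad => fun f : Fin 4 => {f, f + 1}

/-- The vertex adjacent to the vertex `k` of the facet `f` which does not belong to the facet. -/
def opp : {d : ℕ} → (s : Shape d) → Fin s.nv → Fin s.nv → Fin s.nv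
  | _, .simplex _ => fun f _ => f
  | _, .quad => fun (f k : Fin 4) => (if k = f then f + 3 else f + 2 : Fin 4)

/-- Linear part of `bd`. -/
def bdLin : {d : ℕ} → (s : Shape d) → Fin s.nv → Pt d →ₗ[ℝ] ℝ
  | d, .simplex _ => fun f : Fin (d + 1) =>
      Fin.cases (motive := fun _ => Pt d →ₗ[ℝ] ℝ) (-∑ i, LinearMap.proj i)
        (fun i => LinearMap.proj i) f
  | _, .quad => fun f : Fin 4 =>
      (![LinearMap.proj 1, -LinearMap.proj 0, -LinearMap.proj 1, LinearMap.proj 0] :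
        Fin 4 → Pt 2 →ₗ[ℝ] ℝ) f

/-- Constant part of `bd`. -/
def bdConst : {d : ℕ} → (s : Shape d) → Fin s.nv → ℝ
  | d, .simplex _ => fun f : Fin (d + 1) => Fin.cases (motive := fun _ => ℝ) 1 (fun _ => 0) f
  | _, .quad => fun f : Fin 4 => (![0, 1, 1, 0] : Fin 4 → ℝ) f

/-- The affine function which vanishes on the facet `f` and is positive inside the element. -/
def bd {d : ℕ} (s : Shape d) (f : Fin s.nv) (y : Pt d) : ℝ := s.bdConst f + s.bdLin f y

/-- The reference function in `BDM₁` whose normal component vanishes at all the vertices of all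
the facets, except for the vertex `k` of the facet `f`. -/
def corner : {d : ℕ} → (s : Shape d) → Fin s.nv → Fin s.nv → Pt d → Pt d
  | d, .simplex _ => fun (f k : Fin (d + 1)) y =>
      (Shape.simplex d).nodal k y • ((Shape.simplex d).refVert f - (Shape.simplex d).refVert k)
  | _, .quad => fun (f k : Fin 4) y =>
      if f = 0 ∨ f = 2 then
        ![(1 - 2 * Shape.quad.refVert k 0) / 2 * (y 0 * (1 - y 0)),
          (1 - 2 * Shape.quad.refVert k 1) * Shape.quad.nodal k y]
      else
        ![(1 - 2 * Shape.quad.refVert k 0) * Shape.quad.nodal k y,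
          (1 - 2 * Shape.quad.refVert k 1) / 2 * (y 1 * (1 - y 1))]

/-- The (constant) divergence of a function in `BDM₁`, by central differences. -/
def dv (d : ℕ) : (Pt d → Pt d) →ₗ[ℝ] ℝ where
  toFun ζ := ∑ i, (ζ (Pi.single i (1 / 2)) i - ζ (-Pi.single i (1 / 2)) i)
  map_add' ζ η := by
    rw [← Finset.sum_add_distrib]; exact Finset.sum_congr rfl fun i _ => by simp; ring
  map_smul' c ζ := by
    simp only [Pi.smul_apply, smul_eq_mul, RingHom.id_apply, Finset.mul_sum]
    exact Finset.sum_congr rfl fun i _ => by ring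

/-- Vertices of the unit simplex. -/
def simplexVert {d : ℕ} (k : Fin (d + 1)) : Pt d :=
  Fin.cases (motive := fun _ => Pt d) 0 (fun i => Pi.single i 1) k

/-- Barycentric coordinates of the unit simplex. -/
def simplexNodal {d : ℕ} (k : Fin (d + 1)) (x : Pt d) : ℝ :=
  Fin.cases (motive := fun _ => ℝ) (1 - ∑ i, x i) (fun i => x i) k

/-- Vertices of the unit square. -/
def quadVert (k : Fin 4) : Pt 2 := (![![0, 0], ![1, 0], ![1, 1], ![0, 1]] : Fin 4 → Pt 2) k

/-- Bilinear nodal functions of the unit square. -/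
def quadNodal (k : Fin 4) (x : Pt 2) : ℝ :=
  (![(1 - x 0) * (1 - x 1), x 0 * (1 - x 1), x 0 * x 1, (1 - x 0) * x 1] : Fin 4 → ℝ) k

@[simp] lemma simplexVert_zero {d : ℕ} : simplexVert (0 : Fin (d + 1)) = 0 := rfl

@[simp] lemma simplexVert_succ {d : ℕ} (i : Fin d) :
    simplexVert i.succ = Pi.single i (1 : ℝ) := rfl

@[simp] lemma simplexNodal_zero {d : ℕ} (x : Pt d) :
    simplexNodal (0 : Fin (d + 1)) x = 1 - ∑ i, x i := rfl

@[simp] lemma simplexNodal_succ {d : ℕ} (i : Fin d) (x : Pt d) :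
    simplexNodal i.succ x = x i := rfl

lemma quad_bd (f : Fin 4) (y : Pt 2) :
    Shape.quad.bd f y = (![y 1, 1 - y 0, 1 - y 1, y 0] : Fin 4 → ℝ) f := by
  fin_cases f <;> simp [bd, bdConst, bdLin, sub_eq_add_neg] 

lemma simplex_bd {d : ℕ} (f : Fin (d + 1)) (y : Pt d) :
    (Shape.simplex d).bd f y = simplexNodal f y := by
  refine Fin.cases ?_ (fun k => ?_) f <;> simp [bd, bdConst, bdLin, sub_eq_add_neg]

section basic

variable {d : ℕ} (s : Shape d)

lemma card_nodal_sum (y : Pt d) : ∑ k, s.nodal k y = 1 := by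
  cases s with
  | simplex =>
    -- After `cases s` the index type `Fin s.nv` is `Fin (d + 1)` or `Fin 4` only by definition.
    -- Restating the goal with the concrete copies lets `Fin.cases`, `fin_cases` and `decide` act;
    -- the device recurs in most case distinctions on the shape.
    change ∑ k : Fin (d + 1), simplexNodal k y = 1
    rw [Fin.sum_univ_succ]; simp
  | quad =>
    change ∑ k : Fin 4, quadNodal k y = 1
    rw [Fin.sum_univ_four]; simp [quadNodal]; ring

lemma nodal_refVert (k l : Fin s.nv) : s.nodal k (s.refVert l) = if k = l then 1 else 0 := by
  cases s with
  | simplex =>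
    revert k l
    change ∀ k l : Fin (d + 1), simplexNodal k (simplexVert l) = if k = l then 1 else 0
    intro k l
    refine Fin.cases ?_ (fun k => ?_) k <;> refine Fin.cases ?_ (fun l => ?_) l
    · simp
    · simp [(Fin.succ_ne_zero l).symm]
    · simp
    · simp [Pi.single_apply]
  | quad =>
    revert k l
    change ∀ k l : Fin 4, quadNodal k (quadVert l) = if k = l then 1 else 0
    intro k l
    fin_cases k <;> fin_cases l <;> simp [quadNodal, quadVert]

lemma mem_ref_iff (y : Pt d) : y ∈ s.ref ↔ ∀ f, 0 ≤ s.bd f y := by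
  cases s with
  | simplex =>
    change _ ↔ ∀ f : Fin (d + 1), 0 ≤ (Shape.simplex d).bd f y
    simp only [simplex_bd, Fin.forall_fin_succ]
    simp [ref, and_comm]
  | quad =>
    change _ ↔ ∀ f : Fin 4, 0 ≤ Shape.quad.bd f y
    simp only [quad_bd]
    simp [ref, Fin.forall_fin_succ, Pi.le_def]
    tauto

lemma nodal_nonneg {y : Pt d} (hy : y ∈ s.ref) (k : Fin s.nv) : 0 ≤ s.nodal k y := by
  cases s with
  | simplex =>
    obtain ⟨h1, h2⟩ := hy
    revert k
    change ∀ k : Fin (d + 1), 0 ≤ simplexNodal k y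
    rw [Fin.forall_fin_succ]
    exact ⟨by simpa using h2, fun i => by simpa using h1 i⟩
  | quad =>
    obtain ⟨h1, h2⟩ := hy
    have a0 := h1 0; have a1 := h1 1; have b0 := h2 0; have b1 := h2 1
    simp at a0 a1 b0 b1
    revert k
    change ∀ k : Fin 4, 0 ≤ quadNodal k y
    intro k
    fin_cases k <;> simp [quadNodal] <;>
      exact mul_nonneg (by linarith) (by linarith)

lemma refVert_mem (k : Fin s.nv) : s.refVert k ∈ s.ref := by
  cases s with
  | simplex =>
    revert k
    change ∀ k : Fin (d + 1), simplexVert k ∈ (Shape.simplex d).ref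
    rw [Fin.forall_fin_succ]
    refine ⟨by simp [ref], fun i => ?_⟩
    refine ⟨fun j => ?_, by simp⟩
    by_cases h : j = i <;> simp [Pi.single_apply, h]
  | quad =>
    revert k
    change ∀ k : Fin 4, quadVert k ∈ Shape.quad.ref
    intro k
    fin_cases k <;> simp [quadVert, ref, Pi.le_def]

/-- A point of the reference element is the combination of the vertices with nodal weights. -/
lemma map_refVert (y : Pt d) : s.map s.refVert y = y := by
  cases s with
  | simplex =>
    change ∑ k : Fin (d + 1), simplexNodal k y • simplexVert k = y
    rw [Fin.sum_univ_succ]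
    funext j
    simp [Pi.single_apply]
  | quad =>
    change ∑ k : Fin 4, quadNodal k y • quadVert k = y
    rw [Fin.sum_univ_four]
    funext j
    fin_cases j <;> simp [quadNodal, quadVert] <;> ring

lemma convex_ref : Convex ℝ s.ref := by
  have h : s.ref = ⋂ f, {y | 0 ≤ s.bd f y} := by
    ext y; simp [mem_ref_iff]
  rw [h]
  refine convex_iInter fun f => ?_
  have : {y | 0 ≤ s.bd f y} = {y | -s.bdConst f ≤ s.bdLin f y} := by
    ext y; simp only [Set.mem_ofPred_eq, bd]; constructor <;> intro h <;> linarith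
  rw [this]
  exact convex_halfSpace_ge (s.bdLin f).isLinear _

lemma continuous_bd (f : Fin s.nv) : Continuous (s.bd f) :=
  continuous_const.add (s.bdLin f).continuous_of_finiteDimensional

lemma isClosed_ref : IsClosed s.ref := by
  have h : s.ref = ⋂ f, {y | 0 ≤ s.bd f y} := by
    ext y; simp [mem_ref_iff]
  rw [h]
  exact isClosed_iInter fun f => isClosed_le continuous_const (s.continuous_bd f)

lemma isCompact_ref : IsCompact s.ref := by
  refine (isCompact_Icc (a := (0 : Pt d)) (b := 1)).of_isClosed_subset s.isClosed_ref ?_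
  cases s with
  | simplex =>
    rintro y ⟨h1, h2⟩
    refine ⟨h1, fun i => ?_⟩
    exact (Finset.single_le_sum (fun j _ => h1 j) (Finset.mem_univ i)).trans h2
  | quad => exact fun y hy => hy

/-- The open reference element. -/
def inner : Set (Pt d) := {y | ∀ f, 0 < s.bd f y}

lemma isOpen_inner : IsOpen s.inner := by
  have h : s.inner = ⋂ f, {y | 0 < s.bd f y} := by
    ext y; simp [inner]
  rw [h]
  exact isOpen_iInter_of_finite fun f => isOpen_lt continuous_const (s.continuous_bd f)

lemma inner_subset : s.inner ⊆ s.ref := fun y hy => (s.mem_ref_iff y).2 fun f => (hy f).le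

lemma bd_combo (f : Fin s.nv) (x y : Pt d) (t : ℝ) :
    s.bd f (x + t • (y - x)) = (1 - t) * s.bd f x + t * s.bd f y := by
  simp [bd, map_add, map_smul, map_sub]; ring

lemma bd_add (f : Fin s.nv) (x v : Pt d) : s.bd f (x + v) = s.bd f x + s.bdLin f v := by
  simp [bd, map_add]; ring

lemma inner_nonempty : s.inner.Nonempty := by
  cases s with
  | simplex =>
    refine ⟨fun _ => 1 / (d + 1 : ℝ), ?_⟩
    change ∀ f : Fin (d + 1), 0 < (Shape.simplex d).bd f _
    have hd : (0 : ℝ) < d + 1 := by positivity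
    simp only [simplex_bd, Fin.forall_fin_succ]
    refine ⟨?_, fun i => ?_⟩
    · simp
      rw [← div_eq_mul_inv, div_lt_one hd]; linarith
    · simp; positivity
  | quad =>
    refine ⟨fun _ => 1 / 2, ?_⟩
    change ∀ f : Fin 4, 0 < Shape.quad.bd f _
    intro f
    simp only [quad_bd]
    fin_cases f <;> simp <;> norm_num

lemma ref_subset_closure_inner : s.ref ⊆ closure s.inner := by
  intro y hy
  obtain ⟨c, hc⟩ := s.inner_nonempty
  have hcont : ContinuousWithinAt (fun t : ℝ => y + t • (c - y)) (Set.Ioo 0 1) 0 := by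
    fun_prop
  have h0 : (0 : ℝ) ∈ closure (Set.Ioo (0 : ℝ) 1) := by
    rw [closure_Ioo zero_ne_one]; simp
  have := hcont.mem_closure h0 (t := s.inner) ?_
  · simpa using this
  · intro t ht f
    rw [bd_combo]
    have := (s.mem_ref_iff y).1 hy f
    have h1 := mul_nonneg (sub_nonneg.2 ht.2.le) this
    have h2 := mul_pos ht.1 (hc f)
    linarith

/-- The frontier of a convex set is null. A point where some `bd f` vanishes is on the frontier,
because moving from it away from an inner point makes `bd f` negative. -/
lemma volume_ref_diff_inner : volume (s.ref \ s.inner) = 0 := by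
  refine measure_mono_null ?_ (s.convex_ref.addHaar_frontier volume)
  rintro y ⟨hy, hn⟩
  refine ⟨subset_closure hy, fun hi => hn fun f => ?_⟩
  refine lt_of_le_of_ne ((s.mem_ref_iff y).1 hy f) fun h0 => ?_
  obtain ⟨c, hc⟩ := s.inner_nonempty
  have hcont : ContinuousAt (fun t : ℝ => y + t • (c - y)) 0 := by fun_prop
  have : ∀ᶠ t : ℝ in nhds 0, y + t • (c - y) ∈ s.ref := by
    apply hcont.eventually_mem
    simpa using mem_interior_iff_mem_nhds.1 hi
  obtain ⟨ε, he, hb⟩ := Metric.eventually_nhds_iff.1 this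
  have := (s.mem_ref_iff _).1 (hb (y := -(ε / 2)) (by
    simp [abs_of_pos he]; linarith)) f
  rw [bd_combo, ← h0] at this
  have := mul_pos he (hc f)
  nlinarith

lemma volume_ref_lt_top : volume s.ref < ⊤ := s.isCompact_ref.measure_lt_top

lemma volume_real_ref_pos : 0 < volume.real s.ref := by
  refine ENNReal.toReal_pos ?_ s.volume_ref_lt_top.ne
  exact ((s.isOpen_inner.measure_pos volume s.inner_nonempty).trans_le
    (measure_mono s.inner_subset)).ne'

lemma nv_pos : 0 < s.nv := by cases s <;> simp [nv]

end basic

end Shape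

/-! ### Combinatorics of vertices, facets and opposite vertices. -/

namespace Shape

section facets

variable {d : ℕ} (s : Shape d)

lemma isFacet_iff (S : Finset (Fin s.nv)) : s.IsFacet S ↔ ∃ f, S = s.facet f := by
  cases s with
  | simplex =>
    change Finset (Fin (d + 1)) at S
    change S.card = d ↔ ∃ f : Fin (d + 1), S = Finset.univ.erase f
    constructor
    · intro h
      have h1 : Sᶜ.card = 1 := by rw [Finset.card_compl, h]; simp
      obtain ⟨f, hf⟩ := Finset.card_eq_one.1 h1
      refine ⟨f, ?_⟩
      rw [← compl_compl S, hf]; ext; simp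
    · rintro ⟨f, rfl⟩
      simp
  | quad => exact Iff.rfl

lemma card_facet (f : Fin s.nv) : (s.facet f).card = d := by
  cases s with
  | simplex =>
    revert f
    change ∀ f : Fin (d + 1), (Finset.univ.erase f).card = d
    simp
  | quad =>
    revert f
    change ∀ f : Fin 4, ({f, f + 1} : Finset (Fin 4)).card = 2
    decide

lemma facet_injective : Function.Injective s.facet := by
  cases s with
  | simplex =>
    intro f g h
    change Finset.univ.erase (f : Fin (d + 1)) = Finset.univ.erase (g : Fin (d + 1)) at h
    by_contra hne
    have : f ∈ Finset.univ.erase (g : Fin (d + 1)) :=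
      Finset.mem_erase.2 ⟨hne, Finset.mem_univ (α := Fin (d + 1)) f⟩
    rw [← h] at this
    simp at this
  | quad =>
    change ∀ f g : Fin 4, ({f, f + 1} : Finset (Fin 4)) = {g, g + 1} → f = g
    decide

lemma isFace_of_subset_facet {f : Fin s.nv} {S : Finset (Fin s.nv)} (h : S ⊆ s.facet f) :
    s.IsFace S := by
  cases s with
  | simplex =>
    change Finset (Fin (d + 1)) at S
    change S ≠ Finset.univ
    rintro rfl
    have := h (Finset.mem_univ (α := Fin (d + 1)) f)
    exact absurd this (Finset.notMem_erase (α := Fin (d + 1)) f Finset.univ)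
  | quad =>
    revert f S
    change ∀ (f : Fin 4) (S : Finset (Fin 4)), S ⊆ {f, f + 1} →
      (S.card ≤ 1 ∨ ∃ k : Fin 4, S = {k, k + 1})
    decide

lemma isFace_facet (f : Fin s.nv) : s.IsFace (s.facet f) :=
  s.isFace_of_subset_facet subset_rfl

lemma IsFace.eq_facet {s : Shape d} {S : Finset (Fin s.nv)} (hS : s.IsFace S) {f : Fin s.nv}
    (h : s.facet f ⊆ S) : S = s.facet f := by
  cases s with
  | simplex =>
    revert f S
    change ∀ S : Finset (Fin (d + 1)), S ≠ Finset.univ →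
      ∀ f : Fin (d + 1), Finset.univ.erase f ⊆ S → S = Finset.univ.erase f
    intro S hS f h
    refine (Finset.eq_of_subset_of_card_le h ?_).symm
    have := (Finset.card_lt_iff_ne_univ S).2 hS
    simp at this ⊢
    omega
  | quad =>
    revert f S
    change ∀ S : Finset (Fin 4), (S.card ≤ 1 ∨ ∃ k : Fin 4, S = {k, k + 1}) →
      ∀ f : Fin 4, {f, f + 1} ⊆ S → S = {f, f + 1}
    decide

lemma IsFace.exists_facet {s : Shape d} {S : Finset (Fin s.nv)} (hS : s.IsFace S)
    (h : d ≤ S.card) : ∃ f, S = s.facet f := by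
  rw [← isFacet_iff]
  cases s with
  | simplex =>
    revert S
    change ∀ S : Finset (Fin (d + 1)), S ≠ Finset.univ → d ≤ S.card → S.card = d
    intro S hS h
    have := (Finset.card_lt_iff_ne_univ S).2 hS
    simp at this
    omega
  | quad =>
    rcases hS with h1 | h1
    · exact absurd (h.trans h1) (by norm_num)
    · exact h1

lemma opp_notMem {f k : Fin s.nv} (hk : k ∈ s.facet f) : s.opp f k ∉ s.facet f := by
  cases s with
  | simplex => exact Finset.notMem_erase (α := Fin (d + 1)) f Finset.univ
  | quad =>
    revert f k
    change ∀ f k : Fin 4, k ∈ ({f, f + 1} : Finset (Fin 4)) →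
      (if k = f then f + 3 else f + 2) ∉ ({f, f + 1} : Finset (Fin 4))
    decide

lemma bd_refVert_of_mem {f k : Fin s.nv} (hk : k ∈ s.facet f) : s.bd f (s.refVert k) = 0 := by
  cases s with
  | simplex =>
    revert f k
    change ∀ f k : Fin (d + 1), k ∈ Finset.univ.erase f →
      (Shape.simplex d).bd f (simplexVert k) = 0
    intro f k hk
    rw [simplex_bd]
    refine ((Shape.simplex d).nodal_refVert f k).trans (if_neg ?_)
    rintro rfl
    exact Finset.notMem_erase (α := Fin (d + 1)) f Finset.univ hk
  | quad =>
    revert f k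
    change ∀ f k : Fin 4, k ∈ ({f, f + 1} : Finset (Fin 4)) → Shape.quad.bd f (quadVert k) = 0
    intro f k
    rw [quad_bd]
    fin_cases f <;> fin_cases k <;> simp [quadVert]

lemma bd_refVert_of_notMem {f k : Fin s.nv} (hk : k ∉ s.facet f) :
    s.bd f (s.refVert k) = 1 := by
  cases s with
  | simplex =>
    revert f k
    change ∀ f k : Fin (d + 1), k ∉ Finset.univ.erase f →
      (Shape.simplex d).bd f (simplexVert k) = 1
    intro f k hk
    rw [simplex_bd]
    refine ((Shape.simplex d).nodal_refVert f k).trans (if_pos ?_)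
    by_contra hne
    exact hk (Finset.mem_erase.2 ⟨fun h => hne h.symm, Finset.mem_univ (α := Fin (d + 1)) k⟩)
  | quad =>
    revert f k
    change ∀ f k : Fin 4, k ∉ ({f, f + 1} : Finset (Fin 4)) → Shape.quad.bd f (quadVert k) = 1
    intro f k
    rw [quad_bd]
    fin_cases f <;> fin_cases k <;> simp [quadVert]

lemma bdLin_sub (f : Fin s.nv) (x y : Pt d) : s.bdLin f (x - y) = s.bd f x - s.bd f y := by
  simp [bd, map_sub]

lemma bdLin_opp {f k : Fin s.nv} (hk : k ∈ s.facet f) :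
    s.bdLin f (s.refVert (s.opp f k) - s.refVert k) = 1 := by
  rw [bdLin_sub, s.bd_refVert_of_mem hk, s.bd_refVert_of_notMem (s.opp_notMem hk), sub_zero]

/-- On the reference element, a facet is the set where `bd` vanishes. -/
lemma nodal_eq_zero_iff {y : Pt d} (hy : y ∈ s.ref) (f : Fin s.nv) :
    (∀ l, l ∉ s.facet f → s.nodal l y = 0) ↔ s.bd f y = 0 := by
  cases s with
  | simplex =>
    revert f
    change ∀ f : Fin (d + 1), (∀ l : Fin (d + 1), l ∉ Finset.univ.erase f →
      simplexNodal l y = 0) ↔ (Shape.simplex d).bd f y = 0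
    intro f
    rw [simplex_bd]
    simp only [Finset.mem_erase, Finset.mem_univ, and_true, not_not, forall_eq]
  | quad =>
    revert f
    change ∀ f : Fin 4, (∀ l : Fin 4, l ∉ ({f, f + 1} : Finset (Fin 4)) → quadNodal l y = 0) ↔
      Shape.quad.bd f y = 0
    intro f
    rw [quad_bd]
    obtain ⟨h1, h2⟩ := hy
    have a0 := h1 0; have a1 := h1 1; have b0 := h2 0; have b1 := h2 1
    simp at a0 a1 b0 b1
    constructor
    · intro h
      fin_cases f
      · have e1 := h 2 (by decide); have e2 := h 3 (by decide)
        simp [quadNodal] at e1 e2 ⊢; rcases e1 with e | e <;> rcases e2 with e' | e' <;> linarith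
      · have e1 := h 0 (by decide); have e2 := h 3 (by decide)
        simp [quadNodal] at e1 e2 ⊢; rcases e1 with e | e <;> rcases e2 with e' | e' <;> linarith
      · have e1 := h 0 (by decide); have e2 := h 1 (by decide)
        simp [quadNodal] at e1 e2 ⊢; rcases e1 with e | e <;> rcases e2 with e' | e' <;> linarith
      · have e1 := h 1 (by decide); have e2 := h 2 (by decide)
        simp [quadNodal] at e1 e2 ⊢; rcases e1 with e | e <;> rcases e2 with e' | e' <;> linarith
    · intro h l
      fin_cases f <;> fin_cases l <;> simp [quadNodal] at h ⊢ <;> simp [h]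

/-- Nodal functions are positive in the relative interior of a facet. -/
lemma nodal_pos_of_relint {y : Pt d} {f : Fin s.nv}
    (h0 : s.bd f y = 0) (hpos : ∀ g, g ≠ f → 0 < s.bd g y) {k : Fin s.nv} (hk : k ∈ s.facet f) :
    0 < s.nodal k y := by
  cases s with
  | simplex =>
    revert f k
    change ∀ f : Fin (d + 1), (Shape.simplex d).bd f y = 0 →
      (∀ g : Fin (d + 1), g ≠ f → 0 < (Shape.simplex d).bd g y) →
      ∀ k : Fin (d + 1), k ∈ Finset.univ.erase f → 0 < simplexNodal k y
    intro f h0 hpos k hk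
    rw [← simplex_bd]
    exact hpos k (Finset.ne_of_mem_erase hk)
  | quad =>
    revert f k
    change ∀ f : Fin 4, Shape.quad.bd f y = 0 → (∀ g : Fin 4, g ≠ f → 0 < Shape.quad.bd g y) →
      ∀ k : Fin 4, k ∈ ({f, f + 1} : Finset (Fin 4)) → 0 < quadNodal k y
    simp only [quad_bd]
    intro f h0 hp k hk
    have p0 := hp 0; have p1 := hp 1; have p2 := hp 2; have p3 := hp 3
    fin_cases f <;> fin_cases k <;> simp [quadNodal] at h0 hk p0 p1 p2 p3 ⊢ <;>
      exact mul_pos (by linarith) (by linarith)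

/-- The barycentre of a facet is in its relative interior. -/
lemma exists_relint (hd : 0 < d) (f : Fin s.nv) : ∃ y ∈ s.ref, s.bd f y = 0 ∧
    (∀ g, g ≠ f → 0 < s.bd g y) ∧
    y = ∑ k ∈ s.facet f, (d : ℝ)⁻¹ • s.refVert k := by
  have hd' : (0 : ℝ) < (d : ℝ)⁻¹ := by positivity
  have hb : ∀ g, s.bd g (∑ k ∈ s.facet f, (d : ℝ)⁻¹ • s.refVert k) =
      ∑ k ∈ s.facet f, (d : ℝ)⁻¹ * s.bd g (s.refVert k) := by
    intro g
    simp only [bd, map_sum, map_smul, smul_eq_mul, mul_add, Finset.sum_add_distrib,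
      Finset.sum_const, card_facet, nsmul_eq_mul]
    field_simp
  have h0 : s.bd f (∑ k ∈ s.facet f, (d : ℝ)⁻¹ • s.refVert k) = 0 := by
    rw [hb]
    exact Finset.sum_eq_zero fun k hk => by rw [s.bd_refVert_of_mem hk, mul_zero]
  have h1 : ∀ g k, 0 ≤ s.bd g (s.refVert k) := fun g k => (s.mem_ref_iff _).1 (s.refVert_mem k) g
  have h2 : ∀ g, g ≠ f → 0 < s.bd g (∑ k ∈ s.facet f, (d : ℝ)⁻¹ • s.refVert k) := by
    intro g hg
    rw [hb]
    have : ∃ k ∈ s.facet f, k ∉ s.facet g := by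
      by_contra hcon
      push Not at hcon
      exact hg (s.facet_injective ((s.isFace_facet g).eq_facet (f := f) hcon))
    obtain ⟨k, hk, hk'⟩ := this
    refine Finset.sum_pos' (fun l _ => mul_nonneg hd'.le (h1 g l)) ⟨k, hk, ?_⟩
    rw [s.bd_refVert_of_notMem hk', mul_one]
    exact hd'
  refine ⟨_, (s.mem_ref_iff _).2 fun g => ?_, h0, h2, rfl⟩
  by_cases hg : g = f
  · rw [hg, h0]
  · exact (h2 g hg).le

/-- In two dimensions, two facets meet at each corner. -/
lemma exists_other {s : Shape 2} {f k : Fin s.nv} (hk : k ∈ s.facet f) :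
    ∃ f', f' ≠ f ∧ k ∈ s.facet f' ∧ s.opp f' k ≠ k ∧ s.facet f' = {k, s.opp f k} ∧
      s.facet f = {k, s.opp f' k} ∧ ∀ g, k ∈ s.facet g → g = f ∨ g = f' := by
  cases s with
  | simplex =>
    revert f k
    change ∀ f k : Fin 3, k ∈ Finset.univ.erase f → ∃ f' : Fin 3, f' ≠ f ∧
      k ∈ Finset.univ.erase f' ∧ f' ≠ k ∧ Finset.univ.erase f' = {k, f} ∧
      Finset.univ.erase f = {k, f'} ∧ ∀ g : Fin 3, k ∈ Finset.univ.erase g → g = f ∨ g = f'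
    decide
  | quad =>
    revert f k
    change ∀ f k : Fin 4, k ∈ ({f, f + 1} : Finset (Fin 4)) → ∃ f' : Fin 4, f' ≠ f ∧
      k ∈ ({f', f' + 1} : Finset (Fin 4)) ∧ (if k = f' then f' + 3 else f' + 2) ≠ k ∧
      ({f', f' + 1} : Finset (Fin 4)) = {k, (if k = f then f + 3 else f + 2)} ∧
      ({f, f + 1} : Finset (Fin 4)) = {k, (if k = f' then f' + 3 else f' + 2)} ∧
      ∀ g : Fin 4, k ∈ ({g, g + 1} : Finset (Fin 4)) → g = f ∨ g = f'
    decide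

/-- In two dimensions, the boundary of an element remains connected if one facet is removed. -/
lemma forall_of_facets {s : Shape 2} (P : Fin s.nv → Prop) (f₀ : Fin s.nv)
    (h : ∀ f, f ≠ f₀ → ∀ k ∈ s.facet f, ∀ l ∈ s.facet f, P k → P l) (k l : Fin s.nv)
    (hk : P k) : P l := by
  cases s with
  | simplex =>
    revert P f₀ k l
    change ∀ (P : Fin 3 → Prop) (f₀ : Fin 3), (∀ f : Fin 3, f ≠ f₀ →
      ∀ k ∈ Finset.univ.erase f, ∀ l ∈ Finset.univ.erase f, P k → P l) →
      ∀ k l : Fin 3, P k → P l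
    intro P f₀ h k l
    have h0 := h 0; have h1 := h 1; have h2 := h 2
    simp only [Finset.mem_erase, Finset.mem_univ, and_true, Fin.forall_fin_succ] at h0 h1 h2
    fin_cases f₀ <;> fin_cases k <;> fin_cases l <;> simp at h0 h1 h2 ⊢ <;> tauto
  | quad =>
    revert P f₀ k l
    change ∀ (P : Fin 4 → Prop) (f₀ : Fin 4), (∀ f : Fin 4, f ≠ f₀ →
      ∀ k ∈ ({f, f + 1} : Finset (Fin 4)), ∀ l ∈ ({f, f + 1} : Finset (Fin 4)), P k → P l) →
      ∀ k l : Fin 4, P k → P l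
    intro P f₀ h k l
    have e : ∀ f : Fin 4, f ≠ f₀ → (P f ↔ P (f + 1)) := fun f hf =>
      ⟨h f hf f (by simp) (f + 1) (by simp), h f hf (f + 1) (by simp) f (by simp)⟩
    have w : ∀ f : Fin 4, f + 1 ≠ f ∧ f + 2 ≠ f ∧ f + 3 ≠ f ∧ f + 1 + 1 = f + 2 ∧
        f + 2 + 1 = f + 3 ∧ f + 3 + 1 = f := by decide
    obtain ⟨w1, w2, w3, w4, w5, w6⟩ := w f₀
    -- The three remaining edges form the path `f₀ + 1`, `f₀ + 2`, `f₀ + 3`, `f₀`.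
    have e1 := e (f₀ + 1) w1
    have e2 := e (f₀ + 2) w2
    have e3 := e (f₀ + 3) w3
    rw [w4] at e1
    rw [w5] at e2
    rw [w6] at e3
    have key : ∀ k, P k ↔ P f₀ := by
      intro k
      have w' : ∀ f k : Fin 4, k = f ∨ k = f + 1 ∨ k = f + 2 ∨ k = f + 3 := by decide
      have := w' f₀ k
      rcases this with rfl | rfl | rfl | rfl
      · exact Iff.rfl
      · exact e1.trans (e2.trans e3)
      · exact e2.trans e3
      · exact e3
    exact fun hk => (key l).2 ((key k).1 hk)

end facets
end Shape

/-! ### Polynomial spaces in coordinates: unisolvence at the vertices, corner functions. -/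

lemma exists_of_mem_P1 {d : ℕ} {φ : Pt d → ℝ} (h : φ ∈ P1 d) :
    ∃ (a : ℝ) (b : Pt d), ∀ x, φ x = a + ∑ i, b i * x i := by
  induction h using Submodule.span_induction with
  | mem φ h =>
    rcases h with h | ⟨i, rfl⟩
    · rw [Set.mem_singleton_iff] at h
      exact ⟨1, 0, by simp [h]⟩
    · exact ⟨0, Pi.single i 1, fun x => by simp [Pi.single_apply]⟩
  | zero => exact ⟨0, 0, by simp⟩
  | add φ ψ _ _ h1 h2 =>
    obtain ⟨a, b, h1⟩ := h1
    obtain ⟨a', b', h2⟩ := h2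
    refine ⟨a + a', b + b', fun x => ?_⟩
    simp [h1, h2, add_mul, Finset.sum_add_distrib]; ring
  | smul c φ _ h1 =>
    obtain ⟨a, b, h1⟩ := h1
    exact ⟨c * a, c • b, fun x => by simp [h1, mul_add, Finset.mul_sum, mul_assoc]⟩

lemma mem_P1_of {d : ℕ} (a : ℝ) (b : Pt d) : (fun x : Pt d => a + ∑ i, b i * x i) ∈ P1 d := by
  have h1 : (fun _ => 1 : Pt d → ℝ) ∈ P1 d := Submodule.subset_span (Or.inl rfl)
  have h2 : ∀ i, (fun x : Pt d => x i) ∈ P1 d := fun i => Submodule.subset_span (Or.inr ⟨i, rfl⟩)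
  have : (fun x : Pt d => a + ∑ i, b i * x i) =
      a • (fun _ => 1 : Pt d → ℝ) + ∑ i, b i • (fun x : Pt d => x i) := by
    funext x; simp
  rw [this]
  exact (P1 d).add_mem ((P1 d).smul_mem _ h1)
    ((P1 d).sum_mem fun i _ => (P1 d).smul_mem _ (h2 i))

lemma exists_of_mem_P0 {d : ℕ} {φ : Pt d → ℝ} (h : φ ∈ P0 d) : ∃ a : ℝ, ∀ x, φ x = a := by
  obtain ⟨a, rfl⟩ := Submodule.mem_span_singleton.1 h
  exact ⟨a, fun x => by simp⟩

lemma exists_of_mem_P1vec {d : ℕ} {ζ : Pt d → Pt d} (h : ζ ∈ P1vec d) :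
    ∃ (a : Pt d) (B : Fin d → Pt d), ∀ x i, ζ x i = a i + ∑ j, B i j * x j := by
  choose a B h using fun i => exists_of_mem_P1 (h i)
  exact ⟨a, B, fun x i => h i x⟩

lemma exists_of_mem_bdm_quad {ζ : Pt 2 → Pt 2} (h : ζ ∈ Shape.quad.bdm) :
    ∃ (a : Pt 2) (B : Fin 2 → Pt 2) (α β : ℝ), ∀ x,
      ζ x 0 = a 0 + B 0 0 * x 0 + B 0 1 * x 1 + α * x 0 ^ 2 + β * (2 * x 0 * x 1) ∧
      ζ x 1 = a 1 + B 1 0 * x 0 + B 1 1 * x 1 - α * (2 * x 0 * x 1) - β * x 1 ^ 2 := by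
  obtain ⟨ζ₁, h1, ζ₂, h2, rfl⟩ := Submodule.mem_sup.1 h
  obtain ⟨a, B, h1⟩ := exists_of_mem_P1vec h1
  obtain ⟨α, β, rfl⟩ := Submodule.mem_span_pair.1 h2
  refine ⟨a, B, α, β, fun x => ?_⟩
  constructor <;> simp [h1, Fin.sum_univ_two] <;> ring

lemma exists_of_mem_Q1 {φ : Pt 2 → ℝ} (h : φ ∈ Q1) :
    ∃ a b c e : ℝ, ∀ x, φ x = a + b * x 0 + c * x 1 + e * (x 0 * x 1) := by
  obtain ⟨φ₁, h1, φ₂, h2, rfl⟩ := Submodule.mem_sup.1 h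
  obtain ⟨a, b, h1⟩ := exists_of_mem_P1 h1
  obtain ⟨e, rfl⟩ := Submodule.mem_span_singleton.1 h2
  exact ⟨a, b 0, b 1, e, fun x => by simp [h1, Fin.sum_univ_two]; ring⟩

namespace Shape

variable {d : ℕ} (s : Shape d)

lemma eq_zero_of_mem_rot {φ : Pt d → ℝ} (h : φ ∈ s.rot) (h0 : ∀ k, φ (s.refVert k) = 0) :
    φ = 0 := by
  cases s with
  | simplex =>
    obtain ⟨a, b, h⟩ := exists_of_mem_P1 h
    have h0 : ∀ k : Fin (d + 1), φ (simplexVert k) = 0 := h0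
    have ha : a = 0 := by simpa [h] using h0 0
    have hb : ∀ i, b i = 0 := fun i => by
      simpa [h, ha, Pi.single_apply] using h0 i.succ
    funext x; simp [h, ha, hb]
  | quad =>
    obtain ⟨a, b, c, e, h⟩ := exists_of_mem_Q1 h
    have h0 : ∀ k : Fin 4, φ (quadVert k) = 0 := h0
    have h1 := h0 0; have h2 := h0 1; have h3 := h0 2; have h4 := h0 3
    simp [h, quadVert] at h1 h2 h3 h4
    simp only [h1, zero_add] at h2 h4
    have h5 : e = 0 := by linarith
    funext x; simp [h, h1, h2, h4, h5]

/-- `BDM₁` has as many degrees of freedom as there are components at the vertices: `d (d + 1)` on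
the simplex, `6 + 2 = 8` on the square. This vertex unisolvence makes the quadrature definite on the
stress and velocity spaces. -/
lemma eq_zero_of_mem_bdm {ζ : Pt d → Pt d} (h : ζ ∈ s.bdm) (h0 : ∀ k, ζ (s.refVert k) = 0) :
    ζ = 0 := by
  cases s with
  | simplex =>
    obtain ⟨a, B, h⟩ := exists_of_mem_P1vec h
    have h0 : ∀ (k : Fin (d + 1)) i, ζ (simplexVert k) i = 0 := fun k i => by
      have := congrFun (h0 k) i; exact this
    have ha : ∀ i, a i = 0 := fun i => by simpa [h] using h0 0 i
    have hb : ∀ i j, B i j = 0 := fun i j => by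
      simpa [h, ha, Pi.single_apply] using h0 j.succ i
    funext x i; simp [h, ha, hb]
  | quad =>
    obtain ⟨a, B, α, β, h⟩ := exists_of_mem_bdm_quad h
    have h0 : ∀ (k : Fin 4) i, ζ (quadVert k) i = 0 := fun k i => by
      have := congrFun (h0 k) i; exact this
    have h1 := h0 0 0; have h2 := h0 1 0; have h3 := h0 2 0; have h4 := h0 3 0
    have g1 := h0 0 1; have g2 := h0 1 1; have g3 := h0 2 1; have g4 := h0 3 1
    simp [h, quadVert] at h1 h2 h3 h4 g1 g2 g3 g4
    have e1 : B 0 1 = 0 := by linarith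
    have e2 : β = 0 := by linarith
    have e3 : B 1 0 = 0 := by linarith
    have e4 : α = 0 := by linarith
    have e5 : B 0 0 = 0 := by linarith
    have e6 : B 1 1 = 0 := by linarith
    funext x i
    fin_cases i
    · simp [h, h1, e1, e2, e4, e5]
    · simp [h, g1, e2, e3, e4, e6]

lemma contDiff_of_mem_bdm {ζ : Pt d → Pt d} (h : ζ ∈ s.bdm) : ContDiff ℝ (⊤ : ℕ∞) ζ := by
  rw [contDiff_pi]
  intro i
  cases s with
  | simplex =>
    obtain ⟨a, B, h⟩ := exists_of_mem_P1vec h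
    simp only [h]; fun_prop
  | quad =>
    obtain ⟨a, B, α, β, h⟩ := exists_of_mem_bdm_quad h
    fin_cases i
    · simp only [(h _).1, Fin.zero_eta]; fun_prop
    · simp only [(h _).2, Fin.mk_one]; fun_prop

/-- The divergence is constant, since the two curls contribute nothing. A central difference with
step one is exact for quadratics, so `dv` yields this constant while being linear on all functions,
differentiable or not. -/
lemma divg_eq_dv {ζ : Pt d → Pt d} (h : ζ ∈ s.bdm) (y : Pt d) : divg ζ y = dv d ζ := by
  have hproj : ∀ (i : Fin d) (x : Pt d), HasFDerivAt (fun y : Pt d => y i)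
    (ContinuousLinearMap.proj (R := ℝ) (φ := fun _ : Fin d => ℝ) i) x := fun i x =>
      (ContinuousLinearMap.proj (R := ℝ) (φ := fun _ : Fin d => ℝ) i).hasFDerivAt
  cases s with
  | simplex =>
    obtain ⟨a, B, h⟩ := exists_of_mem_P1vec h
    simp only [divg, pderiv, dv, LinearMap.coe_mk, AddHom.coe_mk]
    refine Finset.sum_congr rfl fun i _ => ?_
    have hd : HasFDerivAt (fun y => ζ y i) (∑ j, B i j •
        ContinuousLinearMap.proj (R := ℝ) (φ := fun _ : Fin d => ℝ) j) y := by
      simp only [h]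
      refine HasFDerivAt.const_add _ (HasFDerivAt.fun_sum fun j _ => ?_)
      simpa using (hproj j y).const_mul (B i j)
    rw [hd.fderiv]
    simp [h, Pi.single_apply]
    ring
  | quad =>
    obtain ⟨a, B, α, β, h⟩ := exists_of_mem_bdm_quad h
    have hs : ∀ (i : Fin 2) (φ : Pt 2 → ℝ) (c : ℝ), DifferentiableAt ℝ φ y →
        HasDerivAt (fun t : ℝ => φ (y + t • Pi.single i (1 : ℝ))) c 0 →
        fderiv ℝ φ y (Pi.single i 1) = c := by
      intro i φ c hφ hc
      rw [← hφ.lineDeriv_eq_fderiv]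
      exact hc.deriv
    simp only [divg, pderiv, dv, LinearMap.coe_mk, AddHom.coe_mk, Fin.sum_univ_two, h]
    rw [hs 0 _ (B 0 0 + 2 * α * y 0 + 2 * β * y 1) (by fun_prop),
      hs 1 _ (B 1 1 - 2 * α * y 0 - 2 * β * y 1) (by fun_prop)]
    · simp; ring
    · simp
      have h1 : HasDerivAt (fun t : ℝ => y 1 + t) 1 0 := (hasDerivAt_id (0:ℝ)).const_add (y 1)
      have := (((h1.const_mul (B 1 1)).const_add (a 1 + B 1 0 * y 0)).sub
        ((h1.const_mul (2 * y 0)).const_mul α)).sub ((h1.pow 2).const_mul β)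
      refine this.congr_deriv ?_
      simp; ring
    · simp
      have h1 : HasDerivAt (fun t : ℝ => y 0 + t) 1 0 := (hasDerivAt_id (0:ℝ)).const_add (y 0)
      have := ((((h1.const_mul (B 0 0)).const_add (a 0)).add_const (B 0 1 * y 1)).add
        ((h1.pow 2).const_mul α)).add (((h1.const_mul 2).mul_const (y 1)).const_mul β)
      refine this.congr_deriv ?_
      simp; ring

/-- The value at `k` is the reference edge that leaves the facet `f`. This edge lies in every other
facet through `k`, so only the normal component on `f` survives. -/
lemma corner_refVert {f k : Fin s.nv} (hk : k ∈ s.facet f) (l : Fin s.nv) :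
    s.corner f k (s.refVert l) =
      if l = k then s.refVert (s.opp f k) - s.refVert k else 0 := by
  cases s with
  | simplex =>
    change (Shape.simplex d).nodal k ((Shape.simplex d).refVert l) • _ = _
    rw [nodal_refVert]
    by_cases h : l = k
    · subst h; simp; rfl
    · simp [h, Ne.symm h]
  | quad =>
    revert f k l
    change ∀ f k : Fin 4, k ∈ ({f, f + 1} : Finset (Fin 4)) → ∀ l : Fin 4,
      (if f = 0 ∨ f = 2 then
        ![(1 - 2 * quadVert k 0) / 2 * (quadVert l 0 * (1 - quadVert l 0)),
          (1 - 2 * quadVert k 1) * quadNodal k (quadVert l)]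
      else
        ![(1 - 2 * quadVert k 0) * quadNodal k (quadVert l),
          (1 - 2 * quadVert k 1) / 2 * (quadVert l 1 * (1 - quadVert l 1))] : Pt 2) =
      if l = k then quadVert (if k = f then f + 3 else f + 2) - quadVert k else 0
    intro f k hk l
    funext i
    fin_cases f <;> fin_cases k <;> simp at hk <;> fin_cases l <;> fin_cases i <;>
      simp [quadVert, quadNodal] <;> norm_num

/-- On the square a product `x₀ x₁` occurs in `BDM₁` only paired with a square in the other
component. The bubble in `corner`, which vanishes at all vertices, supplies that square. -/
lemma corner_mem {f k : Fin s.nv} : s.corner f k ∈ s.bdm := by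
  cases s with
  | simplex =>
    intro i
    revert f k
    change ∀ f k : Fin (d + 1),
      (fun x : Pt d => (simplexNodal k x • (simplexVert f - simplexVert k)) i) ∈ P1 d
    intro f k
    have h2 : (fun x : Pt d => simplexNodal k x) ∈ P1 d := by
      refine Fin.cases ?_ (fun j => ?_) k
      · have := mem_P1_of (d := d) 1 (fun _ => -1)
        simpa [sub_eq_add_neg] using this
      · exact Submodule.subset_span (Or.inr ⟨j, rfl⟩)
    have := (P1 d).smul_mem ((simplexVert f - simplexVert k) i) h2
    convert this using 1
    funext x
    simp [mul_comm]
  | quad =>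
    revert f k
    change ∀ f k : Fin 4, (fun y : Pt 2 => (if f = 0 ∨ f = 2 then
        ![(1 - 2 * quadVert k 0) / 2 * (y 0 * (1 - y 0)),
          (1 - 2 * quadVert k 1) * quadNodal k y]
      else
        ![(1 - 2 * quadVert k 0) * quadNodal k y,
          (1 - 2 * quadVert k 1) / 2 * (y 1 * (1 - y 1))] : Pt 2)) ∈ Shape.quad.bdm
    intro f k
    have key : ∀ (a : Pt 2) (B : Fin 2 → Pt 2) (α β : ℝ) (ζ : Pt 2 → Pt 2), (∀ x,
      ζ x 0 = a 0 + B 0 0 * x 0 + B 0 1 * x 1 + α * x 0 ^ 2 + β * (2 * x 0 * x 1) ∧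
      ζ x 1 = a 1 + B 1 0 * x 0 + B 1 1 * x 1 - α * (2 * x 0 * x 1) - β * x 1 ^ 2) →
      ζ ∈ Shape.quad.bdm := by
      intro a B α β ζ h
      refine Submodule.mem_sup.2 ⟨fun x i => a i + ∑ j, B i j * x j,
        fun i => mem_P1_of (a i) (B i), _, Submodule.mem_span_pair.2 ⟨α, β, rfl⟩, ?_⟩
      funext x i
      fin_cases i <;> simp [h, Fin.sum_univ_two] <;> ring
    by_cases hf : f = 0 ∨ f = 2
    · simp only [hf, if_true]
      -- The coefficients come from the factorization of the nodal function into `(1 - kᵢ) + (2 kᵢ -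
      -- 1) yᵢ`, with `kᵢ` the coordinates of the vertex. The coefficient of `x₀ x₁` must be `-2 α`,
      -- which fixes `α`.
      refine key ![0, (1 - 2 * quadVert k 1) * (1 - quadVert k 0) * (1 - quadVert k 1)]
        ![![(1 - 2 * quadVert k 0) / 2, 0],
          ![(1 - 2 * quadVert k 1) * (1 - quadVert k 1) * (2 * quadVert k 0 - 1),
            (1 - 2 * quadVert k 1) * (1 - quadVert k 0) * (2 * quadVert k 1 - 1)]]
        ((2 * quadVert k 0 - 1) / 2) 0 _ fun x => ?_
      fin_cases k <;> constructor <;> simp [quadVert, quadNodal] <;> ring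
    · simp only [hf, if_false]
      refine key ![(1 - 2 * quadVert k 0) * (1 - quadVert k 0) * (1 - quadVert k 1), 0]
        ![![(1 - 2 * quadVert k 0) * (1 - quadVert k 1) * (2 * quadVert k 0 - 1),
            (1 - 2 * quadVert k 0) * (1 - quadVert k 0) * (2 * quadVert k 1 - 1)],
          ![0, (1 - 2 * quadVert k 1) / 2]]
        0 (-(2 * quadVert k 1 - 1) / 2) _ fun x => ?_
      fin_cases k <;> constructor <;> simp [quadVert, quadNodal] <;> ring

end Shape

/-! ### Derivatives of the nodal functions. -/

namespace Shape

/-- Directional derivatives of the nodal functions of the unit simplex. -/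
def simplexDnodal {d : ℕ} (k : Fin (d + 1)) (v : Pt d) : ℝ :=
  Fin.cases (motive := fun _ => ℝ) (-∑ i, v i) (fun i => v i) k

/-- Directional derivatives of the nodal functions of the unit square. -/
def quadDnodal (k : Fin 4) (y v : Pt 2) : ℝ :=
  (![-(v 0 * (1 - y 1)) - (1 - y 0) * v 1, v 0 * (1 - y 1) - y 0 * v 1,
    v 0 * y 1 + y 0 * v 1, -(v 0 * y 1) + (1 - y 0) * v 1] : Fin 4 → ℝ) k

/-- Directional derivatives of the nodal functions. -/
def dnodal : {d : ℕ} → (s : Shape d) → Fin s.nv → Pt d → Pt d → ℝ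
  | _, .simplex _ => fun k _ v => simplexDnodal k v
  | _, .quad => fun k y v => quadDnodal k y v

variable {d : ℕ} (s : Shape d)

lemma contDiff_nodal (k : Fin s.nv) : ContDiff ℝ (⊤ : ℕ∞) (s.nodal k) := by
  cases s with
  | simplex =>
    revert k
    change ∀ k : Fin (d + 1), ContDiff ℝ (⊤ : ℕ∞) (simplexNodal k)
    intro k
    refine Fin.cases ?_ (fun j => ?_) k
    · change ContDiff ℝ (⊤ : ℕ∞) (fun x : Pt d => 1 - ∑ i, x i)
      fun_prop
    · change ContDiff ℝ (⊤ : ℕ∞) (fun x : Pt d => x j)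
      fun_prop
  | quad =>
    revert k
    change ∀ k : Fin 4, ContDiff ℝ (⊤ : ℕ∞) (quadNodal k)
    intro k
    unfold quadNodal
    fin_cases k <;> simp <;> fun_prop

lemma fderiv_nodal (k : Fin s.nv) (y v : Pt d) : fderiv ℝ (s.nodal k) y v = s.dnodal k y v := by
  have hd : DifferentiableAt ℝ (s.nodal k) y :=
    (s.contDiff_nodal k).differentiable (by simp) y
  rw [← hd.lineDeriv_eq_fderiv]
  refine HasDerivAt.deriv ?_
  clear hd
  cases s with
  | simplex =>
    revert k
    change ∀ k : Fin (d + 1), HasDerivAt (fun t : ℝ => simplexNodal k (y + t • v))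
      (simplexDnodal k v) 0
    have hi : ∀ i, HasDerivAt (fun t : ℝ => (y + t • v) i) (v i) 0 := fun i => by
      simpa using ((hasDerivAt_id (0 : ℝ)).mul_const (v i)).const_add (y i)
    intro k
    refine Fin.cases ?_ (fun j => ?_) k
    · exact (HasDerivAt.fun_sum fun i _ => hi i).const_sub 1
    · exact hi j
  | quad =>
    revert k
    change ∀ k : Fin 4, HasDerivAt (fun t : ℝ => quadNodal k (y + t • v))
      (quadDnodal k y v) 0
    have hi : ∀ i, HasDerivAt (fun t : ℝ => y i + t * v i) (v i) 0 := fun i => by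
      simpa using ((hasDerivAt_id (0 : ℝ)).mul_const (v i)).const_add (y i)
    have h0 := hi 0
    have h1 := hi 1
    intro k
    fin_cases k
    · refine ((h0.const_sub 1).mul (h1.const_sub 1)).congr_deriv ?_
      simp [quadDnodal]; ring
    · refine (h0.mul (h1.const_sub 1)).congr_deriv ?_
      simp [quadDnodal]; ring
    · refine (h0.mul h1).congr_deriv ?_
      simp [quadDnodal]
    · refine ((h0.const_sub 1).mul h1).congr_deriv ?_
      simp [quadDnodal]

/-- Nodal functions, also the bilinear ones, are affine along a facet. Hence the derivative in the
direction of an edge of the facet is a difference of vertex values, at every point of the facet. -/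
lemma dnodal_facet {f k l : Fin s.nv} {y : Pt d} (hy : s.bd f y = 0) (hk : k ∈ s.facet f)
    (hl : l ∈ s.facet f) (m : Fin s.nv) :
    s.dnodal m y (s.refVert l - s.refVert k) =
      (if m = l then 1 else 0) - (if m = k then 1 else 0) := by
  cases s with
  | simplex =>
    clear hk hl hy
    revert k l m
    change ∀ k l m : Fin (d + 1), simplexDnodal m (simplexVert l - simplexVert k) =
      (if m = l then 1 else 0) - (if m = k then 1 else 0)
    intro k l m
    refine Eq.trans ?_ (congrArg₂ (· - ·) ((Shape.simplex d).nodal_refVert m l)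
      ((Shape.simplex d).nodal_refVert m k))
    change _ = simplexNodal m (simplexVert l) - simplexNodal m (simplexVert k)
    refine Fin.cases ?_ (fun j => ?_) m <;> simp [simplexDnodal]
  | quad =>
    revert f k l m
    change ∀ f k l : Fin 4, Shape.quad.bd f y = 0 → k ∈ ({f, f + 1} : Finset (Fin 4)) →
      l ∈ ({f, f + 1} : Finset (Fin 4)) → ∀ m : Fin 4,
      quadDnodal m y (quadVert l - quadVert k) =
      (if m = l then 1 else 0) - (if m = k then 1 else 0)
    intro f k l hy hk hl m
    rw [quad_bd] at hy
    fin_cases f <;> fin_cases k <;> simp at hk <;> fin_cases l <;> simp at hl hy <;>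
      fin_cases m <;> simp [quadDnodal, quadVert] <;> linarith

lemma dnodal_opp {f k : Fin s.nv} (hk : k ∈ s.facet f) (m : Fin s.nv) :
    s.dnodal m (s.refVert k) (s.refVert (s.opp f k) - s.refVert k) =
      (if m = s.opp f k then 1 else 0) - (if m = k then 1 else 0) := by
  cases s with
  | simplex =>
    revert f k m
    change ∀ f k : Fin (d + 1), _ → ∀ m : Fin (d + 1),
      simplexDnodal m (simplexVert f - simplexVert k) =
      (if m = f then 1 else 0) - (if m = k then 1 else 0)
    intro f k _ m
    refine Eq.trans ?_ (congrArg₂ (· - ·) ((Shape.simplex d).nodal_refVert m f)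
      ((Shape.simplex d).nodal_refVert m k))
    change _ = simplexNodal m (simplexVert f) - simplexNodal m (simplexVert k)
    refine Fin.cases ?_ (fun j => ?_) m <;> simp [simplexDnodal]
  | quad =>
    revert f k m
    change ∀ f k : Fin 4, k ∈ ({f, f + 1} : Finset (Fin 4)) → ∀ m : Fin 4,
      quadDnodal m (quadVert k) (quadVert (if k = f then f + 3 else f + 2) - quadVert k) =
      (if m = (if k = f then f + 3 else f + 2) then 1 else 0) - (if m = k then 1 else 0)
    intro f k hk m
    fin_cases f <;> fin_cases k <;> simp at hk <;>
      fin_cases m <;> simp [quadDnodal, quadVert]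

end Shape

/-! ### The element map, its inverse, and the open element. -/

namespace Element

variable {d : ℕ} (E : Element d)

lemma contDiff_map : ContDiff ℝ (⊤ : ℕ∞) E.map := by
  change ContDiff ℝ (⊤ : ℕ∞) (fun x => ∑ k, E.shape.nodal k x • E.vert k)
  exact ContDiff.sum fun k _ => (E.shape.contDiff_nodal k).smul contDiff_const

lemma differentiable_map : Differentiable ℝ E.map := E.contDiff_map.differentiable (by simp)

lemma continuous_map : Continuous E.map := E.contDiff_map.continuous

lemma fderiv_map (y v : Pt d) :
    fderiv ℝ E.map y v = ∑ k, E.shape.dnodal k y v • E.vert k := by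
  have : HasFDerivAt E.map (∑ k, (fderiv ℝ (E.shape.nodal k) y).smulRight (E.vert k)) y := by
    change HasFDerivAt (fun x => ∑ k, E.shape.nodal k x • E.vert k) _ y
    refine HasFDerivAt.fun_sum fun k _ => ?_
    exact HasFDerivAt.smul_const
      (((E.shape.contDiff_nodal k).differentiable (by simp)) y).hasFDerivAt (E.vert k)
  rw [this.fderiv]
  simp [Shape.fderiv_nodal]

lemma map_refVert (k : Fin E.shape.nv) : E.map (E.shape.refVert k) = E.vert k := by
  change ∑ l, E.shape.nodal l _ • E.vert l = _
  simp [Shape.nodal_refVert]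

lemma fderiv_facet {f k l : Fin E.shape.nv} {y : Pt d} (hy : E.shape.bd f y = 0)
    (hk : k ∈ E.shape.facet f) (hl : l ∈ E.shape.facet f) :
    fderiv ℝ E.map y (E.shape.refVert l - E.shape.refVert k) = E.vert l - E.vert k := by
  simp [fderiv_map, Shape.dnodal_facet _ hy hk hl, sub_smul, Finset.sum_sub_distrib]

lemma fderiv_opp {f k : Fin E.shape.nv} (hk : k ∈ E.shape.facet f) :
    fderiv ℝ E.map (E.shape.refVert k)
      (E.shape.refVert (E.shape.opp f k) - E.shape.refVert k) =
      E.vert (E.shape.opp f k) - E.vert k := by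
  simp [fderiv_map, Shape.dnodal_opp _ hk, sub_smul, Finset.sum_sub_distrib]

lemma injOn_map : Set.InjOn E.map E.shape.ref := E.injOn

lemma inv_map {y : Pt d} (hy : y ∈ E.shape.ref) : E.inv (E.map y) = y :=
  E.injOn_map.leftInvOn_invFunOn hy

lemma inv_mem {x : Pt d} (hx : x ∈ E.body) : E.inv x ∈ E.shape.ref :=
  Function.invFunOn_mem hx

lemma map_inv {x : Pt d} (hx : x ∈ E.body) : E.map (E.inv x) = x :=
  Function.invFunOn_eq hx

lemma inv_vert (k : Fin E.shape.nv) : E.inv (E.vert k) = E.shape.refVert k := by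
  rw [← map_refVert, E.inv_map (E.shape.refVert_mem k)]

lemma vert_injective : Function.Injective E.vert := by
  intro k l h
  have h1 := congrArg E.inv h
  rw [inv_vert, inv_vert] at h1
  by_contra hne
  have h2 := E.shape.nodal_refVert k k
  rw [h1, Shape.nodal_refVert, if_neg hne] at h2
  simp at h2

lemma isCompact_body : IsCompact E.body := E.shape.isCompact_ref.image E.continuous_map

/-- A continuous injection on a compact set is a homeomorphism onto its image: the preimage of a
closed set under the inverse is the image of a compact set. -/
lemma continuousOn_inv : ContinuousOn E.inv E.body := by
  rw [continuousOn_iff_continuous_domRestrict]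
  refine continuous_iff_isClosed.2 fun C hC => ?_
  have : E.body.domRestrict E.inv ⁻¹' C = Subtype.val ⁻¹' (E.map '' (E.shape.ref ∩ C)) := by
    ext ⟨x, hx⟩
    simp only [Set.mem_preimage, Set.domRestrict_apply, Set.mem_image]
    constructor
    · exact fun h => ⟨E.inv x, ⟨E.inv_mem hx, h⟩, E.map_inv hx⟩
    · rintro ⟨y, ⟨hy, hyC⟩, rfl⟩
      rwa [← E.inv_map hy] at hyC
  rw [this]
  exact ((E.shape.isCompact_ref.inter_right hC).image E.continuous_map).isClosed.preimage
    continuous_subtype_val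

/-- The derivative of the element map, as an equivalence. -/
def fderivEquiv {y : Pt d} (hy : y ∈ E.shape.ref) : Pt d ≃L[ℝ] Pt d :=
  (fderiv ℝ E.map y).toContinuousLinearEquivOfDetNeZero (E.det_ne y hy)

lemma coe_fderivEquiv {y : Pt d} (hy : y ∈ E.shape.ref) :
    (E.fderivEquiv hy : Pt d →L[ℝ] Pt d) = fderiv ℝ E.map y :=
  ContinuousLinearMap.coe_toContinuousLinearEquivOfDetNeZero _ _

lemma fderivEquiv_apply {y : Pt d} (hy : y ∈ E.shape.ref) (v : Pt d) :
    E.fderivEquiv hy v = fderiv ℝ E.map y v := by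
  rw [← coe_fderivEquiv E hy]; rfl

lemma hasStrictFDerivAt_map {y : Pt d} (hy : y ∈ E.shape.ref) :
    HasStrictFDerivAt E.map (E.fderivEquiv hy : Pt d →L[ℝ] Pt d) y := by
  rw [coe_fderivEquiv]
  exact E.contDiff_map.contDiffAt.hasStrictFDerivAt (by simp)

/-- The element map has a local inverse at every point of the closed reference element. -/
lemma exists_localInverse {y : Pt d} (hy : y ∈ E.shape.ref) : ∃ G : Pt d → Pt d,
    G (E.map y) = y ∧ HasFDerivAt G ((E.fderivEquiv hy).symm : Pt d →L[ℝ] Pt d) (E.map y) ∧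
    (∀ᶠ x in nhds (E.map y), E.map (G x) = x) ∧ (∀ᶠ z in nhds y, G (E.map z) = z) ∧
    ∀ᶠ x in nhds (E.map y), x ∈ E.body → G x = E.inv x := by
  have h := E.hasStrictFDerivAt_map hy
  refine ⟨h.localInverse, h.localInverse_apply_image, h.to_localInverse.hasFDerivAt,
    h.eventually_right_inverse, h.eventually_left_inverse, ?_⟩
  have h1 : Filter.Tendsto E.inv (nhdsWithin (E.map y) E.body) (nhds y) := by
    have := E.continuousOn_inv (E.map y) ⟨y, hy, rfl⟩
    rwa [ContinuousWithinAt, E.inv_map hy] at this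
  have h2 := h1.eventually h.eventually_left_inverse
  rw [eventually_nhdsWithin_iff] at h2
  filter_upwards [h2] with x hx hb
  have := hx hb
  rwa [E.map_inv hb] at this

/-- The open element. -/
def inner : Set (Pt d) := E.map '' E.shape.inner

lemma isOpen_inner : IsOpen E.inner := by
  rw [isOpen_iff_mem_nhds]
  rintro _ ⟨y, hy, rfl⟩
  have h := E.hasStrictFDerivAt_map (E.shape.inner_subset hy)
  rw [← h.map_nhds_eq_of_equiv]
  exact Filter.image_mem_map (E.shape.isOpen_inner.mem_nhds hy)

lemma inner_subset_body : E.inner ⊆ E.body := Set.image_mono E.shape.inner_subset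

lemma inner_subset_interior : E.inner ⊆ interior E.body :=
  interior_maximal E.inner_subset_body E.isOpen_inner

lemma inner_nonempty : E.inner.Nonempty := E.shape.inner_nonempty.image _

lemma body_subset_closure_inner : E.body ⊆ closure E.inner :=
  (Set.image_mono E.shape.ref_subset_closure_inner).trans
    (image_closure_subset_closure_image E.continuous_map)

lemma volume_body_diff_inner : volume (E.body \ E.inner) = 0 := by
  refine measure_mono_null (t := E.map '' (E.shape.ref \ E.shape.inner)) ?_ ?_
  · rintro _ ⟨⟨y, hy, rfl⟩, hn⟩
    exact ⟨y, ⟨hy, fun h => hn ⟨y, h, rfl⟩⟩, rfl⟩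
  · exact addHaar_image_eq_zero_of_differentiableOn_of_addHaar_eq_zero volume
      E.differentiable_map.differentiableOn E.shape.volume_ref_diff_inner

lemma volume_body_diff_interior : volume (E.body \ interior E.body) = 0 :=
  measure_mono_null (Set.sdiff_subset_sdiff_right E.inner_subset_interior) E.volume_body_diff_inner

/-- Directions which point into the element. -/
lemma eventually_mem_inner {y v : Pt d} (hy : y ∈ E.shape.ref)
    (hv : ∀ f, E.shape.bd f y = 0 → 0 < E.shape.bdLin f ((E.fderivEquiv hy).symm v)) :
    ∀ᶠ ε : ℝ in nhdsWithin 0 (Set.Ioi 0), E.map y + ε • v ∈ E.inner := by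
  obtain ⟨G, hG0, hGd, hGr, -, -⟩ := E.exists_localInverse hy
  have hline : HasDerivAt (fun ε : ℝ => E.map y + ε • v) v 0 := by
    simpa using ((hasDerivAt_id (0 : ℝ)).smul_const v).const_add (E.map y)
  have hcont : Filter.Tendsto (fun ε : ℝ => E.map y + ε • v) (nhdsWithin 0 (Set.Ioi 0))
      (nhds (E.map y)) := by
    have := hline.continuousAt.tendsto
    simp only [zero_smul, add_zero] at this
    exact this.mono_left nhdsWithin_le_nhds
  have hGd' : HasDerivAt (fun ε : ℝ => G (E.map y + ε • v)) ((E.fderivEquiv hy).symm v) 0 := by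
    have hGd0 : HasFDerivAt G ((E.fderivEquiv hy).symm : Pt d →L[ℝ] Pt d)
        (E.map y + (0 : ℝ) • v) := by simpa using hGd
    exact hGd0.comp_hasDerivAt (0 : ℝ) hline
  have hpos : ∀ f, ∀ᶠ ε : ℝ in nhdsWithin 0 (Set.Ioi 0),
      0 < E.shape.bd f (G (E.map y + ε • v)) := by
    intro f
    have hb : HasDerivAt (fun ε : ℝ => E.shape.bd f (G (E.map y + ε • v)))
        (E.shape.bdLin f ((E.fderivEquiv hy).symm v)) 0 := by
      have := ((LinearMap.toContinuousLinearMap (E.shape.bdLin f)).hasFDerivAt.comp_hasDerivAt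
        (0 : ℝ) hGd').const_add (E.shape.bdConst f)
      exact this
    -- The ray is pulled back by the local inverse. A facet through `y` is left with positive speed;
    -- for the other facets positivity persists by continuity.
    rcases ((E.shape.mem_ref_iff y).1 hy f).eq_or_lt with h0 | h0
    · have h1 := hv f h0.symm
      have := hb.tendsto_slope_zero_right
      have h2 := this.eventually (lt_mem_nhds h1)
      filter_upwards [h2, self_mem_nhdsWithin] with ε hε hε0
      simp [hG0, ← h0] at hε
      have h3 : (0 : ℝ) < ε⁻¹ := inv_pos.2 hε0
      exact (pos_iff_pos_of_mul_pos hε).1 h3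
    · have h1 := hb.continuousAt.tendsto
      simp only [zero_smul, add_zero, hG0] at h1
      exact (h1.mono_left nhdsWithin_le_nhds).eventually (lt_mem_nhds h0)
  filter_upwards [Filter.eventually_all.2 hpos, hcont.eventually hGr] with ε h1 h2
  exact ⟨_, h1, h2⟩

/-- Points of the facets are limits of points outside of the element. -/
lemma mem_closure_compl {y : Pt d} (hy : y ∈ E.shape.ref) {f : Fin E.shape.nv}
    (hf : E.shape.bd f y = 0) : E.map y ∈ closure E.bodyᶜ := by
  obtain ⟨G, hG0, -, -, hGl, hGi⟩ := E.exists_localInverse hy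
  obtain ⟨c, hc⟩ := E.shape.inner_nonempty
  have h1 : Filter.Tendsto (fun ε : ℝ => y + ε • (y - c)) (nhdsWithin 0 (Set.Ioi 0)) (nhds y) := by
    have : ContinuousAt (fun ε : ℝ => y + ε • (y - c)) 0 := by fun_prop
    have := this.tendsto
    simp only [zero_smul, add_zero] at this
    exact this.mono_left nhdsWithin_le_nhds
  have h2 := (E.continuous_map.tendsto y).comp h1
  -- On the prolongation of the segment from the inner point `c` beyond `y` the function `bd f` is
  -- negative. If the image were still in the element, the local inverse would put such a point into
  -- the reference element.
  refine mem_closure_of_tendsto h2 ?_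
  filter_upwards [h2.eventually hGi, h1.eventually hGl, self_mem_nhdsWithin] with ε h3 h4 h5 h6
  have h7 := h3 h6
  simp only [Function.comp_apply] at h6 h7
  rw [h4] at h7
  have h8 := E.inv_mem h6
  rw [← h7] at h8
  have h9 := (E.shape.mem_ref_iff _).1 h8 f
  rw [Shape.bd_add, hf, map_smul, Shape.bdLin_sub, hf, smul_eq_mul] at h9
  have := mul_pos (Set.mem_Ioi.1 h5) (hc f)
  linarith

/-- Points of an element which are not in the open element lie on facets. -/
lemma exists_bd_eq_zero {x : Pt d} (hx : x ∈ E.body) (hn : x ∉ E.inner) :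
    ∃ f, E.shape.bd f (E.inv x) = 0 := by
  by_contra hcon
  push Not at hcon
  refine hn ⟨E.inv x, fun f => ?_, E.map_inv hx⟩
  exact lt_of_le_of_ne ((E.shape.mem_ref_iff _).1 (E.inv_mem hx) f) (hcon f).symm

lemma hasFDerivAt_inv {y : Pt d} (hy : y ∈ E.shape.inner) :
    HasFDerivAt E.inv
      ((E.fderivEquiv (E.shape.inner_subset hy)).symm : Pt d →L[ℝ] Pt d) (E.map y) := by
  obtain ⟨G, hG0, hGd, -, -, hGi⟩ := E.exists_localInverse (E.shape.inner_subset hy)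
  refine hGd.congr_of_eventuallyEq ?_
  have hb : E.body ∈ nhds (E.map y) :=
    Filter.mem_of_superset (E.isOpen_inner.mem_nhds ⟨y, hy, rfl⟩) E.inner_subset_body
  filter_upwards [hGi, hb] with x h1 h2
  exact (h1 h2).symm

lemma J_pos {y : Pt d} (hy : y ∈ E.shape.ref) : 0 < E.J y := abs_pos.2 (E.det_ne y hy)

lemma continuous_J : Continuous E.J := by
  have : Continuous (fderiv ℝ E.map) := E.contDiff_map.continuous_fderiv (by simp)
  exact (ContinuousLinearMap.continuous_det.comp this).abs

/-- Change of variables to the reference element. -/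
lemma integral_body (g : Pt d → ℝ) :
    ∫ x in E.body, g x = ∫ y in E.shape.ref, E.J y * g (E.map y) := by
  have := integral_image_eq_integral_abs_det_fderiv_smul volume
    E.shape.isClosed_ref.measurableSet
    (fun y _ => (E.differentiable_map y).hasFDerivAt.hasFDerivWithinAt) E.injOn_map g
  simpa [body, J] using this

end Element

/-! ### The divergence of a Piola transform. -/

lemma divg_comp_inv {d : ℕ} (E : Element d) {η : Pt d → Pt d} {y : Pt d}
    (hy : y ∈ E.shape.inner) (hη : DifferentiableAt ℝ η y) :
    divg (fun x => η (E.inv x)) (E.map y) = ∑ i, fderiv ℝ η y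
      ((E.fderivEquiv (E.shape.inner_subset hy)).symm (Pi.single i 1)) i := by
  have h1 := E.hasFDerivAt_inv hy
  have hη' : HasFDerivAt η (fderiv ℝ η y) (E.inv (E.map y)) := by
    rw [E.inv_map (E.shape.inner_subset hy)]; exact hη.hasFDerivAt
  have h2 := hasFDerivAt_pi'.1 (hη'.comp _ h1)
  refine Finset.sum_congr rfl fun i _ => ?_
  have h3 := h2 i
  rw [pderiv]
  change fderiv ℝ (fun x => (η ∘ E.inv) x i) _ _ = _
  rw [h3.fderiv]
  simp

/-- The Piola transformation on the reference element. -/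
def Element.piolaRef {d : ℕ} (E : Element d) (ζ : Pt d → Pt d) (y : Pt d) : Pt d :=
  (E.J y)⁻¹ • fderiv ℝ E.map y (ζ y)

lemma Element.differentiableAt_piolaRef {d : ℕ} (E : Element d) {ζ : Pt d → Pt d} {y : Pt d}
    (hy : y ∈ E.shape.ref) (hζ : ContDiff ℝ (⊤ : ℕ∞) ζ) :
    DifferentiableAt ℝ (E.piolaRef ζ) y := by
  have hF : ContDiff ℝ (⊤ : ℕ∞) (fderiv ℝ E.map) := E.contDiff_map.fderiv_right (by simp)
  have hdet : ContDiff ℝ (⊤ : ℕ∞) (fun z => (fderiv ℝ E.map z).det) := by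
    have : ∀ z, (fderiv ℝ E.map z).det =
        (Matrix.of fun i j => fderiv ℝ E.map z (Pi.single j 1) i).det := by
      intro z
      rw [ContinuousLinearMap.det, ← LinearMap.det_toMatrix']
      congr 1
    simp only [this, Matrix.det_apply]
    refine ContDiff.sum fun σ _ => ContDiff.const_smul _ (contDiff_prod fun i _ => ?_)
    have h1 : ContDiff ℝ (⊤ : ℕ∞) (fun z => fderiv ℝ E.map z (Pi.single i 1)) :=
      hF.clm_apply contDiff_const
    exact contDiff_pi.1 h1 _
  have h1 : DifferentiableAt ℝ (fun z => (fderiv ℝ E.map z).det) y :=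
    hdet.differentiable (by simp) y
  have h2 : DifferentiableAt ℝ E.J y := h1.abs (E.det_ne y hy)
  have h3 : DifferentiableAt ℝ (fun z => fderiv ℝ E.map z (ζ z)) y :=
    ((hF.clm_apply hζ).differentiable (by simp)) y
  exact (h2.inv (E.J_pos hy).ne').smul h3

/-- Both sides are traces, and the trace is invariant under conjugation. -/
lemma sum_conj_apply {d : ℕ} (L : Pt d ≃L[ℝ] Pt d) (B : Pt d →L[ℝ] Pt d) :
    ∑ i, L (B (L.symm (Pi.single i 1))) i = ∑ i, B (Pi.single i 1) i := by
  have key : ∀ f : Pt d →ₗ[ℝ] Pt d, ∑ i, f (Pi.single i 1) i = LinearMap.trace ℝ _ f := by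
    intro f
    rw [LinearMap.trace_eq_matrix_trace ℝ (Pi.basisFun ℝ (Fin d))]
    simp [Matrix.trace]
  have h := LinearMap.trace_conj' (B : Pt d →ₗ[ℝ] Pt d) L.toLinearEquiv
  rw [← key, ← key] at h
  simpa [LinearEquiv.conj_apply] using h

lemma quad_map_fderiv (vert : Fin 4 → Pt 2) (y v : Pt 2) :
    fderiv ℝ (Shape.quad.map vert) y v =
      v 0 • ((1 - y 1) • (vert 1 - vert 0) + y 1 • (vert 2 - vert 3)) +
      v 1 • ((1 - y 0) • (vert 3 - vert 0) + y 0 • (vert 2 - vert 1)) := by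
  have : HasFDerivAt (Shape.quad.map vert)
      (∑ k, (fderiv ℝ (Shape.quad.nodal k) y).smulRight (vert k)) y := by
    change HasFDerivAt (fun x => ∑ k, Shape.quad.nodal k x • vert k) _ y
    refine HasFDerivAt.fun_sum fun k _ => ?_
    exact HasFDerivAt.smul_const
      (((Shape.quad.contDiff_nodal k).differentiable (by simp)) y).hasFDerivAt (vert k)
  rw [this.fderiv]
  simp only [FunLike.coe_sum, Finset.sum_apply, ContinuousLinearMap.smulRight_apply,
    Shape.fderiv_nodal]
  change ∑ k : Fin 4, Shape.quadDnodal k y v • vert k = _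
  rw [Fin.sum_univ_four]
  funext i
  simp [Shape.quadDnodal]
  ring

lemma det_fin_two_clm (L : Pt 2 →L[ℝ] Pt 2) : L.det =
    L (Pi.single 0 1) 0 * L (Pi.single 1 1) 1 - L (Pi.single 1 1) 0 * L (Pi.single 0 1) 1 := by
  rw [ContinuousLinearMap.det, ← LinearMap.det_toMatrix', Matrix.det_fin_two]
  simp [LinearMap.toMatrix'_apply]

/-- The divergence of the Piola transform. -/
lemma Element.divg_piola {d : ℕ} (E : Element d) {ζ : Pt d → Pt d} (hζ : ζ ∈ E.shape.bdm)
    {y : Pt d} (hy : y ∈ E.shape.inner) :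
    divg (E.piola ζ) (E.map y) = Shape.dv d ζ / E.J y := by
  have hyr := E.shape.inner_subset hy
  have hζd := E.shape.contDiff_of_mem_bdm hζ
  have hζ' : DifferentiableAt ℝ ζ y := hζd.differentiable (by simp) y
  have hη := E.differentiableAt_piolaRef hyr hζd
  change divg (fun x => E.piolaRef ζ (E.inv x)) (E.map y) = _
  rw [divg_comp_inv E hy hη, ← E.shape.divg_eq_dv hζ y]
  have hζi : ∀ i v, fderiv ℝ (fun z => ζ z i) y v = fderiv ℝ ζ y v i := by
    intro i v
    rw [(hasFDerivAt_pi'.1 hζ'.hasFDerivAt i).fderiv]; simp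
  obtain ⟨shape, vert, hinj, hdet⟩ := E
  cases shape with
  | simplex =>
    set E : Element d := ⟨.simplex d, vert, hinj, hdet⟩
    have hD : ∀ z, fderiv ℝ E.map z = fderiv ℝ E.map y := by
      intro z
      ext1 v
      rw [E.fderiv_map, E.fderiv_map]; rfl
    set L := E.fderivEquiv hyr
    have hL : ∀ z v, fderiv ℝ E.map z v = L v := fun z v => by
      rw [hD z, ← E.fderivEquiv_apply hyr]
    have hJ : ∀ z, E.J z = E.J y := fun z => by simp only [Element.J, hD z]
    have h1 : E.piolaRef ζ = fun z => (E.J y)⁻¹ • (L : Pt d →L[ℝ] Pt d) (ζ z) := by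
      funext z; simp only [Element.piolaRef, hJ z, hL]; rfl
    have h2 : HasFDerivAt (E.piolaRef ζ)
        ((E.J y)⁻¹ • (L : Pt d →L[ℝ] Pt d).comp (fderiv ℝ ζ y)) y := by
      rw [h1]
      exact ((L : Pt d →L[ℝ] Pt d).hasFDerivAt.comp y hζ'.hasFDerivAt).const_smul (E.J y)⁻¹
    change ∑ i, fderiv ℝ (E.piolaRef ζ) y (L.symm (Pi.single i 1)) i = divg ζ y / E.J y
    rw [h2.fderiv]
    -- The element map is affine, so the derivative of the transformed field is `J⁻¹` times a
    -- conjugate of the derivative of `ζ`.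
    have h3 := sum_conj_apply L (fderiv ℝ ζ y)
    simp only [divg, pderiv, hζi, ← h3, Finset.sum_div]
    exact Finset.sum_congr rfl fun i _ => by simp [div_eq_inv_mul]
  | quad =>
    set E : Element 2 := ⟨.quad, vert, hinj, hdet⟩
    let V : Fin 4 → Pt 2 := vert
    have hmap : ∀ z v, fderiv ℝ E.map z v = _ := quad_map_fderiv V
    change ∑ i, fderiv ℝ (E.piolaRef ζ) y ((E.fderivEquiv hyr).symm (Pi.single i 1)) i =
      divg ζ y / E.J y
    clear_value V
    -- `A` and `B` are the partial derivatives of the bilinear map and `Δ` is its determinant. The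
    -- Piola identity is then verified in coordinates.
    set A : Pt 2 → Pt 2 := fun z => (1 - z 1) • (V 1 - V 0) + z 1 • (V 2 - V 3) with hA
    set B : Pt 2 → Pt 2 := fun z => (1 - z 0) • (V 3 - V 0) + z 0 • (V 2 - V 1) with hB
    set Δ : Pt 2 → ℝ := fun z => A z 0 * B z 1 - B z 0 * A z 1 with hΔ
    have hdet' : ∀ z, (fderiv ℝ E.map z).det = Δ z := by
      intro z
      rw [det_fin_two_clm]
      simp [hmap, hΔ, hA, hB]
    have hne : Δ y ≠ 0 := by rw [← hdet']; exact hdet y hyr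
    -- `σ` is the sign of the determinant near `y`; it resolves the absolute value in `J`.
    obtain ⟨σ, hσ, hσJ⟩ : ∃ σ : ℝ, σ * σ = 1 ∧ ∀ᶠ z in nhds y, E.J z = σ * Δ z := by
      have hc : ContinuousAt Δ y := by
        have : Continuous Δ := by simp only [hΔ, hA, hB]; fun_prop
        exact this.continuousAt
      rcases lt_or_gt_of_ne hne with h | h
      · refine ⟨-1, by norm_num, ?_⟩
        filter_upwards [hc.eventually (gt_mem_nhds h)] with z hz
        rw [Element.J, hdet', abs_of_neg hz]; ring
      · refine ⟨1, by norm_num, ?_⟩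
        filter_upwards [hc.eventually (lt_mem_nhds h)] with z hz
        rw [Element.J, hdet', abs_of_pos hz]; ring
    have hσ0 : σ ≠ 0 := fun h => by simp [h] at hσ
    have hσi : σ⁻¹ = σ := by field_simp; nlinarith
    have hline : ∀ (j : Fin 2) (i : Fin 2) (c : ℝ), HasDerivAt (fun t : ℝ =>
        σ * ((A (y + t • Pi.single j 1) i * ζ (y + t • Pi.single j 1) 0 +
          B (y + t • Pi.single j 1) i * ζ (y + t • Pi.single j 1) 1) /
          Δ (y + t • Pi.single j 1))) c 0 →
        fderiv ℝ (E.piolaRef ζ) y (Pi.single j 1) i = c := by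
      intro j i c hc
      have e1 : fderiv ℝ (E.piolaRef ζ) y (Pi.single j 1) i =
          fderiv ℝ (fun z => E.piolaRef ζ z i) y (Pi.single j 1) := by
        rw [(hasFDerivAt_pi'.1 hη.hasFDerivAt i).fderiv]; simp
      have e2 : DifferentiableAt ℝ (fun z => E.piolaRef ζ z i) y :=
        (hasFDerivAt_pi'.1 hη.hasFDerivAt i).differentiableAt
      rw [e1, ← e2.lineDeriv_eq_fderiv]
      refine HasDerivAt.deriv (hc.congr_of_eventuallyEq ?_)
      have hc' : Filter.Tendsto (fun t : ℝ => y + t • (Pi.single j 1 : Pt 2)) (nhds 0)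
          (nhds y) := by
        have : ContinuousAt (fun t : ℝ => y + t • (Pi.single j 1 : Pt 2)) 0 := by fun_prop
        simpa using this.tendsto
      filter_upwards [hc'.eventually hσJ] with t ht
      simp only [Element.piolaRef, ht, hmap, mul_inv, hσi]
      simp [hA, hB]
      ring
    have hz : ∀ i j, HasDerivAt (fun t : ℝ => ζ (y + t • Pi.single j 1) i)
        (fderiv ℝ ζ y (Pi.single j 1) i) 0 := by
      intro i j
      have h0 : HasDerivAt (fun t : ℝ => y + t • (Pi.single j 1 : Pt 2)) (Pi.single j 1) 0 := by
        simpa using ((hasDerivAt_id (0 : ℝ)).smul_const (Pi.single j 1 : Pt 2)).const_add y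
      have h1 : HasFDerivAt ζ (fderiv ℝ ζ y) (y + (0 : ℝ) • Pi.single j 1) := by
        simpa using hζ'.hasFDerivAt
      exact hasDerivAt_pi.1 (h1.comp_hasDerivAt (0 : ℝ) h0) i
    -- `D` is the mixed second derivative of the map: `A` depends only on the second coordinate and
    -- `B` only on the first, both with slope `D`.
    set D : Pt 2 := V 0 - V 1 + V 2 - V 3 with hD
    have hA0 : ∀ (i : Fin 2) (t : ℝ), A (y + t • Pi.single 0 1) i = A y i := fun i t => by simp [hA]
    have hB1 : ∀ (i : Fin 2) (t : ℝ), B (y + t • Pi.single 1 1) i = B y i := fun i t => by simp [hB]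
    have hA1 : ∀ (i : Fin 2) (t : ℝ), A (y + t • Pi.single 1 1) i = A y i + t * D i := fun i t => by
      simp [hA, hD]; ring
    have hB0 : ∀ (i : Fin 2) (t : ℝ), B (y + t • Pi.single 0 1) i = B y i + t * D i := fun i t => by
      simp [hB, hD]; ring
    have hlin : ∀ a b : ℝ, HasDerivAt (fun t : ℝ => a + t * b) b 0 := fun a b => by
      simpa using ((hasDerivAt_id (0 : ℝ)).mul_const b).const_add a
    have hd0 : ∀ i, fderiv ℝ (E.piolaRef ζ) y (Pi.single 0 1) i = _ := fun i => by
      refine hline 0 i _ ?_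
      simp only [hΔ, hA0, hB0]
      refine HasDerivAt.const_mul σ (HasDerivAt.div (((hz 0 0).const_mul (A y i)).add
        ((hlin (B y i) (D i)).mul (hz 1 0)))
        (((hlin (B y 1) (D 1)).const_mul (A y 0)).sub ((hlin (B y 0) (D 0)).mul_const (A y 1))) ?_)
      simpa [hΔ] using hne
    have hd1 : ∀ i, fderiv ℝ (E.piolaRef ζ) y (Pi.single 1 1) i = _ := fun i => by
      refine hline 1 i _ ?_
      simp only [hΔ, hA1, hB1]
      refine HasDerivAt.const_mul σ (HasDerivAt.div (((hlin (A y i) (D i)).mul (hz 0 1)).add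
        ((hz 1 1).const_mul (B y i)))
        (((hlin (A y 0) (D 0)).mul_const (B y 1)).sub ((hlin (A y 1) (D 1)).const_mul (B y 0))) ?_)
      simpa [hΔ] using hne
    -- Cramer's rule for the inverse of the derivative, here and in `hs1`.
    have hs0 : (E.fderivEquiv hyr).symm (Pi.single 0 1) =
        (B y 1 / Δ y) • Pi.single 0 1 + (-A y 1 / Δ y) • Pi.single 1 1 := by
      rw [ContinuousLinearEquiv.symm_apply_eq, E.fderivEquiv_apply, hmap]
      funext i
      fin_cases i <;> simp [← hA, ← hB] <;> field_simp <;> simp [hΔ, hA, hB] <;> ring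
    have hs1 : (E.fderivEquiv hyr).symm (Pi.single 1 1) =
        (-B y 0 / Δ y) • Pi.single 0 1 + (A y 0 / Δ y) • Pi.single 1 1 := by
      rw [ContinuousLinearEquiv.symm_apply_eq, E.fderivEquiv_apply, hmap]
      funext i
      fin_cases i <;> simp [← hA, ← hB] <;> field_simp <;> simp [hΔ, hA, hB] <;> ring
    have hJy : E.J y = σ * Δ y := hσJ.self_of_nhds
    rw [Fin.sum_univ_two, hs0, hs1]
    simp only [map_add, map_smul, Pi.add_apply, Pi.smul_apply, smul_eq_mul, hd0, hd1]
    simp only [divg, pderiv, hζi, Fin.sum_univ_two, hJy, zero_smul, add_zero, zero_mul]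
    have hΔy : Δ y = A y 0 * B y 1 - B y 0 * A y 1 := rfl
    simp only [← hΔy]
    generalize fderiv ℝ ζ y (Pi.single 0 1) 0 = z00
    generalize fderiv ℝ ζ y (Pi.single 0 1) 1 = z01
    generalize fderiv ℝ ζ y (Pi.single 1 1) 0 = z10
    generalize fderiv ℝ ζ y (Pi.single 1 1) 1 = z11
    generalize Δ y = q at hne hΔy ⊢
    -- A polynomial identity is left, in which all terms with `D` cancel: second derivatives of the
    -- map do not enter the divergence of a Piola transform.
    field_simp
    rw [show σ ^ 2 = 1 by rw [pow_two, hσ], hΔy]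
    ring

/-! ### Integration by parts on the unit simplex and the unit square. -/

lemma hasDerivAt_insertNth {n : ℕ} (i : Fin (n + 1)) (x : Pt n) (t : ℝ) :
    HasDerivAt (fun t : ℝ => (i.insertNth t x : Pt (n + 1))) (Pi.single i 1) t := by
  rw [hasDerivAt_pi]
  intro j
  refine Fin.succAboveCases i ?_ (fun k => ?_) j
  · simpa using hasDerivAt_id' t
  · simpa using hasDerivAt_const t (x k)

lemma continuous_insertNth' {n : ℕ} (i : Fin (n + 1)) :
    Continuous (fun p : ℝ × Pt n => (i.insertNth p.1 p.2 : Pt (n + 1))) := by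
  refine continuous_pi fun j => ?_
  refine Fin.succAboveCases i ?_ (fun k => ?_) j
  · simpa using continuous_fst
  · simp only [Fin.insertNth_apply_succAbove]
    exact (continuous_apply k).comp continuous_snd

/-- Iterated integration over the region under a graph. -/
lemma integral_under_graph {n : ℕ} (i : Fin (n + 1)) {S : Set (Pt (n + 1))} {T : Set (Pt n)}
    {b : Pt n → ℝ} (hS : IsCompact S) (hT : IsCompact T) (hb : ∀ x ∈ T, 0 ≤ b x)
    (h : ∀ t x, (i.insertNth t x : Pt (n + 1)) ∈ S ↔ x ∈ T ∧ 0 ≤ t ∧ t ≤ b x)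
    {g : Pt (n + 1) → ℝ} (hg : Continuous g) :
    ∫ y in S, g y = ∫ x in T, ∫ t in (0 : ℝ)..b x, g (i.insertNth t x) := by
  have hmp := (volume_preserving_piFinSuccAbove (fun _ : Fin (n + 1) => ℝ) i).symm
  have hint : Integrable (S.indicator g) :=
    (hg.continuousOn.integrableOn_compact hS).integrable_indicator hS.isClosed.measurableSet
  have hint' : Integrable (fun p : ℝ × Pt n => S.indicator g (i.insertNth p.1 p.2))
      (volume.prod volume) := hmp.integrable_comp_of_integrable hint
  rw [← integral_indicator hS.isClosed.measurableSet, ← hmp.integral_comp' (g := S.indicator g),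
    ← integral_indicator hT.isClosed.measurableSet]
  change ∫ p : ℝ × Pt n, S.indicator g (i.insertNth p.1 p.2) ∂(volume.prod volume) = _
  rw [integral_prod_symm _ hint']
  congr 1
  funext x
  by_cases hx : x ∈ T
  · rw [Set.indicator_of_mem hx, intervalIntegral.integral_of_le (hb x hx),
      ← integral_Icc_eq_integral_Ioc, ← integral_indicator measurableSet_Icc]
    congr 1
    funext t
    by_cases ht : t ∈ Set.Icc 0 (b x)
    · rw [Set.indicator_of_mem ht, Set.indicator_of_mem ((h t x).2 ⟨hx, ht⟩)]
    · rw [Set.indicator_of_notMem ht, Set.indicator_of_notMem]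
      exact fun hc => ht ((h t x).1 hc).2
  · rw [Set.indicator_of_notMem hx]
    refine integral_eq_zero_of_ae (Filter.Eventually.of_forall fun t => ?_)
    exact Set.indicator_of_notMem (fun hc => hx ((h t x).1 hc).1) _

/-- The unit simplex. -/
abbrev unitSimplex (n : ℕ) : Set (Pt n) := (Shape.simplex n).ref

lemma insertNth_mem_unitSimplex {n : ℕ} (t : ℝ) (x : Pt n) :
    ((0 : Fin (n + 1)).insertNth t x : Pt (n + 1)) ∈ unitSimplex (n + 1) ↔
      x ∈ unitSimplex n ∧ 0 ≤ t ∧ t ≤ 1 - ∑ i, x i := by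
  simp only [unitSimplex, Shape.ref, Set.mem_ofPred_eq, Fin.forall_fin_succ, Fin.sum_univ_succ,
    Fin.insertNth_zero', Fin.cons_zero, Fin.cons_succ]
  constructor
  · rintro ⟨⟨h1, h2⟩, h3⟩
    exact ⟨⟨h2, by linarith⟩, h1, by linarith⟩
  · rintro ⟨⟨h1, h2⟩, h3, h4⟩
    exact ⟨⟨h3, h1⟩, by linarith⟩

/-- Divergence theorem on the unit simplex, for a field in the direction of an edge which
vanishes on one of the facets. -/
lemma integral_unitSimplex_edge {n : ℕ} {φ : Pt (n + 1) → ℝ} (hφ : ContDiff ℝ 1 φ) :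
    ∫ y in unitSimplex (n + 1), ((1 - ∑ i, y i) * fderiv ℝ φ y (Pi.single 0 1) - φ y) =
      -∫ x in unitSimplex n, (1 - ∑ i, x i) * φ ((0 : Fin (n + 1)).insertNth 0 x) := by
  have hc : Continuous fun y => fderiv ℝ φ y (Pi.single 0 1) :=
    (hφ.continuous_fderiv (by simp)).clm_apply continuous_const
  have hφc := hφ.continuous
  rw [integral_under_graph (b := fun x => 1 - ∑ i, x i) 0 (Shape.isCompact_ref _)
    (Shape.isCompact_ref (.simplex n)) (fun x hx => sub_nonneg.2 hx.2) insertNth_mem_unitSimplex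
    (by fun_prop), ← integral_neg]
  refine setIntegral_congr_fun (Shape.isClosed_ref (.simplex n)).measurableSet fun x hx => ?_
  have hcont : Continuous fun t : ℝ => ((0 : Fin (n + 1)).insertNth t x : Pt (n + 1)) :=
    (continuous_insertNth' 0).comp (continuous_id.prodMk continuous_const)
  -- The integrand is the derivative of this product along the first coordinate. At the upper limit
  -- the weight vanishes, so only the facet through the origin contributes.
  have hder : ∀ t : ℝ, HasDerivAt (fun t : ℝ => (1 - ∑ i, x i - t) *
      φ ((0 : Fin (n + 1)).insertNth t x))
      ((1 - ∑ i, ((0 : Fin (n + 1)).insertNth t x : Pt (n + 1)) i) *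
        fderiv ℝ φ ((0 : Fin (n + 1)).insertNth t x) (Pi.single 0 1) -
        φ ((0 : Fin (n + 1)).insertNth t x)) t := by
    intro t
    have h1 : HasDerivAt (fun t : ℝ => 1 - ∑ i, x i - t) (-1) t := by
      simpa using (hasDerivAt_id t).const_sub (1 - ∑ i, x i)
    have h2 : HasDerivAt (fun t : ℝ => φ ((0 : Fin (n + 1)).insertNth t x))
        (fderiv ℝ φ ((0 : Fin (n + 1)).insertNth t x) (Pi.single 0 1)) t :=
      ((hφ.differentiable (by simp)) _).hasFDerivAt.comp_hasDerivAt t (hasDerivAt_insertNth 0 x t)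
    refine (h1.mul h2).congr_deriv ?_
    simp [Fin.sum_univ_succ]; ring
  rw [intervalIntegral.integral_eq_sub_of_hasDerivAt (fun t _ => hder t)]
  · simp
  · refine Continuous.intervalIntegrable ?_ _ _
    exact ((continuous_const.sub (continuous_finsetSum _ fun i _ =>
      (continuous_apply i).comp hcont)).mul (hc.comp hcont)).sub (hφc.comp hcont)

/-! ### Affine symmetries of the unit simplex. -/

section permutation

variable {d : ℕ}

lemma simplexNodal_sum (c : Fin (d + 1) → ℝ) (hc : ∑ k, c k = 1) (k : Fin (d + 1)) :
    Shape.simplexNodal k (∑ j, c j • Shape.simplexVert j) = c k := by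
  rw [Fin.sum_univ_succ] at hc ⊢
  have h : ∀ i, (∑ j : Fin d, c j.succ • (Pi.single j 1 : Pt d)) i = c i.succ := by
    intro i; simp [Finset.sum_apply, Pi.single_apply]
  refine Fin.cases ?_ (fun i => ?_) k
  · simp [Pi.single_apply]; linarith
  · simp [Pi.single_apply]

/-- The affine map of the unit simplex which permutes the vertices. -/
def permMap (e : Equiv.Perm (Fin (d + 1))) (y : Pt d) : Pt d :=
  ∑ k, Shape.simplexNodal k y • Shape.simplexVert (e k)

lemma simplexNodal_permMap (e : Equiv.Perm (Fin (d + 1))) (k : Fin (d + 1)) (y : Pt d) :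
    Shape.simplexNodal (e k) (permMap e y) = Shape.simplexNodal k y := by
  have h1 : permMap e y = ∑ k, Shape.simplexNodal (e.symm k) y • Shape.simplexVert k := by
    rw [permMap, ← Equiv.sum_comp e (fun k => Shape.simplexNodal (e.symm k) y •
      Shape.simplexVert k)]
    simp only [Equiv.symm_apply_apply]
  rw [h1, simplexNodal_sum (fun k => Shape.simplexNodal (e.symm k) y)]
  · simp
  · rw [Equiv.sum_comp e.symm (fun k => Shape.simplexNodal k y)]
    exact (Shape.simplex d).card_nodal_sum y

lemma sum_simplexNodal_permMap {V : Type*} [AddCommGroup V] [Module ℝ V]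
    (e : Equiv.Perm (Fin (d + 1))) (P : Fin (d + 1) → V) (y : Pt d) :
    ∑ k, Shape.simplexNodal k (permMap e y) • P k = ∑ k, Shape.simplexNodal k y • P (e k) := by
  rw [← Equiv.sum_comp e]
  simp [simplexNodal_permMap]

lemma permMap_symm_permMap (e : Equiv.Perm (Fin (d + 1))) (y : Pt d) :
    permMap e.symm (permMap e y) = y := by
  rw [permMap, sum_simplexNodal_permMap]
  simp only [Equiv.symm_apply_apply]
  exact (Shape.simplex d).map_refVert y

lemma permMap_mem (e : Equiv.Perm (Fin (d + 1))) {y : Pt d} (hy : y ∈ unitSimplex d) :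
    permMap e y ∈ unitSimplex d := by
  rw [Shape.mem_ref_iff]
  change ∀ f : Fin (d + 1), 0 ≤ (Shape.simplex d).bd f (permMap e y)
  intro f
  rw [Shape.simplex_bd, ← e.apply_symm_apply f, simplexNodal_permMap]
  exact (Shape.simplex d).nodal_nonneg hy _

lemma contDiff_permMap (e : Equiv.Perm (Fin (d + 1))) : ContDiff ℝ (⊤ : ℕ∞) (permMap e) :=
  ContDiff.sum fun k _ => ((Shape.simplex d).contDiff_nodal k).smul contDiff_const

/-- The unit simplex with permuted vertices. -/
def permElement (e : Equiv.Perm (Fin (d + 1))) : Element d where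
  shape := .simplex d
  vert := fun k : Fin (d + 1) => Shape.simplexVert (e k)
  injOn := by
    intro x _ y _ h
    have := congrArg (permMap e.symm) (show permMap e x = permMap e y from h)
    rwa [permMap_symm_permMap, permMap_symm_permMap] at this
  det_ne := by
    intro x _ h0
    change (fderiv ℝ (permMap e) x).det = 0 at h0
    have h1 : HasFDerivAt (permMap e) (fderiv ℝ (permMap e) x) x :=
      ((contDiff_permMap e).differentiable (by simp) x).hasFDerivAt
    have h2 : HasFDerivAt (permMap e.symm) (fderiv ℝ (permMap e.symm) (permMap e x))
      (permMap e x) := ((contDiff_permMap e.symm).differentiable (by simp) _).hasFDerivAt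
    have h3 := h2.comp x h1
    rw [show permMap e.symm ∘ permMap e = id from funext (permMap_symm_permMap e)] at h3
    have h4 := congrArg ContinuousLinearMap.det (h3.unique (hasFDerivAt_id x))
    have h5 : (ContinuousLinearMap.id ℝ (Pt d)).det = 1 := LinearMap.det_id
    rw [h5, ContinuousLinearMap.det] at h4
    rw [ContinuousLinearMap.toLinearMap_comp, LinearMap.det_comp] at h4
    rw [ContinuousLinearMap.det] at h0
    rw [h0, mul_zero] at h4
    exact zero_ne_one h4

lemma permElement_body (e : Equiv.Perm (Fin (d + 1))) :
    (permElement e).body = unitSimplex d := by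
  ext y
  constructor
  · rintro ⟨x, hx, rfl⟩
    exact permMap_mem e hx
  · intro hy
    exact ⟨permMap e.symm y, permMap_mem e.symm hy, permMap_symm_permMap e.symm y⟩

/-- The Jacobian is constant because the map is affine. It is one because the simplex and its image
are the same set of finite positive volume. -/
lemma permElement_J (e : Equiv.Perm (Fin (d + 1))) (y : Pt d) : (permElement e).J y = 1 := by
  have hc : ∀ z, (permElement e).J z = (permElement e).J y := by
    intro z
    have : fderiv ℝ (permElement e).map z = fderiv ℝ (permElement e).map y := by
      ext1 v
      rw [Element.fderiv_map, Element.fderiv_map]; rfl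
    simp only [Element.J, this]
  have h := (permElement e).integral_body (fun _ => 1)
  rw [permElement_body] at h
  simp only [hc, mul_one] at h
  change ∫ _ in unitSimplex d, (1 : ℝ) = ∫ _ in unitSimplex d, _ at h
  rw [setIntegral_const, setIntegral_const, smul_eq_mul, smul_eq_mul] at h
  have := (Shape.simplex d).volume_real_ref_pos
  exact (mul_left_cancel₀ this.ne' h).symm

lemma integral_permMap (e : Equiv.Perm (Fin (d + 1))) (g : Pt d → ℝ) :
    ∫ y in unitSimplex d, g (permMap e y) = ∫ y in unitSimplex d, g y := by
  have h := (permElement e).integral_body g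
  rw [permElement_body] at h
  simp only [permElement_J, one_mul] at h
  exact h.symm

end permutation

lemma insertNth_mem_Icc (i : Fin 2) (t : ℝ) (x : Pt 1) :
    (i.insertNth t x : Pt 2) ∈ Set.Icc (0 : Pt 2) 1 ↔
      x ∈ unitSimplex 1 ∧ 0 ≤ t ∧ t ≤ 1 := by
  have h1 : x ∈ unitSimplex 1 ↔ 0 ≤ x 0 ∧ x 0 ≤ 1 := by
    simp [unitSimplex, Shape.ref]
  have h2 : (i.insertNth t x : Pt 2) ∈ Set.Icc (0 : Pt 2) 1 ↔
      (0 ≤ t ∧ 0 ≤ x 0) ∧ t ≤ 1 ∧ x 0 ≤ 1 := by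
    rw [Set.mem_Icc, Pi.le_def, Pi.le_def, Fin.forall_iff_succAbove i, Fin.forall_iff_succAbove i]
    simp
  rw [h1, h2]; tauto

/-- Fundamental theorem of calculus along a coordinate direction of the unit square. -/
lemma integral_Icc_deriv (i : Fin 2) {ψ ψ' : Pt 2 → ℝ} (hc : Continuous ψ')
    (h : ∀ (x : Pt 1) (t : ℝ), HasDerivAt (fun t : ℝ => ψ (i.insertNth t x))
      (ψ' (i.insertNth t x)) t) :
    ∫ y in Set.Icc (0 : Pt 2) 1, ψ' y =
      ∫ x in unitSimplex 1, (ψ (i.insertNth 1 x) - ψ (i.insertNth 0 x)) := by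
  rw [integral_under_graph (b := fun _ => 1) i isCompact_Icc
    (Shape.isCompact_ref (.simplex 1)) (fun x _ => zero_le_one) (insertNth_mem_Icc i) hc]
  refine setIntegral_congr_fun (Shape.isClosed_ref (.simplex 1)).measurableSet fun x _ => ?_
  refine intervalIntegral.integral_eq_sub_of_hasDerivAt (fun t _ => h x t) ?_
  exact (hc.comp ((continuous_insertNth' i).comp
    (continuous_id.prodMk continuous_const))).intervalIntegrable _ _

/-- Green's formula on the unit square for the corner function of the vertex with coordinates
`p` (along the facet) and `q` (across the facet). -/
lemma integral_square_corner (i : Fin 2) {p q : ℝ} (hq : (1 - 2 * q) ^ 2 = 1) {φ : Pt 2 → ℝ}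
    (hφ : ContDiff ℝ 1 φ) :
    ∫ y in Set.Icc (0 : Pt 2) 1,
      ((1 - 2 * p) / 2 * (y i * (1 - y i)) * fderiv ℝ φ y (Pi.single i 1) +
        (1 - 2 * q) * (((1 - p) + (2 * p - 1) * y i) *
          ((1 - q) + (2 * q - 1) * y (i.succAbove 0))) *
          fderiv ℝ φ y (Pi.single (i.succAbove 0) 1) - 1 / 2 * φ y) =
      ∫ x in unitSimplex 1, (1 - 2 * q) * ((1 - p) + (2 * p - 1) * x 0) *
        (q * φ (i.insertNth (x 0) (fun _ => 1)) - (1 - q) * φ (i.insertNth (x 0) (fun _ => 0))) := by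
  have hfc : ∀ v, Continuous fun y => fderiv ℝ φ y v := fun v =>
    (hφ.continuous_fderiv (by simp)).clm_apply continuous_const
  have hφc := hφ.continuous
  set j := i.succAbove 0 with hj
  have hij : i ≠ j := (Fin.succAbove_ne i 0).symm
  have hins : ∀ (t : ℝ) (x : Pt 1), (j.insertNth t x : Pt 2) = i.insertNth (x 0) (fun _ => t) := by
    intro t x
    have hji : j.succAbove 0 = i := by
      rw [hj]; fin_cases i <;> rfl
    funext k
    have hk : k = i ∨ k = j := by
      revert hij; clear_value j; clear hj hji; revert i j k; decide
    rcases hk with rfl | rfl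
    · rw [Fin.insertNth_apply_same, ← hji, Fin.insertNth_apply_succAbove]
    · rw [Fin.insertNth_apply_same, hj, Fin.insertNth_apply_succAbove]
  have hdφ : ∀ (k : Fin 2) (x : Pt 1) (t : ℝ), HasDerivAt (fun t : ℝ => φ (k.insertNth t x))
      (fderiv ℝ φ (k.insertNth t x) (Pi.single k 1)) t := fun k x t =>
    ((hφ.differentiable (by simp)) _).hasFDerivAt.comp_hasDerivAt t (hasDerivAt_insertNth k x t)
  -- Each of the two components of the corner function is integrated by parts in its own direction:
  -- the bubble in direction `i`, the bilinear one in direction `j`.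
  have h1 := integral_Icc_deriv i
    (ψ := fun y => (1 - 2 * p) / 2 * (y i * (1 - y i)) * φ y)
    (ψ' := fun y => (1 - 2 * p) / 2 * (1 - 2 * y i) * φ y +
      (1 - 2 * p) / 2 * (y i * (1 - y i)) * fderiv ℝ φ y (Pi.single i 1))
    (by have := hfc (Pi.single i 1); fun_prop) (by
      intro x t
      simp only [Fin.insertNth_apply_same]
      have ha := (((hasDerivAt_id' t).mul ((hasDerivAt_id' t).const_sub 1)).const_mul
        ((1 - 2 * p) / 2)).mul (hdφ i x t)
      refine ha.congr_deriv ?_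
      simp only [Pi.mul_apply]; ring)
  have h2 := integral_Icc_deriv j
    (ψ := fun y => (1 - 2 * q) * (((1 - p) + (2 * p - 1) * y i) *
          ((1 - q) + (2 * q - 1) * y j)) * φ y)
    (ψ' := fun y => (1 - 2 * q) * (2 * q - 1) * ((1 - p) + (2 * p - 1) * y i) * φ y +
      (1 - 2 * q) * (((1 - p) + (2 * p - 1) * y i) * ((1 - q) + (2 * q - 1) * y j)) *
        fderiv ℝ φ y (Pi.single j 1))
    (by have := hfc (Pi.single j 1); fun_prop) (by
      intro x t
      have e : ∀ t : ℝ, (j.insertNth t x : Pt 2) i = x 0 := fun t => by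
        rw [hins, Fin.insertNth_apply_same]
      simp only [Fin.insertNth_apply_same, e]
      have ha := (((((hasDerivAt_id' t).const_mul (2 * q - 1)).const_add (1 - q)).const_mul
        ((1 - p) + (2 * p - 1) * x 0)).const_mul (1 - 2 * q)).mul (hdφ j x t)
      refine ha.congr_deriv ?_
      ring)
  have hI : ∀ {g : Pt 2 → ℝ}, Continuous g → IntegrableOn g (Set.Icc 0 1) := fun hg =>
    hg.continuousOn.integrableOn_compact isCompact_Icc
  have hf1 := hfc (Pi.single i 1)
  have hf2 := hfc (Pi.single j 1)
  have h3 := integral_add (μ := volume.restrict (Set.Icc (0 : Pt 2) 1))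
    (hI (g := fun y => (1 - 2 * p) / 2 * (1 - 2 * y i) * φ y +
      (1 - 2 * p) / 2 * (y i * (1 - y i)) * fderiv ℝ φ y (Pi.single i 1)) (by fun_prop))
    (hI (g := fun y => (1 - 2 * q) * (2 * q - 1) * ((1 - p) + (2 * p - 1) * y i) * φ y +
      (1 - 2 * q) * (((1 - p) + (2 * p - 1) * y i) * ((1 - q) + (2 * q - 1) * y j)) *
        fderiv ℝ φ y (Pi.single j 1)) (by fun_prop))
  rw [h1, h2] at h3
  refine Eq.trans (setIntegral_congr_fun measurableSet_Icc fun y _ => ?_) (h3.trans ?_)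
  -- The zero-order terms add up to the constant divergence `-1/2`, since `q` is `0` or `1` by `hq`.
  · have : (1 - 2 * q) * (2 * q - 1) = -1 := by linarith
    simp only [this]
    ring
  -- The bubble vanishes at both ends and leaves no boundary term.
  · have hz : ∫ x in unitSimplex 1, ((1 - 2 * p) / 2 * ((i.insertNth (1 : ℝ) x : Pt 2) i *
        (1 - (i.insertNth (1 : ℝ) x : Pt 2) i)) * φ (i.insertNth 1 x) -
        (1 - 2 * p) / 2 * ((i.insertNth (0 : ℝ) x : Pt 2) i *
        (1 - (i.insertNth (0 : ℝ) x : Pt 2) i)) * φ (i.insertNth 0 x)) = 0 := by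
      simp
    rw [hz, zero_add]
    refine setIntegral_congr_fun (Shape.isClosed_ref (.simplex 1)).measurableSet fun x _ => ?_
    simp only [Fin.insertNth_apply_same, hins]
    ring

/-! ### Green's formula for the corner functions on a physical element. -/

/-- The integral over a facet with vertices `r` and `s j`, with the weight that is one at `r`
and vanishes at all `s j`. -/
def facetIntegral {n d : ℕ} (r : Pt d) (s : Fin n → Pt d) (φ : Pt d → ℝ) : ℝ :=
  ∫ x in unitSimplex n, (1 - ∑ i, x i) * φ (r + ∑ j, x j • (s j - r))

lemma Shape.contDiff_simplexNodal {d : ℕ} (j : Fin (d + 1)) :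
    ContDiff ℝ (⊤ : ℕ∞) (Shape.simplexNodal j : Pt d → ℝ) :=
  (Shape.simplex d).contDiff_nodal j

lemma Shape.fderiv_simplexNodal {d : ℕ} (j : Fin (d + 1)) (x v : Pt d) :
    fderiv ℝ (Shape.simplexNodal j) x v = Shape.simplexDnodal j v :=
  (Shape.simplex d).fderiv_nodal j x v

/-- The substitution `x ↦ 1 - x`. On the square the edges are parametrized along the coordinate
directions, so the distinguished vertex may be at either end. -/
lemma facetIntegral_flip {d : ℕ} (r q : Pt d) (φ : Pt d → ℝ) :
    ∫ x in unitSimplex 1, x 0 * φ (q + x 0 • (r - q)) =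
      facetIntegral r (fun _ : Fin 1 => q) φ := by
  rw [facetIntegral, ← integral_permMap (Equiv.swap 0 1)]
  refine setIntegral_congr_fun (Shape.isClosed_ref (.simplex 1)).measurableSet fun x _ => ?_
  have h : permMap (Equiv.swap 0 1) x 0 = 1 - x 0 := by
    have h1 : (1 : Fin 2) = Fin.succ 0 := rfl
    have h2 : permMap (Equiv.swap 0 1) x = Shape.simplexNodal 0 x • Shape.simplexVert (1 : Fin 2) +
        Shape.simplexNodal 1 x • Shape.simplexVert (0 : Fin 2) := by
      refine (Fin.sum_univ_two _).trans ?_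
      rw [Equiv.swap_apply_left, Equiv.swap_apply_right]
    rw [h2, h1, Shape.simplexVert_succ, Shape.simplexVert_zero, Shape.simplexNodal_zero]
    simp
  simp only [h, Fin.sum_univ_one, Finset.univ_unique, Fin.default_eq_zero, Finset.sum_singleton]
  congr 2
  funext k
  simp; ring

lemma dv_corner_quad (f k : Fin 4) (hk : k ∈ ({f, f + 1} : Finset (Fin 4))) :
    Shape.dv 2 (Shape.quad.corner f k) = -(1 / 2) := by
  rw [show Shape.quad.corner f k = (fun y : Pt 2 => (if f = 0 ∨ f = 2 then
        ![(1 - 2 * Shape.quadVert k 0) / 2 * (y 0 * (1 - y 0)),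
          (1 - 2 * Shape.quadVert k 1) * Shape.quadNodal k y]
      else
        ![(1 - 2 * Shape.quadVert k 0) * Shape.quadNodal k y,
          (1 - 2 * Shape.quadVert k 1) / 2 * (y 1 * (1 - y 1))] : Pt 2)) from rfl]
  simp only [Shape.dv, LinearMap.coe_mk, AddHom.coe_mk, Fin.sum_univ_two]
  fin_cases f <;> fin_cases k <;> simp at hk <;>
    simp [Shape.quadVert, Shape.quadNodal] <;> norm_num

lemma dv_corner_simplex {d : ℕ} (f k : Fin (d + 1)) (hk : k ≠ f) :
    Shape.dv d ((Shape.simplex d).corner f k) = -1 := by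
  have h1 : ∀ c : Pt d, ∑ i, (Shape.simplexNodal k (Pi.single i (1 / 2)) * c i -
      Shape.simplexNodal k (-Pi.single i (1 / 2)) * c i) = Shape.simplexDnodal k c := by
    intro c
    refine Fin.cases ?_ (fun j => ?_) k
    · simp only [Shape.simplexNodal_zero, Shape.simplexDnodal, Fin.cases_zero,
        ← Finset.sum_neg_distrib]
      refine Finset.sum_congr rfl fun i _ => ?_
      simp; ring
    · simp only [Shape.simplexNodal_succ, Shape.simplexDnodal, Fin.cases_succ]
      rw [Finset.sum_eq_single j]
      · simp; ring
      · intro b _ hb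
        simp [Pi.single_apply, hb.symm]
      · simp
  have h2 := h1 (Shape.simplexVert f - Shape.simplexVert k)
  rw [show Shape.simplexDnodal k (Shape.simplexVert f - Shape.simplexVert k) = -1 by
    have := (Shape.simplex d).dnodal_opp (f := f) (k := k)
      (Finset.mem_erase.2 ⟨hk, Finset.mem_univ (α := Fin (d + 1)) k⟩) k
    refine this.trans ?_
    change (if k = f then (1 : ℝ) else 0) - (if k = k then 1 else 0) = -1
    simp [hk]] at h2
  exact h2

namespace Element

/-- After a permutation of the vertices, `k` is the origin and `f` the first unit vector. The corner
function then is `1 - ∑ yᵢ` times the first unit direction, for which the divergence theorem reduces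
to integration in one variable. -/
lemma green_corner_simplex {n : ℕ} (W : Fin (Shape.simplex (n + 1)).nv → Pt (n + 1)) (V : Fin (n + 2) → Pt (n + 1)) (hV : V = W)
    (hinj : Set.InjOn ((Shape.simplex (n + 1)).map W) (Shape.simplex (n + 1)).ref)
    (hdet : ∀ x ∈ (Shape.simplex (n + 1)).ref,
      (fderiv ℝ ((Shape.simplex (n + 1)).map W) x).det ≠ 0)
    {E : Element (n + 1)} (hE : E = ⟨.simplex (n + 1), W, hinj, hdet⟩)
    {f k : Fin (n + 2)} (hk : k ∈ Finset.univ.erase f) {s : Fin n → Pt (n + 1)}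
    (hs : Function.Injective s) (hr : Set.range s = V '' ((Finset.univ.erase f).erase k))
    {φ : Pt (n + 1) → ℝ} (hφ : ContDiff ℝ 1 φ) :
    ∫ y in unitSimplex (n + 1), (fderiv ℝ φ (E.map y) (fderiv ℝ E.map y
        (Shape.simplexNodal k y • (Shape.simplexVert f - Shape.simplexVert k))) +
        Shape.dv (n + 1) ((Shape.simplex (n + 1)).corner f k) * φ (E.map y)) =
      -facetIntegral (V k) s φ := by
  have hmap0 : ∀ y, E.map y = ∑ j, Shape.simplexNodal j y • V j := by subst hE hV; exact fun y => rfl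
  have hfd : ∀ y v, fderiv ℝ E.map y v = ∑ j : Fin (n + 2), Shape.simplexDnodal j v • V j := by
    subst hE hV
    exact fun y v => Element.fderiv_map _ y v
  have hfn : ∀ (j : Fin (n + 2)) (x v : Pt (n + 1)),
      fderiv ℝ (Shape.simplexNodal j) x v = Shape.simplexDnodal j v :=
    Shape.fderiv_simplexNodal
  have hdir : ∀ y, fderiv ℝ E.map y (Shape.simplexVert f - Shape.simplexVert k) = V f - V k := by
    intro y
    have := (⟨.simplex (n + 1), W, hinj, hdet⟩ : Element (n + 1)).fderiv_opp (f := f) (k := k) hk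
    rw [hfd]
    have h2 := Element.fderiv_map ⟨.simplex (n + 1), W, hinj, hdet⟩
      (Shape.simplexVert k) (Shape.simplexVert f - Shape.simplexVert k)
    subst hV
    exact h2.symm.trans this
  have hkf : k ≠ f := Finset.ne_of_mem_erase hk
  rw [dv_corner_simplex f k hkf]
  have hsσ : ∀ j, ∃ m, m ∉ ({f, k} : Finset (Fin (n + 2))) ∧ V m = s j := by
    intro j
    have : s j ∈ V '' ((Finset.univ.erase f).erase k) := hr ▸ Set.mem_range_self j
    obtain ⟨m, hm, hm'⟩ := this
    simp at hm
    exact ⟨m, by simp; tauto, hm'⟩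
  choose σ hσ1 hσ2 using hsσ
  have hσi : Function.Injective σ := fun a b h => hs (by rw [← hσ2, ← hσ2, h])
  -- The remaining vertices follow in the order prescribed by `s`, so that the boundary term is
  -- literally the facet integral over the given enumeration.
  let e₀ : Fin (n + 2) → Fin (n + 2) := Fin.cons k (Fin.cons f σ)
  have he₀ : Function.Injective e₀ := by
    refine Fin.cons_injective_iff.2 ⟨?_, Fin.cons_injective_iff.2 ⟨?_, hσi⟩⟩
    · rintro ⟨j, hj⟩
      revert hj
      refine Fin.cases (fun hj => hkf hj.symm) (fun j hj => ?_) j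
      have := hσ1 j
      simp at this hj
      tauto
    · rintro ⟨j, hj⟩
      have := hσ1 j
      simp at this
      tauto
  let e : Equiv.Perm (Fin (n + 2)) := Equiv.ofBijective e₀ (Finite.injective_iff_bijective.1 he₀)
  have e0 : e 0 = k := rfl
  have e1 : e 1 = f := rfl
  have ej : ∀ j : Fin n, e j.succ.succ = σ j := fun j => rfl
  have hmapE : ∀ y, E.map (permMap e y) = ∑ j, Shape.simplexNodal j y • V (e j) := fun y =>
    (hmap0 _).trans (sum_simplexNodal_permMap e V y)
  have hnod : ∀ j : Fin (n + 2), ContDiff ℝ (⊤ : ℕ∞) (Shape.simplexNodal j : Pt (n + 1) → ℝ) :=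
    Shape.contDiff_simplexNodal
  let P : Pt (n + 1) → Pt (n + 1) := fun y => ∑ j, Shape.simplexNodal j y • V (e j)
  have hPE : ∀ y, P y = E.map (permMap e y) := fun y => (hmapE y).symm
  have hPc : ContDiff ℝ (⊤ : ℕ∞) P :=
    ContDiff.sum fun j _ => (hnod j).smul contDiff_const
  have hPd : ∀ y, fderiv ℝ P y (Pi.single 0 1) = V f - V k := by
    intro y
    have hf : HasFDerivAt P (∑ j, (fderiv ℝ (Shape.simplexNodal j) y).smulRight (V (e j))) y := by
      refine HasFDerivAt.fun_sum fun j _ => ?_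
      exact HasFDerivAt.smul_const
        ((hnod j).differentiable (by simp) y).hasFDerivAt _
    rw [hf.fderiv]
    have hn : ∀ j : Fin (n + 2), fderiv ℝ (Shape.simplexNodal j) y (Pi.single 0 1) =
        Shape.simplexDnodal j (Pi.single 0 1 : Pt (n + 1)) := fun j => hfn j y _
    simp only [FunLike.coe_sum, Finset.sum_apply, ContinuousLinearMap.smulRight_apply, hn]
    rw [Fin.sum_univ_succ, Fin.sum_univ_succ]
    simp [Shape.simplexDnodal, e0, Pi.single_apply, Fin.succ_ne_zero]
    rw [e1, show (1 : Fin (n + 2)) = Fin.succ 0 from rfl, Fin.cases_succ]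
    simp
    abel
  rw [← integral_permMap e]
  have hgreen := integral_unitSimplex_edge (hφ.comp (hPc.of_le (by exact_mod_cast le_top)))
  rw [facetIntegral]
  refine Eq.trans (setIntegral_congr_fun
    (Shape.isClosed_ref (.simplex (n + 1))).measurableSet fun y _ => ?_) (hgreen.trans ?_)
  · have hkk : Shape.simplexNodal k (permMap e y) = 1 - ∑ i, y i := by
      rw [← e0, simplexNodal_permMap]; rfl
    simp only [hkk, map_smul, hdir, smul_eq_mul, Function.comp_apply]
    rw [fderiv_comp y (hφ.differentiable (by simp) _) (hPc.differentiable (by simp) y)]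
    simp only [ContinuousLinearMap.comp_apply, hPd, hPE]
    ring
  · congr 1
    refine setIntegral_congr_fun (Shape.isClosed_ref (.simplex n)).measurableSet fun x _ => ?_
    simp only [Function.comp_apply]
    congr 2
    simp only [P]
    rw [Fin.sum_univ_succ, Fin.sum_univ_succ]
    simp only [Shape.simplexNodal_zero, Shape.simplexNodal_succ, e0, Fin.insertNth_zero',
      Fin.cons_zero, Fin.sum_univ_succ, Fin.cons_succ, zero_smul, zero_add, ej, hσ2]
    funext m
    simp [mul_sub, Finset.sum_sub_distrib, ← Finset.sum_mul]
    ring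

/-- The gradient is moved to `φ ∘ E.map`, which leaves the formula on the unit square. The bilinear
map is affine along each edge, so the boundary term is a facet integral over the physical edge. -/
lemma green_corner_quad (W : Fin Shape.quad.nv → Pt 2) (V : Fin 4 → Pt 2) (hV : V = W)
    (hinj : Set.InjOn (Shape.quad.map W) Shape.quad.ref)
    (hdet : ∀ x ∈ Shape.quad.ref, (fderiv ℝ (Shape.quad.map W) x).det ≠ 0)
    {E : Element 2} (hE : E = ⟨.quad, W, hinj, hdet⟩)
    {f k : Fin 4} (hk : k ∈ ({f, f + 1} : Finset (Fin 4))) {s : Fin 1 → Pt 2}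
    (hr : Set.range s = V '' (({f, f + 1} : Finset (Fin 4)).erase k))
    {φ : Pt 2 → ℝ} (hφ : ContDiff ℝ 1 φ) :
    ∫ y in Set.Icc (0 : Pt 2) 1, (fderiv ℝ φ (E.map y) (fderiv ℝ E.map y
        (Shape.quad.corner f k y)) +
        Shape.dv 2 (Shape.quad.corner f k) * φ (E.map y)) = -facetIntegral (V k) s φ := by
  have hcd : ContDiff ℝ 1 E.map := E.contDiff_map.of_le (by exact_mod_cast le_top)
  have hcomp : ∀ y v, fderiv ℝ φ (E.map y) (fderiv ℝ E.map y v) =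
      fderiv ℝ (φ ∘ E.map) y v := by
    intro y v
    rw [fderiv_comp y (hφ.differentiable (by simp) _) (E.differentiable_map y)]
    rfl
  have hφE : ContDiff ℝ 1 (φ ∘ E.map) := hφ.comp hcd
  rw [dv_corner_quad f k hk]
  simp only [hcomp]
  have hmap : ∀ y, E.map y = ∑ j : Fin 4, Shape.quadNodal j y • V j := by subst hE hV; exact fun y => rfl
  have hcor : ∀ y, Shape.quad.corner f k y = (if f = 0 ∨ f = 2 then
      ![(1 - 2 * Shape.quadVert k 0) / 2 * (y 0 * (1 - y 0)),
        (1 - 2 * Shape.quadVert k 1) * Shape.quadNodal k y]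
    else
      ![(1 - 2 * Shape.quadVert k 0) * Shape.quadNodal k y,
        (1 - 2 * Shape.quadVert k 1) / 2 * (y 1 * (1 - y 1))] : Pt 2) := fun y => rfl
  have hlin : ∀ y (a b : ℝ), fderiv ℝ (φ ∘ E.map) y ![a, b] =
      a * fderiv ℝ (φ ∘ E.map) y (Pi.single 0 1) +
      b * fderiv ℝ (φ ∘ E.map) y (Pi.single 1 1) := by
    intro y a b
    rw [show (![a, b] : Pt 2) = a • Pi.single 0 1 + b • Pi.single 1 1 by
      funext i; fin_cases i <;> simp, map_add, map_smul, map_smul]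
    rfl
  have hs1 : s = fun _ => s 0 := by funext j; rw [Subsingleton.elim j 0]
  have hside : ∀ l : Fin 4, ({f, f + 1} : Finset (Fin 4)).erase k = {l} → s 0 = V l := by
    intro l hl
    have : s 0 ∈ V '' (({f, f + 1} : Finset (Fin 4)).erase k) := hr ▸ Set.mem_range_self 0
    rw [hl] at this
    obtain ⟨m, hm, hm'⟩ := this
    rw [← hm', Finset.mem_singleton.1 (Finset.mem_coe.1 hm)]
  have hn : ∀ y, Shape.quadNodal k y = ((1 - Shape.quadVert k 0) +
      (2 * Shape.quadVert k 0 - 1) * y 0) * ((1 - Shape.quadVert k 1) +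
      (2 * Shape.quadVert k 1 - 1) * y 1) := by
    intro y; fin_cases k <;> simp [Shape.quadNodal, Shape.quadVert] <;> ring
  have hq : ∀ i, (1 - 2 * Shape.quadVert k i) ^ 2 = 1 := by
    intro i; fin_cases k <;> fin_cases i <;> simp [Shape.quadVert] <;> norm_num
  have flip := fun r q => facetIntegral_flip (d := 2) r q φ
  have dir := fun (r q : Pt 2) => show facetIntegral r (fun _ : Fin 1 => q) φ =
    ∫ x in unitSimplex 1, (1 - x 0) * φ (r + x 0 • (q - r)) by simp [facetIntegral]
  have hE0 : ∀ x : ℝ, E.map ![x, 0] = V 0 + x • (V 1 - V 0) := by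
    intro x; rw [hmap, Fin.sum_univ_four]; funext i; simp [Shape.quadNodal]; ring
  have hE1 : ∀ x : ℝ, E.map ![x, 1] = V 3 + x • (V 2 - V 3) := by
    intro x; rw [hmap, Fin.sum_univ_four]; funext i; simp [Shape.quadNodal]; ring
  have hE2 : ∀ x : ℝ, E.map ![0, x] = V 0 + x • (V 3 - V 0) := by
    intro x; rw [hmap, Fin.sum_univ_four]; funext i; simp [Shape.quadNodal]; ring
  have hE3 : ∀ x : ℝ, E.map ![1, x] = V 1 + x • (V 2 - V 1) := by
    intro x; rw [hmap, Fin.sum_univ_four]; funext i; simp [Shape.quadNodal]; ring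
  by_cases hf : f = 0 ∨ f = 2
  · have key := integral_square_corner 0 (p := Shape.quadVert k 0) (q := Shape.quadVert k 1)
      (hq 1) hφE
    refine Eq.trans (setIntegral_congr_fun measurableSet_Icc fun y _ => ?_) (key.trans ?_)
    · simp only [hcor, hf, if_true, hlin, hn]
      simp
      ring
    · have hi : ∀ x t : ℝ, ((0 : Fin 2).insertNth x (fun _ => t) : Pt 2) = ![x, t] := by
        intro x t; funext i; fin_cases i <;> simp
      simp only [hi, Function.comp_apply, hE0, hE1]
      rw [hs1]
      have hk' : k = f ∨ k = f + 1 := by simpa using hk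
      clear hn hcor hq key
      rcases hf with rfl | rfl <;> rcases hk' with rfl | rfl
      · rw [hside 1 (by decide), dir, ← integral_neg]
        refine integral_congr_ae (Filter.Eventually.of_forall fun x => ?_)
        simp only [Shape.quadVert, Matrix.cons_val, Fin.isValue, Fin.reduceAdd]
        ring
      · rw [hside 0 (by decide), ← flip, ← integral_neg]
        refine integral_congr_ae (Filter.Eventually.of_forall fun x => ?_)
        simp only [Shape.quadVert, Matrix.cons_val, Fin.isValue, Fin.reduceAdd]
        ring
      · rw [hside 3 (by decide), ← flip, ← integral_neg]
        refine integral_congr_ae (Filter.Eventually.of_forall fun x => ?_)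
        simp only [Shape.quadVert, Matrix.cons_val, Fin.isValue, Fin.reduceAdd]
        ring
      · rw [hside 2 (by decide), dir, ← integral_neg]
        refine integral_congr_ae (Filter.Eventually.of_forall fun x => ?_)
        simp only [Shape.quadVert, Matrix.cons_val, Fin.isValue, Fin.reduceAdd]
        ring
  · have key := integral_square_corner 1 (p := Shape.quadVert k 1) (q := Shape.quadVert k 0)
      (hq 0) hφE
    have h10 : (1 : Fin 2).succAbove 0 = 0 := rfl
    rw [h10] at key
    refine Eq.trans (setIntegral_congr_fun measurableSet_Icc fun y _ => ?_) (key.trans ?_)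
    · simp only [hcor, hf, if_false, hlin, hn, Function.comp_apply]
      ring
    · have hi : ∀ x t : ℝ, ((1 : Fin 2).insertNth x (fun _ => t) : Pt 2) = ![t, x] := by
        intro x t; funext i; fin_cases i
        · exact Fin.insertNth_apply_succAbove (α := fun _ => ℝ) (1 : Fin 2) x (fun _ => t) 0
        · simp
      simp only [hi, Function.comp_apply, hE2, hE3]
      rw [hs1]
      replace hf : f = 1 ∨ f = 3 := by clear * - hf; revert hf; revert f; decide
      have hk' : k = f ∨ k = f + 1 := by simpa using hk
      clear hn hcor hq key
      rcases hf with rfl | rfl <;> rcases hk' with rfl | rfl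
      · rw [hside 2 (by decide), dir, ← integral_neg]
        refine integral_congr_ae (Filter.Eventually.of_forall fun x => ?_)
        simp only [Shape.quadVert, Matrix.cons_val, Fin.isValue, Fin.reduceAdd]
        ring
      · rw [hside 1 (by decide), ← flip, ← integral_neg]
        refine integral_congr_ae (Filter.Eventually.of_forall fun x => ?_)
        simp only [Shape.quadVert, Matrix.cons_val, Fin.isValue, Fin.reduceAdd]
        ring
      · rw [hside 0 (by decide), ← flip, ← integral_neg]
        refine integral_congr_ae (Filter.Eventually.of_forall fun x => ?_)
        simp only [Shape.quadVert, Matrix.cons_val, Fin.isValue, Fin.reduceAdd]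
        ring
      · rw [hside 3 (by decide), dir, ← integral_neg]
        refine integral_congr_ae (Filter.Eventually.of_forall fun x => ?_)
        simp only [Shape.quadVert, Matrix.cons_val, Fin.isValue, Fin.reduceAdd]
        ring

/-- Green's formula for the corner functions. -/
theorem green_corner {n : ℕ} (E : Element (n + 1)) {f k : Fin E.shape.nv}
    (hk : k ∈ E.shape.facet f) {s : Fin n → Pt (n + 1)}
    (hs : Function.Injective s) (hr : Set.range s = E.vert '' ((E.shape.facet f).erase k))
    {φ : Pt (n + 1) → ℝ} (hφ : ContDiff ℝ 1 φ) :
    ∫ y in E.shape.ref, (fderiv ℝ φ (E.map y) (fderiv ℝ E.map y (E.shape.corner f k y)) +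
      Shape.dv (n + 1) (E.shape.corner f k) * φ (E.map y)) =
      -facetIntegral (E.vert k) s φ := by
  obtain ⟨shape, vert, hinj, hdet⟩ := E
  cases shape with
  | simplex => exact green_corner_simplex vert _ rfl hinj hdet rfl hk hs hr hφ
  | quad => exact green_corner_quad vert _ rfl hinj hdet rfl hk hr hφ

end Element

/-! ### Weak divergence, the Piola transformation in integrals, gluing of elementwise fields. -/

section Hdiv

variable {d : ℕ} {Ω ΓD : Set (Pt d)}

lemma continuous_pderiv {φ : Pt d → ℝ} (hφ : ContDiff ℝ (⊤ : ℕ∞) φ) (i : Fin d) :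
    Continuous (pderiv i φ) :=
  (hφ.continuous_fderiv (by simp)).clm_apply continuous_const

lemma hasCompactSupport_pderiv {φ : Pt d → ℝ} (hφ : HasCompactSupport φ) (i : Fin d) :
    HasCompactSupport (pderiv i φ) :=
  hφ.fderiv_apply (𝕜 := ℝ) (Pi.single i 1)

lemma integrable_mul_test {g ψ : Pt d → ℝ} (hg : MemLp g 2 (volume.restrict Ω))
    (hψ : Continuous ψ) (hψc : HasCompactSupport ψ) :
    Integrable (fun x => g x * ψ x) (volume.restrict Ω) :=
  MemLp.integrable_mul (p := 2) (q := 2) hg (hψ.memLp_of_hasCompactSupport hψc)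

lemma memLp_apply {ζ : Pt d → Pt d} (hζ : MemLp ζ 2 (volume.restrict Ω)) (i : Fin d) :
    MemLp (fun x => ζ x i) 2 (volume.restrict Ω) :=
  (ContinuousLinearMap.proj (R := ℝ) (φ := fun _ : Fin d => ℝ) i).comp_memLp' hζ

lemma integrable_sum_test {ζ : Pt d → Pt d} {φ : Pt d → ℝ}
    (hζ : MemLp ζ 2 (volume.restrict Ω)) (hφ : ContDiff ℝ (⊤ : ℕ∞) φ)
    (hφc : HasCompactSupport φ) :
    Integrable (fun x => ∑ i, ζ x i * pderiv i φ x) (volume.restrict Ω) :=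
  integrable_finsetSum _ fun i _ =>
    integrable_mul_test (memLp_apply hζ i) (continuous_pderiv hφ i) (hasCompactSupport_pderiv hφc i)

lemma MemHdiv.add {ζ η : Pt d → Pt d} (hζ : MemHdiv Ω ΓD ζ) (hη : MemHdiv Ω ΓD η) :
    MemHdiv Ω ΓD (ζ + η) := by
  obtain ⟨h1, g, hg, h2⟩ := hζ
  obtain ⟨k1, g', hg', k2⟩ := hη
  refine ⟨h1.add k1, g + g', hg.add hg', fun φ hφ hφc hd => ?_⟩
  have e1 := integral_add (integrable_sum_test h1 hφ hφc) (integrable_sum_test k1 hφ hφc)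
  have e2 := integral_add (integrable_mul_test hg hφ.continuous hφc)
    (integrable_mul_test hg' hφ.continuous hφc)
  simp only [Pi.add_apply, add_mul, Finset.sum_add_distrib] at *
  rw [e1, e2, h2 φ hφ hφc hd, k2 φ hφ hφc hd]
  ring

lemma MemHdiv.const_smul {ζ : Pt d → Pt d} (hζ : MemHdiv Ω ΓD ζ) (c : ℝ) :
    MemHdiv Ω ΓD (c • ζ) := by
  obtain ⟨h1, g, hg, h2⟩ := hζ
  refine ⟨h1.const_smul c, c • g, hg.const_smul c, fun φ hφ hφc hd => ?_⟩
  simp only [Pi.smul_apply, smul_eq_mul, mul_assoc, ← Finset.mul_sum, integral_const_mul]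
  rw [h2 φ hφ hφc hd]
  ring

lemma MemHdiv.zero : MemHdiv Ω ΓD (0 : Pt d → Pt d) :=
  ⟨MemLp.zero, 0, MemLp.zero, fun φ _ _ _ => by simp⟩

end Hdiv

namespace Element

variable {d : ℕ} (E : Element d)

lemma piola_map {y : Pt d} (hy : y ∈ E.shape.ref) (ζ : Pt d → Pt d) :
    E.piola ζ (E.map y) = (E.J y)⁻¹ • fderiv ℝ E.map y (ζ y) := by
  rw [piola, E.inv_map hy]

lemma push_map {α : Type} {y : Pt d} (hy : y ∈ E.shape.ref) (w : Pt d → α) :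
    E.push w (E.map y) = w y := by
  rw [push, E.inv_map hy]

lemma piola_vert (k : Fin E.shape.nv) (ζ : Pt d → Pt d) :
    E.piola ζ (E.vert k) = (E.J (E.shape.refVert k))⁻¹ •
      fderiv ℝ E.map (E.shape.refVert k) (ζ (E.shape.refVert k)) := by
  rw [← E.map_refVert k, E.piola_map (E.shape.refVert_mem k)]

lemma push_vert {α : Type} (k : Fin E.shape.nv) (w : Pt d → α) :
    E.push w (E.vert k) = w (E.shape.refVert k) := by
  rw [push, E.inv_vert]

lemma piola_add (ζ η : Pt d → Pt d) : E.piola (ζ + η) = E.piola ζ + E.piola η := by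
  funext x; simp [piola]

lemma piola_smul (c : ℝ) (ζ : Pt d → Pt d) : E.piola (c • ζ) = c • E.piola ζ := by
  funext x; simp [piola, smul_comm c]

lemma fderiv_apply_eq_sum (φ : Pt d → ℝ) (x v : Pt d) :
    fderiv ℝ φ x v = ∑ i, v i * pderiv i φ x := by
  have : v = ∑ i, v i • (Pi.single i 1 : Pt d) := by
    funext j; simp [Pi.single_apply]
  conv_lhs => rw [this]
  simp [pderiv]

/-- The factor `J⁻¹` of the Piola transformation cancels the Jacobian of the change of variables,
and the chain rule absorbs the derivative of the map. -/
lemma integral_piola (ζ : Pt d → Pt d) (φ : Pt d → ℝ) :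
    ∫ x in E.body, ∑ i, E.piola ζ x i * pderiv i φ x =
      ∫ y in E.shape.ref, fderiv ℝ φ (E.map y) (fderiv ℝ E.map y (ζ y)) := by
  rw [E.integral_body]
  refine setIntegral_congr_fun E.shape.isClosed_ref.measurableSet fun y hy => ?_
  have hJ := (E.J_pos hy).ne'
  simp only [← fderiv_apply_eq_sum, E.piola_map hy, map_smul, smul_eq_mul]
  field_simp

lemma integral_push_div (c : ℝ) (φ : Pt d → ℝ) :
    ∫ x in E.body, E.push (fun y => c / E.J y) x * φ x =
      ∫ y in E.shape.ref, c * φ (E.map y) := by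
  rw [E.integral_body]
  refine setIntegral_congr_fun E.shape.isClosed_ref.measurableSet fun y hy => ?_
  have hJ := (E.J_pos hy).ne'
  simp only [E.push_map hy]
  field_simp

lemma integral_divg_piola {ζ : Pt d → Pt d} (hζ : ζ ∈ E.shape.bdm) :
    ∫ x in E.body, divg (E.piola ζ) x = Shape.dv d ζ * volume.real E.shape.ref := by
  rw [E.integral_body]
  have h : ∀ᵐ y ∂(volume.restrict E.shape.ref),
      E.J y * divg (E.piola ζ) (E.map y) = Shape.dv d ζ := by
    -- The formula for the divergence holds in the open element only, hence almost everywhere.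
    have h0 : ∀ᵐ y ∂(volume.restrict E.shape.ref), y ∈ E.shape.inner := by
      rw [ae_restrict_iff' E.shape.isClosed_ref.measurableSet]
      refine measure_mono_null (fun y hy => ?_) E.shape.volume_ref_diff_inner
      simp at hy
      exact hy
    filter_upwards [h0] with y hy
    rw [E.divg_piola hζ hy]
    have hJ := (E.J_pos (E.shape.inner_subset hy)).ne'
    field_simp
  rw [integral_congr_ae h]
  simp [mul_comm]

lemma continuousOn_push {α : Type} [TopologicalSpace α] {w : Pt d → α} (hw : Continuous w) :
    ContinuousOn (E.push w) E.body :=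
  hw.comp_continuousOn E.continuousOn_inv

lemma continuousOn_piola {ζ : Pt d → Pt d} (hζ : Continuous ζ) :
    ContinuousOn (E.piola ζ) E.body := by
  have h1 : ContinuousOn (fun y => (E.J y)⁻¹ • fderiv ℝ E.map y (ζ y)) E.shape.ref := by
    refine ContinuousOn.smul (E.continuous_J.continuousOn.inv₀ fun y hy => (E.J_pos hy).ne') ?_
    exact ((E.contDiff_map.continuous_fderiv (by simp)).clm_apply hζ).continuousOn
  exact h1.comp E.continuousOn_inv fun x hx => E.inv_mem hx

lemma memLp_indicator {F : Type} [NormedAddCommGroup F] {g : Pt d → F}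
    (hg : ContinuousOn g E.body) (Ω : Set (Pt d)) :
    MemLp ((interior E.body).indicator g) 2 (volume.restrict Ω) := by
  refine MemLp.restrict _ ?_
  rw [memLp_indicator_iff_restrict isOpen_interior.measurableSet]
  have h : MemLp g 2 (volume.restrict E.body) := by
    obtain ⟨C, hC⟩ := E.isCompact_body.exists_bound_of_continuousOn hg
    have : IsFiniteMeasure (volume.restrict E.body) :=
      ⟨by simpa using E.isCompact_body.measure_lt_top⟩
    refine MemLp.of_bound (hg.aestronglyMeasurable_of_isCompact E.isCompact_body
      E.isCompact_body.measurableSet) C ?_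
    exact (ae_restrict_iff' E.isCompact_body.measurableSet).2 (Filter.Eventually.of_forall hC)
  exact h.mono_measure (Measure.restrict_mono interior_subset le_rfl)

lemma setIntegral_interior (g : Pt d → ℝ) :
    ∫ x in interior E.body, g x = ∫ x in E.body, g x := by
  refine setIntegral_congr_set ?_
  exact ae_eq_set.2 ⟨by simp [Set.sdiff_eq_empty.2 (interior_subset (s := E.body))], E.volume_body_diff_interior⟩
end Element

namespace Mesh

variable {d : ℕ} {Ω ΓD : Set (Pt d)} (M : Mesh Ω)

lemma interior_body_subset (hΩ : interior (closure Ω) = Ω) (i : Fin M.n) :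
    interior (M.elem i).body ⊆ Ω := by
  refine (interior_mono ?_).trans hΩ.subset
  exact M.cover ▸ Set.subset_iUnion (fun i => (M.elem i).body) i

lemma integral_sum_indicator (hΩ : interior (closure Ω) = Ω) {g : Fin M.n → Pt d → ℝ}
    (hg : ∀ i, IntegrableOn (g i) (M.elem i).body) :
    ∫ x in Ω, ∑ i, (interior (M.elem i).body).indicator (g i) x =
      ∑ i, ∫ x in (M.elem i).body, g i x := by
  rw [integral_finsetSum]
  · refine Finset.sum_congr rfl fun i _ => ?_
    rw [setIntegral_indicator isOpen_interior.measurableSet,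
      Set.inter_eq_right.2 (M.interior_body_subset hΩ i), Element.setIntegral_interior]
  · intro i _
    refine Integrable.restrict ?_
    rw [integrable_indicator_iff isOpen_interior.measurableSet]
    exact (hg i).mono_set interior_subset

/-- A family of `BDM₁` fields which satisfies Green's formula on the whole is in `H(div)`. -/
theorem memHdiv_glue (hΩ : interior (closure Ω) = Ω) {ζ : Fin M.n → Pt d → Pt d}
    (hζ : ∀ i, ζ i ∈ (M.elem i).shape.bdm)
    (h : ∀ φ : Pt d → ℝ, ContDiff ℝ (⊤ : ℕ∞) φ → Disjoint (tsupport φ) ΓD →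
      ∑ i, ∫ y in (M.elem i).shape.ref, (fderiv ℝ φ ((M.elem i).map y)
        (fderiv ℝ (M.elem i).map y (ζ i y)) + Shape.dv d (ζ i) * φ ((M.elem i).map y)) = 0) :
    MemHdiv Ω ΓD (M.glue (M.vecField ζ)) := by
  have hζc : ∀ i, Continuous (ζ i) := fun i => (Shape.contDiff_of_mem_bdm _ (hζ i)).continuous
  -- The weak divergence is the elementwise one, `dv / J` transported to the physical element.
  let g : Fin M.n → Pt d → ℝ := fun i =>
    (M.elem i).push fun y => Shape.dv d (ζ i) / (M.elem i).J y
  have hpc : ∀ i, ContinuousOn ((M.elem i).piola (ζ i)) (M.elem i).body := fun i =>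
    (M.elem i).continuousOn_piola (hζc i)
  have hgc : ∀ i, ContinuousOn (g i) (M.elem i).body := fun i =>
    (continuousOn_const.div (M.elem i).continuous_J.continuousOn fun y hy =>
      ((M.elem i).J_pos hy).ne').comp (M.elem i).continuousOn_inv fun x hx => (M.elem i).inv_mem hx
  refine ⟨?_, fun x => ∑ i, (interior (M.elem i).body).indicator (g i) x, ?_, ?_⟩
  · refine memLp_finsetSum _ fun i _ => ?_
    exact (M.elem i).memLp_indicator (hpc i) Ω
  · refine memLp_finsetSum _ fun i _ => ?_
    exact (M.elem i).memLp_indicator (hgc i) Ω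
  · intro φ hφ hφc hd
    have hp : ∀ k, Continuous (pderiv k φ) := continuous_pderiv hφ
    have e1 : ∀ x, ∑ k, M.glue (M.vecField ζ) x k * pderiv k φ x =
        ∑ i, (interior (M.elem i).body).indicator
          (fun x => ∑ k, (M.elem i).piola (ζ i) x k * pderiv k φ x) x := by
      intro x
      simp only [glue, Finset.sum_apply, Finset.sum_mul]
      rw [Finset.sum_comm]
      refine Finset.sum_congr rfl fun i _ => ?_
      by_cases hx : x ∈ interior (M.elem i).body <;> simp [hx, vecField]
    have e2 : ∀ x, (∑ i, (interior (M.elem i).body).indicator (g i) x) * φ x =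
        ∑ i, (interior (M.elem i).body).indicator (fun x => g i x * φ x) x := by
      intro x
      rw [Finset.sum_mul]
      refine Finset.sum_congr rfl fun i _ => ?_
      by_cases hx : x ∈ interior (M.elem i).body <;> simp [hx]
    simp only [e1, e2]
    rw [M.integral_sum_indicator hΩ, M.integral_sum_indicator hΩ, eq_neg_iff_add_eq_zero,
      ← Finset.sum_add_distrib, ← h φ hφ hd]
    · refine Finset.sum_congr rfl fun i _ => ?_
      have hcm := (M.elem i).continuous_map
      have hdm := (M.elem i).contDiff_map.continuous_fderiv (n := (⊤ : ℕ∞)) (by simp)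
      have hdφ := hφ.continuous_fderiv (by simp)
      rw [Element.integral_piola, Element.integral_push_div, ← integral_add]
      · refine ContinuousOn.integrableOn_compact (M.elem i).shape.isCompact_ref (Continuous.continuousOn ?_)
        exact (hdφ.comp hcm).clm_apply (hdm.clm_apply (hζc i))
      · refine ContinuousOn.integrableOn_compact (M.elem i).shape.isCompact_ref (Continuous.continuousOn ?_)
        exact continuous_const.mul (hφ.continuous.comp hcm)
    · intro i
      exact ((hgc i).mul hφ.continuous.continuousOn).integrableOn_compact (M.elem i).isCompact_body
    · intro i
      refine ContinuousOn.integrableOn_compact (M.elem i).isCompact_body ?_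
      refine continuousOn_finsetSum _ fun k _ => ContinuousOn.mul ?_ (hp k).continuousOn
      exact (continuous_apply k).comp_continuousOn (hpc i)

/-- The `f`-th facet of the `i`-th element is the `f'`-th facet of the `j`-th element. -/
structure Shared (i : Fin M.n) (f : Fin (M.elem i).shape.nv) (j : Fin M.n)
    (f' : Fin (M.elem j).shape.nv) : Prop where
  ne : i ≠ j
  vert_eq : (M.elem i).vert '' ((M.elem i).shape.facet f) =
    (M.elem j).vert '' ((M.elem j).shape.facet f')
  inter_eq : (M.elem i).body ∩ (M.elem j).body = (M.elem i).hull ((M.elem i).shape.facet f)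

end Mesh

/-! ### Corner functions as members of the discrete `H(div)` spaces. -/

section Corner

/-- The integral over the unit simplex of the nodal function of the origin. -/
def cornerMass (n : ℕ) : ℝ := ∫ x in unitSimplex n, (1 - ∑ i, x i)

variable {n : ℕ}

lemma cornerMass_pos : 0 < cornerMass n := by
  have hc : Continuous fun x : Pt n => 1 - ∑ i, x i := by fun_prop
  have hi : IntegrableOn (fun x : Pt n => 1 - ∑ i, x i) (unitSimplex n) :=
    hc.continuousOn.integrableOn_compact (Shape.isCompact_ref (.simplex n))
  have hm : MeasurableSet (unitSimplex n) := (Shape.isClosed_ref (.simplex n)).measurableSet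
  rw [cornerMass, setIntegral_pos_iff_support_of_nonneg_ae _ hi]
  · have hin : (Shape.simplex n).inner ⊆
        (Function.support fun x : Pt n => 1 - ∑ i, x i) ∩ unitSimplex n := by
      intro x hx
      have h := hx (0 : Fin (n + 1))
      rw [Shape.simplex_bd] at h
      exact ⟨h.ne', Shape.inner_subset _ hx⟩
    exact ((Shape.isOpen_inner _).measure_pos volume (Shape.inner_nonempty _)).trans_le
      (measure_mono hin)
  · refine (ae_restrict_iff' hm).2 (Filter.Eventually.of_forall fun x hx => ?_)
    simpa using hx.2

lemma Element.exists_enum (E : Element (n + 1)) {f k : Fin E.shape.nv}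
    (hk : k ∈ E.shape.facet f) : ∃ s : Fin n → Pt (n + 1), Function.Injective s ∧
      Set.range s = E.vert '' ((E.shape.facet f).erase k) := by
  have hcard : ((E.shape.facet f).erase k).card = n := by
    rw [Finset.card_erase_of_mem hk, E.shape.card_facet]; rfl
  let e := ((E.shape.facet f).erase k).equivFinOfCardEq hcard
  refine ⟨fun j => E.vert (e.symm j), ?_, ?_⟩
  · exact E.vert_injective.comp (Subtype.val_injective.comp e.symm.injective)
  · rw [show (fun j => E.vert (e.symm j)) = E.vert ∘ Subtype.val ∘ e.symm from rfl,
      Set.range_comp, Set.range_comp, e.symm.range_eq_univ, Set.image_univ]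
    congr 1
    ext x
    simp [and_comm]

/-- Green's formula with the test function one. The total flux of a corner function is the same for
all elements of both shapes, which provides a single mass in the kernel relations. -/
lemma Element.dv_corner (E : Element (n + 1)) {f k : Fin E.shape.nv}
    (hk : k ∈ E.shape.facet f) :
    Shape.dv (n + 1) (E.shape.corner f k) * volume.real E.shape.ref = -cornerMass n := by
  obtain ⟨s, hs, hr⟩ := E.exists_enum hk
  have h := E.green_corner hk hs hr (φ := fun _ => 1) contDiff_const
  simp only [fderiv_fun_const, Pi.zero_apply, zero_apply, zero_add, mul_one,
    facetIntegral] at h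
  rw [setIntegral_const, smul_eq_mul] at h
  rw [cornerMass, ← h, mul_comm]

lemma facetIntegral_eq_zero {d : ℕ} {r : Pt d} {s : Fin n → Pt d} {φ : Pt d → ℝ} {C : Set (Pt d)}
    (hC : Convex ℝ C) (hr : r ∈ C) (hs : ∀ j, s j ∈ C) (h : ∀ x ∈ C, φ x = 0) :
    facetIntegral r s φ = 0 := by
  rw [facetIntegral, setIntegral_eq_zero_of_forall_eq_zero]
  intro x hx
  rw [h _ _, mul_zero]
  have e : r + ∑ j, x j • (s j - r) =
      ∑ j, (Fin.cons (1 - ∑ i, x i) x : Fin (n + 1) → ℝ) j • (Fin.cons r s : Fin (n + 1) → Pt d) j := by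
    rw [Fin.sum_univ_succ]
    simp only [Fin.cons_zero, Fin.cons_succ, smul_sub, Finset.sum_sub_distrib, sub_smul, one_smul,
      Finset.sum_smul]
    abel
  rw [e]
  refine hC.sum_mem (fun j _ => ?_) (by rw [Fin.sum_univ_succ]; simp) fun j _ => ?_
  · refine Fin.cases ?_ (fun j => ?_) j
    · simpa using hx.2
    · simpa using hx.1 j
  · exact Fin.cases hr hs j

namespace Mesh

variable {Ω : Set (Pt (n + 1))} (M : Mesh Ω)

lemma single_corner_mem_bdm (i : Fin M.n) (f k : Fin (M.elem i).shape.nv) (j : Fin M.n) :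
    (Pi.single i ((M.elem i).shape.corner f k) : Fin M.n → Pt (n + 1) → Pt (n + 1)) j ∈
      (M.elem j).shape.bdm := by
  rcases eq_or_ne j i with rfl | h
  · rw [Pi.single_eq_same]; exact Shape.corner_mem _
  · rw [Pi.single_eq_of_ne h]; exact Submodule.zero_mem _

/-- Corner function of a Dirichlet facet. -/
theorem corner_mem_Zh (hΩ : interior (closure Ω) = Ω) (Γ : BoundarySplit Ω) {i : Fin M.n}
    {f k : Fin (M.elem i).shape.nv} (hk : k ∈ (M.elem i).shape.facet f)
    (hf : (M.elem i).hull ((M.elem i).shape.facet f) ⊆ Γ.ΓD) :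
    (Pi.single i ((M.elem i).shape.corner f k) : Fin M.n → Pt (n + 1) → Pt (n + 1)) ∈
      M.Zh Γ := by
  refine ⟨M.single_corner_mem_bdm i f k, M.memHdiv_glue hΩ (M.single_corner_mem_bdm i f k) ?_⟩
  intro φ hφ hd
  rw [Finset.sum_eq_single i]
  · obtain ⟨s, hs, hr⟩ := (M.elem i).exists_enum hk
    rw [Pi.single_eq_same, (M.elem i).green_corner hk hs hr (hφ.of_le (by exact_mod_cast le_top)),
      facetIntegral_eq_zero (convex_convexHull ℝ _) (C := (M.elem i).hull _), neg_zero]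
    · exact subset_convexHull ℝ _ ⟨k, hk, rfl⟩
    · intro j
      refine convexHull_mono (Set.image_mono ?_) (subset_convexHull ℝ _ (hr ▸ Set.mem_range_self j))
      exact_mod_cast Finset.erase_subset k _
    · intro x hx
      by_contra hne
      exact Set.disjoint_left.1 hd (subset_tsupport φ hne) (hf hx)
  · intro j _ hj
    simp [Pi.single_eq_of_ne hj]
  · simp

/-- Difference of the corner functions of a shared facet. -/
theorem Shared.corner_sub_mem_Zh {M : Mesh Ω} (hΩ : interior (closure Ω) = Ω)
    (Γ : BoundarySplit Ω) {i j : Fin M.n}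
    {f : Fin (M.elem i).shape.nv} {f' : Fin (M.elem j).shape.nv} (h : M.Shared i f j f')
    {k : Fin (M.elem i).shape.nv} {l : Fin (M.elem j).shape.nv}
    (hk : k ∈ (M.elem i).shape.facet f) (hl : l ∈ (M.elem j).shape.facet f')
    (hkl : (M.elem i).vert k = (M.elem j).vert l) :
    (Pi.single i ((M.elem i).shape.corner f k) - Pi.single j ((M.elem j).shape.corner f' l) :
      Fin M.n → Pt (n + 1) → Pt (n + 1)) ∈ M.Zh Γ := by
  have hb : ∀ m, (Pi.single i ((M.elem i).shape.corner f k) -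
      Pi.single j ((M.elem j).shape.corner f' l) : Fin M.n → Pt (n + 1) → Pt (n + 1)) m ∈
      (M.elem m).shape.bdm := fun m =>
    Submodule.sub_mem _ (M.single_corner_mem_bdm i f k m) (M.single_corner_mem_bdm j f' l m)
  refine ⟨hb, M.memHdiv_glue hΩ hb ?_⟩
  intro φ hφ _
  have hφ1 : ContDiff ℝ 1 φ := hφ.of_le (by exact_mod_cast le_top)
  rw [Finset.sum_eq_add i j h.ne]
  · obtain ⟨s, hs, hr⟩ := (M.elem i).exists_enum hk
    -- One enumeration of the common facet serves both elements. The two facet integrals therefore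
    -- agree, and they cancel for every test function.
    have hr' : Set.range s = (M.elem j).vert '' (((M.elem j).shape.facet f').erase l) := by
      rw [hr, Finset.coe_erase, Finset.coe_erase, Set.image_sdiff (M.elem i).vert_injective,
        Set.image_sdiff (M.elem j).vert_injective, h.vert_eq]
      simp [hkl]
    have e1 := (M.elem i).green_corner hk hs hr hφ1
    have e2 := (M.elem j).green_corner hl hs hr' hφ1
    simp only [Pi.sub_apply, Pi.single_eq_same, Pi.single_eq_of_ne h.ne,
      Pi.single_eq_of_ne h.ne.symm, sub_zero, zero_sub, Pi.zero_apply]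
    rw [e1]
    have e3 : ∀ y, fderiv ℝ φ ((M.elem j).map y) (fderiv ℝ (M.elem j).map y
        (-(M.elem j).shape.corner f' l y)) + Shape.dv (n + 1) (-(M.elem j).shape.corner f' l) *
        φ ((M.elem j).map y) = -(fderiv ℝ φ ((M.elem j).map y) (fderiv ℝ (M.elem j).map y
        ((M.elem j).shape.corner f' l y)) + Shape.dv (n + 1) ((M.elem j).shape.corner f' l) *
        φ ((M.elem j).map y)) := by
      intro y
      rw [map_neg, map_neg, map_neg]
      ring
    rw [integral_congr_ae (Filter.Eventually.of_forall e3), integral_neg, e2, hkl]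
    ring
  · intro m _ hm
    simp [Pi.single_eq_of_ne hm.1, Pi.single_eq_of_ne hm.2]
  · simp
  · simp

end Mesh

end Corner

/-! ### Faces of elements, their convex hulls, and normals. -/

namespace Shape

variable {d : ℕ} (s : Shape d)

lemma IsFace.subset_facet {s : Shape d} {S : Finset (Fin s.nv)} (hS : s.IsFace S) :
    ∃ f, S ⊆ s.facet f := by
  cases s with
  | simplex =>
    revert S
    change ∀ S : Finset (Fin (d + 1)), S ≠ Finset.univ → ∃ f : Fin (d + 1), S ⊆ Finset.univ.erase f
    intro S hS
    obtain ⟨f, hf⟩ : ∃ f, f ∉ S := by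
      by_contra h
      push Not at h
      exact hS (Finset.eq_univ_iff_forall.2 h)
    exact ⟨f, fun k hk => Finset.mem_erase.2 ⟨fun h => hf (h ▸ hk), Finset.mem_univ k⟩⟩
  | quad =>
    revert S
    change ∀ S : Finset (Fin 4), (S.card ≤ 1 ∨ ∃ k : Fin 4, S = {k, k + 1}) →
      ∃ f : Fin 4, S ⊆ {f, f + 1}
    rintro S (h | ⟨k, rfl⟩)
    · rcases Finset.card_le_one_iff_subset_singleton.1 h with ⟨x, hx⟩
      exact ⟨x, hx.trans (by simp)⟩
    · exact ⟨k, subset_rfl⟩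

/-- Nodal functions are affine on a face. This holds also for the square, where a proper face is
contained in an edge, along which a bilinear function is affine. -/
lemma nodal_face_combo {S : Finset (Fin s.nv)} (hS : s.IsFace S) {c : Fin s.nv → ℝ}
    (hc : ∀ k, k ∉ S → c k = 0) (h1 : ∑ k, c k = 1) (j : Fin s.nv) :
    s.nodal j (∑ k, c k • s.refVert k) = c j := by
  obtain ⟨f, hf⟩ := hS.subset_facet
  replace hc : ∀ k, k ∉ s.facet f → c k = 0 := fun k hk => hc k fun h => hk (hf h)
  clear hf hS S
  cases s with
  | simplex => exact simplexNodal_sum c h1 j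
  | quad =>
    revert c f j
    change ∀ c : Fin 4 → ℝ, ∑ k, c k = 1 → ∀ j f : Fin 4,
      (∀ k : Fin 4, k ∉ ({f, f + 1} : Finset (Fin 4)) → c k = 0) →
      quadNodal j (∑ k : Fin 4, c k • quadVert k) = c j
    intro c h1 j f hc
    rw [Fin.sum_univ_four] at h1 ⊢
    have h2 := hc (f + 2) (by clear * -; revert f; decide)
    have h3 := hc (f + 3) (by clear * -; revert f; decide)
    clear hc
    fin_cases f <;> simp at h2 h3 <;> simp only [h2, h3, add_zero, zero_add] at h1 <;>
      have e := eq_sub_of_add_eq h1 <;> fin_cases j <;>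
      simp [quadNodal, quadVert, h2, h3, e]

lemma bd_sum (f : Fin s.nv) {ι : Type*} (t : Finset ι) (c : ι → ℝ) (x : ι → Pt d)
    (h1 : ∑ k ∈ t, c k = 1) : s.bd f (∑ k ∈ t, c k • x k) = ∑ k ∈ t, c k * s.bd f (x k) := by
  simp only [bd, mul_add, Finset.sum_add_distrib, ← Finset.sum_mul, h1, map_sum, map_smul,
    smul_eq_mul, one_mul]

/-- A linear functional which is constant on a facet is a multiple of `bdLin`. -/
lemma eq_mul_bdLin {f k₀ : Fin s.nv} (hk₀ : k₀ ∈ s.facet f) (L : Pt d →ₗ[ℝ] ℝ)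
    (hL : ∀ k ∈ s.facet f, ∀ l ∈ s.facet f, L (s.refVert k - s.refVert l) = 0) (v : Pt d) :
    L v = L (s.refVert (s.opp f k₀) - s.refVert k₀) * s.bdLin f v := by
  have hker : ∀ v, s.bdLin f v = 0 → L v = 0 := by
    clear hk₀
    cases s with
    | simplex =>
      revert f
      change ∀ f : Fin (d + 1), (∀ k ∈ Finset.univ.erase f, ∀ l ∈ Finset.univ.erase f,
        L (simplexVert k - simplexVert l) = 0) → ∀ v, (Shape.simplex d).bdLin f v = 0 → L v = 0
      intro f hL v hv
      have hv' : simplexDnodal f v = 0 := by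
        rw [← hv]
        refine Fin.cases ?_ (fun i => ?_) f
        · change -∑ i, v i = (-∑ i, LinearMap.proj i : Pt d →ₗ[ℝ] ℝ) v
          simp
        · rfl
      have hsum : ∑ k : Fin (d + 1), simplexDnodal k v = 0 := by
        rw [Fin.sum_univ_succ]; simp [simplexDnodal]
      have hrep : v = ∑ k : Fin (d + 1), simplexDnodal k v • simplexVert k := by
        rw [Fin.sum_univ_succ]
        funext j
        simp [simplexDnodal, Pi.single_apply]
      by_cases hne : ∃ l, l ≠ f
      · obtain ⟨l, hl⟩ := hne
        have : v = ∑ k : Fin (d + 1), simplexDnodal k v • (simplexVert k - simplexVert l) := by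
          simp only [smul_sub, Finset.sum_sub_distrib, ← Finset.sum_smul, hsum, zero_smul, sub_zero]
          exact hrep
        rw [this, map_sum]
        refine Finset.sum_eq_zero fun k _ => ?_
        rw [map_smul]
        rcases eq_or_ne k f with rfl | hk
        · rw [hv', zero_smul]
        · rw [hL k (by simp [hk]) l (by simp [hl]), smul_zero]
      · push Not at hne
        rw [hrep, map_sum]
        refine Finset.sum_eq_zero fun k _ => ?_
        rw [hne k, hv', zero_smul, map_zero]
    | quad =>
      revert f
      change ∀ f : Fin 4, (∀ k ∈ ({f, f + 1} : Finset (Fin 4)), ∀ l ∈ ({f, f + 1} : Finset (Fin 4)),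
        L (quadVert k - quadVert l) = 0) → ∀ v, (![LinearMap.proj 1, -LinearMap.proj 0,
          -LinearMap.proj 1, LinearMap.proj 0] : Fin 4 → Pt 2 →ₗ[ℝ] ℝ) f v = 0 → L v = 0
      intro f hL v hv
      have h := hL (f + 1) (by simp) f (by simp)
      have : ∃ c : ℝ, v = c • (quadVert (f + 1) - quadVert f) := by
        fin_cases f
        · refine ⟨v 0, ?_⟩
          simp at hv
          funext i; fin_cases i <;> simp [quadVert, hv]
        · refine ⟨v 1, ?_⟩
          simp at hv
          funext i; fin_cases i <;> simp [quadVert, hv]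
        · refine ⟨-v 0, ?_⟩
          simp at hv
          funext i; fin_cases i <;> simp [quadVert, hv]
        · refine ⟨-v 1, ?_⟩
          simp at hv
          funext i; fin_cases i <;> simp [quadVert, hv]
      obtain ⟨c, hc⟩ := this
      rw [hc, map_smul, h, smul_zero]
  have := hker (v - s.bdLin f v • (s.refVert (s.opp f k₀) - s.refVert k₀)) (by
    rw [map_sub, map_smul, s.bdLin_opp hk₀]; simp)
  rw [map_sub, map_smul, sub_eq_zero, smul_eq_mul] at this
  rw [this, mul_comm]

end Shape

namespace Element

variable {d : ℕ} (E : Element d)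

lemma map_eq_sum (y : Pt d) : E.map y = ∑ k, E.shape.nodal k y • E.vert k := rfl

lemma map_mem_hull {S : Finset (Fin E.shape.nv)} {y : Pt d} (hy : y ∈ E.shape.ref)
    (h : ∀ j, j ∉ S → E.shape.nodal j y = 0) : E.map y ∈ E.hull S := by
  rw [map_eq_sum, ← Finset.sum_subset (Finset.subset_univ S)
    fun k _ hk => by rw [h k hk, zero_smul]]
  refine (convex_convexHull ℝ _).sum_mem (fun k _ => E.shape.nodal_nonneg hy k) ?_
    fun k hk => subset_convexHull ℝ _ ⟨k, hk, rfl⟩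
  rw [Finset.sum_subset (Finset.subset_univ S) fun k _ hk => h k hk]
  exact E.shape.card_nodal_sum y

lemma sum_refVert_mem {c : Fin E.shape.nv → ℝ} (h0 : ∀ k, 0 ≤ c k) (h1 : ∑ k, c k = 1) :
    ∑ k, c k • E.shape.refVert k ∈ E.shape.ref :=
  E.shape.convex_ref.sum_mem (fun k _ => h0 k) h1 fun k _ => E.shape.refVert_mem k

lemma map_face_combo {S : Finset (Fin E.shape.nv)} (hS : E.shape.IsFace S)
    {c : Fin E.shape.nv → ℝ} (hc : ∀ k, k ∉ S → c k = 0) (h1 : ∑ k, c k = 1) :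
    E.map (∑ k, c k • E.shape.refVert k) = ∑ k, c k • E.vert k := by
  rw [map_eq_sum]
  exact Finset.sum_congr rfl fun k _ => by rw [E.shape.nodal_face_combo hS hc h1]

lemma exists_of_mem_hull {S : Finset (Fin E.shape.nv)} {x : Pt d} (hx : x ∈ E.hull S) :
    ∃ c : Fin E.shape.nv → ℝ, (∀ k, 0 ≤ c k) ∧ (∀ k, k ∉ S → c k = 0) ∧ ∑ k, c k = 1 ∧
      ∑ k, c k • E.vert k = x := by
  classical
  rw [hull, ← Finset.coe_image, Finset.mem_convexHull'] at hx
  obtain ⟨w, h0, h1, h2⟩ := hx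
  rw [Finset.sum_image E.vert_injective.injOn] at h1 h2
  refine ⟨fun k => if k ∈ S then w (E.vert k) else 0, fun k => ?_, fun k hk => if_neg hk, ?_, ?_⟩
  · dsimp only
    split_ifs with h
    · exact h0 _ (Finset.mem_image_of_mem _ h)
    · exact le_rfl
  · simpa using h1
  · simpa [ite_smul] using h2

/-- The element map is affine on faces, so the hull of the vertices of a face is the image of the
reference face, which is cut out by nodal functions. -/
lemma mem_hull_iff {S : Finset (Fin E.shape.nv)} (hS : E.shape.IsFace S) {x : Pt d} :
    x ∈ E.hull S ↔ x ∈ E.body ∧ ∀ j, j ∉ S → E.shape.nodal j (E.inv x) = 0 := by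
  constructor
  · intro hx
    obtain ⟨c, h0, hc, h1, rfl⟩ := E.exists_of_mem_hull hx
    rw [← E.map_face_combo hS hc h1]
    have hm := E.sum_refVert_mem h0 h1
    refine ⟨⟨_, hm, rfl⟩, fun j hj => ?_⟩
    rw [E.inv_map hm, E.shape.nodal_face_combo hS hc h1, hc j hj]
  · rintro ⟨hx, h⟩
    rw [← E.map_inv hx]
    exact E.map_mem_hull (E.inv_mem hx) h

lemma mem_hull_facet_iff {f : Fin E.shape.nv} {x : Pt d} :
    x ∈ E.hull (E.shape.facet f) ↔ x ∈ E.body ∧ E.shape.bd f (E.inv x) = 0 := by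
  rw [E.mem_hull_iff (E.shape.isFace_facet f)]
  exact and_congr_right fun hx => E.shape.nodal_eq_zero_iff (E.inv_mem hx) f

lemma isClosed_hull (S : Finset (Fin E.shape.nv)) : IsClosed (E.hull S) :=
  (Set.Finite.isCompact_convexHull (𝕜 := ℝ) (S.finite_toSet.image _)).isClosed

lemma hull_facet_disjoint_interior {f : Fin E.shape.nv} {x : Pt d}
    (hx : x ∈ E.hull (E.shape.facet f)) : x ∉ interior E.body := by
  obtain ⟨hb, h0⟩ := E.mem_hull_facet_iff.1 hx
  have := E.mem_closure_compl (E.inv_mem hb) h0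
  rwa [E.map_inv hb, closure_compl] at this

/-- A functional `ν` with `ν > ν (vertices of the facet)` in direction of the element, to first
order at the facet `f`. -/
def IsNormal (f : Fin E.shape.nv) (ν : Pt d →ₗ[ℝ] ℝ) : Prop :=
  (∀ k ∈ E.shape.facet f, ∀ l ∈ E.shape.facet f, ν (E.vert k) = ν (E.vert l)) ∧
  ∀ y ∈ E.shape.ref, E.shape.bd f y = 0 →
    ∃ c : ℝ, 0 < c ∧ ∀ v, ν (fderiv ℝ E.map y v) = c * E.shape.bdLin f v

/-- Pull `bdLin f` back by the derivative at one vertex of the facet. Composed with the derivative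
at any other point of the facet, the functional still annihilates the edges of the facet, so it is a
multiple of `bdLin f`. This factor is continuous and never zero on the convex facet, and equals one
at the chosen vertex; hence it is positive. -/
lemma exists_isNormal {f k₀ : Fin E.shape.nv} (hk₀ : k₀ ∈ E.shape.facet f) :
    ∃ ν, E.IsNormal f ν := by
  have hr := E.shape.refVert_mem k₀
  set ν : Pt d →ₗ[ℝ] ℝ := E.shape.bdLin f ∘ₗ
    ((E.fderivEquiv hr).symm : Pt d →L[ℝ] Pt d).toLinearMap with hν
  set w := E.shape.refVert (E.shape.opp f k₀) - E.shape.refVert k₀ with hw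
  have hνD : ∀ v, ν (fderiv ℝ E.map (E.shape.refVert k₀) v) = E.shape.bdLin f v := by
    intro v
    rw [← E.fderivEquiv_apply hr]
    simp [hν]
  have hz := E.shape.bd_refVert_of_mem hk₀
  have htan : ∀ k ∈ E.shape.facet f, ∀ l ∈ E.shape.facet f, ν (E.vert k - E.vert l) = 0 := by
    intro k hk l hl
    rw [← E.fderiv_facet hz hl hk, hνD, E.shape.bdLin_sub, E.shape.bd_refVert_of_mem hk,
      E.shape.bd_refVert_of_mem hl, sub_zero]
  have hmul : ∀ y ∈ E.shape.ref, E.shape.bd f y = 0 → ∀ v, ν (fderiv ℝ E.map y v) =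
      ν (fderiv ℝ E.map y w) * E.shape.bdLin f v := by
    intro y _ hy0 v
    refine E.shape.eq_mul_bdLin hk₀ (ν ∘ₗ (fderiv ℝ E.map y).toLinearMap) (fun k hk l hl => ?_) v
    have := E.fderiv_facet hy0 hl hk
    simpa [this] using htan k hk l hl
  have hne : ∀ y ∈ E.shape.ref, E.shape.bd f y = 0 → ν (fderiv ℝ E.map y w) ≠ 0 := by
    intro y hy hy0 h
    have h1 := hmul y hy hy0 ((E.fderivEquiv hy).symm (fderiv ℝ E.map (E.shape.refVert k₀) w))
    rw [h, zero_mul, ← E.fderivEquiv_apply hy, ContinuousLinearEquiv.apply_symm_apply, hνD, hw,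
      E.shape.bdLin_opp hk₀] at h1
    exact one_ne_zero h1
  have hcont : Continuous fun y => ν (fderiv ℝ E.map y w) := by
    have h1 : Continuous fun y => fderiv ℝ E.map y w :=
      (E.contDiff_map.continuous_fderiv (by simp)).clm_apply continuous_const
    exact ν.continuous_of_finiteDimensional.comp h1
  refine ⟨ν, fun k hk l hl => sub_eq_zero.1 (by rw [← map_sub]; exact htan k hk l hl),
    fun y hy hy0 => ⟨ν (fderiv ℝ E.map y w), ?_, hmul y hy hy0⟩⟩
  by_contra hle
  have hconv : Convex ℝ {y | y ∈ E.shape.ref ∧ E.shape.bd f y = 0} := by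
    refine E.shape.convex_ref.inter (t := {y | E.shape.bd f y = 0}) ?_
    intro a ha b hb p q _ _ hpq
    have := E.shape.bd_sum f Finset.univ ![p, q] ![a, b] (by simpa using hpq)
    simp only [Fin.sum_univ_two, Matrix.cons_val_zero, Matrix.cons_val_one] at this
    change E.shape.bd f _ = 0
    rw [this, show E.shape.bd f a = 0 from ha, show E.shape.bd f b = 0 from hb]
    simp
  have h1 : ν (fderiv ℝ E.map (E.shape.refVert k₀) w) = 1 := by rw [hνD, E.shape.bdLin_opp hk₀]
  obtain ⟨y', hy', h0⟩ := hconv.isPreconnected.intermediate_value (f := fun y => ν (fderiv ℝ E.map y w))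
    ⟨hy, hy0⟩ ⟨hr, hz⟩ hcont.continuousOn (show (0 : ℝ) ∈ Set.Icc _ _ from
      ⟨not_lt.1 hle, by simp only [h1]; norm_num⟩)
  exact hne y' hy'.1 hy'.2 h0

variable {E}

lemma IsNormal.pos {f k : Fin E.shape.nv} {ν : Pt d →ₗ[ℝ] ℝ} (h : E.IsNormal f ν)
    (hk : k ∈ E.shape.facet f) : 0 < ν (E.vert (E.shape.opp f k) - E.vert k) := by
  obtain ⟨c, hc, h1⟩ := h.2 _ (E.shape.refVert_mem k) (E.shape.bd_refVert_of_mem hk)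
  rw [← E.fderiv_opp hk, h1, E.shape.bdLin_opp hk, mul_one]
  exact hc

lemma IsNormal.eventually_mem_inner {f : Fin E.shape.nv} {ν : Pt d →ₗ[ℝ] ℝ}
    (h : E.IsNormal f ν) {y v : Pt d} (hy : y ∈ E.shape.ref) (hy0 : E.shape.bd f y = 0)
    (hpos : ∀ g, g ≠ f → 0 < E.shape.bd g y) (hv : 0 < ν v) :
    ∀ᶠ ε : ℝ in nhdsWithin 0 (Set.Ioi 0), E.map y + ε • v ∈ E.inner := by
  refine E.eventually_mem_inner hy fun g hg => ?_
  obtain rfl : g = f := by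
    by_contra hne
    exact (hpos g hne).ne' hg
  obtain ⟨c, hc, h1⟩ := h.2 y hy hy0
  have := h1 ((E.fderivEquiv hy).symm v)
  rw [← E.fderivEquiv_apply hy, ContinuousLinearEquiv.apply_symm_apply] at this
  rw [this] at hv
  exact pos_of_mul_pos_right hv hc.le

/-- Near a relatively interior point of a facet, the element contains a half ball. -/
lemma IsNormal.exists_half_ball {f : Fin E.shape.nv} {ν : Pt d →ₗ[ℝ] ℝ}
    (h : E.IsNormal f ν) {y : Pt d} (hy : y ∈ E.shape.ref) (hy0 : E.shape.bd f y = 0)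
    (hpos : ∀ g, g ≠ f → 0 < E.shape.bd g y) :
    ∃ ε : ℝ, 0 < ε ∧ ∀ z, dist z (E.map y) < ε → 0 < ν (z - E.map y) → z ∈ interior E.body := by
  set x := E.map y with hx
  have hxb : x ∈ E.body := ⟨y, hy, rfl⟩
  obtain ⟨k₀, hk₀⟩ | hemp := (E.shape.facet f).eq_empty_or_nonempty.symm
  swap
  · -- the facet is empty, so that `d = 0`
    have hd : d = 0 := by rw [← E.shape.card_facet f, hemp, Finset.card_empty]
    subst hd
    refine ⟨1, one_pos, fun z _ hz => ?_⟩
    rw [Subsingleton.elim (z - x) 0, map_zero] at hz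
    exact absurd hz (lt_irrefl _)
  have hνx : ∀ z ∈ E.hull (E.shape.facet f), ν z = ν (E.vert k₀) := by
    intro z hz
    obtain ⟨c, _, hc, h1, rfl⟩ := E.exists_of_mem_hull hz
    rw [map_sum]
    calc ∑ k, ν (c k • E.vert k) = ∑ k, c k * ν (E.vert k₀) := by
          refine Finset.sum_congr rfl fun k _ => ?_
          rw [map_smul, smul_eq_mul]
          by_cases hk : k ∈ E.shape.facet f
          · rw [h.1 k hk k₀ hk₀]
          · rw [hc k hk]; simp
      _ = ν (E.vert k₀) := by rw [← Finset.sum_mul, h1, one_mul]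
  have hxf : x ∈ E.hull (E.shape.facet f) := by
    rw [mem_hull_facet_iff, E.inv_map hy]; exact ⟨hxb, hy0⟩
  have hnear : ∀ᶠ z in nhdsWithin x E.body, ∀ g, g ≠ f → 0 < E.shape.bd g (E.inv z) := by
    rw [Filter.eventually_all]
    intro g
    by_cases hg : g = f
    · exact Filter.Eventually.of_forall fun z h => absurd hg h
    · have hc : ContinuousOn (fun z => E.shape.bd g (E.inv z)) E.body :=
        (E.shape.continuous_bd g).comp_continuousOn E.continuousOn_inv
      have := (hc x hxb).eventually (lt_mem_nhds (a := 0) (by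
        rw [hx]; dsimp only; rw [E.inv_map hy]; exact hpos g hg))
      filter_upwards [this] with z hz _ using hz
  rw [eventually_nhdsWithin_iff, Metric.eventually_nhds_iff] at hnear
  obtain ⟨ε, hε, hnear⟩ := hnear
  refine ⟨ε, hε, fun z hz hνz => ?_⟩
  -- The half ball `H` is convex, hence connected. It meets the interior of the element but not its
  -- frontier: near the given point, frontier points lie on the facet `f`, where `ν` is constant. So
  -- `H` lies inside the element.
  set H : Set (Pt d) := Metric.ball x ε ∩ {z | 0 < ν (z - x)} with hH
  have hHconv : Convex ℝ H := by
    refine (convex_ball x ε).inter ?_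
    have : {z | 0 < ν (z - x)} = {z | ν x < ν z} := by ext z; simp
    rw [this]
    exact convex_halfSpace_gt ν.isLinear _
  have hHopen : IsOpen H := by
    refine Metric.isOpen_ball.inter ?_
    exact isOpen_lt continuous_const
      (ν.continuous_of_finiteDimensional.comp (continuous_id.sub continuous_const))
  have hdisj : Disjoint H (frontier E.body) := by
    rw [Set.disjoint_left]
    intro p hp hpf
    have hpb : p ∈ E.body := E.isCompact_body.isClosed.frontier_subset hpf
    have hpi : p ∉ E.inner := fun hi => hpf.2 (E.inner_subset_interior hi)
    obtain ⟨g, hg⟩ := E.exists_bd_eq_zero hpb hpi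
    obtain rfl : g = f := by
      by_contra hne
      exact (hnear (Metric.mem_ball.1 hp.1) hpb g hne).ne' hg
    have h1 := hνx p (E.mem_hull_facet_iff.2 ⟨hpb, hg⟩)
    have h2 := hp.2
    rw [Set.mem_ofPred_eq, map_sub, h1, hνx x hxf, sub_self] at h2
    exact lt_irrefl _ h2
  have hmeet : (H ∩ interior E.body).Nonempty := by
    have h1 := h.eventually_mem_inner hy hy0 hpos hνz
    have h2 : ∀ᶠ t : ℝ in nhdsWithin 0 (Set.Ioi 0), x + t • (z - x) ∈ Metric.ball x ε := by
      have : Filter.Tendsto (fun t : ℝ => x + t • (z - x)) (nhdsWithin 0 (Set.Ioi 0)) (nhds x) := by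
        have hc : Continuous fun t : ℝ => x + t • (z - x) := by fun_prop
        simpa using (hc.tendsto 0).mono_left nhdsWithin_le_nhds
      exact this.eventually (Metric.ball_mem_nhds x hε)
    obtain ⟨t, ⟨ht1, ht2⟩, ht0⟩ := ((h1.and h2).and self_mem_nhdsWithin).exists
    refine ⟨_, ⟨ht2, ?_⟩, E.inner_subset_interior ht1⟩
    change 0 < ν (x + t • (z - x) - x)
    rw [add_sub_cancel_left, map_smul]
    exact mul_pos ht0 hνz
  have hsub : H ⊆ E.body := by
    by_contra hns
    obtain ⟨p, hp, hpn⟩ := Set.not_subset.1 hns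
    obtain ⟨q, _, hq, hq'⟩ := hHconv.isPreconnected _ _ isOpen_interior
      E.isCompact_body.isClosed.isOpen_compl (fun q hq => by
        by_cases hqb : q ∈ E.body
        · by_cases hqi : q ∈ interior E.body
          · exact Or.inl hqi
          · exact absurd ⟨subset_closure hqb, hqi⟩ (Set.disjoint_left.1 hdisj hq)
        · exact Or.inr hqb) hmeet ⟨p, hp, hpn⟩
    exact hq' (interior_subset hq)
  exact (interior_maximal hsub hHopen) ⟨hz, hνz⟩

end Element

/-! ### Two elements along a common facet. -/

namespace Element

variable {d : ℕ} (E : Element d)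

/-- Relatively interior points of a facet of the reference element. -/
def IsRelint (f : Fin E.shape.nv) (y : Pt d) : Prop :=
  y ∈ E.shape.ref ∧ E.shape.bd f y = 0 ∧ ∀ g, g ≠ f → 0 < E.shape.bd g y

lemma isRelint_combo {f : Fin E.shape.nv} {c : Fin E.shape.nv → ℝ}
    (h0 : ∀ k ∈ E.shape.facet f, 0 < c k) (hc : ∀ k, k ∉ E.shape.facet f → c k = 0)
    (h1 : ∑ k, c k = 1) : E.IsRelint f (∑ k, c k • E.shape.refVert k) := by
  have h0' : ∀ k, 0 ≤ c k := fun k => by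
    by_cases hk : k ∈ E.shape.facet f
    · exact (h0 k hk).le
    · rw [hc k hk]
  have hb : ∀ g k, 0 ≤ E.shape.bd g (E.shape.refVert k) := fun g k =>
    (E.shape.mem_ref_iff _).1 (E.shape.refVert_mem k) g
  refine ⟨E.sum_refVert_mem h0' h1, ?_, fun g hg => ?_⟩
  · rw [E.shape.bd_sum f _ _ _ h1]
    refine Finset.sum_eq_zero fun k _ => ?_
    by_cases hk : k ∈ E.shape.facet f
    · rw [E.shape.bd_refVert_of_mem hk, mul_zero]
    · rw [hc k hk, zero_mul]
  · rw [E.shape.bd_sum g _ _ _ h1]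
    obtain ⟨k, hk, hk'⟩ : ∃ k ∈ E.shape.facet f, k ∉ E.shape.facet g := by
      by_contra h
      push Not at h
      have := Finset.eq_of_subset_of_card_le h (by rw [E.shape.card_facet, E.shape.card_facet])
      exact hg (E.shape.facet_injective this).symm
    refine Finset.sum_pos' (fun k _ => mul_nonneg (h0' k) (hb g k)) ⟨k, Finset.mem_univ k, ?_⟩
    rw [E.shape.bd_refVert_of_notMem hk', mul_one]
    exact h0 k hk

/-- A point with positive weights at the vertices of a facet. -/
lemma exists_isRelint_of_weights {f : Fin E.shape.nv} {V : Finset (Pt d)}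
    (hV : (V : Set (Pt d)) = E.vert '' (E.shape.facet f)) {w : Pt d → ℝ} (h0 : ∀ p ∈ V, 0 < w p)
    (h1 : ∑ p ∈ V, w p = 1) : ∃ y, E.IsRelint f y ∧ E.map y = ∑ p ∈ V, w p • p := by
  classical
  have hV' : V = (E.shape.facet f).image E.vert := by
    apply Finset.coe_injective; rw [hV, Finset.coe_image]
  subst hV'
  rw [Finset.sum_image E.vert_injective.injOn] at h1 ⊢
  let c : Fin E.shape.nv → ℝ := fun k => if k ∈ E.shape.facet f then w (E.vert k) else 0
  have hc : ∀ k, k ∉ E.shape.facet f → c k = 0 := fun k hk => if_neg hk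
  have hc1 : ∑ k, c k = 1 := by simpa [c] using h1
  refine ⟨_, E.isRelint_combo (c := c) (fun k hk => ?_) hc hc1, ?_⟩
  · simp only [c, if_pos hk]
    exact h0 _ (Finset.mem_image_of_mem _ hk)
  · rw [E.map_face_combo (E.shape.isFace_facet f) hc hc1]
    simp [c, ite_smul]

variable {E}

/-- The edges of a facet span a hyperplane, so the functionals constant on its vertices form a line.
The comparison is made after composition with the derivative at one vertex. -/
lemma IsNormal.exists_eq_smul {f k₀ : Fin E.shape.nv} {ν : Pt d →ₗ[ℝ] ℝ} (h : E.IsNormal f ν)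
    (hk₀ : k₀ ∈ E.shape.facet f) (μ : Pt d →ₗ[ℝ] ℝ)
    (hμ : ∀ k ∈ E.shape.facet f, ∀ l ∈ E.shape.facet f, μ (E.vert k) = μ (E.vert l)) :
    ∃ c : ℝ, μ = c • ν := by
  have hr := E.shape.refVert_mem k₀
  have hz := E.shape.bd_refVert_of_mem hk₀
  obtain ⟨c, hc, h1⟩ := h.2 _ hr hz
  have h2 := E.shape.eq_mul_bdLin hk₀ (μ ∘ₗ (fderiv ℝ E.map (E.shape.refVert k₀)).toLinearMap)
    (fun k hk l hl => by
      have := E.fderiv_facet hz hl hk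
      simp [this, hμ k hk l hl])
  set b := (μ ∘ₗ (fderiv ℝ E.map (E.shape.refVert k₀)).toLinearMap)
    (E.shape.refVert (E.shape.opp f k₀) - E.shape.refVert k₀) with hb
  refine ⟨b / c, LinearMap.ext fun v => ?_⟩
  have e1 := h1 ((E.fderivEquiv hr).symm v)
  have e2 := h2 ((E.fderivEquiv hr).symm v)
  rw [LinearMap.comp_apply, ContinuousLinearMap.coe_coe] at e2
  rw [← E.fderivEquiv_apply hr, ContinuousLinearEquiv.apply_symm_apply] at e1 e2
  rw [LinearMap.smul_apply, e1, e2, smul_eq_mul]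
  field_simp

/-- Two elements on the two sides of a common relatively interior point of two facets. -/
lemma IsNormal.mem_interior_union {E' : Element d} {f : Fin E.shape.nv} {f' : Fin E'.shape.nv}
    {ν ν' : Pt d →ₗ[ℝ] ℝ} (h : E.IsNormal f ν) (h' : E'.IsNormal f' ν') {y y' : Pt d}
    (hy : E.IsRelint f y) (hy' : E'.IsRelint f' y') (hyy : E.map y = E'.map y') {c : ℝ}
    (hc : c < 0) (hν : ν' = c • ν) {k₀ : Fin E.shape.nv} (hk₀ : k₀ ∈ E.shape.facet f) :
    E.map y ∈ interior (E.body ∪ E'.body) := by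
  obtain ⟨ε, hε, h1⟩ := h.exists_half_ball hy.1 hy.2.1 hy.2.2
  obtain ⟨ε', hε', h1'⟩ := h'.exists_half_ball hy'.1 hy'.2.1 hy'.2.2
  rw [← hyy] at h1'
  set x := E.map y
  have hclosed : IsClosed (E.body ∪ E'.body) := E.isCompact_body.isClosed.union E'.isCompact_body.isClosed
  have hne : ∀ z ∈ Metric.ball x (min ε ε'), ν (z - x) ≠ 0 → z ∈ E.body ∪ E'.body := by
    intro z hz hνz
    rw [Metric.mem_ball, lt_min_iff] at hz
    rcases lt_or_gt_of_ne hνz with hlt | hgt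
    · exact Or.inr (interior_subset (h1' z hz.2 (by
        rw [hν, LinearMap.smul_apply, smul_eq_mul]; exact mul_pos_of_neg_of_neg hc hlt)))
    · exact Or.inl (interior_subset (h1 z hz.1 hgt))
  rw [mem_interior]
  refine ⟨Metric.ball x (min ε ε'), fun z hz => ?_, Metric.isOpen_ball,
    Metric.mem_ball_self (lt_min hε hε')⟩
  by_cases hνz : ν (z - x) = 0
  -- Points of the hyperplane `ν = ν x` in the ball are limits of points off it, and the union of
  -- the two elements is closed.
  · set v := E.vert (E.shape.opp f k₀) - E.vert k₀
    have hv : 0 < ν v := h.pos hk₀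
    have ht : Filter.Tendsto (fun t : ℝ => z + t • v) (nhdsWithin 0 (Set.Ioi 0)) (nhds z) := by
      have hcont : Continuous fun t : ℝ => z + t • v := by fun_prop
      simpa using (hcont.tendsto 0).mono_left nhdsWithin_le_nhds
    refine hclosed.mem_of_tendsto ht ?_
    filter_upwards [ht.eventually (Metric.isOpen_ball.mem_nhds hz), self_mem_nhdsWithin] with t h3 h4
    refine hne _ h3 ?_
    rw [show z + t • v - x = (z - x) + t • v by abel, map_add, hνz, map_smul, zero_add]
    exact (mul_pos h4 hv).ne'
  · exact hne z hz hνz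

/-- Vertices are extreme points. Write the vertex `k` as a combination of vertices of `T`, and each
of these as a combination of vertices of `S`. Uniqueness of the nodal coordinates forces the total
weight at `k` to be one, so some vertex of `T` has all its weight at `k`. -/
lemma hull_vert_subset {E' : Element d} {S : Finset (Fin E.shape.nv)} {T : Finset (Fin E'.shape.nv)}
    (hS : E.shape.IsFace S) (h : E.hull S = E'.hull T) :
    E.vert '' S ⊆ E'.vert '' T := by
  rintro _ ⟨k, hk, rfl⟩
  have hkT : E.vert k ∈ E'.hull T := h ▸ subset_convexHull ℝ _ ⟨k, hk, rfl⟩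
  obtain ⟨c, c0, cT, c1, hc⟩ := E'.exists_of_mem_hull hkT
  have hl : ∀ l, ∃ μ : Fin E.shape.nv → ℝ, (∀ m, 0 ≤ μ m) ∧ ∑ m, μ m = 1 ∧
      (∀ m, m ∉ S → μ m = 0) ∧ (l ∈ T → ∑ m, μ m • E.vert m = E'.vert l) := by
    intro l
    by_cases hl : l ∈ T
    · obtain ⟨μ, a, b, e, g⟩ := E.exists_of_mem_hull (h ▸ subset_convexHull ℝ _ ⟨l, hl, rfl⟩ :
        E'.vert l ∈ E.hull S)
      exact ⟨μ, a, e, b, fun _ => g⟩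
    -- Outside `T` the coefficient `c l` is zero, so any admissible weights serve as a default.
    · refine ⟨Pi.single k 1, fun m => ?_, by simp, fun m hm => ?_, fun h => absurd h hl⟩
      · by_cases hm : m = k
        · subst hm; simp
        · simp [Pi.single_eq_of_ne hm]
      · rw [Pi.single_eq_of_ne]; rintro rfl; exact hm hk
  choose μ μ0 μ1 μS hμ using hl
  set C : Fin E.shape.nv → ℝ := fun m => ∑ l, c l * μ l m with hC
  have hC1 : ∑ m, C m = 1 := by
    simp only [hC]
    rw [Finset.sum_comm]
    simp [← Finset.mul_sum, μ1, c1]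
  have hCS : ∀ m, m ∉ S → C m = 0 := fun m hm => by simp [hC, μS _ m hm]
  have hC0 : ∀ m, 0 ≤ C m := fun m => Finset.sum_nonneg fun l _ => mul_nonneg (c0 l) (μ0 l m)
  have hmap : E.map (∑ m, C m • E.shape.refVert m) = E.map (E.shape.refVert k) := by
    rw [E.map_face_combo hS hCS hC1, E.map_refVert, ← hc]
    simp only [hC, Finset.sum_smul]
    rw [Finset.sum_comm]
    refine Finset.sum_congr rfl fun l _ => ?_
    simp only [mul_smul, ← Finset.smul_sum]
    by_cases hl : l ∈ T
    · rw [hμ l hl]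
    · rw [cT l hl, zero_smul, zero_smul]
  have heq := E.injOn_map (E.sum_refVert_mem hC0 hC1) (E.shape.refVert_mem k) hmap
  have hCk : C k = 1 := by
    rw [← E.shape.nodal_face_combo hS hCS hC1 k, heq, E.shape.nodal_refVert, if_pos rfl]
  have hle : ∀ l, μ l k ≤ 1 := fun l => by
    rw [← μ1 l]; exact Finset.single_le_sum (fun m _ => μ0 l m) (Finset.mem_univ k)
  obtain ⟨l, hl, hlk⟩ : ∃ l, 0 < c l ∧ μ l k = 1 := by
    by_contra hcon
    push Not at hcon
    have hlt : ∑ l, c l * μ l k < ∑ l, c l := by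
      obtain ⟨l, _, hl⟩ : ∃ l ∈ Finset.univ, 0 < c l := by
        apply Finset.exists_lt_of_sum_lt
        simp [c1]
      refine Finset.sum_lt_sum (fun l _ => mul_le_of_le_one_right (c0 l) (hle l))
        ⟨l, Finset.mem_univ l, ?_⟩
      exact mul_lt_of_lt_one_right hl (lt_of_le_of_ne (hle l) (hcon l hl))
    rw [c1] at hlt
    exact hlt.ne hCk
  have hlT : l ∈ T := by
    by_contra h; rw [cT l h] at hl; exact lt_irrefl _ hl
  refine ⟨l, hlT, ?_⟩
  rw [← hμ l hlT, Finset.sum_eq_single k, hlk, one_smul]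
  · intro m _ hm
    have h2 : μ l k + μ l m ≤ 1 := by
      rw [← μ1 l, ← Finset.sum_pair hm.symm]
      exact Finset.sum_le_sum_of_subset_of_nonneg (Finset.subset_univ _) fun m _ _ => μ0 l m
    have := μ0 l m
    rw [show μ l m = 0 by linarith, zero_smul]
  · simp

end Element

/-! ### Topology of the mesh: shared facets, connectedness, existence of a Dirichlet facet. -/

namespace Mesh

variable {d : ℕ} {Ω : Set (Pt d)} {M : Mesh Ω}

lemma body_subset_closure (M : Mesh Ω) (i : Fin M.n) : (M.elem i).body ⊆ closure Ω :=
  M.cover ▸ Set.subset_iUnion (fun i => (M.elem i).body) i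

/-- Two elements meet in a proper face. It is contained in a facet, and points of a facet are limits
of points outside the element. -/
lemma notMem_interior {i j : Fin M.n} (h : i ≠ j) {x : Pt d} (hx : x ∈ (M.elem j).body) :
    x ∉ interior (M.elem i).body := by
  intro hi
  obtain ⟨S, T, hS, _, hST, _⟩ := M.conform i j h
  have hxS : x ∈ (M.elem i).hull S := hST ▸ ⟨interior_subset hi, hx⟩
  obtain ⟨f, hf⟩ := hS.subset_facet
  exact (M.elem i).hull_facet_disjoint_interior
    (convexHull_mono (Set.image_mono (Finset.coe_subset.2 hf)) hxS) hi

/-- The intersection is also the hull of a face of the second element. Equal hulls have equal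
vertices, so that face has `d` vertices and must be a facet. -/
lemma exists_shared_of_inter_eq {i j : Fin M.n} (h : i ≠ j) {f : Fin (M.elem i).shape.nv}
    (hf : (M.elem i).body ∩ (M.elem j).body = (M.elem i).hull ((M.elem i).shape.facet f)) :
    ∃ f', M.Shared i f j f' := by
  obtain ⟨S, T, hS, hT, hS', hT'⟩ := M.conform i j h
  have e : (M.elem i).hull ((M.elem i).shape.facet f) = (M.elem j).hull T := hf.symm.trans hT'
  have hv := (Element.hull_vert_subset ((M.elem i).shape.isFace_facet f) e).antisymm
    (Element.hull_vert_subset hT e.symm)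
  have hcard : d ≤ T.card := by
    refine ((M.elem i).shape.card_facet f).symm.le.trans ?_
    rw [← Set.ncard_coe_finset, ← Set.ncard_coe_finset,
      ← Set.ncard_image_of_injective _ (M.elem i).vert_injective, hv,
      Set.ncard_image_of_injective _ (M.elem j).vert_injective]
  obtain ⟨f', rfl⟩ := hT.exists_facet hcard
  exact ⟨f', h, hv, hf⟩

/-- If no other element contained the point, a neighbourhood of it would be covered by this element
alone, which is impossible on a facet. The common face with the other element contains a relatively
interior point of `f`, hence all of `f`, and being proper it equals `f`. -/
lemma exists_shared_of_relint (hΩo : IsOpen Ω) {i : Fin M.n} {f : Fin (M.elem i).shape.nv}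
    {y : Pt d} (hy : (M.elem i).IsRelint f y) (hyΩ : (M.elem i).map y ∈ Ω) :
    ∃ j f', M.Shared i f j f' := by
  set x := (M.elem i).map y
  have hxb : x ∈ (M.elem i).body := ⟨y, hy.1, rfl⟩
  have hxf : x ∈ (M.elem i).hull ((M.elem i).shape.facet f) := by
    rw [Element.mem_hull_facet_iff, Element.inv_map _ hy.1]; exact ⟨hxb, hy.2.1⟩
  obtain ⟨j, hij, hj⟩ : ∃ j, i ≠ j ∧ x ∈ (M.elem j).body := by
    by_contra hcon
    push Not at hcon
    set K : Set (Pt d) := ⋃ j ∈ {j | i ≠ j}, (M.elem j).body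
    have hK : IsClosed K := (Set.toFinite _).isClosed_biUnion fun j _ =>
      (M.elem j).isCompact_body.isClosed
    have hxK : x ∉ K := by
      simp only [K, Set.mem_iUnion, not_exists]
      exact fun j hj => hcon j hj
    refine (M.elem i).hull_facet_disjoint_interior hxf
      ((interior_maximal (t := Ω ∩ Kᶜ) ?_ (hΩo.inter hK.isOpen_compl)) ⟨hyΩ, hxK⟩)
    rintro z ⟨hz, hzK⟩
    have := subset_closure hz
    rw [← M.cover, Set.mem_iUnion] at this
    obtain ⟨j, hj⟩ := this
    by_cases hij : i = j
    · exact hij ▸ hj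
    · exact absurd (Set.mem_biUnion (show j ∈ {j | i ≠ j} from hij) hj) hzK
  obtain ⟨S, T, hS, hT, hS', hT'⟩ := M.conform i j hij
  have hxS : x ∈ (M.elem i).hull S := hS' ▸ ⟨hxb, hj⟩
  have hsub : (M.elem i).shape.facet f ⊆ S := by
    intro k hk
    by_contra hkS
    have h1 := (((M.elem i).mem_hull_iff hS).1 hxS).2 k hkS
    rw [Element.inv_map _ hy.1] at h1
    exact ((M.elem i).shape.nodal_pos_of_relint hy.2.1 hy.2.2 hk).ne' h1
  rw [hS.eq_facet hsub] at hS'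
  obtain ⟨f', h⟩ := exists_shared_of_inter_eq hij hS'
  exact ⟨j, f', h⟩

/-- Each facet either is shared or lies on the boundary of the domain. -/
theorem shared_or_subset_frontier (hd : 0 < d) (hΩo : IsOpen Ω)
    (i : Fin M.n) (f : Fin (M.elem i).shape.nv) :
    (∃ j f', M.Shared i f j f') ∨
      (M.elem i).hull ((M.elem i).shape.facet f) ⊆ frontier Ω := by
  by_contra hcon
  push Not at hcon
  obtain ⟨hns, hnf⟩ := hcon
  obtain ⟨p, hp, hpf⟩ := Set.not_subset.1 hnf
  obtain ⟨hpb, hp0⟩ := (M.elem i).mem_hull_facet_iff.1 hp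
  have hpΩ : p ∈ Ω := by
    by_contra h
    exact hpf ⟨M.body_subset_closure i hpb, by rwa [hΩo.interior_eq]⟩
  obtain ⟨yb, hyb, hyb0, hybpos, _⟩ := (M.elem i).shape.exists_relint hd f
  set y := (M.elem i).inv p
  -- A point of the facet inside `Ω` is moved slightly towards the barycentre of the facet. It
  -- becomes relatively interior without leaving `Ω`.
  have hcont : Continuous fun t : ℝ => (M.elem i).map (y + t • (yb - y)) :=
    (M.elem i).continuous_map.comp (by fun_prop)
  have h1 : ∀ᶠ t : ℝ in nhdsWithin 0 (Set.Ioi 0), (M.elem i).map (y + t • (yb - y)) ∈ Ω := by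
    have := (hcont.tendsto 0).mono_left (nhdsWithin_le_nhds (s := Set.Ioi 0))
    simp only [zero_smul, add_zero] at this
    rw [(M.elem i).map_inv hpb] at this
    exact this.eventually (hΩo.mem_nhds hpΩ)
  have h2 : ∀ᶠ t : ℝ in nhdsWithin 0 (Set.Ioi 0), t < 1 :=
    (eventually_lt_nhds zero_lt_one).filter_mono nhdsWithin_le_nhds
  obtain ⟨t, ⟨ht1, ht2⟩, ht0⟩ := ((h1.and h2).and self_mem_nhdsWithin).exists
  have ht0 : 0 < t := ht0
  have hyr := (M.elem i).inv_mem hpb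
  have hrel : (M.elem i).IsRelint f (y + t • (yb - y)) := by
    refine ⟨(M.elem i).shape.convex_ref.add_smul_sub_mem hyr hyb ⟨ht0.le, ht2.le⟩, ?_,
      fun g hg => ?_⟩
    · rw [Shape.bd_combo, hp0, hyb0]; ring
    · rw [Shape.bd_combo]
      have h3 := hybpos g hg
      have h4 := mul_nonneg (sub_nonneg.2 ht2.le) (((M.elem i).shape.mem_ref_iff y).1 hyr g)
      positivity
  obtain ⟨j, f', h⟩ := exists_shared_of_relint hΩo hrel ht1
  exact hns j f' h

/-- The vertices of a facet. -/
def verts (M : Mesh Ω) (i : Fin M.n) (f : Fin (M.elem i).shape.nv) : Finset (Pt d) :=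
  ((M.elem i).shape.facet f).map ⟨(M.elem i).vert, (M.elem i).vert_injective⟩

lemma coe_verts (i : Fin M.n) (f : Fin (M.elem i).shape.nv) :
    (M.verts i f : Set (Pt d)) = (M.elem i).vert '' ((M.elem i).shape.facet f) := by
  simp [verts]

lemma card_verts (i : Fin M.n) (f : Fin (M.elem i).shape.nv) : (M.verts i f).card = d := by
  rw [verts, Finset.card_map, Shape.card_facet]

/-- The normals of the two sides are proportional. With a positive factor both elements would
contain the same points near the barycentre of the facet, against disjointness of interiors. -/
lemma Shared.normal_neg (hd : 0 < d) {i j : Fin M.n} {f f'} (h : M.Shared i f j f')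
    {ν ν' : Pt d →ₗ[ℝ] ℝ} (hν : (M.elem i).IsNormal f ν) (hν' : (M.elem j).IsNormal f' ν') :
    ∃ c : ℝ, c < 0 ∧ ν' = c • ν := by
  have hd' : (d : ℝ) ≠ 0 := by exact_mod_cast hd.ne'
  have hV := M.coe_verts i f
  have hw : ∑ p ∈ M.verts i f, (d : ℝ)⁻¹ = 1 := by
    rw [Finset.sum_const, M.card_verts]; simp [hd']
  have hp : ∀ p ∈ M.verts i f, 0 < (d : ℝ)⁻¹ := fun p _ => by positivity
  obtain ⟨y, hy, hy1⟩ := (M.elem i).exists_isRelint_of_weights hV (w := fun _ => (d : ℝ)⁻¹) hp hw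
  obtain ⟨y', hy', hy1'⟩ := (M.elem j).exists_isRelint_of_weights (hV.trans h.vert_eq)
    (w := fun _ => (d : ℝ)⁻¹) hp hw
  obtain ⟨k₀, hk₀⟩ : ((M.elem i).shape.facet f).Nonempty := by
    rw [← Finset.card_pos, Shape.card_facet]; exact hd
  obtain ⟨l₀, hl₀⟩ : ((M.elem j).shape.facet f').Nonempty := by
    rw [← Finset.card_pos, Shape.card_facet]; exact hd
  obtain ⟨c, hc⟩ := hν.exists_eq_smul hk₀ ν' (by
    intro k hk l hl
    have hk' : (M.elem i).vert k ∈ (M.elem j).vert '' ((M.elem j).shape.facet f') :=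
      h.vert_eq ▸ ⟨k, hk, rfl⟩
    have hl' : (M.elem i).vert l ∈ (M.elem j).vert '' ((M.elem j).shape.facet f') :=
      h.vert_eq ▸ ⟨l, hl, rfl⟩
    obtain ⟨k', hk', e⟩ := hk'
    obtain ⟨l', hl', e'⟩ := hl'
    rw [← e, ← e']
    exact hν'.1 k' hk' l' hl')
  refine ⟨c, ?_, hc⟩
  by_contra hle
  have hpos' := hν'.pos hl₀
  rcases (not_lt.1 hle).eq_or_lt with h0 | h0
  · rw [hc, ← h0, zero_smul] at hpos'
    exact lt_irrefl _ hpos'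
  · have hv := hν.pos hk₀
    have hv' : 0 < ν' ((M.elem i).vert ((M.elem i).shape.opp f k₀) - (M.elem i).vert k₀) := by
      rw [hc]; exact mul_pos h0 hv
    have e1 := hν.eventually_mem_inner hy.1 hy.2.1 hy.2.2 hv
    have e2 := hν'.eventually_mem_inner hy'.1 hy'.2.1 hy'.2.2 hv'
    rw [hy1', ← hy1] at e2
    obtain ⟨t, h1, h2⟩ := (e1.and e2).exists
    exact notMem_interior h.ne ((M.elem j).inner_subset_body h2)
      ((M.elem i).inner_subset_interior h1)

/-- Relatively interior points of shared facets belong to the domain. -/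
lemma Shared.mem_of_weights (hd : 0 < d) (hΩ : interior (closure Ω) = Ω) {i j : Fin M.n} {f f'}
    (h : M.Shared i f j f') {w : Pt d → ℝ} (h0 : ∀ p ∈ M.verts i f, 0 < w p)
    (h1 : ∑ p ∈ M.verts i f, w p = 1) : ∑ p ∈ M.verts i f, w p • p ∈ Ω := by
  have hV := M.coe_verts i f
  obtain ⟨y, hy, hy1⟩ := (M.elem i).exists_isRelint_of_weights hV h0 h1
  obtain ⟨y', hy', hy1'⟩ := (M.elem j).exists_isRelint_of_weights (hV.trans h.vert_eq) h0 h1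
  obtain ⟨k₀, hk₀⟩ : ((M.elem i).shape.facet f).Nonempty := by
    rw [← Finset.card_pos, Shape.card_facet]; exact hd
  obtain ⟨l₀, hl₀⟩ : ((M.elem j).shape.facet f').Nonempty := by
    rw [← Finset.card_pos, Shape.card_facet]; exact hd
  obtain ⟨ν, hν⟩ := (M.elem i).exists_isNormal hk₀
  obtain ⟨ν', hν'⟩ := (M.elem j).exists_isNormal hl₀
  obtain ⟨c, hc, hcν⟩ := h.normal_neg hd hν hν'
  have := hν.mem_interior_union hν' hy hy' (hy1.trans hy1'.symm) hc hcν hk₀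
  rw [← hy1]
  exact hΩ.subset <| interior_mono (Set.union_subset (M.body_subset_closure i) (M.body_subset_closure j)) this


lemma finrank_vectorSpan_lt {V : Finset (Pt d)} (hd : 0 < d) (hV : V.card ≤ d) :
    Module.finrank ℝ (vectorSpan ℝ (V : Set (Pt d))) + 1 ≤ d := by
  obtain ⟨m, rfl⟩ : ∃ m, d = m + 1 := ⟨d - 1, by omega⟩
  rcases V.eq_empty_or_nonempty with rfl | hne
  · rw [Finset.coe_empty, vectorSpan_empty, finrank_bot]; omega
  · obtain ⟨c, hc⟩ : ∃ c, V.card = c + 1 := ⟨V.card - 1, by have := hne.card_pos; omega⟩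
    classical
    have := finrank_vectorSpan_image_finset_le ℝ (id : Pt (m + 1) → Pt (m + 1)) V hc
    rw [Finset.image_id] at this
    omega

lemma volume_affineSpan_eq_zero {V : Finset (Pt d)} (hd : 0 < d) (hV : V.card ≤ d) :
    volume (affineSpan ℝ (V : Set (Pt d)) : Set (Pt d)) = 0 := by
  refine Measure.addHaar_affineSubspace _ _ fun h => ?_
  have h1 := finrank_vectorSpan_lt hd hV
  rw [← direction_affineSpan, h, AffineSubspace.direction_top, finrank_top, Module.finrank_fin_fun]
    at h1
  omega

/-- Two arbitrary elements are connected by a chain of elements with shared facets. -/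
theorem shared_induction (hd : 0 < d) (hΩo : IsOpen Ω) (hΩc : IsConnected Ω)
    (P : Fin M.n → Prop)
    (hP : ∀ i f j f', M.Shared i f j f' → P i → P j) {i₀ : Fin M.n} (h₀ : P i₀) (j₀ : Fin M.n) :
    P j₀ := by
  classical
  by_contra hj₀
  let U : Set (Pt d) := ⋃ i ∈ {i | P i}, (M.elem i).body
  let V : Set (Pt d) := ⋃ i ∈ {i | ¬P i}, (M.elem i).body
  have hU : IsClosed U := (Set.toFinite _).isClosed_biUnion fun j _ =>
    (M.elem j).isCompact_body.isClosed
  have hV : IsClosed V := (Set.toFinite _).isClosed_biUnion fun j _ =>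
    (M.elem j).isCompact_body.isClosed
  have hUV : Ω ⊆ U ∪ V := by
    intro z hz
    have := subset_closure hz
    rw [← M.cover, Set.mem_iUnion] at this
    obtain ⟨j, hj⟩ := this
    by_cases hPj : P j
    · exact Or.inl (Set.mem_biUnion (show j ∈ {i | P i} from hPj) hj)
    · exact Or.inr (Set.mem_biUnion (show j ∈ {i | ¬P i} from hPj) hj)
  have hmeet : ∀ (i : Fin M.n) (W : Set (Pt d)), IsOpen W → ((M.elem i).body ∩ W).Nonempty →
      ((M.elem i).inner ∩ W).Nonempty := by
    rintro i W hW ⟨z, hz, hzW⟩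
    obtain ⟨q, h1, h2⟩ := mem_closure_iff.1 ((M.elem i).body_subset_closure_inner hz) W hW hzW
    exact ⟨q, h2, h1⟩
  have hΩmeet : ∀ i, ((M.elem i).body ∩ Ω).Nonempty := by
    intro i
    obtain ⟨z, hz⟩ := (M.elem i).inner_nonempty
    have h1 := M.body_subset_closure i ((M.elem i).inner_subset_body hz)
    obtain ⟨q, h2, h3⟩ := mem_closure_iff.1 h1 _ (M.elem i).isOpen_inner hz
    exact ⟨q, (M.elem i).inner_subset_body h2, h3⟩
  -- Elements with and without `P` give two closed sets covering the connected set `Ω`, so they meet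
  -- in `Ω`. Their meeting point may lie on a low-dimensional face, which is why a generic segment
  -- nearby is needed.
  obtain ⟨p, hpΩ, hpU, hpV⟩ := isPreconnected_closed_iff.1 hΩc.isPreconnected U V hU hV hUV
    (by
      obtain ⟨z, h1, h2⟩ := hΩmeet i₀
      exact ⟨z, h2, Set.mem_biUnion (show i₀ ∈ {i | P i} from h₀) h1⟩)
    (by
      obtain ⟨z, h1, h2⟩ := hΩmeet j₀
      exact ⟨z, h2, Set.mem_biUnion (show j₀ ∈ {i | ¬P i} from hj₀) h1⟩)
  obtain ⟨ε, hε, hball⟩ := Metric.isOpen_iff.1 hΩo p hpΩ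
  simp only [U, V, Set.mem_iUnion, Set.mem_ofPred_eq, exists_prop] at hpU hpV
  obtain ⟨i, hi, hpi⟩ := hpU
  obtain ⟨j, hj, hpj⟩ := hpV
  obtain ⟨a, hai, haB⟩ := hmeet i _ Metric.isOpen_ball ⟨p, hpi, Metric.mem_ball_self hε⟩
  -- Generic choice of `b`: the affine hull of `a` and fewer than `d` vertices is a null set, and
  -- there are finitely many of these. The segment from `a` to `b` then misses all faces of
  -- codimension at least two.
  obtain ⟨b, ⟨hbj, hbB⟩, hbad⟩ : ∃ b ∈ (M.elem j).inner ∩ Metric.ball p ε,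
      ∀ (k : Fin M.n) (S : Finset (Fin (M.elem k).shape.nv)), S.card < d →
        b ∉ affineSpan ℝ ((insert a (S.image (M.elem k).vert) : Finset (Pt d)) : Set (Pt d)) := by
    by_contra hcon
    push Not at hcon
    have hpos : 0 < volume ((M.elem j).inner ∩ Metric.ball p ε) :=
      ((M.elem j).isOpen_inner.inter Metric.isOpen_ball).measure_pos volume
        (hmeet j _ Metric.isOpen_ball ⟨p, hpj, Metric.mem_ball_self hε⟩)
    refine hpos.ne' (measure_mono_null (t := ⋃ (k : Fin M.n),
      ⋃ (S : Finset (Fin (M.elem k).shape.nv)), ⋃ (_ : S.card < d),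
      (affineSpan ℝ ((insert a (S.image (M.elem k).vert) : Finset (Pt d)) : Set (Pt d)) :
        Set (Pt d))) (fun b hb => ?_) ?_)
    · obtain ⟨k, S, hS, h⟩ := hcon b hb
      simp only [Set.mem_iUnion]
      exact ⟨k, S, hS, h⟩
    · refine measure_iUnion_null fun k => measure_iUnion_null fun S => measure_iUnion_null fun hS => ?_
      refine volume_affineSpan_eq_zero hd ((Finset.card_insert_le _ _).trans ?_)
      exact (Nat.succ_le_succ Finset.card_image_le).trans hS
  have hseg : segment ℝ a b ⊆ Ω := ((convex_ball p ε).segment_subset haB hbB).trans hball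
  -- Connectedness once more, now along the segment: it passes from an element with `P` to one
  -- without.
  obtain ⟨x, hxs, hxU, hxV⟩ := isPreconnected_closed_iff.1
    (convex_segment (𝕜 := ℝ) a b).isPreconnected U V hU hV (hseg.trans hUV)
    ⟨a, left_mem_segment ℝ a b, Set.mem_biUnion (show i ∈ {i | P i} from hi)
      ((M.elem i).inner_subset_body hai)⟩
    ⟨b, right_mem_segment ℝ a b, Set.mem_biUnion (show j ∈ {i | ¬P i} from hj)
      ((M.elem j).inner_subset_body hbj)⟩
  simp only [U, V, Set.mem_iUnion, Set.mem_ofPred_eq, exists_prop] at hxU hxV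
  obtain ⟨k, hk, hxk⟩ := hxU
  obtain ⟨l, hl, hxl⟩ := hxV
  have hkl : k ≠ l := by rintro rfl; exact hl hk
  obtain ⟨S, T, hS, hT, hS', hT'⟩ := M.conform k l hkl
  rcases Nat.lt_or_ge S.card d with hlt | hge
  -- The common face has fewer than `d` vertices. As `b` is on the line through `a` and `x`, it
  -- would lie in one of the excluded affine hulls.
  · have hxa : x ≠ a := by
      rintro rfl
      have hil : i ≠ l := by rintro rfl; exact hl hi
      exact notMem_interior hil hxl ((M.elem i).inner_subset_interior hai)
    refine hbad k S hlt ?_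
    obtain ⟨t, _, ht⟩ := (segment_eq_image_lineMap ℝ a b ▸ hxs :
      x ∈ (AffineMap.lineMap a b : ℝ →ᵃ[ℝ] Pt d) '' Set.Icc (0 : ℝ) 1)
    have ht0 : t ≠ 0 := by
      rintro rfl
      rw [AffineMap.lineMap_apply_zero] at ht
      exact hxa ht.symm
    have hbeq : b = AffineMap.lineMap a x t⁻¹ := by
      rw [← ht]
      simp only [AffineMap.lineMap_apply, vsub_eq_sub, vadd_eq_add, add_sub_cancel_right, smul_smul,
        inv_mul_cancel₀ ht0, one_smul, sub_add_cancel]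
    rw [hbeq]
    refine AffineMap.lineMap_mem _ (subset_affineSpan ℝ _ (by simp)) ?_
    have hxS : x ∈ (M.elem k).hull S := hS' ▸ ⟨hxk, hxl⟩
    refine affineSpan_mono ℝ ?_ (convexHull_subset_affineSpan _ hxS)
    rw [Finset.coe_insert, Finset.coe_image]
    exact Set.subset_insert _ _
  · obtain ⟨f, rfl⟩ := hS.exists_facet hge
    obtain ⟨f', h⟩ := exists_shared_of_inter_eq hkl hS'
    exact hl (hP k f l f' h hk)

/-- Fewer than `d` points lie in an affine subspace of dimension at most `d - 2`, so their hull has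
Hausdorff dimension below `d - 1`. -/
lemma hausdorffMeasure_hull_eq_zero (hd : 2 ≤ d) (E : Element d) {S : Finset (Fin E.shape.nv)}
    (hS : S.card < d) : Measure.hausdorffMeasure ((d : ℝ) - 1) (E.hull S) = 0 := by
  classical
  rcases S.eq_empty_or_nonempty with rfl | ⟨k, hk⟩
  · simp [Element.hull]
  · have hfr : Module.finrank ℝ (vectorSpan ℝ (E.vert '' S)) + 2 ≤ d := by
      obtain ⟨c, hc⟩ : ∃ c, S.card = c + 1 :=
        ⟨S.card - 1, by have := Finset.card_pos.2 ⟨k, hk⟩; omega⟩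
      have := finrank_vectorSpan_image_finset_le ℝ E.vert S hc
      rw [Finset.coe_image] at this
      omega
    set W := vectorSpan ℝ (E.vert '' S)
    have hsub : E.hull S ⊆ Set.range fun w : W => E.vert k + (w : Pt d) := by
      intro x hx
      have hx' := convexHull_subset_affineSpan _ hx
      have hk' := subset_affineSpan ℝ (E.vert '' S) ⟨k, hk, rfl⟩
      have := AffineSubspace.vsub_mem_direction hx' hk'
      rw [direction_affineSpan] at this
      exact ⟨⟨_, this⟩, by simp⟩
    have hdim : dimH (E.hull S) ≤ Module.finrank ℝ W := by
      refine (dimH_mono hsub).trans (ContDiff.dimH_range_le ?_)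
      exact contDiff_const.add W.subtypeL.contDiff
    have h1 : (((d - 1 : ℕ) : NNReal) : ℝ) = (d : ℝ) - 1 := by
      rw [NNReal.coe_natCast, Nat.cast_sub (by omega), Nat.cast_one]
    rw [← h1]
    refine hausdorffMeasure_of_dimH_lt (hdim.trans_lt ?_)
    have : Module.finrank ℝ W < d - 1 := by omega
    exact_mod_cast this

/-- There is a facet in the Dirichlet part of the boundary. -/
theorem exists_dirichlet_facet (hd : 2 ≤ d) (hΩo : IsOpen Ω) (hΩ : interior (closure Ω) = Ω)
    {Γ : BoundarySplit Ω} (hM : M.Resolves Γ) :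
    ∃ (i : Fin M.n) (f : Fin (M.elem i).shape.nv),
      (M.elem i).hull ((M.elem i).shape.facet f) ⊆ Γ.ΓD := by
  classical
  by_contra hcon
  push Not at hcon
  have hd0 : 0 < d := by omega
  have hDf : Γ.ΓD ⊆ frontier Ω := Γ.union_eq ▸ Set.subset_union_left
  -- Without a facet in the Dirichlet part, that part is covered by the null overlap and by faces of
  -- lower dimension, against its positive measure.
  have hcov : Γ.ΓD ⊆ (Γ.ΓD ∩ Γ.ΓN) ∪ ⋃ (i : Fin M.n),
      ⋃ (S : Finset (Fin (M.elem i).shape.nv)), ⋃ (_ : S.card < d), (M.elem i).hull S := by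
    intro x hx
    have hxf := hDf hx
    have hxc := frontier_subset_closure hxf
    rw [← M.cover, Set.mem_iUnion] at hxc
    obtain ⟨i, hi⟩ := hxc
    have hxn : x ∉ Ω := by
      have := hxf.2
      rwa [hΩo.interior_eq] at this
    have hxi : x ∉ (M.elem i).inner := fun h =>
      hxn (M.interior_body_subset hΩ i ((M.elem i).inner_subset_interior h))
    obtain ⟨f, hf⟩ := (M.elem i).exists_bd_eq_zero hi hxi
    have hxh := (M.elem i).mem_hull_facet_iff.2 ⟨hi, hf⟩
    rcases shared_or_subset_frontier hd0 hΩo i f with ⟨j, f', hs⟩ | hfr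
    · right
      -- Relatively interior points of a shared facet belong to `Ω`. A boundary point on it
      -- therefore lies on a second facet of the element, hence on a face with fewer than `d`
      -- vertices.
      obtain ⟨g, hg, hg0⟩ : ∃ g, g ≠ f ∧ (M.elem i).shape.bd g ((M.elem i).inv x) = 0 := by
        by_contra hno
        push Not at hno
        have hy : (M.elem i).IsRelint f ((M.elem i).inv x) :=
          ⟨(M.elem i).inv_mem hi, hf, fun g hg =>
            lt_of_le_of_ne (((M.elem i).shape.mem_ref_iff _).1 ((M.elem i).inv_mem hi) g)
              (hno g hg).symm⟩
        refine hxn ?_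
        obtain ⟨k₀, hk₀⟩ : ((M.elem i).shape.facet f).Nonempty := by
          rw [← Finset.card_pos, Shape.card_facet]; exact hd0
        have hpos : ∀ k ∈ (M.elem i).shape.facet f, 0 < (M.elem i).shape.nodal k ((M.elem i).inv x) :=
          fun k hk => (M.elem i).shape.nodal_pos_of_relint hf hy.2.2 hk
        have hzero := ((M.elem i).shape.nodal_eq_zero_iff hy.1 f).2 hf
        have : Nonempty (Fin (M.elem i).shape.nv) := ⟨k₀⟩
        let w : Pt d → ℝ := fun p => (M.elem i).shape.nodal
          (Function.invFun (M.elem i).vert p) ((M.elem i).inv x)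
        have hw : ∀ k, w ((M.elem i).vert k) = (M.elem i).shape.nodal k ((M.elem i).inv x) := by
          intro k
          simp only [w]
          rw [Function.leftInverse_invFun (M.elem i).vert_injective k]
        have := hs.mem_of_weights hd0 hΩ (w := w) (by
          intro p hp
          obtain ⟨k, hk, rfl⟩ := Finset.mem_map.1 hp
          exact (hw k).symm ▸ hpos k hk) (by
          rw [verts, Finset.sum_map]
          simp only [Function.Embedding.coeFn_mk, hw]
          rw [← (M.elem i).shape.card_nodal_sum ((M.elem i).inv x)]
          exact Finset.sum_subset (Finset.subset_univ _) fun k _ hk => hzero k hk)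
        rw [verts, Finset.sum_map] at this
        simp only [Function.Embedding.coeFn_mk, hw] at this
        rw [Finset.sum_subset (Finset.subset_univ _) fun k _ hk => by rw [hzero k hk, zero_smul],
          ← Element.map_eq_sum, (M.elem i).map_inv hi] at this
        exact this
      simp only [Set.mem_iUnion]
      refine ⟨i, (M.elem i).shape.facet f ∩ (M.elem i).shape.facet g, ?_, ?_⟩
      · refine lt_of_lt_of_eq (Finset.card_lt_card (Finset.ssubset_iff_subset_ne.2
          ⟨Finset.inter_subset_left, fun h => ?_⟩)) ((M.elem i).shape.card_facet f)
        have h1 : (M.elem i).shape.facet f ⊆ (M.elem i).shape.facet g := by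
          rw [← h]; exact Finset.inter_subset_right
        have := Finset.eq_of_subset_of_card_le h1 (by
          rw [(M.elem i).shape.card_facet, (M.elem i).shape.card_facet])
        exact hg ((M.elem i).shape.facet_injective this).symm
      · rw [(M.elem i).mem_hull_iff ((M.elem i).shape.isFace_of_subset_facet
          (f := f) Finset.inter_subset_left)]
        refine ⟨hi, fun k hk => ?_⟩
        rw [Finset.mem_inter, not_and_or] at hk
        rcases hk with hk | hk
        · exact ((M.elem i).shape.nodal_eq_zero_iff ((M.elem i).inv_mem hi) f).2 hf k hk
        · exact ((M.elem i).shape.nodal_eq_zero_iff ((M.elem i).inv_mem hi) g).2 hg0 k hk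
    · left
      rcases hM i _ (((M.elem i).shape.isFacet_iff _).2 ⟨f, rfl⟩) hfr with h | h
      · exact absurd h (hcon i f)
      · exact ⟨hx, h hxh⟩
  refine Γ.posD.ne' (measure_mono_null hcov (measure_union_null Γ.overlap ?_))
  exact measure_iUnion_null fun i => measure_iUnion_null fun S => measure_iUnion_null fun hS =>
    hausdorffMeasure_hull_eq_zero hd _ hS

end Mesh

/-! ### The local relations for displacement and rotation. -/

namespace Mesh

variable {d : ℕ} {Ω : Set (Pt d)}

/-- A displacement `u` and a rotation `γ` (given by its values at the vertices) which satisfy the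
relations obtained by testing with the corner functions. -/
structure Kernel (M : Mesh Ω) (Γ : BoundarySplit Ω) (m : ℝ) (q : Fin M.n → ℝ)
    (u : Fin M.n → Pt d) (γ : ∀ i, Fin (M.elem i).shape.nv → Mat d) : Prop where
  mass_pos : 0 < m
  weight_pos : ∀ i, 0 < q i
  skew : ∀ i k, (γ i k).transpose = -γ i k
  cont : ∀ {i f j f'}, M.Shared i f j f' → ∀ k ∈ (M.elem i).shape.facet f,
    ∀ l ∈ (M.elem j).shape.facet f', (M.elem i).vert k = (M.elem j).vert l → γ i k = γ j l
  dirichlet : ∀ {i f}, (M.elem i).hull ((M.elem i).shape.facet f) ⊆ Γ.ΓD →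
    ∀ k ∈ (M.elem i).shape.facet f, m • u i =
      q i • (γ i k).mulVec ((M.elem i).vert ((M.elem i).shape.opp f k) - (M.elem i).vert k)
  shared : ∀ {i f j f'}, M.Shared i f j f' → ∀ k ∈ (M.elem i).shape.facet f,
    ∀ l ∈ (M.elem j).shape.facet f', (M.elem i).vert k = (M.elem j).vert l →
    m • (u j - u i) = (γ i k).mulVec
      (q j • ((M.elem j).vert ((M.elem j).shape.opp f' l) - (M.elem j).vert l) -
       q i • ((M.elem i).vert ((M.elem i).shape.opp f k) - (M.elem i).vert k))

lemma Shared.exists_vert {M : Mesh Ω} {i j : Fin M.n} {f f'} (h : M.Shared i f j f')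
    {k : Fin (M.elem i).shape.nv} (hk : k ∈ (M.elem i).shape.facet f) :
    ∃ l ∈ (M.elem j).shape.facet f', (M.elem i).vert k = (M.elem j).vert l := by
  have : (M.elem i).vert k ∈ (M.elem j).vert '' ((M.elem j).shape.facet f') :=
    h.vert_eq ▸ ⟨k, hk, rfl⟩
  obtain ⟨l, hl, e⟩ := this
  exact ⟨l, hl, e.symm⟩

lemma facet_nonempty (hd : 0 < d) (s : Shape d) (f : Fin s.nv) : (s.facet f).Nonempty := by
  rw [← Finset.card_pos, s.card_facet]; exact hd

/-- The vectors in the relation for a shared facet are transversal to the facet. -/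
lemma Shared.exists_separation (hd : 0 < d) {M : Mesh Ω} {i j : Fin M.n} {f f'}
    (h : M.Shared i f j f') : ∃ ν : Pt d →ₗ[ℝ] ℝ, (M.elem i).IsNormal f ν ∧
      ∀ l ∈ (M.elem j).shape.facet f',
        ν ((M.elem j).vert ((M.elem j).shape.opp f' l) - (M.elem j).vert l) < 0 := by
  obtain ⟨k₀, hk₀⟩ := facet_nonempty hd (M.elem i).shape f
  obtain ⟨l₀, hl₀⟩ := facet_nonempty hd (M.elem j).shape f'
  obtain ⟨ν, hν⟩ := (M.elem i).exists_isNormal hk₀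
  obtain ⟨ν', hν'⟩ := (M.elem j).exists_isNormal hl₀
  obtain ⟨c, hc, hcν⟩ := h.normal_neg hd hν hν'
  refine ⟨ν, hν, fun l hl => ?_⟩
  have := hν'.pos hl
  rw [hcν, LinearMap.smul_apply, smul_eq_mul] at this
  by_contra hge
  exact absurd this (not_lt.2 (mul_nonpos_of_nonpos_of_nonneg hc.le (not_lt.1 hge)))

lemma Resolves.of_not_neumann (hd : 0 < d) (hΩo : IsOpen Ω) {M : Mesh Ω} {Γ : BoundarySplit Ω}
    (hM : M.Resolves Γ) {i : Fin M.n} {f : Fin (M.elem i).shape.nv}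
    (h : ¬(M.elem i).hull ((M.elem i).shape.facet f) ⊆ Γ.ΓN) :
    (∃ j f', M.Shared i f j f') ∨ (M.elem i).hull ((M.elem i).shape.facet f) ⊆ Γ.ΓD := by
  rcases shared_or_subset_frontier hd hΩo i f with hs | hf
  · exact Or.inl hs
  · exact Or.inr ((hM i _ (((M.elem i).shape.isFacet_iff _).2 ⟨f, rfl⟩) hf).resolve_right h)

/-- All facets of an element but one are not on the Neumann part. -/
lemma AtMostOneNeumannFacet.exists_facet {M : Mesh Ω} {Γ : BoundarySplit Ω}
    (hM : M.AtMostOneNeumannFacet Γ) (i : Fin M.n) : ∃ f₀ : Fin (M.elem i).shape.nv,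
      ∀ f, f ≠ f₀ → ¬(M.elem i).hull ((M.elem i).shape.facet f) ⊆ Γ.ΓN := by
  by_cases h : ∃ f₀, (M.elem i).hull ((M.elem i).shape.facet f₀) ⊆ Γ.ΓN
  · obtain ⟨f₀, h₀⟩ := h
    refine ⟨f₀, fun f hf hN => hf ?_⟩
    exact (M.elem i).shape.facet_injective (hM i _ _
      (((M.elem i).shape.isFacet_iff _).2 ⟨f, rfl⟩) (((M.elem i).shape.isFacet_iff _).2 ⟨f₀, rfl⟩)
      hN h₀)
  · push Not at h
    exact ⟨⟨0, (M.elem i).shape.nv_pos⟩, fun f _ => h f⟩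

namespace Kernel

variable {M : Mesh Ω} {Γ : BoundarySplit Ω} {m : ℝ} {q : Fin M.n → ℝ} {u : Fin M.n → Pt d}
  {γ : ∀ i, Fin (M.elem i).shape.nv → Mat d}

/-- Without rotation the relations make `u` equal on neighbours and zero at a Dirichlet facet; the
mesh is connected through shared facets. -/
lemma u_eq_zero (hK : M.Kernel Γ m q u γ) (hd : 2 ≤ d) (hΩo : IsOpen Ω) (hΩc : IsConnected Ω)
    (hΩ : interior (closure Ω) = Ω) (hM : M.Resolves Γ) (hγ : ∀ i k, γ i k = 0) (i : Fin M.n) :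
    u i = 0 := by
  have hd0 : 0 < d := by omega
  obtain ⟨i₀, f₀, h₀⟩ := exists_dirichlet_facet hd hΩo hΩ hM
  refine shared_induction hd0 hΩo hΩc (fun i => u i = 0) (fun i f j f' hs hi => ?_) (i₀ := i₀) ?_ i
  · obtain ⟨k, hk⟩ := facet_nonempty hd0 (M.elem i).shape f
    obtain ⟨l, hl, e⟩ := hs.exists_vert hk
    have := hK.shared hs k hk l hl e
    rw [hγ, Matrix.zero_mulVec, hi, sub_zero] at this
    exact (smul_eq_zero.1 this).resolve_left hK.mass_pos.ne'
  · obtain ⟨k, hk⟩ := facet_nonempty hd0 (M.elem i₀).shape f₀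
    have := hK.dirichlet h₀ k hk
    rw [hγ, Matrix.zero_mulVec, smul_zero] at this
    exact (smul_eq_zero.1 this).resolve_left hK.mass_pos.ne'

end Kernel

/-! ### Two dimensions -/

/-- Rotation by a right angle. -/
def rot : Pt 2 →ₗ[ℝ] Pt 2 where
  toFun v := ![v 1, -v 0]
  map_add' v w := by funext i; fin_cases i <;> simp; ring
  map_smul' c v := by funext i; fin_cases i <;> simp

lemma rot_injective : Function.Injective rot := by
  intro v w h
  have h0 := congrFun h 0
  have h1 := congrFun h 1
  simp [rot] at h0 h1
  funext i; fin_cases i <;> assumption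

lemma mulVec_of_skew {A : Mat 2} (hA : A.transpose = -A) (v : Pt 2) :
    A.mulVec v = A 0 1 • rot v := by
  have h : ∀ i j, A j i = -A i j := fun i j => congrFun (congrFun hA i) j
  have h00 := h 0 0
  have h11 := h 1 1
  have h01 := h 0 1
  have e0 : A 0 0 = 0 := by linarith
  have e1 : A 1 1 = 0 := by linarith
  funext i
  fin_cases i <;> simp [Matrix.mulVec, dotProduct, Fin.sum_univ_two, rot, e0, e1, h01]

lemma eq_zero_of_skew {A : Mat 2} (hA : A.transpose = -A) (h01 : A 0 1 = 0) : A = 0 := by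
  have h : ∀ i j, A j i = -A i j := fun i j => congrFun (congrFun hA i) j
  have h00 := h 0 0
  have h11 := h 1 1
  have h10 := h 0 1
  ext i j
  fin_cases i <;> fin_cases j <;> simp <;> linarith

namespace Kernel

variable {Ω : Set (Pt 2)} {M : Mesh Ω} {Γ : BoundarySplit Ω} {m : ℝ} {q : Fin M.n → ℝ}
  {u : Fin M.n → Pt 2} {γ : ∀ i, Fin (M.elem i).shape.nv → Mat 2}

lemma dirichlet_rot (hK : M.Kernel Γ m q u γ) {i f}
    (hf : (M.elem i).hull ((M.elem i).shape.facet f) ⊆ Γ.ΓD) {k}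
    (hk : k ∈ (M.elem i).shape.facet f) :
    m • u i = (q i * γ i k 0 1) •
      rot ((M.elem i).vert ((M.elem i).shape.opp f k) - (M.elem i).vert k) := by
  rw [hK.dirichlet hf k hk, mulVec_of_skew (hK.skew i k), smul_smul]

/-- A zero of the rotation at `k` gives equal displacements on the two sides. At `l` the rotation is
then a scalar times the quarter turn of `q' b' - q b` and vanishes. This vector is nonzero, since
`b` and `b'` point to opposite sides of the facet. On a Dirichlet facet the same works with `u = 0`
and `b` alone. -/
lemma zero_along_facet (hK : M.Kernel Γ m q u γ) {i : Fin M.n} {f : Fin (M.elem i).shape.nv}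
    (hf : (∃ j f', M.Shared i f j f') ∨ (M.elem i).hull ((M.elem i).shape.facet f) ⊆ Γ.ΓD)
    {k l} (hk : k ∈ (M.elem i).shape.facet f) (hl : l ∈ (M.elem i).shape.facet f)
    (h0 : γ i k 0 1 = 0) : γ i l 0 1 = 0 := by
  rcases hf with ⟨j, f', hs⟩ | hD
  · obtain ⟨ν, hν, hneg⟩ := hs.exists_separation two_pos
    obtain ⟨k', hk', ek⟩ := hs.exists_vert hk
    obtain ⟨l', hl', el⟩ := hs.exists_vert hl
    have h1 := hK.shared hs k hk k' hk' ek
    have h2 := hK.shared hs l hl l' hl' el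
    rw [mulVec_of_skew (hK.skew i k), h0, zero_smul] at h1
    rw [h1, mulVec_of_skew (hK.skew i l)] at h2
    refine (smul_eq_zero.1 h2.symm).resolve_right fun h3 => ?_
    have h4 := rot_injective (h3.trans (map_zero rot).symm)
    have h5 := congrArg ν h4
    rw [map_sub, map_smul, map_smul, map_zero, smul_eq_mul, smul_eq_mul] at h5
    have h6 := mul_pos (hK.weight_pos i) (hν.pos hl)
    have h7 := mul_neg_of_pos_of_neg (hK.weight_pos j) (hneg l' hl')
    linarith
  · have h1 := hK.dirichlet_rot hD hk
    have h2 := hK.dirichlet_rot hD hl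
    rw [h0, mul_zero, zero_smul] at h1
    rw [h1] at h2
    rcases smul_eq_zero.1 h2.symm with h3 | h3
    · exact (mul_eq_zero.1 h3).resolve_left (hK.weight_pos i).ne'
    · exfalso
      obtain ⟨ν, hν⟩ := (M.elem i).exists_isNormal hl
      have h4 := rot_injective (h3.trans (map_zero rot).symm)
      have := hν.pos hl
      rw [h4, map_zero] at this
      exact lt_irrefl _ this

/-- In two dimensions the rotation either vanishes everywhere or nowhere. -/
theorem eq_zero_of_exists_zero (hK : M.Kernel Γ m q u γ) (hΩo : IsOpen Ω) (hΩc : IsConnected Ω)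
    (hM : M.Resolves Γ) (hN : M.AtMostOneNeumannFacet Γ)
    (h0 : ∃ i k, γ i k 0 1 = 0) (i : Fin M.n) (k : Fin (M.elem i).shape.nv) : γ i k = 0 := by
  have hall : ∀ i k, γ i k 0 1 = 0 → ∀ l, γ i l 0 1 = 0 := by
    intro i k hk l
    obtain ⟨f₀, hf₀⟩ := hN.exists_facet i
    exact Shape.forall_of_facets (fun k => γ i k 0 1 = 0) f₀ (fun f hf a ha b hb h =>
      hK.zero_along_facet (hM.of_not_neumann two_pos hΩo (hf₀ f hf)) ha hb h) k l hk
  obtain ⟨i₀, k₀, h₀⟩ := h0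
  refine eq_zero_of_skew (hK.skew i k) ?_
  refine shared_induction two_pos hΩo hΩc (fun i => ∀ k, γ i k 0 1 = 0)
    (fun i f j f' hs hi => ?_) (hall i₀ k₀ h₀) i k
  obtain ⟨k, hk⟩ := facet_nonempty two_pos (M.elem i).shape f
  obtain ⟨l, hl, e⟩ := hs.exists_vert hk
  exact hall j l (by rw [← hK.cont hs k hk l hl e]; exact hi k)

/-- Triangular meshes. -/
theorem eq_zero_of_simplicial (hK : M.Kernel Γ m q u γ) (hΩo : IsOpen Ω) (hΩc : IsConnected Ω)
    (hΩ : interior (closure Ω) = Ω)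
    (hM : M.Resolves Γ) (hN : M.AtMostOneNeumannFacet Γ) (hs : M.IsSimplicial)
    (i : Fin M.n) (k : Fin (M.elem i).shape.nv) : γ i k = 0 := by
  refine hK.eq_zero_of_exists_zero hΩo hΩc hM hN ?_ i k
  obtain ⟨i, f, hf⟩ := exists_dirichlet_facet le_rfl hΩo hΩ hM
  have hopp : ∀ (s : Shape 2), s = Shape.simplex 2 → ∀ f k : Fin s.nv, s.opp f k = f := by
    rintro s rfl f k; rfl
  obtain ⟨k, l, hkl, hfac⟩ := Finset.card_eq_two.1 ((M.elem i).shape.card_facet f)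
  have hk : k ∈ (M.elem i).shape.facet f := by rw [hfac]; simp
  have hl : l ∈ (M.elem i).shape.facet f := by rw [hfac]; simp
  have h1 := hK.dirichlet_rot hf hk
  have h2 := hK.dirichlet_rot hf hl
  -- In a triangle both edges leaving the Dirichlet edge end at the same vertex. Their normal
  -- components agree, so the two coefficients agree; subtracting, the coefficient times the
  -- Dirichlet edge is zero.
  rw [hopp _ (hs i)] at h1 h2
  rw [h1, ← map_smul, ← map_smul] at h2
  have h3 := rot_injective h2
  obtain ⟨ν, hν⟩ := (M.elem i).exists_isNormal hk
  have h4 := congrArg ν h3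
  have h5 := hν.pos hk
  rw [hopp _ (hs i)] at h5
  rw [map_smul, map_smul, map_sub, map_sub, hν.1 k hk l hl, ← map_sub] at h4
  rw [map_sub, hν.1 k hk l hl, ← map_sub] at h5
  have h6 : q i * γ i k 0 1 = q i * γ i l 0 1 := mul_right_cancel₀ h5.ne' h4
  rw [← h6, ← sub_eq_zero, ← smul_sub] at h3
  rcases smul_eq_zero.1 h3 with h7 | h7
  · exact ⟨i, k, (mul_eq_zero.1 h7).resolve_left (hK.weight_pos i).ne'⟩
  · exfalso
    refine hkl ((M.elem i).vert_injective ?_)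
    rw [sub_sub_sub_cancel_left, sub_eq_zero] at h7
    exact h7.symm

end Kernel

end Mesh

/-! ### Three dimensions: axial vectors on tetrahedral meshes. -/

/-- Axial vector of a skew-symmetric matrix. -/
def axial (A : Mat 3) : Pt 3 := ![A 2 1, A 0 2, A 1 0]

lemma mulVec_eq_cross {A : Mat 3} (hA : A.transpose = -A) (v : Pt 3) :
    A.mulVec v = crossProduct (axial A) v := by
  have h : ∀ i j, A j i = -A i j := fun i j => congrFun (congrFun hA i) j
  have h00 := h 0 0
  have h11 := h 1 1
  have h22 := h 2 2
  have e0 : A 0 0 = 0 := by linarith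
  have e1 : A 1 1 = 0 := by linarith
  have e2 : A 2 2 = 0 := by linarith
  funext i
  fin_cases i <;> simp [Matrix.mulVec, dotProduct, Fin.sum_univ_three, axial, cross_apply, e0, e1,
    e2, h 1 0, h 2 1, h 0 2] <;> ring

lemma eq_zero_of_axial {A : Mat 3} (hA : A.transpose = -A) (h0 : axial A = 0) : A = 0 := by
  have h : ∀ i j, A j i = -A i j := fun i j => congrFun (congrFun hA i) j
  have a0 : A 2 1 = 0 := congrFun h0 0
  have a1 : A 0 2 = 0 := congrFun h0 1
  have a2 : A 1 0 = 0 := congrFun h0 2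
  have h00 := h 0 0
  have h11 := h 1 1
  have h22 := h 2 2
  have h10 := h 1 0
  have h21 := h 2 1
  have h02 := h 0 2
  ext i j
  fin_cases i <;> fin_cases j <;> simp <;> linarith

lemma exists_smul_of_cross_eq_zero {a b : Pt 3} (hb : b ≠ 0) (h : crossProduct a b = 0) :
    ∃ t : ℝ, a = t • b := by
  have h0 : a 1 * b 2 - a 2 * b 1 = 0 := congrFun h 0
  have h1 : a 2 * b 0 - a 0 * b 2 = 0 := congrFun h 1
  have h2 : a 0 * b 1 - a 1 * b 0 = 0 := congrFun h 2
  obtain ⟨i, hi⟩ := Function.ne_iff.1 hb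
  simp only [Pi.zero_apply] at hi
  refine ⟨a i / b i, ?_⟩
  funext j
  simp only [Pi.smul_apply, smul_eq_mul]
  rw [div_mul_eq_mul_div, eq_div_iff hi]
  fin_cases i <;> fin_cases j <;> simp <;> linarith

namespace Element

lemma opp_eq (E : Element 3) (f k : Fin E.shape.nv) : E.shape.opp f k = f := by
  obtain ⟨shape, vert, hinj, hdet⟩ := E
  cases shape
  rfl

lemma mem_facet (E : Element 3) {f k : Fin E.shape.nv} : k ∈ E.shape.facet f ↔ k ≠ f := by
  obtain ⟨shape, vert, hinj, hdet⟩ := E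
  cases shape
  revert f k
  change ∀ f k : Fin 4, k ∈ Finset.univ.erase f ↔ k ≠ f
  intro f k
  simp

lemma exists_others (E : Element 3) (o : Fin E.shape.nv) : ∃ a b c : Fin E.shape.nv,
    (a ≠ o ∧ b ≠ o ∧ c ≠ o ∧ a ≠ b ∧ a ≠ c ∧ b ≠ c) ∧
      ∀ x, x = o ∨ x = a ∨ x = b ∨ x = c := by
  obtain ⟨shape, vert, hinj, hdet⟩ := E
  cases shape
  revert o
  change ∀ o : Fin 4, ∃ a b c : Fin 4, (a ≠ o ∧ b ≠ o ∧ c ≠ o ∧ a ≠ b ∧ a ≠ c ∧ b ≠ c) ∧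
      ∀ x, x = o ∨ x = a ∨ x = b ∨ x = c
  decide

lemma eq_or_eq (E : Element 3) {p r k l g : Fin E.shape.nv} (hpr : p ≠ r)
    (hkp : k ≠ p) (hkr : k ≠ r) (hlp : l ≠ p) (hlr : l ≠ r) (hkl : k ≠ l) (hgk : g ≠ k)
    (hgl : g ≠ l) : g = p ∨ g = r := by
  have hnv : Fintype.card (Fin E.shape.nv) = 4 := by
    obtain ⟨shape, vert, hinj, hdet⟩ := E
    cases shape
    rfl
  have hcard : ({p, r, k, l} : Finset (Fin E.shape.nv)).card = 4 := by
    rw [Finset.card_insert_of_notMem, Finset.card_insert_of_notMem, Finset.card_insert_of_notMem,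
      Finset.card_singleton] <;> simp <;> tauto
  have := Finset.eq_univ_of_card _ (hcard.trans hnv.symm)
  have hg := this ▸ Finset.mem_univ g
  simp only [Finset.mem_insert, Finset.mem_singleton] at hg
  tauto

lemma IsNormal.pos_of_ne {E : Element 3} {f k : Fin E.shape.nv} {ν : Pt 3 →ₗ[ℝ] ℝ}
    (h : E.IsNormal f ν) (hk : k ≠ f) : 0 < ν (E.vert f - E.vert k) := by
  have := h.pos (E.mem_facet.2 hk)
  rwa [E.opp_eq] at this

lemma IsNormal.sub_eq_zero {E : Element 3} {f k l : Fin E.shape.nv} {ν : Pt 3 →ₗ[ℝ] ℝ}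
    (h : E.IsNormal f ν) (hk : k ≠ f) (hl : l ≠ f) : ν (E.vert k - E.vert l) = 0 := by
  rw [map_sub, h.1 k (E.mem_facet.2 hk) l (E.mem_facet.2 hl), sub_self]

lemma exists_isNormal' (E : Element 3) (f : Fin E.shape.nv) : ∃ ν, E.IsNormal f ν := by
  obtain ⟨k, hk⟩ := Mesh.facet_nonempty three_pos E.shape f
  exact E.exists_isNormal hk

/-- Two edges from a common vertex are not parallel. -/
lemma eq_zero_of_parallel (E : Element 3) {p r k : Fin E.shape.nv} (hpr : r ≠ p) (hkp : k ≠ p)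
    {w : Pt 3} {a b : ℝ} (ha : w = a • (E.vert p - E.vert k))
    (hb : w = b • (E.vert r - E.vert k)) : w = 0 := by
  obtain ⟨ν, hν⟩ := E.exists_isNormal' p
  have h1 := congrArg ν (ha.symm.trans hb)
  rw [map_smul, map_smul, hν.sub_eq_zero hpr hkp, smul_zero] at h1
  rw [ha, (smul_eq_zero.1 h1).resolve_right (hν.pos_of_ne hkp).ne', zero_smul]

/-- The tangent cone at the midpoint of an edge. -/
lemma eventually_mem_inner_of_edge (E : Element 3) {p r k l : Fin E.shape.nv} (hpr : p ≠ r)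
    (hkp : k ≠ p) (hkr : k ≠ r) (hlp : l ≠ p) (hlr : l ≠ r) (hkl : k ≠ l) {α β : ℝ} (hα : 0 < α)
    (hβ : 0 < β) : ∀ᶠ ε : ℝ in nhdsWithin 0 (Set.Ioi 0),
      (1 / 2 : ℝ) • (E.vert k + E.vert l) + ε •
        (α • (E.vert p - (1 / 2 : ℝ) • (E.vert k + E.vert l)) +
         β • (E.vert r - (1 / 2 : ℝ) • (E.vert k + E.vert l))) ∈ E.inner := by
  set V := E.shape.refVert
  set y := (1 / 2 : ℝ) • (V k + V l) with hy
  have hysum : y = ∑ j, (Pi.single k (1 / 2) + Pi.single l (1 / 2) : Fin E.shape.nv → ℝ) j • V j := by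
    simp only [Pi.add_apply, add_smul, Finset.sum_add_distrib, Pi.single_apply, ite_smul, zero_smul,
      Finset.sum_ite_eq', Finset.mem_univ, if_true]
    rw [hy, smul_add]
  have h1 : ∑ j, (Pi.single k (1 / 2) + Pi.single l (1 / 2) : Fin E.shape.nv → ℝ) j = 1 := by
    simp only [Pi.add_apply, Finset.sum_add_distrib, Pi.single_apply, Finset.sum_ite_eq',
      Finset.mem_univ, if_true]
    norm_num
  have h0 : ∀ j, 0 ≤ (Pi.single k (1 / 2) + Pi.single l (1 / 2) : Fin E.shape.nv → ℝ) j := by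
    intro j
    simp only [Pi.add_apply, Pi.single_apply]
    split_ifs <;> norm_num
  have hyr : y ∈ E.shape.ref := hysum ▸ E.sum_refVert_mem h0 h1
  have hbdV : ∀ g j, E.shape.bd g (V j) = if j = g then 1 else 0 := by
    intro g j
    split_ifs with h
    · exact E.shape.bd_refVert_of_notMem fun h' => E.mem_facet.1 h' h
    · exact E.shape.bd_refVert_of_mem (E.mem_facet.2 h)
  have hbdy : ∀ g, E.shape.bd g y = 1 / 2 * (if k = g then 1 else 0) +
      1 / 2 * (if l = g then 1 else 0) := by
    intro g
    have := E.shape.bd_sum g Finset.univ ![(1 / 2 : ℝ), 1 / 2] ![V k, V l] (by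
      rw [Fin.sum_univ_two]; norm_num)
    simp only [Fin.sum_univ_two, Matrix.cons_val_zero, Matrix.cons_val_one] at this
    rw [hy, smul_add, this, hbdV, hbdV]
  have hp0 : E.shape.bd p y = 0 := by rw [hbdy, if_neg hkp, if_neg hlp]; norm_num
  have hr0 : E.shape.bd r y = 0 := by rw [hbdy, if_neg hkr, if_neg hlr]; norm_num
  have hmapy : E.map y = (1 / 2 : ℝ) • (E.vert k + E.vert l) := by
    rw [hysum, E.map_face_combo (E.shape.isFace_facet p) (fun j hj => ?_) h1]
    · simp only [Pi.add_apply, add_smul, Finset.sum_add_distrib, Pi.single_apply, ite_smul, zero_smul,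
        Finset.sum_ite_eq', Finset.mem_univ, if_true]
      rw [smul_add]
    · have : j = p := by by_contra h; exact hj (E.mem_facet.2 h)
      subst this
      simp [hkp.symm, hlp.symm]
  have hD : ∀ g, E.shape.bd g y = 0 → ∀ a b, a ≠ g → b ≠ g →
      fderiv ℝ E.map y (V a - V b) = E.vert a - E.vert b := fun g hg a b ha hb =>
    E.fderiv_facet hg (E.mem_facet.2 hb) (E.mem_facet.2 ha)
  have hDmid : ∀ g, E.shape.bd g y = 0 → ∀ a, a ≠ g → k ≠ g → l ≠ g →
      fderiv ℝ E.map y (V a - y) = E.vert a - (1 / 2 : ℝ) • (E.vert k + E.vert l) := by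
    intro g hg a ha hk hl
    have e1 : V a - y = (1 / 2 : ℝ) • (V a - V k) + (1 / 2 : ℝ) • (V a - V l) := by
      rw [hy]; module
    rw [e1, map_add, map_smul, map_smul, hD g hg a k ha hk, hD g hg a l ha hl]
    module
  set v := α • (E.vert p - (1 / 2 : ℝ) • (E.vert k + E.vert l)) +
         β • (E.vert r - (1 / 2 : ℝ) • (E.vert k + E.vert l)) with hv
  have hvD : fderiv ℝ E.map y (α • (V p - y) + β • (V r - y)) = v := by
    rw [map_add, map_smul, map_smul, hDmid r hr0 p hpr hkr hlr, hDmid p hp0 r hpr.symm hkp hlp]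
  rw [← hmapy]
  refine E.eventually_mem_inner hyr fun g hg => ?_
  rw [← hvD, ← E.fderivEquiv_apply hyr, ContinuousLinearEquiv.symm_apply_apply, map_add, map_smul,
    map_smul, Shape.bdLin_sub, Shape.bdLin_sub, hg, hbdV, hbdV, sub_zero, sub_zero]
  have hg' : g = p ∨ g = r := by
    rw [hbdy] at hg
    have hkg : k ≠ g := by
      rintro rfl
      rw [if_pos rfl] at hg
      split_ifs at hg <;> norm_num at hg
    have hlg : l ≠ g := by
      rintro rfl
      rw [if_pos rfl] at hg
      split_ifs at hg <;> norm_num at hg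
    exact E.eq_or_eq hpr hkp hkr hlp hlr hkl hkg.symm hlg.symm
  rcases hg' with rfl | rfl
  · rw [if_pos rfl, if_neg hpr.symm]; simpa using hα
  · rw [if_neg hpr, if_pos rfl]; simpa using hβ

end Element

namespace Mesh

variable {Ω : Set (Pt 3)} {M : Mesh Ω}

/-- Two shared facets of a tetrahedron whose neighbours have their vertices in parallel directions
from the vertices of the tetrahedron: these directions are opposite. -/
lemma Shared.not_same_direction {i j j' : Fin M.n} {f f' g g'} (hf : M.Shared i f j f')
    (hg : M.Shared i g j' g') (hfg : f ≠ g) {e : Pt 3} {t t' : ℝ}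
    (ht : (M.elem j).vert f' - (M.elem i).vert f = t • e)
    (ht' : (M.elem j').vert g' - (M.elem i).vert g = t' • e) : ¬0 < t * t' := by
  intro hpos
  have htt' : 0 < t / t' := by
    rcases pos_and_pos_or_neg_and_neg_of_mul_pos hpos with h | h
    · exact div_pos h.1 h.2
    · exact div_pos_of_neg_of_neg h.1 h.2
  have ht'0 : t' ≠ 0 := by rintro rfl; simp at hpos
  have hjj : j ≠ j' := by
    rintro rfl
    have h1 := hf.inter_eq.symm.trans hg.inter_eq
    have h2 := (Element.hull_vert_subset ((M.elem i).shape.isFace_facet f) h1).antisymm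
      (Element.hull_vert_subset ((M.elem i).shape.isFace_facet g) h1.symm)
    exact hfg ((M.elem i).shape.facet_injective
      (Finset.coe_injective ((M.elem i).vert_injective.image_injective h2)))
  obtain ⟨k, l, hkf, hkg, hlf, hlg, hkl⟩ : ∃ k l, k ≠ f ∧ k ≠ g ∧ l ≠ f ∧ l ≠ g ∧ k ≠ l := by
    obtain ⟨a, b, c, ⟨h1, h2, h3, h4, h5, h6⟩, hall⟩ := (M.elem i).exists_others f
    rcases hall g with rfl | rfl | rfl | rfl
    · exact absurd rfl hfg
    · exact ⟨b, c, h2, h4.symm, h3, h5.symm, h6⟩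
    · exact ⟨a, c, h1, h4, h3, h6.symm, h5⟩
    · exact ⟨a, b, h1, h5, h2, h6, h4⟩
  have hm : ∀ {j f f'} (_ : M.Shared i f j f') {k}, k ≠ f →
      ∃ l, l ≠ f' ∧ (M.elem i).vert k = (M.elem j).vert l := by
    intro j f f' h k hk
    obtain ⟨l, hl, e⟩ := h.exists_vert ((M.elem i).mem_facet.2 hk)
    exact ⟨l, (M.elem j).mem_facet.1 hl, e⟩
  obtain ⟨k₁, hk₁, ek₁⟩ := hm hf hkf
  obtain ⟨l₁, hl₁, el₁⟩ := hm hf hlf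
  obtain ⟨g₁, hg₁, eg₁⟩ := hm hf hfg.symm
  obtain ⟨k₂, hk₂, ek₂⟩ := hm hg hkg
  obtain ⟨l₂, hl₂, el₂⟩ := hm hg hlg
  obtain ⟨f₂, hf₂, ef₂⟩ := hm hg hfg
  have hne : ∀ {j : Fin M.n} {a b : Fin (M.elem i).shape.nv} {a' b' : Fin (M.elem j).shape.nv},
      a ≠ b → (M.elem i).vert a = (M.elem j).vert a' → (M.elem i).vert b = (M.elem j).vert b' →
      a' ≠ b' := by
    rintro j a b a' b' h h1 h2 rfl
    exact h ((M.elem i).vert_injective (h1.trans h2.symm))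
  -- With `m` the midpoint of the edge common to both facets, and `f`, `g` standing for the
  -- vertices, `(f + t e - m) + (t / t') (g - m) = (f - m) + (t / t') (g + t' e - m)`. This vector
  -- would lie in the open tangent cones at `m` of both neighbours, which would then overlap.
  have c1 := (M.elem j).eventually_mem_inner_of_edge hg₁.symm hk₁ (hne hkg ek₁ eg₁) hl₁
    (hne hlg el₁ eg₁) (hne hkl ek₁ el₁) one_pos htt'
  have c2 := (M.elem j').eventually_mem_inner_of_edge hf₂.symm hk₂ (hne hkf ek₂ ef₂) hl₂
    (hne hlf el₂ ef₂) (hne hkl ek₂ el₂) htt' one_pos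
  rw [← ek₁, ← el₁, ← eg₁] at c1
  rw [← ek₂, ← el₂, ← ef₂] at c2
  rw [eq_add_of_sub_eq ht] at c1
  rw [eq_add_of_sub_eq ht'] at c2
  obtain ⟨ε, h1, h2⟩ := (c1.and c2).exists
  refine notMem_interior hjj ((M.elem j').inner_subset_body h2)
    ((M.elem j).inner_subset_interior ?_)
  convert h1 using 3
  have : t = t / t' * t' := (div_mul_cancel₀ t ht'0).symm
  generalize t / t' = s at *
  subst this
  module

namespace Kernel

variable {Γ : BoundarySplit Ω} {m : ℝ} {q : Fin M.n → ℝ} {u : Fin M.n → Pt 3}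
  {γ : ∀ i, Fin (M.elem i).shape.nv → Mat 3}

/-- Across a shared facet, the rotation vectors at the vertices differ in direction of the jump. -/
lemma axial_shared (hK : M.Kernel Γ m q u γ) (hq : ∀ i j, q i = q j) {i j : Fin M.n} {f f'}
    (h : M.Shared i f j f') {k l} (hk : k ≠ f) (hl : l ≠ f) :
    ∃ t : ℝ, axial (γ i k) - axial (γ i l) =
      t • ((M.elem j).vert f' - (M.elem i).vert f) := by
  obtain ⟨ν, hν, hneg⟩ := h.exists_separation three_pos
  -- All weights are equal, so the contributions of the vertex `k` cancel in `b' - b`. The vector in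
  -- the relation is the one joining the two opposite vertices, for every vertex of the facet.
  have key : ∀ k, k ≠ f → m • (u j - u i) = q i • crossProduct (axial (γ i k))
      ((M.elem j).vert f' - (M.elem i).vert f) := by
    intro k hk
    obtain ⟨k', hk', e⟩ := h.exists_vert ((M.elem i).mem_facet.2 hk)
    rw [hK.shared h k ((M.elem i).mem_facet.2 hk) k' hk' e, hq j i, ← smul_sub, Element.opp_eq,
      Element.opp_eq, ← e, sub_sub_sub_cancel_right, Matrix.mulVec_smul,
      mulVec_eq_cross (hK.skew i k)]
  refine exists_smul_of_cross_eq_zero ?_ ?_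
  · obtain ⟨k', hk', e⟩ := h.exists_vert ((M.elem i).mem_facet.2 hk)
    have h1 := hneg k' hk'
    have h2 := hν.pos_of_ne hk
    rw [Element.opp_eq, ← e] at h1
    intro h0
    rw [sub_eq_zero.1 h0] at h1
    exact lt_asymm h1 h2
  · rw [LinearMap.map_sub₂, sub_eq_zero]
    exact smul_right_injective _ (hK.weight_pos i).ne' ((key k hk).symm.trans (key l hl))

/-- The normal component of the jump across a shared facet. -/
lemma shared_jump {i j : Fin M.n} {f f'} (h : M.Shared i f j f') : ∃ ν, (M.elem i).IsNormal f ν ∧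
    ν ((M.elem j).vert f' - (M.elem i).vert f) < 0 := by
  obtain ⟨ν, hν, hneg⟩ := h.exists_separation three_pos
  refine ⟨ν, hν, ?_⟩
  obtain ⟨k, hk⟩ := facet_nonempty three_pos (M.elem i).shape f
  obtain ⟨k', hk', e⟩ := h.exists_vert hk
  have h1 := hneg k' hk'
  have h2 := hν.pos_of_ne ((M.elem i).mem_facet.1 hk)
  rw [Element.opp_eq, ← e] at h1
  rw [map_sub] at *
  linarith

/-- By the cross product in the relations, `u` is orthogonal to the three edges from the facet to
the opposite vertex. These span the space, so `u = 0`, and the axial vector at `k` is parallel to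
the edge at `k`. -/
lemma axial_dirichlet (hK : M.Kernel Γ m q u γ) {i f}
    (hf : (M.elem i).hull ((M.elem i).shape.facet f) ⊆ Γ.ΓD) {k} (hk : k ≠ f) :
    ∃ t : ℝ, axial (γ i k) = t • ((M.elem i).vert f - (M.elem i).vert k) := by
  obtain ⟨ν, hν⟩ := (M.elem i).exists_isNormal' f
  have key : ∀ k, k ≠ f → m • u i = q i • crossProduct (axial (γ i k))
      ((M.elem i).vert f - (M.elem i).vert k) := by
    intro k hk
    rw [hK.dirichlet hf k ((M.elem i).mem_facet.2 hk), Element.opp_eq,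
      mulVec_eq_cross (hK.skew i k)]
  have hL : ∀ k, k ≠ f → (m • u i) ⬝ᵥ ((M.elem i).vert f - (M.elem i).vert k) = 0 := by
    intro k hk
    rw [key k hk, smul_dotProduct, dotProduct_comm, dot_cross_self, smul_zero]
  let L : Pt 3 →ₗ[ℝ] ℝ := dotProductBilin ℝ ℝ (m • u i)
  have hLd : ∀ v, L v = (m • u i) ⬝ᵥ v := fun v => rfl
  obtain ⟨c, hc⟩ := hν.exists_eq_smul ((M.elem i).mem_facet.2 hk) L (by
    intro a ha b hb
    have h1 := hL a ((M.elem i).mem_facet.1 ha)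
    have h2 := hL b ((M.elem i).mem_facet.1 hb)
    rw [← hLd, map_sub] at h1 h2
    linarith)
  have hc0 : c = 0 := by
    have h1 := hL k hk
    rw [← hLd, hc, LinearMap.smul_apply] at h1
    exact (smul_eq_zero.1 h1).resolve_right (hν.pos_of_ne hk).ne'
  have hu : m • u i = 0 := by
    rw [← dotProduct_self_eq_zero, ← hLd, hc, hc0, zero_smul, LinearMap.zero_apply]
  have h1 := key k hk
  rw [hu] at h1
  refine exists_smul_of_cross_eq_zero ?_
    ((smul_eq_zero.1 h1.symm).resolve_left (hK.weight_pos i).ne')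
  intro h0
  have := hν.pos_of_ne hk
  rw [h0, map_zero] at this
  exact lt_irrefl _ this


/-- Only one vertex opposite to a Dirichlet facet may have a rotation. -/
lemma axial_eq_zero_of_dirichlet (hK : M.Kernel Γ m q u γ) (hq : ∀ i j, q i = q j) {i : Fin M.n}
    {f g : Fin (M.elem i).shape.nv} (hfg : g ≠ f)
    (hf : (M.elem i).hull ((M.elem i).shape.facet f) ⊆ Γ.ΓD)
    (hg : (∃ j f', M.Shared i g j f') ∨ (M.elem i).hull ((M.elem i).shape.facet g) ⊆ Γ.ΓD)
    {k k' : Fin (M.elem i).shape.nv} (hkf : k ≠ f) (hkg : k ≠ g) (hkf' : k' ≠ f) (hkg' : k' ≠ g)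
    (hkk' : k ≠ k') : axial (γ i k) = 0 := by
  obtain ⟨α, hα⟩ := hK.axial_dirichlet hf hkf
  rcases hg with ⟨j, g', hs⟩ | hD
  · obtain ⟨β, hβ⟩ := hK.axial_dirichlet hf hkf'
    obtain ⟨ν, hν, hneg⟩ := shared_jump hs
    obtain ⟨t, ht⟩ := hK.axial_shared hq hs hkg hkg'
    -- Both axial vectors are parallel to edges in the facet `g`, while the jump across `g` is
    -- transversal to it. So the two vectors coincide; being parallel to two different edges, they
    -- vanish.
    have h1 := congrArg ν ht
    rw [hα, hβ, map_sub, map_smul, map_smul, hν.sub_eq_zero hfg.symm hkg,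
      hν.sub_eq_zero hfg.symm hkg', map_smul, smul_zero, smul_zero, sub_zero] at h1
    rw [(smul_eq_zero.1 h1.symm).resolve_right hneg.ne, zero_smul, sub_eq_zero] at ht
    refine (M.elem i).eq_zero_of_parallel (p := k) (r := k') (k := f) hkk'.symm hkf.symm
      (a := -α) (b := -β) ?_ ?_
    · rw [hα]; module
    · rw [ht, hβ]; module
  · obtain ⟨β, hβ⟩ := hK.axial_dirichlet hD hkg
    exact (M.elem i).eq_zero_of_parallel hfg hkf hα hβ

/-- If the rotation is not constant on a tetrahedron, then there are two shared facets with a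
common edge along which it is not constant. -/
lemma exists_two (hK : M.Kernel Γ m q u γ) (hq : ∀ i j, q i = q j) (hΩo : IsOpen Ω)
    (hM : M.Resolves Γ) (hN : M.AtMostOneNeumannFacet Γ) (i : Fin M.n) {e : Pt 3} (he : e ≠ 0)
    (hbad : ∃ a b, ∃ s : ℝ, s ≠ 0 ∧ axial (γ i a) - axial (γ i b) = s • e) :
    ∃ f g a b : Fin (M.elem i).shape.nv, f ≠ g ∧ a ≠ f ∧ b ≠ f ∧ a ≠ g ∧ b ≠ g ∧
      (∃ j f', M.Shared i f j f') ∧ (∃ j g', M.Shared i g j g') ∧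
      ∃ s : ℝ, s ≠ 0 ∧ axial (γ i a) - axial (γ i b) = s • e := by
  obtain ⟨o, ho⟩ := hN.exists_facet i
  have hface : ∀ f, f ≠ o → (∃ j f', M.Shared i f j f') ∨
      (M.elem i).hull ((M.elem i).shape.facet f) ⊆ Γ.ΓD := fun f hf =>
    hM.of_not_neumann three_pos hΩo (ho f hf)
  obtain ⟨p, r, hp0⟩ : ∃ p r : Fin (M.elem i).shape.nv, ∃ s : ℝ, s ≠ 0 ∧
    axial (γ i p) - axial (γ i r) = s • e := hbad
  obtain ⟨s, hs, hpr⟩ := hp0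
  have hse : s • e ≠ 0 := smul_ne_zero hs he
  -- for each vertex, the two remaining ones
  have hrest : ∀ f, f ≠ o → ∃ x y, x ≠ o ∧ y ≠ o ∧ x ≠ f ∧ y ≠ f ∧ x ≠ y ∧
      ∀ k, k = o ∨ k = f ∨ k = x ∨ k = y := by
    intro f hf
    obtain ⟨a, b, c, ⟨h1, h2, h3, h4, h5, h6⟩, hall⟩ := (M.elem i).exists_others o
    rcases hall f with rfl | rfl | rfl | rfl
    · exact absurd rfl hf
    · exact ⟨b, c, h2, h3, h4.symm, h5.symm, h6, hall⟩
    · exact ⟨a, c, h1, h3, h4, h6.symm, h5, fun k => by have := hall k; tauto⟩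
    · exact ⟨a, b, h1, h2, h5, h6, h4, fun k => by have := hall k; tauto⟩
  by_cases hD : ∃ f, f ≠ o ∧ (M.elem i).hull ((M.elem i).shape.facet f) ⊆ Γ.ΓD
  -- With a Dirichlet face `f`, only the vertex `f` can carry a rotation. The two faces other than
  -- `f` and `o` are then not Dirichlet, hence shared, and they contain the edge from `f` to `o`.
  · have hzero : ∀ f, f ≠ o → (M.elem i).hull ((M.elem i).shape.facet f) ⊆ Γ.ΓD →
        ∀ k, k ≠ f → axial (γ i k) = 0 := by
      intro f hf hfD k hk
      obtain ⟨x, y, hxo, hyo, hxf, hyf, hxy, hall⟩ := hrest f hf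
      rcases hall k with rfl | rfl | rfl | rfl
      · exact hK.axial_eq_zero_of_dirichlet hq hxf hfD (hface x hxo) hk hxo.symm hyf hxy.symm
          hyo.symm
      · exact absurd rfl hk
      · exact hK.axial_eq_zero_of_dirichlet hq hyf hfD (hface y hyo) hk hxy hf.symm hyo.symm hxo
      · exact hK.axial_eq_zero_of_dirichlet hq hxf hfD (hface x hxo) hk hxy.symm hf.symm hxo.symm
          hyo
    obtain ⟨f, hf, hfD⟩ := hD
    have hwf : ∃ s' : ℝ, s' ≠ 0 ∧ axial (γ i f) = s' • e := by
      by_cases hpf : p = f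
      · subst hpf
        have hrp : r ≠ p := by rintro rfl; rw [sub_self] at hpr; exact hse hpr.symm
        rw [hzero p hf hfD r hrp, sub_zero] at hpr
        exact ⟨s, hs, hpr⟩
      · rw [hzero f hf hfD p hpf, zero_sub] at hpr
        by_cases hrf : r = f
        · subst hrf
          exact ⟨-s, neg_ne_zero.2 hs, by rw [neg_smul, ← hpr, neg_neg]⟩
        · rw [hzero f hf hfD r hrf, neg_zero] at hpr
          exact absurd hpr.symm hse
    obtain ⟨s', hs', hwf⟩ := hwf
    obtain ⟨x, y, hxo, hyo, hxf, hyf, hxy, hall⟩ := hrest f hf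
    have hnD : ∀ x, x ≠ o → x ≠ f → ∃ j f', M.Shared i x j f' := by
      intro x hxo hxf
      refine (hface x hxo).resolve_right fun hxD => ?_
      rw [hzero x hxo hxD f hxf.symm] at hwf
      exact smul_ne_zero hs' he hwf.symm
    exact ⟨x, y, f, o, hxy, hxf.symm, hxo.symm, hyf.symm, hyo.symm, hnD x hxo hxf, hnD y hyo hyf,
      s', hs', by rw [hwf, hzero f hf hfD o hf.symm, sub_zero]⟩
  · push Not at hD
    have hsh : ∀ f, f ≠ o → ∃ j f', M.Shared i f j f' := fun f hf =>
      (hface f hf).resolve_right (hD f hf)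
    choose nb nf hnb using hsh
    -- Otherwise the jumps across the three shared faces opposite to `x`, `k` and `l` would all be
    -- parallel. Two of them would have the same direction, against `Shared.not_same_direction`.
    have hpair : ∀ k l, k ≠ o → l ≠ o → k ≠ l → axial (γ i k) - axial (γ i o) ≠ 0 →
        axial (γ i l) - axial (γ i o) = 0 := by
      intro k l hk hl hkl hδk
      by_contra hδl
      obtain ⟨x, hxo, hxk, hxl⟩ : ∃ x, x ≠ o ∧ x ≠ k ∧ x ≠ l := by
        obtain ⟨x, y, hxo, hyo, hxk, hyk, hxy, hall⟩ := hrest k hk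
        rcases hall l with rfl | rfl | rfl | rfl
        · exact absurd rfl hl
        · exact absurd rfl hkl
        · exact ⟨y, hyo, hyk, hxy.symm⟩
        · exact ⟨x, hxo, hxk, hxy⟩
      obtain ⟨t1, h1⟩ := hK.axial_shared hq (hnb x hxo) hxk.symm hxo.symm
      obtain ⟨t2, h2⟩ := hK.axial_shared hq (hnb l hl) hkl hl.symm
      obtain ⟨t3, h3⟩ := hK.axial_shared hq (hnb k hk) hkl.symm hk.symm
      obtain ⟨t4, h4⟩ := hK.axial_shared hq (hnb x hxo) hxl.symm hxo.symm
      set δ := axial (γ i k) - axial (γ i o) with hδ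
      have n1 : t1 ≠ 0 := by rintro rfl; rw [zero_smul] at h1; exact hδk h1
      have n2 : t2 ≠ 0 := by rintro rfl; rw [zero_smul] at h2; exact hδk h2
      have n3 : t3 ≠ 0 := by rintro rfl; rw [zero_smul] at h3; exact hδl h3
      have n4 : t4 ≠ 0 := by rintro rfl; rw [zero_smul] at h4; exact hδl h4
      have e1 := (inv_smul_smul₀ n1 _).symm.trans (congrArg (t1⁻¹ • ·) h1.symm)
      have e2 := (inv_smul_smul₀ n2 _).symm.trans (congrArg (t2⁻¹ • ·) h2.symm)
      have e3 := (inv_smul_smul₀ n3 _).symm.trans (congrArg (t3⁻¹ • ·) h3.symm)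
      rw [h4] at e3
      rw [e1, smul_smul, smul_smul] at e3
      have k12 := Shared.not_same_direction (hnb x hxo) (hnb l hl) hxl e1 e2
      have k13 := Shared.not_same_direction (hnb x hxo) (hnb k hk) hxk e1 e3
      have k23 := Shared.not_same_direction (hnb l hl) (hnb k hk) hkl.symm e2 e3
      have i1 := inv_ne_zero n1
      have i2 := inv_ne_zero n2
      have i3 : t3⁻¹ * t4 * t1⁻¹ ≠ 0 := mul_ne_zero (mul_ne_zero (inv_ne_zero n3) n4) i1
      generalize t3⁻¹ * t4 * t1⁻¹ = z at *
      generalize t2⁻¹ = y at *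
      generalize t1⁻¹ = x at *
      rcases lt_or_gt_of_ne i1 with a1 | a1 <;> rcases lt_or_gt_of_ne i2 with a2 | a2 <;>
        rcases lt_or_gt_of_ne i3 with a3 | a3 <;>
        first
        | exact k12 (mul_pos_of_neg_of_neg a1 a2)
        | exact k13 (mul_pos_of_neg_of_neg a1 a3)
        | exact k23 (mul_pos_of_neg_of_neg a2 a3)
        | exact k12 (mul_pos a1 a2)
        | exact k13 (mul_pos a1 a3)
        | exact k23 (mul_pos a2 a3)
    have hone : ∃ k, k ≠ o ∧ ∃ s' : ℝ, s' ≠ 0 ∧ axial (γ i k) - axial (γ i o) = s' • e := by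
      have hdiff : (axial (γ i p) - axial (γ i o)) - (axial (γ i r) - axial (γ i o)) = s • e := by
        rw [← hpr]; abel
      have hprne : p ≠ r := by rintro rfl; rw [sub_self] at hpr; exact hse hpr.symm
      by_cases hδp : axial (γ i p) - axial (γ i o) = 0
      · rw [hδp, zero_sub] at hdiff
        refine ⟨r, ?_, -s, neg_ne_zero.2 hs, by rw [neg_smul, ← hdiff, neg_neg]⟩
        rintro rfl
        rw [sub_self, neg_zero] at hdiff
        exact hse hdiff.symm
      · have hpo : p ≠ o := by rintro rfl; exact hδp (sub_self _)
        have hδr : axial (γ i r) - axial (γ i o) = 0 := by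
          by_cases hro : r = o
          · rw [hro, sub_self]
          · exact hpair p r hpo hro hprne hδp
        rw [hδr, sub_zero] at hdiff
        exact ⟨p, hpo, s, hs, hdiff⟩
    obtain ⟨k, hk, s', hs', hδ⟩ := hone
    obtain ⟨x, y, hxo, hyo, hxk, hyk, hxy, hall⟩ := hrest k hk
    exact ⟨x, y, k, o, hxy, hxk.symm, hxo.symm, hyk.symm, hyo.symm, ⟨_, _, hnb x hxo⟩,
      ⟨_, _, hnb y hyo⟩, s', hs', hδ⟩

/-- If the rotation is not constant on a tetrahedron, then it is not constant on a neighbour in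
a given direction. -/
lemma exists_up (hK : M.Kernel Γ m q u γ) (hq : ∀ i j, q i = q j) (hΩo : IsOpen Ω)
    (hM : M.Resolves Γ) (hN : M.AtMostOneNeumannFacet Γ) (i : Fin M.n) {e : Pt 3} (he : e ≠ 0)
    (hbad : ∃ a b, ∃ s : ℝ, s ≠ 0 ∧ axial (γ i a) - axial (γ i b) = s • e) :
    ∃ f j f', M.Shared i f j f' ∧
      (∃ t : ℝ, 0 < t ∧ (M.elem j).vert f' - (M.elem i).vert f = t • e) ∧
      ∃ a b, ∃ s : ℝ, s ≠ 0 ∧ axial (γ j a) - axial (γ j b) = s • e := by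
  obtain ⟨f, g, a, b, hfg, haf, hbf, hag, hbg, ⟨j, f', hf⟩, ⟨j', g', hg⟩, s, hs, hab⟩ :=
    hK.exists_two hq hΩo hM hN i he hbad
  have hse : s • e ≠ 0 := smul_ne_zero hs he
  have hdir : ∀ {f j f'}, M.Shared i f j f' → a ≠ f → b ≠ f →
      ∃ t : ℝ, t ≠ 0 ∧ (M.elem j).vert f' - (M.elem i).vert f = t • e := by
    intro f j f' h ha hb
    obtain ⟨t, ht⟩ := hK.axial_shared hq h ha hb
    rw [hab] at ht
    have ht0 : t ≠ 0 := by rintro rfl; rw [zero_smul] at ht; exact hse ht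
    refine ⟨t⁻¹ * s, mul_ne_zero (inv_ne_zero ht0) hs, ?_⟩
    rw [mul_smul, ht, inv_smul_smul₀ ht0]
  have hbad' : ∀ {f j f'}, M.Shared i f j f' → a ≠ f → b ≠ f →
      ∃ a b, ∃ s : ℝ, s ≠ 0 ∧ axial (γ j a) - axial (γ j b) = s • e := by
    intro f j f' h ha hb
    obtain ⟨a', ha', ea⟩ := h.exists_vert ((M.elem i).mem_facet.2 ha)
    obtain ⟨b', hb', eb⟩ := h.exists_vert ((M.elem i).mem_facet.2 hb)
    refine ⟨a', b', s, hs, ?_⟩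
    rw [← hK.cont h a ((M.elem i).mem_facet.2 ha) a' ha' ea,
      ← hK.cont h b ((M.elem i).mem_facet.2 hb) b' hb' eb, hab]
  obtain ⟨t, ht0, ht⟩ := hdir hf haf hbf
  obtain ⟨t', ht0', ht'⟩ := hdir hg hag hbg
  have hsign := Shared.not_same_direction hf hg hfg ht ht'
  rcases lt_or_gt_of_ne ht0 with h | h
  · rcases lt_or_gt_of_ne ht0' with h' | h'
    · exact absurd (mul_pos_of_neg_of_neg h h') hsign
    · exact ⟨g, j', g', hg, ⟨t', h', ht'⟩, hbad' hg hag hbg⟩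
  · exact ⟨f, j, f', hf, ⟨t, h, ht⟩, hbad' hf haf hbf⟩

/-- Tetrahedral meshes. -/
theorem eq_zero_of_tetrahedral (hK : M.Kernel Γ m q u γ) (hq : ∀ i j, q i = q j)
    (hΩo : IsOpen Ω) (hΩc : IsConnected Ω) (hΩ : interior (closure Ω) = Ω)
    (hM : M.Resolves Γ) (hN : M.AtMostOneNeumannFacet Γ)
    (i : Fin M.n) (k : Fin (M.elem i).shape.nv) : γ i k = 0 := by
  have hconst : ∀ i k l, axial (γ i k) = axial (γ i l) := by
    intro i k l
    by_contra hne
    set e := axial (γ i k) - axial (γ i l) with he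
    have he0 : e ≠ 0 := sub_ne_zero.2 hne
    classical
    -- Among the elements that are nonconstant in direction `e`, take one whose sum of vertices is
    -- highest in direction `e`. Passing to the neighbour given by `exists_up` exchanges one vertex
    -- only and raises this sum.
    let bad : Finset (Fin M.n) := Finset.univ.filter fun i =>
      ∃ a b, ∃ s : ℝ, s ≠ 0 ∧ axial (γ i a) - axial (γ i b) = s • e
    have hbne : bad.Nonempty := ⟨i, by
      simp only [bad, Finset.mem_filter, Finset.mem_univ, true_and]
      exact ⟨k, l, 1, one_ne_zero, by rw [one_smul]⟩⟩
    obtain ⟨i, hi, hmax⟩ := bad.exists_max_image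
      (fun i => e ⬝ᵥ ∑ k, (M.elem i).vert k) hbne
    simp only [bad, Finset.mem_filter, Finset.mem_univ, true_and] at hi hmax
    obtain ⟨f, j, f', hs, ⟨t, ht, htd⟩, hbad⟩ := hK.exists_up hq hΩo hM hN i he0 hi
    have h1 := hmax j hbad
    have hsum : ∀ (i : Fin M.n) f, ∑ k, (M.elem i).vert k =
        (M.elem i).vert f + ∑ p ∈ M.verts i f, p := by
      intro i f
      rw [verts, Finset.sum_map]
      rw [← Finset.add_sum_erase _ _ (Finset.mem_univ f)]
      congr 1
      refine Finset.sum_congr ?_ fun _ _ => rfl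
      ext x
      rw [(M.elem i).mem_facet]; simp
    have hv : M.verts i f = M.verts j f' := by
      apply Finset.coe_injective
      rw [coe_verts, coe_verts, hs.vert_eq]
    rw [hsum i f, hsum j f', hv, dotProduct_add, dotProduct_add, eq_add_of_sub_eq htd,
      dotProduct_add, dotProduct_smul, smul_eq_mul] at h1
    have : 0 < e ⬝ᵥ e := by
      have h0 : 0 ≤ e ⬝ᵥ e := Finset.sum_nonneg fun _ _ => mul_self_nonneg _
      exact lt_of_le_of_ne h0 fun h => he0 (dotProduct_self_eq_zero.1 h.symm)
    have := mul_pos ht this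
    linarith
  -- The rotation is now constant on each tetrahedron and propagates across shared faces. On the
  -- element with a Dirichlet face it is parallel to two edges ending at the same vertex.
  refine eq_zero_of_axial (hK.skew i k) ?_
  obtain ⟨i₀, f₀, h₀⟩ := exists_dirichlet_facet (by norm_num) hΩo hΩ hM
  refine shared_induction three_pos hΩo hΩc (fun i => ∀ k, axial (γ i k) = 0)
    (fun i f j f' hs hi l => ?_) (i₀ := i₀) (fun k => ?_) i k
  · obtain ⟨k, hk⟩ := facet_nonempty three_pos (M.elem i).shape f
    obtain ⟨k', hk', e⟩ := hs.exists_vert hk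
    rw [hconst j l k', ← hK.cont hs k hk k' hk' e, hi k]
  · obtain ⟨a, b, c, ⟨h1, h2, h3, h4, h5, h6⟩, hall⟩ := (M.elem i₀).exists_others f₀
    obtain ⟨α, hα⟩ := hK.axial_dirichlet h₀ h1
    obtain ⟨β, hβ⟩ := hK.axial_dirichlet h₀ h2
    rw [hconst i₀ k a]
    rw [hconst i₀ b a] at hβ
    refine (M.elem i₀).eq_zero_of_parallel (p := a) (r := b) (k := f₀) h4.symm h1.symm
      (a := -α) (b := -β) ?_ ?_
    · rw [hα]; module
    · rw [hβ]; module

end Kernel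

end Mesh

/-! ### Quadrilaterals: adapted Cartesian coordinates. -/

/-- Cartesian coordinates with respect to some orthonormal basis of the plane. -/
structure IsFrame (X Y : Pt 2 →ₗ[ℝ] ℝ) : Prop where
  sq : ∀ v, v 0 ^ 2 + v 1 ^ 2 = X v ^ 2 + Y v ^ 2
  surj : ∀ a b : ℝ, ∃ v, X v = a ∧ Y v = b

namespace IsFrame

variable {X Y : Pt 2 →ₗ[ℝ] ℝ}

lemma eq_zero (hF : IsFrame X Y) {v : Pt 2} (hX : X v = 0) (hY : Y v = 0) : v = 0 := by
  have h := hF.sq v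
  rw [hX, hY] at h
  have h0 : v 0 = 0 := by nlinarith [sq_nonneg (v 0), sq_nonneg (v 1)]
  have h1 : v 1 = 0 := by nlinarith [sq_nonneg (v 0), sq_nonneg (v 1)]
  funext i
  fin_cases i
  · exact h0
  · exact h1

lemma ext (hF : IsFrame X Y) {v w : Pt 2} (hX : X v = X w) (hY : Y v = Y w) : v = w := by
  rw [← sub_eq_zero]
  exact hF.eq_zero (by rw [map_sub, hX, sub_self]) (by rw [map_sub, hY, sub_self])

lemma norm_sq (hF : IsFrame X Y) (v : Pt 2) :
    ‖(WithLp.toLp 2 v : EuclideanSpace ℝ (Fin 2))‖ ^ 2 = X v ^ 2 + Y v ^ 2 := by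
  rw [EuclideanSpace.real_norm_sq_eq, Fin.sum_univ_two, ← hF.sq]

lemma abs_le (hF : IsFrame X Y) (v : Pt 2) :
    |X v| ≤ ‖(WithLp.toLp 2 v : EuclideanSpace ℝ (Fin 2))‖ ∧
      |Y v| ≤ ‖(WithLp.toLp 2 v : EuclideanSpace ℝ (Fin 2))‖ := by
  have h := hF.norm_sq v
  constructor <;> refine abs_le_of_sq_le_sq ?_ (norm_nonneg _) <;> rw [h]
  · linarith [sq_nonneg (Y v)]
  · linarith [sq_nonneg (X v)]

/-- `Y` is the normalized normal and `X` the normalized tangential coordinate; its sign `σ` is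
chosen so that `e` points to the right. -/
lemma exists_of_normal {ν : Pt 2 →ₗ[ℝ] ℝ} (hν : ν ≠ 0) {e : Pt 2} (he : e ≠ 0) (hνe : ν e = 0) :
    ∃ X Y, IsFrame X Y ∧ 0 < X e ∧ ∃ c : ℝ, 0 < c ∧ Y = c • ν := by
  set a := ν (Pi.single 0 1) with ha
  set b := ν (Pi.single 1 1) with hb
  have hν' : ∀ v, ν v = a * v 0 + b * v 1 := by
    intro v
    have : v = v 0 • Pi.single 0 1 + v 1 • Pi.single 1 1 := by
      funext i; fin_cases i <;> simp
    conv_lhs => rw [this]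
    rw [map_add, map_smul, map_smul, smul_eq_mul, smul_eq_mul]
    ring
  have hab : 0 < a ^ 2 + b ^ 2 := by
    by_contra h
    have h0 : a = 0 := by nlinarith [sq_nonneg a, sq_nonneg b]
    have h1 : b = 0 := by nlinarith [sq_nonneg a, sq_nonneg b]
    exact hν (LinearMap.ext fun v => by rw [hν', h0, h1]; simp)
  set N := √(a ^ 2 + b ^ 2) with hN
  have hN0 : 0 < N := Real.sqrt_pos.2 hab
  have hN2 : N ^ 2 = a ^ 2 + b ^ 2 := Real.sq_sqrt hab.le
  have key : ∀ σ : ℝ, σ ^ 2 = 1 → 0 < σ * (b * e 0 - a * e 1) →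
      ∃ X Y, IsFrame X Y ∧ 0 < X e ∧ ∃ c : ℝ, 0 < c ∧ Y = c • ν := by
    intro σ hσ hpos
    let X : Pt 2 →ₗ[ℝ] ℝ := (N⁻¹ * σ) • (b • LinearMap.proj 0 - a • LinearMap.proj 1)
    have hX : ∀ v, X v = N⁻¹ * σ * (b * v 0 - a * v 1) := fun v => by simp [X]
    have hY : ∀ v, (N⁻¹ • ν) v = N⁻¹ * (a * v 0 + b * v 1) := fun v => by simp [hν']
    refine ⟨X, N⁻¹ • ν, ⟨fun v => ?_, fun p q => ?_⟩, ?_, N⁻¹, inv_pos.2 hN0, rfl⟩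
    · rw [hX, hY]
      field_simp
      linear_combination (v 0 ^ 2 + v 1 ^ 2) * hN2 - (b * v 0 - a * v 1) ^ 2 * hσ
    · refine ⟨![N⁻¹ * (q * a + σ * p * b), N⁻¹ * (q * b - σ * p * a)], ?_, ?_⟩
      · rw [hX]
        simp only [Matrix.cons_val_zero, Matrix.cons_val_one]
        field_simp
        linear_combination (p * (a ^ 2 + b ^ 2)) * hσ - p * hN2
      · rw [hY]
        simp only [Matrix.cons_val_zero, Matrix.cons_val_one]
        field_simp
        linear_combination (-q) * hN2
    · rw [hX, mul_assoc]
      exact mul_pos (inv_pos.2 hN0) hpos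
  have hne : b * e 0 - a * e 1 ≠ 0 := by
    intro h
    rw [hν'] at hνe
    have h0 : (a ^ 2 + b ^ 2) * e 0 = 0 := by linear_combination a * hνe + b * h
    have h1 : (a ^ 2 + b ^ 2) * e 1 = 0 := by linear_combination b * hνe - a * h
    refine he (funext fun i => ?_)
    fin_cases i
    · exact (mul_eq_zero.1 h0).resolve_left hab.ne'
    · exact (mul_eq_zero.1 h1).resolve_left hab.ne'
  rcases lt_or_gt_of_ne hne with h | h
  · exact key (-1) (by norm_num) (by linarith)
  · exact key 1 (by norm_num) (by linarith)

end IsFrame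

lemma Element.IsNormal.smul {d : ℕ} {E : Element d} {f : Fin E.shape.nv} {ν : Pt d →ₗ[ℝ] ℝ}
    (h : E.IsNormal f ν) {c : ℝ} (hc : 0 < c) : E.IsNormal f (c • ν) := by
  refine ⟨fun k hk l hl => ?_, fun y hy hy0 => ?_⟩
  · rw [LinearMap.smul_apply, LinearMap.smul_apply, h.1 k hk l hl]
  · obtain ⟨a, ha, hv⟩ := h.2 y hy hy0
    exact ⟨c * a, mul_pos hc ha, fun v => by
      rw [LinearMap.smul_apply, hv, smul_eq_mul, mul_assoc]⟩

/-! ### Corners of plane elements and their widths. -/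

namespace Element

/-- The two edges `f` and `f'` of a plane element meet at the vertex `k`. -/
structure IsCorner (E : Element 2) (k f f' : Fin E.shape.nv) : Prop where
  ne : f ≠ f'
  mem : k ∈ E.shape.facet f
  mem' : k ∈ E.shape.facet f'
  facet_eq : E.shape.facet f = {k, E.shape.opp f' k}
  facet_eq' : E.shape.facet f' = {k, E.shape.opp f k}
  eq_or_eq : ∀ g, k ∈ E.shape.facet g → g = f ∨ g = f'

variable {E : Element 2}

lemma exists_isCorner {f k : Fin E.shape.nv} (hk : k ∈ E.shape.facet f) :
    ∃ f', E.IsCorner k f f' := by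
  obtain ⟨f', h1, h2, -, h4, h5, h6⟩ := Shape.exists_other hk
  exact ⟨f', h1.symm, hk, h2, h5, h4, h6⟩

lemma IsCorner.symm {k f f' : Fin E.shape.nv} (h : E.IsCorner k f f') : E.IsCorner k f' f :=
  ⟨h.ne.symm, h.mem', h.mem, h.facet_eq', h.facet_eq, fun g hg => (h.eq_or_eq g hg).symm⟩

lemma IsCorner.bdLin_apply {k f f' : Fin E.shape.nv} (h : E.IsCorner k f f') (α β : ℝ) :
    E.shape.bdLin f (α • (E.shape.refVert (E.shape.opp f k) - E.shape.refVert k) +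
      β • (E.shape.refVert (E.shape.opp f' k) - E.shape.refVert k)) = α := by
  have h1 : E.shape.opp f' k ∈ E.shape.facet f := by rw [h.facet_eq]; simp
  rw [map_add, map_smul, map_smul, E.shape.bdLin_opp h.mem, E.shape.bdLin_sub,
    E.shape.bd_refVert_of_mem h1, E.shape.bd_refVert_of_mem h.mem]
  simp

/-- At a corner the tangent cone is spanned by the two edges: the derivative of the element map
sends the reference edges at `k` to the physical ones, and only the facets `f` and `f'` are active
there. -/
lemma IsCorner.eventually_mem_inner {k f f' : Fin E.shape.nv} (h : E.IsCorner k f f') {α β : ℝ}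
    (hα : 0 < α) (hβ : 0 < β) : ∀ᶠ ε : ℝ in nhdsWithin 0 (Set.Ioi 0), E.vert k + ε •
      (α • (E.vert (E.shape.opp f k) - E.vert k) + β • (E.vert (E.shape.opp f' k) - E.vert k)) ∈
        E.inner := by
  have hr := E.shape.refVert_mem k
  have hv : α • (E.vert (E.shape.opp f k) - E.vert k) +
      β • (E.vert (E.shape.opp f' k) - E.vert k) = E.fderivEquiv hr
        (α • (E.shape.refVert (E.shape.opp f k) - E.shape.refVert k) +
          β • (E.shape.refVert (E.shape.opp f' k) - E.shape.refVert k)) := by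
    rw [map_add, map_smul, map_smul, E.fderivEquiv_apply, E.fderivEquiv_apply,
      E.fderiv_opp h.mem, E.fderiv_opp h.mem']
  rw [hv, ← E.map_refVert k]
  refine E.eventually_mem_inner hr fun g hg => ?_
  rw [ContinuousLinearEquiv.symm_apply_apply]
  have hkg : k ∈ E.shape.facet g := by
    by_contra hn
    rw [E.shape.bd_refVert_of_notMem hn] at hg
    exact one_ne_zero hg
  rcases h.eq_or_eq g hkg with rfl | rfl
  · rw [h.bdLin_apply]; exact hα
  · rw [add_comm, h.symm.bdLin_apply]; exact hβ

lemma hull_pair {f k l : Fin E.shape.nv} (h : E.shape.facet f = {k, l}) :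
    E.hull (E.shape.facet f) = segment ℝ (E.vert k) (E.vert l) := by
  rw [h, hull, Finset.coe_pair, Set.image_pair, convexHull_pair]

lemma ne_of_facet_eq {f k l : Fin E.shape.nv} (h : E.shape.facet f = {k, l}) : k ≠ l := by
  rintro rfl
  have := E.shape.card_facet f
  rw [h] at this
  simp at this

lemma exists_isRelint_pair {f k l : Fin E.shape.nv} (h : E.shape.facet f = {k, l}) {t : ℝ}
    (h0 : 0 < t) (h1 : t < 1) :
    ∃ y, E.IsRelint f y ∧ E.map y = E.vert k + t • (E.vert l - E.vert k) := by
  have hkl := ne_of_facet_eq h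
  let c : Fin E.shape.nv → ℝ := fun j => if j = k then 1 - t else if j = l then t else 0
  have hck : c k = 1 - t := by simp [c]
  have hcl : c l = t := by simp [c, hkl.symm]
  have hc0 : ∀ j, j ≠ k ∧ j ≠ l → c j = 0 := fun j hj => by simp [c, hj.1, hj.2]
  have hc : ∀ j, j ∉ E.shape.facet f → c j = 0 := fun j hj => by
    rw [h] at hj
    simp only [Finset.mem_insert, Finset.mem_singleton, not_or] at hj
    exact hc0 j hj
  have hs : ∑ j, c j = 1 := by
    rw [Fintype.sum_eq_add k l hkl hc0, hck, hcl]; ring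
  refine ⟨_, E.isRelint_combo (fun j hj => ?_) hc hs, ?_⟩
  · rw [h] at hj
    simp only [Finset.mem_insert, Finset.mem_singleton] at hj
    rcases hj with rfl | rfl
    · rw [hck]; linarith
    · rw [hcl]; exact h0
  · rw [E.map_face_combo (E.shape.isFace_facet f) hc hs, Fintype.sum_eq_add k l hkl, hck, hcl]
    · rw [smul_sub, sub_smul, one_smul]; abel
    · intro j hj
      rw [hc0 j hj, zero_smul]

/-- A point of a horizontal edge is determined by its abscissa. -/
lemma exists_isRelint_of_frame {X Y : Pt 2 →ₗ[ℝ] ℝ} (hF : IsFrame X Y) {f k l : Fin E.shape.nv}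
    (h : E.shape.facet f = {k, l}) (hY : Y (E.vert k) = Y (E.vert l)) {p : Pt 2}
    (hp : Y p = Y (E.vert k)) (h1 : X (E.vert k) < X p) (h2 : X p < X (E.vert l)) :
    ∃ y, E.IsRelint f y ∧ E.map y = p := by
  have hlt : 0 < X (E.vert l) - X (E.vert k) := by linarith
  obtain ⟨y, hy, e⟩ := exists_isRelint_pair h (t := (X p - X (E.vert k)) /
    (X (E.vert l) - X (E.vert k))) (div_pos (by linarith) hlt) (by rw [div_lt_one hlt]; linarith)
  refine ⟨y, hy, e.trans (hF.ext ?_ ?_)⟩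
  · rw [map_add, map_smul, map_sub, smul_eq_mul, div_mul_cancel₀ _ hlt.ne']; ring
  · rw [map_add, map_smul, map_sub, hY, sub_self, smul_zero, add_zero, hp, hY]

lemma bounded_body (E : Element 2) : Bornology.IsBounded
    ((fun x : Pt 2 => (WithLp.toLp 2 x : EuclideanSpace ℝ (Fin 2))) '' E.body) :=
  (E.isCompact_body.image (PiLp.continuous_toLp 2 _)).isBounded

lemma abs_sub_le_eDiam {X Y : Pt 2 →ₗ[ℝ] ℝ} (hF : IsFrame X Y) (E : Element 2)
    (k l : Fin E.shape.nv) : |X (E.vert k - E.vert l)| ≤ eDiam E.body ∧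
      |Y (E.vert k - E.vert l)| ≤ eDiam E.body := by
  have hv : ∀ k, E.vert k ∈ E.body := fun k => ⟨_, E.shape.refVert_mem k, E.map_refVert k⟩
  have h := Metric.dist_le_diam_of_mem (bounded_body E) ⟨_, hv k, rfl⟩ ⟨_, hv l, rfl⟩
  rw [dist_eq_norm, ← WithLp.toLp_sub] at h
  exact ⟨(hF.abs_le _).1.trans h, (hF.abs_le _).2.trans h⟩

end Element

/-- Shape regularity bounds the width of the corner triangles from below. -/
lemma Element.IsCorner.width {κ : ℝ} (hκ : 0 < κ) {E : Element 2} (hM : ∀ S : Finset (Fin E.shape.nv),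
    S.card = 3 → ∃ c, eBall c (eDiam E.body / κ) ⊆ E.hull S) {k f f'}
    (h : E.IsCorner k f f') {Z : Pt 2 →ₗ[ℝ] ℝ} {w : Pt 2}
    (hw : w 0 ^ 2 + w 1 ^ 2 = 1) (hZw : Z w = 1)
    (hZ : Z (E.vert (E.shape.opp f' k) - E.vert k) = 0) :
    2 * (eDiam E.body / κ) ≤
      |Z (E.vert (E.shape.opp f k) - E.vert k)| := by
  set a := Z (E.vert (E.shape.opp f k) - E.vert k) with ha
  have hd : 0 ≤ eDiam E.body / κ := div_nonneg Metric.diam_nonneg hκ.le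
  set r := eDiam E.body / κ
  have h1 : E.shape.opp f k ≠ k := fun e => E.shape.opp_notMem h.mem (e.symm ▸ h.mem)
  have h2 : E.shape.opp f' k ≠ k := fun e => E.shape.opp_notMem h.mem' (e.symm ▸ h.mem')
  have h3 : E.shape.opp f k ≠ E.shape.opp f' k := fun e => E.shape.opp_notMem h.mem (by
    rw [e, h.facet_eq]; simp)
  obtain ⟨c, hc⟩ := hM {k, E.shape.opp f k, E.shape.opp f' k}
    (Finset.card_eq_three.2 ⟨_, _, _, h1.symm, h2.symm, h3, rfl⟩)
  have hnw : ‖(WithLp.toLp 2 w : EuclideanSpace ℝ (Fin 2))‖ = 1 := by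
    rw [← pow_left_inj₀ (norm_nonneg _) zero_le_one two_ne_zero, EuclideanSpace.real_norm_sq_eq,
      Fin.sum_univ_two, one_pow]
    exact hw
  have hmem : ∀ s : ℝ, |s| ≤ r → c + s • w ∈ E.hull {k, E.shape.opp f k, E.shape.opp f' k} := by
    intro s hs
    refine hc ?_
    change dist _ _ ≤ r
    rw [dist_eq_norm, ← WithLp.toLp_sub, add_sub_cancel_left, WithLp.toLp_smul, norm_smul, hnw,
      mul_one]
    exact hs
  -- `Z` takes equal values at two vertices of the corner triangle and differs by `a` at the third,
  -- so it maps the triangle into an interval of length `|a|`. A diameter of the inscribed ball in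
  -- direction `w` is mapped onto an interval of length `2 r`.
  have hsub : E.hull {k, E.shape.opp f k, E.shape.opp f' k} ⊆
      Z ⁻¹' Metric.closedBall (Z (E.vert k) + a / 2) (|a| / 2) := by
    refine convexHull_min ?_ ((convex_closedBall _ _).linear_preimage Z)
    have e1 : Z (E.vert (E.shape.opp f k)) = Z (E.vert k) + a := by rw [ha, map_sub]; ring
    have e2 : Z (E.vert (E.shape.opp f' k)) = Z (E.vert k) := by
      rw [map_sub] at hZ; linarith
    rintro _ ⟨j, hj, rfl⟩
    simp only [Finset.coe_insert, Finset.coe_singleton, Set.mem_insert_iff,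
      Set.mem_singleton_iff] at hj
    rw [Set.mem_preimage, Metric.mem_closedBall, Real.dist_eq]
    have e3 : |a / 2| ≤ |a| / 2 := by rw [abs_div, abs_two]
    rcases hj with rfl | rfl | rfl
    · rw [show Z (E.vert j) - (Z (E.vert j) + a / 2) = -(a / 2) by ring, abs_neg]
      exact e3
    · rw [e1, show Z (E.vert k) + a - (Z (E.vert k) + a / 2) = a / 2 by ring]
      exact e3
    · rw [e2, show Z (E.vert k) - (Z (E.vert k) + a / 2) = -(a / 2) by ring, abs_neg]
      exact e3
  have p1 := hsub (hmem r (abs_of_nonneg hd).le)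
  have p2 := hsub (hmem (-r) (by rw [abs_neg]; exact (abs_of_nonneg hd).le))
  rw [Set.mem_preimage, Metric.mem_closedBall, Real.dist_eq, map_add, map_smul, hZw, smul_eq_mul,
    abs_le] at p1 p2
  linarith [p1.2, p2.1]

/-! ### Dirichlet edges along a fixed straight segment. -/

namespace Mesh

lemma exists_facet_of_mem_frontier {d : ℕ} {Ω : Set (Pt d)} (hΩo : IsOpen Ω)
    (hΩ : interior (closure Ω) = Ω) (M : Mesh Ω) {p : Pt d} (hp : p ∈ frontier Ω) :
    ∃ i f, p ∈ (M.elem i).hull ((M.elem i).shape.facet f) := by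
  have h1 : p ∈ ⋃ i, (M.elem i).body := by rw [M.cover]; exact frontier_subset_closure hp
  obtain ⟨i, hi⟩ := Set.mem_iUnion.1 h1
  have h2 : p ∉ (M.elem i).inner := fun h => by
    rw [hΩo.frontier_eq] at hp
    exact hp.2 (M.interior_body_subset hΩ i ((M.elem i).inner_subset_interior h))
  obtain ⟨f, hf⟩ := (M.elem i).exists_bd_eq_zero hi h2
  exact ⟨i, f, (M.elem i).mem_hull_facet_iff.2 ⟨hi, hf⟩⟩

variable {Ω : Set (Pt 2)} {M : Mesh Ω}

/-- A common direction of the open tangent cones at a common vertex would lead into both elements.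
-/
lemma cones_disjoint {i j : Fin M.n} (hij : i ≠ j) {k f f'} (h : (M.elem i).IsCorner k f f')
    {l g g'} (h' : (M.elem j).IsCorner l g g') (hkl : (M.elem i).vert k = (M.elem j).vert l)
    {α β α' β' : ℝ} (hα : 0 < α) (hβ : 0 < β) (hα' : 0 < α') (hβ' : 0 < β') :
    α • ((M.elem i).vert ((M.elem i).shape.opp f k) - (M.elem i).vert k) +
        β • ((M.elem i).vert ((M.elem i).shape.opp f' k) - (M.elem i).vert k) ≠
      α' • ((M.elem j).vert ((M.elem j).shape.opp g l) - (M.elem j).vert l) +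
        β' • ((M.elem j).vert ((M.elem j).shape.opp g' l) - (M.elem j).vert l) := by
  intro e
  have h1 := h.eventually_mem_inner hα hβ
  have h2 := h'.eventually_mem_inner hα' hβ'
  rw [e, hkl] at h1
  obtain ⟨ε, h3, h4⟩ := (h1.and h2).exists
  exact notMem_interior hij ((M.elem j).inner_subset_body h4)
    ((M.elem i).inner_subset_interior h3)

/-- The edge `f`, with left end `k` and right end `l`, lies on the line `Y = y₀` and on the
Dirichlet boundary, below its element. -/
structure IsBottom (M : Mesh Ω) (Γ : BoundarySplit Ω) (X Y : Pt 2 →ₗ[ℝ] ℝ) (y₀ : ℝ) (i : Fin M.n)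
    (f k l : Fin (M.elem i).shape.nv) : Prop where
  normal : (M.elem i).IsNormal f Y
  facet_eq : (M.elem i).shape.facet f = {k, l}
  lt : X ((M.elem i).vert k) < X ((M.elem i).vert l)
  level : Y ((M.elem i).vert k) = y₀
  dirichlet : (M.elem i).hull ((M.elem i).shape.facet f) ⊆ Γ.ΓD

/-- The edge of the fixed element `E` provides a straight Dirichlet segment independent of the mesh.
An arbitrary resolving mesh has a boundary edge on this segment covering the abscissae just to the
right of `x`. The edge is not shared, as it contains relatively interior points outside `Ω`. It is
not Neumann, as the two parts overlap in a null set only. Its element lies on the same side as `E`,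
as otherwise the two would surround a boundary point. -/
theorem exists_isBottom (hΩo : IsOpen Ω) (hΩ : interior (closure Ω) = Ω) {Γ : BoundarySplit Ω}
    (hM : M.Resolves Γ) {X Y : Pt 2 →ₗ[ℝ] ℝ} (hF : IsFrame X Y) {E : Element 2}
    (hE : E.body ⊆ closure Ω) {f₀ k₀ l₀ : Fin E.shape.nv} (hν : E.IsNormal f₀ Y)
    (hD : E.hull (E.shape.facet f₀) ⊆ Γ.ΓD) (hf₀ : E.shape.facet f₀ = {k₀, l₀}) {x : ℝ}
    (h1 : X (E.vert k₀) ≤ x) (h2 : x < X (E.vert l₀)) :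
    ∃ i f k l, M.IsBottom Γ X Y (Y (E.vert k₀)) i f k l ∧
      X ((M.elem i).vert k) ≤ x ∧ x < X ((M.elem i).vert l) := by
  have hk₀ : k₀ ∈ E.shape.facet f₀ := by rw [hf₀]; simp
  have hl₀ : l₀ ∈ E.shape.facet f₀ := by rw [hf₀]; simp
  have hYkl := hν.1 k₀ hk₀ l₀ hl₀
  have hDf : Γ.ΓD ⊆ frontier Ω := Γ.union_eq ▸ Set.subset_union_left
  obtain ⟨e, heX, heY⟩ := hF.surj 1 0
  obtain ⟨p, hpX, hpY⟩ := hF.surj x (Y (E.vert k₀))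
  have hrel : ∀ v, Y v = Y (E.vert k₀) → X (E.vert k₀) < X v → X v < X (E.vert l₀) →
      ∃ y, E.IsRelint f₀ y ∧ E.map y = v := fun v hv a b =>
    Element.exists_isRelint_of_frame hF hf₀ hYkl hv a b
  have hmemD : ∀ v, Y v = Y (E.vert k₀) → X (E.vert k₀) < X v → X v < X (E.vert l₀) →
      v ∈ Γ.ΓD := fun v hv a b => by
    obtain ⟨y, hy, rfl⟩ := hrel v hv a b
    refine hD (E.mem_hull_facet_iff.2 ⟨⟨y, hy.1, rfl⟩, ?_⟩)
    rw [E.inv_map hy.1]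
    exact hy.2.1
  have hev : ∀ᶠ ε : ℝ in nhdsWithin 0 (Set.Ioi 0), 0 < ε ∧ ε < X (E.vert l₀) - x := by
    refine Filter.Eventually.and self_mem_nhdsWithin ?_
    exact nhdsWithin_le_nhds (gt_mem_nhds (by linarith))
  have hXp : ∀ ε : ℝ, X (p + ε • e) = x + ε := fun ε => by
    rw [map_add, map_smul, hpX, heX, smul_eq_mul, mul_one]
  have hYp : ∀ ε : ℝ, Y (p + ε • e) = Y (E.vert k₀) := fun ε => by
    rw [map_add, map_smul, hpY, heY, smul_zero, add_zero]
  -- There are finitely many facets, so a single one contains points `p + ε • e` for arbitrarily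
  -- small positive `ε`. Being closed, it also contains `p`, and two of its points fix its line.
  obtain ⟨⟨i, f⟩, hfreq⟩ : ∃ a : Σ i, Fin (M.elem i).shape.nv,
      ∃ᶠ ε : ℝ in nhdsWithin 0 (Set.Ioi 0),
        p + ε • e ∈ (M.elem a.1).hull ((M.elem a.1).shape.facet a.2) := by
    by_contra hcon
    push Not at hcon
    have := Filter.eventually_all.2 hcon
    obtain ⟨ε, h3, h4, h5⟩ := (this.and hev).exists
    obtain ⟨i, f, hif⟩ := exists_facet_of_mem_frontier hΩo hΩ M
      (hDf (hmemD (p + ε • e) (hYp ε) (by rw [hXp]; linarith) (by rw [hXp]; linarith)))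
    exact h3 ⟨i, f⟩ hif
  simp only at hfreq
  have hpmem : p ∈ (M.elem i).hull ((M.elem i).shape.facet f) := by
    refine ((M.elem i).isClosed_hull _).mem_of_frequently_of_tendsto hfreq ?_
    have : Filter.Tendsto (fun ε : ℝ => p + ε • e) (nhds 0) (nhds (p + (0 : ℝ) • e)) :=
      (Continuous.tendsto (by fun_prop) 0)
    rw [zero_smul, add_zero] at this
    exact this.mono_left nhdsWithin_le_nhds
  obtain ⟨ε, hεmem, hε0, hεlt⟩ := (hfreq.and_eventually hev).exists
  obtain ⟨k, l, hfac, hab⟩ : ∃ k l, (M.elem i).shape.facet f = {k, l} ∧ ∃ a b : ℝ, 0 ≤ a ∧ a < b ∧ b ≤ 1 ∧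
      (M.elem i).vert k + a • ((M.elem i).vert l - (M.elem i).vert k) = p ∧
      (M.elem i).vert k + b • ((M.elem i).vert l - (M.elem i).vert k) = p + ε • e := by
    obtain ⟨k, l, -, hfac⟩ := Finset.card_eq_two.1 ((M.elem i).shape.card_facet f)
    have hpm := hpmem
    have hem := hεmem
    rw [Element.hull_pair hfac, segment_eq_image'] at hpm hem
    obtain ⟨a, ha, ea⟩ := hpm
    obtain ⟨b, hb, eb⟩ := hem
    simp only at ea eb
    rcases lt_trichotomy a b with hlt | heq | hgt
    · exact ⟨k, l, hfac, a, b, ha.1, hlt, hb.2, ea, eb⟩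
    · exfalso
      have := congrArg X (ea.symm.trans (heq ▸ eb))
      rw [hXp, hpX] at this
      linarith
    · refine ⟨l, k, by rw [hfac, Finset.pair_comm], 1 - a, 1 - b, by linarith [ha.2],
        by linarith, by linarith [hb.1], ?_, ?_⟩
      · rw [← ea, sub_smul, one_smul, smul_sub, smul_sub]; abel
      · rw [← eb, sub_smul, one_smul, smul_sub, smul_sub]; abel
  obtain ⟨a, b, ha0, hab, hb1, ea, eb⟩ := hab
  have hk : k ∈ (M.elem i).shape.facet f := by rw [hfac]; simp
  have hl : l ∈ (M.elem i).shape.facet f := by rw [hfac]; simp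
  have hX1 := congrArg X ea
  have hX2 := congrArg X eb
  have hY1 := congrArg Y ea
  have hY2 := congrArg Y eb
  rw [map_add, map_smul, smul_eq_mul, map_sub] at hX1 hX2 hY1 hY2
  rw [hXp] at hX2
  rw [hYp] at hY2
  rw [hpX] at hX1
  rw [hpY] at hY1
  have hba : 0 < b - a := by linarith
  have hYeq : Y ((M.elem i).vert l) - Y ((M.elem i).vert k) = 0 := by
    have : (b - a) * (Y ((M.elem i).vert l) - Y ((M.elem i).vert k)) = 0 := by linarith
    exact (mul_eq_zero.1 this).resolve_left hba.ne'
  have hXlt : 0 < X ((M.elem i).vert l) - X ((M.elem i).vert k) := by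
    have : 0 < (b - a) * (X ((M.elem i).vert l) - X ((M.elem i).vert k)) := by linarith
    exact (pos_iff_pos_of_mul_pos this).1 hba
  have hlev : Y ((M.elem i).vert k) = Y (E.vert k₀) := by rw [hYeq] at hY1; linarith
  have hXk : X ((M.elem i).vert k) ≤ x := by
    have := mul_nonneg ha0 hXlt.le
    linarith
  have hXl : x + ε ≤ X ((M.elem i).vert l) := by
    have := mul_nonneg (sub_nonneg.2 hb1) hXlt.le
    linarith
  -- the midpoint of the two points found
  have hmX := hXp (ε / 2)
  have hmY := hYp (ε / 2)
  set z := p + (ε / 2) • e with hz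
  obtain ⟨y, hy, eyz⟩ := hrel z hmY (by linarith) (by linarith)
  obtain ⟨y', hy', eyz'⟩ := Element.exists_isRelint_of_frame hF hfac (by linarith) (p := z)
    (by linarith) (by linarith) (by linarith)
  have hzD : z ∈ Γ.ΓD := hmemD z hmY (by linarith) (by linarith)
  have hzΩ : z ∉ Ω := by
    have := hDf hzD
    rw [hΩo.frontier_eq] at this
    exact this.2
  have hsubf : (M.elem i).hull ((M.elem i).shape.facet f) ⊆ frontier Ω := by
    refine (shared_or_subset_frontier two_pos hΩo i f).resolve_left ?_
    rintro ⟨j, f', hs⟩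
    refine hzΩ ?_
    have hlt : 0 < X ((M.elem i).vert l) - X ((M.elem i).vert k) := hXlt
    have hkl : (M.elem i).vert k ≠ (M.elem i).vert l := fun e => by rw [e, sub_self] at hlt; exact lt_irrefl _ hlt
    have hV : M.verts i f = {(M.elem i).vert k, (M.elem i).vert l} := by
      apply Finset.coe_injective
      rw [coe_verts, hfac, Finset.coe_pair, Finset.coe_pair, Set.image_pair]
    set τ := (X z - X ((M.elem i).vert k)) / (X ((M.elem i).vert l) - X ((M.elem i).vert k)) with hτ
    have hτ0 : 0 < τ := div_pos (by linarith) hlt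
    have hτ1 : τ < 1 := by rw [hτ, div_lt_one hlt]; linarith
    have := hs.mem_of_weights two_pos hΩ (w := fun v => if v = (M.elem i).vert k then 1 - τ else τ)
      (fun v _ => by split_ifs <;> linarith)
      (by rw [hV, Finset.sum_pair hkl, if_pos rfl, if_neg hkl.symm]; ring)
    rw [hV, Finset.sum_pair hkl, if_pos rfl, if_neg hkl.symm] at this
    convert this using 1
    refine hF.ext (Eq.symm ?_) (Eq.symm ?_)
    · rw [map_add, map_smul, map_smul, smul_eq_mul, smul_eq_mul]
      have : τ * (X ((M.elem i).vert l) - X ((M.elem i).vert k)) = X z - X ((M.elem i).vert k) :=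
        div_mul_cancel₀ _ hlt.ne'
      linarith
    · rw [map_add, map_smul, map_smul, smul_eq_mul, smul_eq_mul]
      have : Y ((M.elem i).vert l) = Y ((M.elem i).vert k) := by linarith
      rw [this, hmY, hlev]; ring
  have hDir : (M.elem i).hull ((M.elem i).shape.facet f) ⊆ Γ.ΓD := by
    refine (hM i _ (Shape.isFacet_iff _ _ |>.2 ⟨f, rfl⟩) hsubf).resolve_right fun hN => ?_
    -- A Neumann edge would share with the Dirichlet part a segment of positive length, which is its
    -- one-dimensional Hausdorff measure.
    have hseg : segment ℝ z (p + ε • e) ⊆ Γ.ΓD ∩ Γ.ΓN := by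
      refine Set.subset_inter ?_ ?_
      · intro v hv
        rw [segment_eq_image'] at hv
        obtain ⟨t, ht, rfl⟩ := hv
        have e1 : p + ε • e - z = (ε / 2) • e := by
          rw [hz, add_sub_add_left_eq_sub, ← sub_smul]; congr 1; ring
        have e2 : z + t • (p + ε • e - z) = p + (ε / 2 + t * (ε / 2)) • e := by
          rw [e1, hz, add_smul, smul_smul, add_assoc]
        have := mul_nonneg ht.1 hε0.le
        have := mul_nonneg (sub_nonneg.2 ht.2) hε0.le
        simp only [e2]
        exact hmemD _ (hYp _) (by rw [hXp]; linarith) (by rw [hXp]; linarith)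
      · refine Set.Subset.trans (Convex.segment_subset (convex_convexHull ℝ _) ?_ ?_) hN
        · rw [← eyz']
          exact (M.elem i).mem_hull_facet_iff.2 ⟨⟨y', hy'.1, rfl⟩, by rw [(M.elem i).inv_map hy'.1]; exact hy'.2.1⟩
        · exact hεmem
    have h0 := measure_mono_null hseg Γ.overlap
    rw [show ((2 : ℕ) : ℝ) - 1 = 1 by norm_num, hausdorffMeasure_segment, edist_eq_zero] at h0
    have := congrArg X h0
    rw [hXp, hXp] at this
    linarith
  obtain ⟨ν, hν'⟩ := (M.elem i).exists_isNormal hk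
  obtain ⟨c, hc⟩ := hν'.exists_eq_smul hk Y (fun r hr s hs => by
    rw [hfac] at hr hs
    simp only [Finset.mem_insert, Finset.mem_singleton] at hr hs
    rcases hr with rfl | rfl <;> rcases hs with rfl | rfl <;> linarith)
  have hcne : c ≠ 0 := by
    rintro rfl
    obtain ⟨v, -, hv⟩ := hF.surj 0 1
    rw [hc, zero_smul] at hv
    simp at hv
  rcases lt_or_gt_of_ne hcne with hneg | hpos
  -- With opposite normals, `E` and the element would cover a neighbourhood of `z`, placing `z` in
  -- the interior of the closure of `Ω`, that is in `Ω`.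
  · exfalso
    have hν2 : ν = c⁻¹ • Y := by rw [hc, smul_smul, inv_mul_cancel₀ hcne, one_smul]
    have := hν.mem_interior_union hν' hy hy' (eyz.trans eyz'.symm) (inv_lt_zero.2 hneg) hν2 hk₀
    rw [eyz] at this
    refine hzΩ ?_
    rw [← hΩ]
    exact interior_mono (Set.union_subset hE (M.body_subset_closure i)) this
  · exact ⟨i, f, k, l, ⟨hc ▸ hν'.smul hpos, hfac, by linarith, hlev, hDir⟩, hXk, by linarith⟩

end Mesh

/-! ### Slopes of lateral edges: growth along the boundary against shape regularity. -/

namespace Mesh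

variable {Ω : Set (Pt 2)} {M : Mesh Ω} {Γ : BoundarySplit Ω} {X Y : Pt 2 →ₗ[ℝ] ℝ} {y₀ : ℝ}

namespace IsBottom

variable {i : Fin M.n} {f k l : Fin (M.elem i).shape.nv}

lemma mem_left (h : M.IsBottom Γ X Y y₀ i f k l) : k ∈ (M.elem i).shape.facet f := by
  rw [h.facet_eq]; simp

lemma mem_right (h : M.IsBottom Γ X Y y₀ i f k l) : l ∈ (M.elem i).shape.facet f := by
  rw [h.facet_eq]; simp

lemma level' (h : M.IsBottom Γ X Y y₀ i f k l) : Y ((M.elem i).vert l) = y₀ :=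
  (h.normal.1 l h.mem_right k h.mem_left).trans h.level

lemma exists_corner_left (h : M.IsBottom Γ X Y y₀ i f k l) :
    ∃ f', (M.elem i).IsCorner k f f' ∧ (M.elem i).shape.opp f' k = l := by
  obtain ⟨f', hc⟩ := Element.exists_isCorner h.mem_left
  refine ⟨f', hc, ?_⟩
  have h1 : (M.elem i).shape.opp f' k ∈ (M.elem i).shape.facet f := by rw [hc.facet_eq]; simp
  rw [h.facet_eq] at h1
  simp only [Finset.mem_insert, Finset.mem_singleton] at h1
  refine h1.resolve_left fun e => (M.elem i).shape.opp_notMem hc.mem' ?_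
  rw [e]; exact hc.mem'

lemma exists_corner_right (h : M.IsBottom Γ X Y y₀ i f k l) :
    ∃ f', (M.elem i).IsCorner l f f' ∧ (M.elem i).shape.opp f' l = k := by
  obtain ⟨f', hc⟩ := Element.exists_isCorner h.mem_right
  refine ⟨f', hc, ?_⟩
  have h1 : (M.elem i).shape.opp f' l ∈ (M.elem i).shape.facet f := by rw [hc.facet_eq]; simp
  rw [h.facet_eq] at h1
  simp only [Finset.mem_insert, Finset.mem_singleton] at h1
  refine h1.resolve_right fun e => (M.elem i).shape.opp_notMem hc.mem' ?_
  rw [e]; exact hc.mem'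

/-- Two edges on the same side of a line do not overlap. -/
lemma le_left (hF : IsFrame X Y) (h : M.IsBottom Γ X Y y₀ i f k l) {i' : Fin M.n} {f' k' l'}
    (h' : M.IsBottom Γ X Y y₀ i' f' k' l')
    (hlt : X ((M.elem i).vert l) < X ((M.elem i').vert l')) :
    X ((M.elem i).vert l) ≤ X ((M.elem i').vert k') := by
  by_contra hcon
  push Not at hcon
  have hlo := max_lt h.lt hcon
  -- An abscissa in the relative interior of both edges. In one element the two edges would
  -- coincide; two different elements would overlap just above this point.
  set x := (max (X ((M.elem i).vert k)) (X ((M.elem i').vert k')) + X ((M.elem i).vert l)) / 2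
    with hx
  have x1 : X ((M.elem i).vert k) < x := by
    have := le_max_left (X ((M.elem i).vert k)) (X ((M.elem i').vert k'))
    rw [hx]; linarith
  have x2 : X ((M.elem i').vert k') < x := by
    have := le_max_right (X ((M.elem i).vert k)) (X ((M.elem i').vert k'))
    rw [hx]; linarith
  have x3 : x < X ((M.elem i).vert l) := by rw [hx]; linarith
  obtain ⟨z, hzX, hzY⟩ := hF.surj x y₀
  obtain ⟨y, hy, ey⟩ := Element.exists_isRelint_of_frame hF h.facet_eq
    (h.level.trans h.level'.symm) (p := z) (by rw [hzY, h.level]) (by rwa [hzX]) (by rwa [hzX])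
  obtain ⟨y', hy', ey'⟩ := Element.exists_isRelint_of_frame hF h'.facet_eq
    (h'.level.trans h'.level'.symm) (p := z) (by rw [hzY, h'.level]) (by rwa [hzX])
    (by rw [hzX]; linarith)
  by_cases hii : i = i'
  · subst hii
    have hyy : y = y' := (M.elem i).injOn_map hy.1 hy'.1 (ey.trans ey'.symm)
    subst hyy
    have hff : f' = f := by
      by_contra hne
      exact (hy.2.2 f' hne).ne' hy'.2.1
    subst hff
    have hl' := h'.mem_right
    rw [h.facet_eq] at hl'
    simp only [Finset.mem_insert, Finset.mem_singleton] at hl'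
    have := h.lt
    rcases hl' with rfl | rfl <;> linarith
  · obtain ⟨v, -, hv⟩ := hF.surj 0 1
    have hv0 : 0 < Y v := by rw [hv]; exact one_pos
    have e1 := h.normal.eventually_mem_inner hy.1 hy.2.1 hy.2.2 hv0
    have e2 := h'.normal.eventually_mem_inner hy'.1 hy'.2.1 hy'.2.2 hv0
    rw [ey] at e1
    rw [ey'] at e2
    obtain ⟨ε, h3, h4⟩ := (e1.and e2).exists
    exact notMem_interior hii ((M.elem i').inner_subset_body h4)
      ((M.elem i).inner_subset_interior h3)

end IsBottom

variable {m : ℝ} {q : Fin M.n → ℝ} {u : Fin M.n → Pt 2}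
  {γ : ∀ i, Fin (M.elem i).shape.nv → Mat 2} {κ : ℝ}

/-- The lateral edges at the two ends of a Dirichlet edge are parallel. -/
lemma Kernel.lateral (hK : M.Kernel Γ m q u γ) (hne : ∀ i k, γ i k 0 1 ≠ 0) {i : Fin M.n}
    {f k l : Fin (M.elem i).shape.nv} (h : M.IsBottom Γ X Y y₀ i f k l) {t : ℝ}
    (ht : X ((M.elem i).vert ((M.elem i).shape.opp f k) - (M.elem i).vert k) =
      t * Y ((M.elem i).vert ((M.elem i).shape.opp f k) - (M.elem i).vert k)) :
    X ((M.elem i).vert ((M.elem i).shape.opp f l) - (M.elem i).vert l) =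
      t * Y ((M.elem i).vert ((M.elem i).shape.opp f l) - (M.elem i).vert l) := by
  have h1 := hK.dirichlet_rot h.dirichlet h.mem_left
  have h2 := hK.dirichlet_rot h.dirichlet h.mem_right
  -- Both ends yield the same displacement, so nonzero multiples of the two lateral edges coincide.
  rw [h1, ← map_smul, ← map_smul] at h2
  have h3 := rot_injective h2
  have hX := congrArg X h3
  have hY := congrArg Y h3
  rw [map_smul, map_smul, smul_eq_mul, smul_eq_mul] at hX hY
  have hc : q i * γ i l 0 1 ≠ 0 := mul_ne_zero (hK.weight_pos i).ne' (hne i l)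
  refine mul_left_cancel₀ hc ?_
  rw [← hX, ht]
  linear_combination t * hY

/-- If two Dirichlet edges on a line meet, then the slope of the lateral edges increases. -/
theorem Kernel.exists_next (hK : M.Kernel Γ m q u γ) (hne : ∀ i k, γ i k 0 1 ≠ 0)
    (hΩo : IsOpen Ω) (hκ : 0 < κ) (hreg : M.ShapeRegular κ) (hF : IsFrame X Y)
    {i : Fin M.n} {f k l : Fin (M.elem i).shape.nv} (h : M.IsBottom Γ X Y y₀ i f k l)
    {i' : Fin M.n} {f' k' l'} (h' : M.IsBottom Γ X Y y₀ i' f' k' l')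
    (hlk : (M.elem i).vert l = (M.elem i').vert k')
    (hball : ∃ ε : ℝ, 0 < ε ∧ ∀ z, dist z ((M.elem i).vert l) < ε →
      0 < Y (z - (M.elem i).vert l) → z ∈ Ω) {t t' : ℝ}
    (ht : X ((M.elem i).vert ((M.elem i).shape.opp f l) - (M.elem i).vert l) =
      t * Y ((M.elem i).vert ((M.elem i).shape.opp f l) - (M.elem i).vert l))
    (ht' : X ((M.elem i').vert ((M.elem i').shape.opp f' k') - (M.elem i').vert k') =
      t' * Y ((M.elem i').vert ((M.elem i').shape.opp f' k') - (M.elem i').vert k')) :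
    t + 2 / κ ≤ t' := by
  obtain ⟨g, hc, hg⟩ := h.exists_corner_right
  obtain ⟨g', hc', hg'⟩ := h'.exists_corner_left
  set A := (M.elem i).vert ((M.elem i).shape.opp f l) with hA
  set s := (M.elem i).vert l with hs
  set A' := (M.elem i').vert ((M.elem i').shape.opp f' k') with hA'
  have hYA : 0 < Y (A - s) := h.normal.pos h.mem_right
  have hYA' : 0 < Y (A' - s) := by rw [hlk]; exact h'.normal.pos h'.mem_left
  -- the lateral edge lies in the domain near its lower end
  obtain ⟨ε, hε, hΩε⟩ := hball
  have hz : ∃ τ : ℝ, 0 < τ ∧ τ < 1 ∧ s + τ • (A - s) ∈ Ω := by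
    have hlim : Filter.Tendsto (fun τ : ℝ => s + τ • (A - s)) (nhdsWithin 0 (Set.Ioi 0))
        (nhds s) := by
      have : Filter.Tendsto (fun τ : ℝ => s + τ • (A - s)) (nhds 0) (nhds (s + (0 : ℝ) • (A - s))) :=
        Continuous.tendsto (by fun_prop) 0
      rw [zero_smul, add_zero] at this
      exact this.mono_left nhdsWithin_le_nhds
    have h1 : ∀ᶠ τ : ℝ in nhdsWithin 0 (Set.Ioi 0), s + τ • (A - s) ∈ Metric.ball s ε :=
      hlim (Metric.ball_mem_nhds s hε)
    have h2 : ∀ᶠ τ : ℝ in nhdsWithin 0 (Set.Ioi 0), τ < 1 :=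
      nhdsWithin_le_nhds (gt_mem_nhds one_pos)
    obtain ⟨τ, h3, h4, h5⟩ := (h1.and (h2.and self_mem_nhdsWithin)).exists
    refine ⟨τ, h5, h4, hΩε _ h3 ?_⟩
    rw [add_sub_cancel_left, map_smul, smul_eq_mul]
    exact mul_pos h5 hYA
  obtain ⟨τ, hτ0, hτ1, hzΩ⟩ := hz
  obtain ⟨y, hy, ey⟩ := Element.exists_isRelint_pair hc.facet_eq' hτ0 hτ1
  -- The lateral edge enters `Ω`, so it has a neighbour `j` on its other side. `B` will be the end
  -- of the next edge of `j` at the vertex `s`.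
  obtain ⟨j, e, hsh⟩ := exists_shared_of_relint hΩo hy (by rw [ey]; exact hzΩ)
  obtain ⟨k₂, hk₂, hsk₂⟩ := hsh.exists_vert hc.mem'
  obtain ⟨e', hc₂⟩ := Element.exists_isCorner hk₂
  set B := (M.elem j).vert ((M.elem j).shape.opp e k₂) with hB
  have hA₂ : (M.elem j).vert ((M.elem j).shape.opp e' k₂) = A := by
    obtain ⟨l₂, hl₂, hAl₂⟩ := hsh.exists_vert (k := (M.elem i).shape.opp f l)
      (by rw [hc.facet_eq']; simp)
    rw [hc₂.facet_eq] at hl₂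
    simp only [Finset.mem_insert, Finset.mem_singleton] at hl₂
    rcases hl₂ with rfl | rfl
    · exfalso
      have := (M.elem i).vert_injective (hAl₂.trans hsk₂.symm)
      exact (M.elem i).shape.opp_notMem hc.mem (this.symm ▸ hc.mem)
    · exact hAl₂.symm
  -- the third edge lies to the right of the lateral edge
  have hXk : X ((M.elem i).vert k - s) < 0 := by
    rw [map_sub]; linarith [h.lt]
  have hYk : Y ((M.elem i).vert k - s) = 0 := by
    rw [map_sub, hs, h.level, h.level', sub_self]
  have hZB : 0 < X (B - s) - t * Y (B - s) := by
    obtain ⟨ν, hν, hνneg⟩ := hsh.exists_separation two_pos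
    have hνB := hνneg k₂ hk₂
    rw [← hsk₂, ← hB] at hνB
    have hνk := hν.pos hc.mem'
    rw [hg] at hνk
    obtain ⟨a, ha⟩ := hν.exists_eq_smul hc.mem' (X - t • Y) (fun r hr r' hr' => by
      rw [hc.facet_eq'] at hr hr'
      simp only [Finset.mem_insert, Finset.mem_singleton] at hr hr'
      have e1 : (X - t • Y) A = (X - t • Y) s := by
        rw [← sub_eq_zero, ← map_sub]
        simp only [LinearMap.sub_apply, LinearMap.smul_apply, smul_eq_mul]
        linarith
      rcases hr with rfl | rfl <;> rcases hr' with rfl | rfl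
      · rfl
      · exact e1.symm
      · exact e1
      · rfl)
    have e1 := congrArg (fun L : Pt 2 →ₗ[ℝ] ℝ => L ((M.elem i).vert k - s)) ha
    have e2 := congrArg (fun L : Pt 2 →ₗ[ℝ] ℝ => L (B - s)) ha
    simp only [LinearMap.sub_apply, LinearMap.smul_apply, smul_eq_mul] at e1 e2
    rw [hYk] at e1
    have ha0 : a < 0 := by
      by_contra hcon
      have := mul_nonneg (not_lt.1 hcon) hνk.le
      linarith
    rw [e2]
    exact mul_pos_of_neg_of_neg ha0 hνB
  by_cases hji : j = i'
  · -- the two neighbours share the lateral edge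
    exfalso
    subst hji
    have hkk : k₂ = k' := (M.elem j).vert_injective (hsk₂.symm.trans hlk)
    subst hkk
    have heg : e = g' := by
      rcases hc'.eq_or_eq e hk₂ with rfl | rfl
      · exfalso
        have h1 : (M.elem j).shape.opp e' k₂ ∈ (M.elem j).shape.facet e := by
          rw [hc₂.facet_eq]; simp
        have h2 := h'.normal.1 _ h1 _ hk₂
        rw [hA₂, ← hsk₂] at h2
        rw [map_sub, h2, sub_self] at hYA
        exact lt_irrefl _ hYA
      · rfl
    subst heg
    have hee : e' = f' := by
      rcases hc'.eq_or_eq e' hc₂.mem' with h1 | h1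
      · exact h1
      · exact absurd h1.symm hc₂.ne
    subst hee
    -- Both Dirichlet relations contain the common edge `A - s` and the same nonzero rotation.
    -- Inserted into the relation of the shared edge they give `(q' - q) (A - s) = q' (l' - s) - q
    -- (k - s)`. The right-hand side is horizontal with positive abscissa; the vertical component
    -- gives `q' = q`, which makes the left-hand side zero.
    have hγ := hK.cont hsh l hc.mem' k₂ hk₂ hsk₂
    have r1 := hK.shared hsh l hc.mem' k₂ hk₂ hsk₂
    have r2 := hK.dirichlet_rot h.dirichlet h.mem_right
    have r3 := hK.dirichlet_rot h'.dirichlet h'.mem_left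
    rw [mulVec_of_skew (hK.skew i l), hg, hg', ← hsk₂] at r1
    rw [hA₂, ← hsk₂, ← hγ] at r3
    rw [smul_sub, r3, r2, mul_comm, mul_smul, mul_comm (q i), mul_smul, ← smul_sub, ← map_smul,
      ← map_smul, ← map_sub] at r1
    have r4 := rot_injective (smul_right_injective _ (hne i l) r1)
    have rX := congrArg X r4
    have rY := congrArg Y r4
    simp only [map_sub X (_ • _), map_sub Y (_ • _), map_smul, smul_eq_mul] at rX rY
    have hYl' : Y ((M.elem j).vert l' - s) = 0 := by
      rw [map_sub, hs, h'.level', h.level', sub_self]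
    have hXl' : 0 < X ((M.elem j).vert l' - s) := by
      rw [map_sub, hlk]; linarith [h'.lt]
    have p1 := mul_pos (hK.weight_pos j) hXl'
    have p2 := mul_neg_of_pos_of_neg (hK.weight_pos i) hXk
    rw [← hs, ← hA] at rX rY
    rw [hYl', hYk] at rY
    rw [ht] at rX
    have : q j * (t * Y (A - s)) - q i * (t * Y (A - s)) = 0 := by linear_combination t * rY
    linarith
  · obtain ⟨w, hwX, hwY⟩ := hF.surj 1 0
    -- `X - t Y` vanishes on the lateral edge, so it measures the width of the corner triangle of
    -- `j` seen along that edge.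
    have hw := hc₂.width hκ (hreg j) (Z := X - t • Y) (w := w) (by rw [hF.sq, hwX, hwY]; norm_num) (by simp [hwX, hwY]) (by
      rw [hA₂, ← hsk₂, LinearMap.sub_apply, LinearMap.smul_apply, smul_eq_mul, ht, sub_self])
    have hYB := ((Element.abs_sub_le_eDiam hF (M.elem j) ((M.elem j).shape.opp e k₂) k₂).2)
    rw [← hB, ← hsk₂] at hw hYB
    rw [LinearMap.sub_apply, LinearMap.smul_apply, smul_eq_mul, abs_of_pos hZB] at hw
    have hYB' := (le_abs_self _).trans hYB
    -- If this failed, the direction with coordinates `(r, 1)` would lie strictly between `A - s`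
    -- and `B - s`, hence in the cone of `j`. It also lies between `A' - s` and the next Dirichlet
    -- edge, hence in the cone of `i'`.
    have key : ∀ r, t < r → t' < r → X (B - s) - t * Y (B - s) ≤ (r - t) * Y (B - s) := by
      intro r hr hr'
      by_contra hcon
      push Not at hcon
      have hX' : 0 < X ((M.elem i').vert l' - s) := by
        rw [map_sub, hlk]; linarith [h'.lt]
      have hY' : Y ((M.elem i').vert l' - s) = 0 := by
        rw [map_sub, hs, h'.level', h.level', sub_self]
      rw [← hlk] at ht'
      set z := X (B - s) - t * Y (B - s)
      have hβ : 0 < (r - t) / z := div_pos (by linarith) hZB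
      have hα : 0 < 1 - (r - t) / z * Y (B - s) := by
        rw [div_mul_eq_mul_div, sub_pos, div_lt_one hZB]; exact hcon
      refine cones_disjoint hji hc₂ hc' (hsk₂.symm.trans hlk) hβ (div_pos hα hYA)
        (div_pos one_pos hYA') (div_pos (sub_pos.2 hr') hX') ?_
      rw [hA₂, ← hB, ← hsk₂, ← hA', hg', ← hlk]
      have b1 : (r - t) / z * z = r - t := div_mul_cancel₀ _ hZB.ne'
      have b2 := div_mul_cancel₀ (1 - (r - t) / z * Y (B - s)) hYA.ne'
      have b3 := div_mul_cancel₀ 1 hYA'.ne'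
      have b4 := div_mul_cancel₀ (r - t') hX'.ne'
      refine hF.ext ?_ ?_
      · simp only [map_add, map_smul, smul_eq_mul]
        rw [ht, ht', b4, mul_left_comm, b2, mul_left_comm (1 / _), b3]
        linear_combination b1
      · simp only [map_add, map_smul, smul_eq_mul]
        rw [b2, b3, hY']
        ring
    have hYBpos : 0 < Y (B - s) := by
      have h1 := key (max t t' + 1) (by linarith [le_max_left t t'])
        (by linarith [le_max_right t t'])
      have h2 : 0 < max t t' + 1 - t := by linarith [le_max_left t t']
      exact (pos_iff_pos_of_mul_pos (hZB.trans_le h1)).1 h2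
    have hdiv : 2 / κ * Y (B - s) ≤ X (B - s) - t * Y (B - s) := by
      refine le_trans ?_ hw
      rw [div_mul_eq_mul_div, mul_div_assoc]
      exact mul_le_mul_of_nonneg_left (div_le_div_of_nonneg_right hYB' hκ.le) two_pos.le
    have hfin : ∀ r, t < r → t' < r → 2 / κ ≤ r - t := fun r hr hr' =>
      le_of_mul_le_mul_right (hdiv.trans (key r hr hr')) hYBpos
    have h2κ : 0 < 2 / κ := div_pos two_pos hκ
    -- Let `r` decrease to `max t t'`. The maximum cannot be `t`, as `2 / κ` is positive.
    have hmax : t + 2 / κ ≤ max t t' := by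
      refine le_of_forall_gt fun r hr => ?_
      have := hfin ((max t t' + r) / 2) (by linarith [le_max_left t t'])
        (by linarith [le_max_right t t'])
      linarith
    rcases le_max_iff.1 hmax with h1 | h1
    · linarith
    · exact h1

/-- Shape regularity bounds the slopes of the lateral edges. -/
lemma IsBottom.abs_slope_le (hκ : 0 < κ) (hreg : M.ShapeRegular κ) (hF : IsFrame X Y)
    {i : Fin M.n} {f k l : Fin (M.elem i).shape.nv} (h : M.IsBottom Γ X Y y₀ i f k l) {t : ℝ}
    (ht : X ((M.elem i).vert ((M.elem i).shape.opp f k) - (M.elem i).vert k) =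
      t * Y ((M.elem i).vert ((M.elem i).shape.opp f k) - (M.elem i).vert k)) :
    |t| ≤ κ / 2 := by
  obtain ⟨g, hc, hg⟩ := h.exists_corner_left
  obtain ⟨w, hwX, hwY⟩ := hF.surj 0 1
  -- The height of the corner triangle is at least `2 diam / κ`, and its lateral edge has horizontal
  -- extent at most `diam`; the quotient is `κ / 2`.
  have h1 := hc.width hκ (hreg i) (Z := Y) (w := w) (by rw [hF.sq, hwX, hwY]; norm_num) hwY
    (by rw [hg, map_sub, h.level, h.level', sub_self])
  have h2 := (Element.abs_sub_le_eDiam hF (M.elem i) ((M.elem i).shape.opp f k) k).1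
  have h3 := h.normal.pos h.mem_left
  rw [ht, abs_mul] at h2
  rw [abs_of_pos h3] at h1 h2
  refine le_of_mul_le_mul_right (h2.trans ?_) h3
  have h4 : 2 * (eDiam (M.elem i).body / κ) * (κ / 2) = eDiam (M.elem i).body := by
    field_simp
  rw [← h4, mul_comm (κ / 2)]
  exact mul_le_mul_of_nonneg_right h1 (by positivity)

lemma IsBottom.length_le (hF : IsFrame X Y) {i : Fin M.n} {f k l : Fin (M.elem i).shape.nv}
    (_h : M.IsBottom Γ X Y y₀ i f k l) :
    X ((M.elem i).vert l) ≤ X ((M.elem i).vert k) + M.size := by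
  have h1 := (le_abs_self _).trans (Element.abs_sub_le_eDiam hF (M.elem i) l k).1
  have h2 : eDiam (M.elem i).body ≤ M.size :=
    le_ciSup (f := fun i => eDiam (M.elem i).body) (Set.finite_range _).bddAbove i
  rw [map_sub] at h1
  linarith

/-- On sufficiently fine shape regular meshes the rotations in the kernel vanish. -/
theorem exists_size_kernel_eq_zero (hΩo : IsOpen Ω) (hΩc : IsConnected Ω)
    (hΩ : interior (closure Ω) = Ω) (Γ : BoundarySplit Ω) (hκ : 0 < κ) :
    ∃ h₀ : ℝ, 0 < h₀ ∧ ∀ M : Mesh Ω, M.ShapeRegular κ → M.Resolves Γ →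
      M.AtMostOneNeumannFacet Γ → M.size ≤ h₀ → ∀ (m : ℝ) (q : Fin M.n → ℝ) (u : Fin M.n → Pt 2)
        (γ : ∀ i, Fin (M.elem i).shape.nv → Mat 2), M.Kernel Γ m q u γ → ∀ i k, γ i k = 0 := by
  by_cases hex : ∃ M₀ : Mesh Ω, M₀.Resolves Γ
  swap
  · exact ⟨1, one_pos, fun M _ hM => absurd ⟨M, hM⟩ hex⟩
  -- The mesh `M₀` serves only to exhibit a straight Dirichlet segment with `Ω` on one side, which
  -- depends on `Ω` and `Γ` alone.
  obtain ⟨M₀, hM₀⟩ := hex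
  obtain ⟨i₀, f₀, hD⟩ := exists_dirichlet_facet le_rfl hΩo hΩ hM₀
  have hEΩ := M₀.body_subset_closure i₀
  have hEint := M₀.interior_body_subset hΩ i₀
  generalize M₀.elem i₀ = E at f₀ hD hEΩ hEint
  obtain ⟨k₀, l₀, hkl, hfac⟩ := Finset.card_eq_two.1 (E.shape.card_facet f₀)
  have hk₀ : k₀ ∈ E.shape.facet f₀ := by rw [hfac]; simp
  have hl₀ : l₀ ∈ E.shape.facet f₀ := by rw [hfac]; simp
  obtain ⟨ν, hν⟩ := E.exists_isNormal hk₀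
  obtain ⟨X, Y, hF, hXe, c, hc, rfl⟩ := IsFrame.exists_of_normal (ν := ν)
    (e := E.vert l₀ - E.vert k₀) (fun h0 => by have := hν.pos hk₀; simp [h0] at this)
    (sub_ne_zero.2 fun h0 => hkl (E.vert_injective h0).symm)
    (by rw [map_sub, hν.1 l₀ hl₀ k₀ hk₀, sub_self])
  have hνY := hν.smul hc
  set Y := c • ν
  rw [map_sub] at hXe
  set D := X (E.vert l₀) - X (E.vert k₀) with hDdef
  -- Slopes lie in an interval of length `κ` and grow by `2 / κ` per element, so `K` steps are too
  -- many as soon as `K > κ² / 2`.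
  obtain ⟨K, hK⟩ := exists_nat_gt (κ ^ 2 / 2)
  have hK3 : (0 : ℝ) < K + 3 := by positivity
  -- After `n` steps the right end is at most `n + 2` mesh sizes away from the left end of the
  -- segment, so `K` steps stay inside a segment of length `(K + 3) h`.
  refine ⟨D / (K + 3), div_pos hXe hK3, fun M hreg hM hN hsize m q u γ hker => ?_⟩
  set h := D / (K + 3) with hh
  have hh0 : 0 < h := div_pos hXe hK3
  have hhD : (K + 3) * h = D := mul_div_cancel₀ _ hK3.ne'
  by_cases hz : ∃ i k, γ i k 0 1 = 0
  · exact hker.eq_zero_of_exists_zero hΩo hΩc hM hN hz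
  exfalso
  push Not at hz
  have slope : ∀ {i f k l}, M.IsBottom Γ X Y (Y (E.vert k₀)) i f k l → ∃ t : ℝ,
      X ((M.elem i).vert ((M.elem i).shape.opp f k) - (M.elem i).vert k) =
        t * Y ((M.elem i).vert ((M.elem i).shape.opp f k) - (M.elem i).vert k) := fun hb =>
    ⟨_, (div_mul_cancel₀ _ (hb.normal.pos hb.mem_left).ne').symm⟩
  -- Induction along the consecutive Dirichlet edges of the segment, carrying the position of the
  -- right end and a lower bound of the slope.
  have main : ∀ n : ℕ, n ≤ K → ∃ i f k l, M.IsBottom Γ X Y (Y (E.vert k₀)) i f k l ∧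
      X (E.vert k₀) < X ((M.elem i).vert l) ∧
      X ((M.elem i).vert l) ≤ X (E.vert k₀) + (n + 2) * h ∧ ∃ t : ℝ,
      X ((M.elem i).vert ((M.elem i).shape.opp f k) - (M.elem i).vert k) =
        t * Y ((M.elem i).vert ((M.elem i).shape.opp f k) - (M.elem i).vert k) ∧
      -(κ / 2) + n * (2 / κ) ≤ t := by
    intro n
    induction n with
    | zero =>
      intro _
      have hKh : 0 ≤ (K : ℝ) * h := by positivity
      obtain ⟨i, f, k, l, hb, h1, h2⟩ := exists_isBottom hΩo hΩ hM hF hEΩ hνY hD hfac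
        (x := X (E.vert k₀) + h) (by linarith) (by linarith)
      obtain ⟨t, ht⟩ := slope hb
      have h3 := hb.length_le hF
      have h4 := hb.abs_slope_le hκ hreg hF ht
      refine ⟨i, f, k, l, hb, by linarith, ?_, t, ht, ?_⟩
      · push_cast; linarith
      · push_cast; linarith [neg_le_of_abs_le h4]
    | succ n ih =>
      intro hn
      obtain ⟨i, f, k, l, hb, h1, h2, t, ht, h3⟩ := ih (by omega)
      have hnK : (n : ℝ) + 1 ≤ K := by exact_mod_cast hn
      have h4 : X ((M.elem i).vert l) < X (E.vert l₀) := by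
        have := mul_le_mul_of_nonneg_right hnK hh0.le
        linarith
      obtain ⟨i', f', k', l', hb', h5, h6⟩ := exists_isBottom hΩo hΩ hM hF hEΩ hνY hD hfac
        h1.le h4
      have h7 := hb.le_left hF hb' h6
      have hlk : (M.elem i).vert l = (M.elem i').vert k' :=
        hF.ext (le_antisymm h7 h5) (hb.level'.trans hb'.level.symm)
      obtain ⟨t', ht'⟩ := slope hb'
      obtain ⟨y, hy, ey⟩ := Element.exists_isRelint_of_frame hF hfac (hνY.1 k₀ hk₀ l₀ hl₀)
        (p := (M.elem i).vert l) hb.level' h1 h4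
      obtain ⟨ε, hε, hball⟩ := hνY.exists_half_ball hy.1 hy.2.1 hy.2.2
      rw [ey] at hball
      have h8 := hker.exists_next hz hΩo hκ hreg hF hb hb' hlk
        ⟨ε, hε, fun z z1 z2 => hEint (hball z z1 z2)⟩ (hker.lateral hz hb ht) ht'
      have h9 := hb'.length_le hF
      refine ⟨i', f', k', l', hb', by linarith, ?_, t', ht', ?_⟩
      · push_cast; linarith
      · push_cast; linarith
  obtain ⟨i, f, k, l, hb, -, -, t, ht, h3⟩ := main K le_rfl
  have h4 := (le_abs_self t).trans (hb.abs_slope_le hκ hreg hF ht)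
  have h5 : (K : ℝ) * (2 / κ) ≤ κ := by linarith
  have h6 : (K : ℝ) * (2 / κ) * κ = 2 * K := by field_simp
  have h7 := mul_le_mul_of_nonneg_right h5 hκ.le
  nlinarith

end Mesh

/-! ### The discrete spaces as finite-dimensional vector spaces; continuity of rotations at
vertices. -/

lemma Shape.continuous_of_mem_rot {d : ℕ} (s : Shape d) {φ : Pt d → ℝ} (h : φ ∈ s.rot) :
    Continuous φ := by
  cases s with
  | simplex d =>
    obtain ⟨a, b, hab⟩ := exists_of_mem_P1 h
    rw [funext hab]
    fun_prop
  | quad =>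
    obtain ⟨a, b, c, e, hab⟩ := exists_of_mem_Q1 h
    rw [funext hab]
    fun_prop

namespace Element

variable {d : ℕ} (E : Element d)

/-- The rows of a matrix are transformed by the derivative of `F_E` at a vertex. -/
def rowDeriv (k : Fin E.shape.nv) : Mat d →ₗ[ℝ] Mat d where
  toFun T := Matrix.of fun r => fderiv ℝ E.map (E.shape.refVert k) (T r)
  map_add' S T := by
    ext r s
    exact congrFun (map_add (fderiv ℝ E.map (E.shape.refVert k)) (S r) (T r)) s
  map_smul' c T := by
    ext r s
    exact congrFun (map_smul (fderiv ℝ E.map (E.shape.refVert k)) c (T r)) s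

lemma fderiv_refVert_injective (k : Fin E.shape.nv) :
    Function.Injective (fderiv ℝ E.map (E.shape.refVert k)) := fun v w h => by
  have hr := E.shape.refVert_mem k
  rw [← E.fderivEquiv_apply hr, ← E.fderivEquiv_apply hr] at h
  exact (E.fderivEquiv hr).injective h

lemma piolaMat_vert (k : Fin E.shape.nv) (τ : Pt d → Mat d) :
    E.piolaMat τ (E.vert k) =
      (E.J (E.shape.refVert k))⁻¹ • E.rowDeriv k (τ (E.shape.refVert k)) := by
  ext r s
  exact congrFun (E.piola_vert k fun y => τ y r) s

lemma vert_mem_body (k : Fin E.shape.nv) : E.vert k ∈ E.body :=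
  ⟨_, E.shape.refVert_mem k, E.map_refVert k⟩

lemma push_of_mem_P0 {w : Pt d → ℝ} (hw : w ∈ P0 d) (x : Pt d) : E.push w x = w 0 := by
  obtain ⟨a, ha⟩ := exists_of_mem_P0 hw
  rw [push, ha, ha]

/-- Off a null set the divergence agrees with `dv / J`, which is continuous on the compact element.
-/
lemma integrableOn_divg_piola {ζ : Pt d → Pt d} (hζ : ζ ∈ E.shape.bdm) :
    IntegrableOn (divg (E.piola ζ)) E.body := by
  have h1 : ContinuousOn (E.push fun y => Shape.dv d ζ / E.J y) E.body :=
    (continuousOn_const.div E.continuous_J.continuousOn fun y hy => (E.J_pos hy).ne').comp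
      E.continuousOn_inv fun x hx => E.inv_mem hx
  refine (h1.integrableOn_compact E.isCompact_body).congr ?_
  rw [Filter.EventuallyEq, ae_restrict_iff' E.isCompact_body.measurableSet]
  have h2 : ∀ᵐ x : Pt d, x ∉ E.body \ E.inner := measure_eq_zero_iff_ae_notMem.1 E.volume_body_diff_inner
  filter_upwards [h2] with x hx hxb
  have hxi : x ∈ E.inner := by
    by_contra hn
    exact hx ⟨hxb, hn⟩
  obtain ⟨y, hy, rfl⟩ := hxi
  rw [E.push_map (E.shape.inner_subset hy), E.divg_piola hζ hy]

end Element

namespace Mesh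

variable {d : ℕ} {Ω : Set (Pt d)} (M : Mesh Ω)

lemma glue_add (ζ η : Fin M.n → Pt d → Pt d) : M.glue (ζ + η) = M.glue ζ + M.glue η := by
  funext x
  simp only [glue, Pi.add_apply, ← Finset.sum_add_distrib]
  refine Finset.sum_congr rfl fun i _ => ?_
  rw [Set.indicator_add']
  rfl

lemma glue_smul (c : ℝ) (ζ : Fin M.n → Pt d → Pt d) : M.glue (c • ζ) = c • M.glue ζ := by
  funext x
  simp only [glue, Pi.smul_apply, Finset.smul_sum]
  refine Finset.sum_congr rfl fun i _ => ?_
  exact Set.indicator_const_smul_apply _ c (ζ i) x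

lemma glue_zero : M.glue (0 : Fin M.n → Pt d → Pt d) = 0 := by
  funext x
  simp [glue]

/-- The velocity space as a submodule. -/
def velocity (Γ : BoundarySplit Ω) : Submodule ℝ (Fin M.n → Pt d → Pt d) where
  carrier := M.Zh Γ
  add_mem' {ζ η} h h' := by
    refine ⟨fun i => Submodule.add_mem _ (h.1 i) (h'.1 i), ?_⟩
    have : M.vecField (ζ + η) = M.vecField ζ + M.vecField η :=
      funext fun i => (M.elem i).piola_add (ζ i) (η i)
    rw [this, glue_add]
    exact h.2.add h'.2
  zero_mem' := by
    refine ⟨fun i => Submodule.zero_mem _, ?_⟩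
    have : M.vecField (0 : Fin M.n → Pt d → Pt d) = 0 := funext fun i => by
      have := (M.elem i).piola_smul 0 0
      rw [zero_smul, zero_smul] at this
      exact this
    rw [this, glue_zero]
    exact MemHdiv.zero
  smul_mem' c ζ h := by
    refine ⟨fun i => Submodule.smul_mem _ c (h.1 i), ?_⟩
    have : M.vecField (c • ζ) = c • M.vecField ζ := funext fun i => (M.elem i).piola_smul c (ζ i)
    rw [this, glue_smul]
    exact h.2.const_smul c

lemma mem_Xh_iff {Γ : BoundarySplit Ω} {τ : Fin M.n → Pt d → Mat d} :
    τ ∈ M.Xh Γ ↔ ∀ r, (fun i y => τ i y r) ∈ M.velocity Γ :=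
  ⟨fun h r => ⟨fun i => h.1 i r, h.2 r⟩, fun h => ⟨fun i r => (h r).1 i, fun r => (h r).2⟩⟩

/-- The stress space as a submodule. -/
def stress (Γ : BoundarySplit Ω) : Submodule ℝ (Fin M.n → Pt d → Mat d) where
  carrier := M.Xh Γ
  add_mem' h h' := M.mem_Xh_iff.2 fun r =>
    (M.velocity Γ).add_mem (M.mem_Xh_iff.1 h r) (M.mem_Xh_iff.1 h' r)
  zero_mem' := M.mem_Xh_iff.2 fun _ => (M.velocity Γ).zero_mem
  smul_mem' c _ h := M.mem_Xh_iff.2 fun r => (M.velocity Γ).smul_mem c (M.mem_Xh_iff.1 h r)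

/-- The displacement space as a submodule. -/
def displacement : Submodule ℝ (Fin M.n → Pt d → Pt d) where
  carrier := M.Vh
  add_mem' h h' i k := (P0 d).add_mem (h i k) (h' i k)
  zero_mem' _ _ := (P0 d).zero_mem
  smul_mem' c _ h i k := (P0 d).smul_mem c (h i k)

/-- The rotation space as a submodule. -/
def rotation : Submodule ℝ (Fin M.n → Pt d → Mat d) where
  carrier := M.Qh
  add_mem' {ξ η} h h' := by
    refine ⟨fun i k l => Submodule.add_mem _ (h.1 i k l) (h'.1 i k l), fun i y => ?_, ?_⟩
    · rw [Pi.add_apply, Pi.add_apply, Matrix.transpose_add, h.2.1, h'.2.1, neg_add]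
    · obtain ⟨g, hg, hgi⟩ := h.2.2
      obtain ⟨g', hg', hgi'⟩ := h'.2.2
      exact ⟨g + g', hg.add hg', fun i x hx => congrArg₂ (· + ·) (hgi i x hx) (hgi' i x hx)⟩
  zero_mem' := ⟨fun i k l => Submodule.zero_mem _, fun i y => by simp, 0, continuousOn_const,
    fun i x _ => rfl⟩
  smul_mem' c ξ h := by
    refine ⟨fun i k l => Submodule.smul_mem _ c (h.1 i k l), fun i y => ?_, ?_⟩
    · rw [Pi.smul_apply, Pi.smul_apply, Matrix.transpose_smul, h.2.1, smul_neg]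
    · obtain ⟨g, hg, hgi⟩ := h.2.2
      exact ⟨c • g, hg.const_smul c, fun i x hx => congrArg (c • ·) (hgi i x hx)⟩

/-- The pressure space as a submodule. -/
def pressure : Submodule ℝ (Fin M.n → Pt d → ℝ) where
  carrier := M.Wh
  add_mem' h h' i := (P0 d).add_mem (h i) (h' i)
  zero_mem' _ := (P0 d).zero_mem
  smul_mem' c _ h i := (P0 d).smul_mem c (h i)

/-- Evaluation at the vertices is injective by unisolvence. -/
instance (Γ : BoundarySplit Ω) : Module.Finite ℝ (M.velocity Γ) := by
  let ev : M.velocity Γ →ₗ[ℝ] ∀ i, Fin (M.elem i).shape.nv → Pt d :=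
    { toFun := fun ζ i k => ζ.1 i ((M.elem i).shape.refVert k)
      map_add' := fun _ _ => rfl
      map_smul' := fun _ _ => rfl }
  refine Module.Finite.of_injective ev ((injective_iff_map_eq_zero ev).2 fun ζ h => ?_)
  exact Subtype.ext (funext fun i => Shape.eq_zero_of_mem_bdm _ (ζ.2.1 i) fun k =>
    congrFun (congrFun h i) k)

instance (Γ : BoundarySplit Ω) : Module.Finite ℝ (M.stress Γ) := by
  let ev : M.stress Γ →ₗ[ℝ] ∀ i, Fin (M.elem i).shape.nv → Mat d :=
    { toFun := fun τ i k => τ.1 i ((M.elem i).shape.refVert k)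
      map_add' := fun _ _ => rfl
      map_smul' := fun _ _ => rfl }
  refine Module.Finite.of_injective ev ((injective_iff_map_eq_zero ev).2 fun τ h => ?_)
  refine Subtype.ext (funext fun i => funext fun y => funext fun r => ?_)
  exact congrFun (Shape.eq_zero_of_mem_bdm _ (τ.2.1 i r) fun k =>
    congrFun (congrFun (congrFun h i) k) r) y

instance : Module.Finite ℝ M.displacement := by
  let ev : M.displacement →ₗ[ℝ] Fin M.n → Pt d :=
    { toFun := fun v i => v.1 i 0
      map_add' := fun _ _ => rfl
      map_smul' := fun _ _ => rfl }
  refine Module.Finite.of_injective ev ((injective_iff_map_eq_zero ev).2 fun v h => ?_)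
  refine Subtype.ext (funext fun i => funext fun y => funext fun r => ?_)
  obtain ⟨a, ha⟩ := exists_of_mem_P0 (v.2 i r)
  exact (ha y).trans ((ha 0).symm.trans (congrFun (congrFun h i) r))

instance : Module.Finite ℝ M.rotation := by
  let ev : M.rotation →ₗ[ℝ] ∀ i, Fin (M.elem i).shape.nv → Mat d :=
    { toFun := fun ξ i k => ξ.1 i ((M.elem i).shape.refVert k)
      map_add' := fun _ _ => rfl
      map_smul' := fun _ _ => rfl }
  refine Module.Finite.of_injective ev ((injective_iff_map_eq_zero ev).2 fun ξ h => ?_)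
  refine Subtype.ext (funext fun i => funext fun y => funext fun r => funext fun s => ?_)
  exact congrFun (Shape.eq_zero_of_mem_rot _ (ξ.2.1 i r s) fun k =>
    congrFun (congrFun (congrFun (congrFun h i) k) r) s) y

instance : Module.Finite ℝ M.pressure := by
  let ev : M.pressure →ₗ[ℝ] Fin M.n → ℝ :=
    { toFun := fun v i => v.1 i 0
      map_add' := fun _ _ => rfl
      map_smul' := fun _ _ => rfl }
  refine Module.Finite.of_injective ev ((injective_iff_map_eq_zero ev).2 fun v h => ?_)
  refine Subtype.ext (funext fun i => funext fun y => ?_)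
  obtain ⟨a, ha⟩ := exists_of_mem_P0 (v.2 i)
  exact (ha y).trans ((ha 0).symm.trans (congrFun h i))

variable {M}

/-- Products of vectors with scalar-valued test functions of `Z_h` type are stresses. -/
lemma outer_mem_Xh {Γ : BoundarySplit Ω} {ψ : Fin M.n → Pt d → Pt d} (hψ : ψ ∈ M.Zh Γ)
    (c : Pt d) : (fun i y => Matrix.of fun r => c r • ψ i y) ∈ M.Xh Γ :=
  M.mem_Xh_iff.2 fun r => (M.velocity Γ).smul_mem (c r) hψ

/-- The values of a continuous rotation at a common vertex agree. -/
lemma Shared.rotation_eq (hd : 0 < d) (hΩ : interior (closure Ω) = Ω)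
    {ξ : Fin M.n → Pt d → Mat d} (hξ : ξ ∈ M.Qh) {i j : Fin M.n} {f f'}
    (h : M.Shared i f j f') {k} (hk : k ∈ (M.elem i).shape.facet f) {l}
    (hkl : (M.elem i).vert k = (M.elem j).vert l) :
    ξ i ((M.elem i).shape.refVert k) = ξ j ((M.elem j).shape.refVert l) := by
  obtain ⟨g, -, hg⟩ := hξ.2.2
  have hcont : ∀ i, Continuous (ξ i) := fun i =>
    continuous_matrix fun r s => Shape.continuous_of_mem_rot _ (hξ.1 i r s)
  have hd' : (0 : ℝ) < d := Nat.cast_pos.2 hd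
  set V := M.verts i f
  set v := (M.elem i).vert k with hv
  have hvV : v ∈ V := by
    rw [← Finset.mem_coe, coe_verts]
    exact ⟨k, hk, rfl⟩
  set b := ∑ p ∈ V, (d : ℝ)⁻¹ • p with hb
  -- The common vertex may lie on the boundary of `Ω`, where continuity is not prescribed. It is
  -- approached through the relative interior of the shared facet, which belongs to `Ω`, and both
  -- elementwise functions are continuous up to the vertex.
  let x : ℝ → Pt d := fun ε => (1 - ε) • v + ε • b
  have hx : ∀ ε, 0 < ε → ε < 1 → x ε ∈ Ω ∧ x ε ∈ (M.elem i).body ∧ x ε ∈ (M.elem j).body := by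
    intro ε h0 h1
    classical
    let w : Pt d → ℝ := fun p => (if p = v then 1 - ε else 0) + ε * (d : ℝ)⁻¹
    have hw0 : ∀ p ∈ V, 0 < w p := fun p _ => by
      have : 0 < ε * (d : ℝ)⁻¹ := by positivity
      simp only [w]
      split_ifs <;> linarith
    have hw1 : ∑ p ∈ V, w p = 1 := by
      simp only [w, Finset.sum_add_distrib, Finset.sum_ite_eq', if_pos hvV, Finset.sum_const,
        nsmul_eq_mul, V, card_verts]
      field_simp
      ring
    have hwx : ∑ p ∈ V, w p • p = x ε := by
      simp only [w, add_smul, Finset.sum_add_distrib, ite_smul, zero_smul, Finset.sum_ite_eq',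
        if_pos hvV, mul_smul, ← Finset.smul_sum]
      rfl
    have hmem : x ε ∈ (M.elem i).hull ((M.elem i).shape.facet f) := by
      rw [← hwx, Element.hull, ← coe_verts]
      exact (convex_convexHull ℝ _).sum_mem (fun p hp => (hw0 p hp).le) hw1
        fun p hp => subset_convexHull ℝ _ hp
    rw [← h.inter_eq] at hmem
    exact ⟨hwx ▸ h.mem_of_weights hd hΩ hw0 hw1, hmem⟩
  have hlim : Filter.Tendsto x (nhdsWithin 0 (Set.Ioi 0)) (nhds v) := by
    have h1 : Filter.Tendsto x (nhds 0) (nhds (x 0)) := Continuous.tendsto (by fun_prop) 0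
    have h2 : x 0 = v := by simp [x]
    rw [h2] at h1
    exact h1.mono_left nhdsWithin_le_nhds
  have hev : ∀ᶠ ε : ℝ in nhdsWithin 0 (Set.Ioi 0), 0 < ε ∧ ε < 1 :=
    Filter.Eventually.and self_mem_nhdsWithin (nhdsWithin_le_nhds (gt_mem_nhds one_pos))
  have hvi : v ∈ (M.elem i).body := (M.elem i).vert_mem_body k
  have hvj : v ∈ (M.elem j).body := hkl ▸ (M.elem j).vert_mem_body l
  have ti : Filter.Tendsto (fun ε => (M.elem i).push (ξ i) (x ε)) (nhdsWithin 0 (Set.Ioi 0))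
      (nhds ((M.elem i).push (ξ i) v)) :=
    ((M.elem i).continuousOn_push (hcont i) v hvi).tendsto.comp
      (tendsto_nhdsWithin_iff.2 ⟨hlim, hev.mono fun ε hε => (hx ε hε.1 hε.2).2.1⟩)
  have tj : Filter.Tendsto (fun ε => (M.elem j).push (ξ j) (x ε)) (nhdsWithin 0 (Set.Ioi 0))
      (nhds ((M.elem j).push (ξ j) v)) :=
    ((M.elem j).continuousOn_push (hcont j) v hvj).tendsto.comp
      (tendsto_nhdsWithin_iff.2 ⟨hlim, hev.mono fun ε hε => (hx ε hε.1 hε.2).2.2⟩)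
  have heq : (fun ε => (M.elem i).push (ξ i) (x ε)) =ᶠ[nhdsWithin 0 (Set.Ioi 0)]
      fun ε => (M.elem j).push (ξ j) (x ε) := by
    filter_upwards [hev] with ε hε
    obtain ⟨h1, h2, h3⟩ := hx ε hε.1 hε.2
    exact (hg i _ ⟨h2, h1⟩).trans (hg j _ ⟨h3, h1⟩).symm
  have := tendsto_nhds_unique (ti.congr' heq) tj
  rw [(M.elem i).push_vert, hkl, (M.elem j).push_vert] at this
  exact this

end Mesh

/-! ### Quadrature and exact integrals in terms of vertex values and fluxes. -/

section Frob

variable {d : ℕ}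

/-- The inner product of matrices as a bilinear form. -/
def frobB : Mat d →ₗ[ℝ] Mat d →ₗ[ℝ] ℝ :=
  LinearMap.mk₂ ℝ frob
    (fun σ σ' τ => by simp [frob, add_mul, Finset.sum_add_distrib])
    (fun c σ τ => by simp [frob, mul_assoc, Finset.mul_sum])
    (fun σ τ τ' => by simp [frob, mul_add, Finset.sum_add_distrib])
    (fun c σ τ => by simp [frob, mul_left_comm, Finset.mul_sum])

@[simp] lemma frobB_apply (σ τ : Mat d) : frobB σ τ = frob σ τ := rfl

lemma frob_smul_right (c : ℝ) (σ τ : Mat d) : frob σ (c • τ) = c * frob σ τ :=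
  (frobB σ).map_smul c τ

lemma frob_smul_left (c : ℝ) (σ τ : Mat d) : frob (c • σ) τ = c * frob σ τ :=
  LinearMap.map_smul₂ frobB c σ τ

lemma frob_add_right (σ τ τ' : Mat d) : frob σ (τ + τ') = frob σ τ + frob σ τ' :=
  (frobB σ).map_add τ τ'

lemma frob_sub_left (σ σ' τ : Mat d) : frob (σ - σ') τ = frob σ τ - frob σ' τ :=
  LinearMap.map_sub₂ frobB σ σ' τ

lemma frob_outer (G : Mat d) (c v : Pt d) :
    frob G (Matrix.of fun r => c r • v) = c ⬝ᵥ G.mulVec v := by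
  simp only [frob, dotProduct, Matrix.mulVec, Matrix.of_apply, Pi.smul_apply, smul_eq_mul,
    Finset.mul_sum]
  exact Finset.sum_congr rfl fun i _ => Finset.sum_congr rfl fun j _ => by ring

end Frob

namespace Mesh

variable {d : ℕ} {Ω : Set (Pt d)} (M : Mesh Ω)

/-- Weight of the vertex quadrature rule. -/
def weight (i : Fin M.n) : ℝ := volume.real (M.elem i).shape.ref / (M.elem i).shape.nv

lemma weight_pos (i : Fin M.n) : 0 < M.weight i :=
  div_pos (Shape.volume_real_ref_pos _) (Nat.cast_pos.2 (Shape.nv_pos _))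

/-- Value of a stress at a vertex, up to the factor `J_E`. -/
def stressAt (i : Fin M.n) (k : Fin (M.elem i).shape.nv) :
    (Fin M.n → Pt d → Mat d) →ₗ[ℝ] Mat d :=
  (M.elem i).rowDeriv k ∘ₗ LinearMap.proj ((M.elem i).shape.refVert k) ∘ₗ LinearMap.proj i

/-- Value of a velocity at a vertex, up to the factor `J_E`. -/
def velocityAt (i : Fin M.n) (k : Fin (M.elem i).shape.nv) :
    (Fin M.n → Pt d → Pt d) →ₗ[ℝ] Pt d :=
  (fderiv ℝ (M.elem i).map ((M.elem i).shape.refVert k)).toLinearMap ∘ₗ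
    LinearMap.proj ((M.elem i).shape.refVert k) ∘ₗ LinearMap.proj i

/-- Value of a rotation at a vertex. -/
def rotationAt (i : Fin M.n) (k : Fin (M.elem i).shape.nv) :
    (Fin M.n → Pt d → Mat d) →ₗ[ℝ] Mat d :=
  LinearMap.proj ((M.elem i).shape.refVert k) ∘ₗ LinearMap.proj i

/-- Value of a piecewise constant function. -/
def valueAt {F : Type} [AddCommGroup F] [Module ℝ F] (i : Fin M.n) :
    (Fin M.n → Pt d → F) →ₗ[ℝ] F :=
  LinearMap.proj (0 : Pt d) ∘ₗ LinearMap.proj i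

/-- Integral of the divergence of a velocity over an element. -/
def flux (i : Fin M.n) : (Fin M.n → Pt d → Pt d) →ₗ[ℝ] ℝ :=
  volume.real (M.elem i).shape.ref • (Shape.dv d ∘ₗ LinearMap.proj i)

/-- Integral of the divergence of a stress over an element. -/
def stressFlux (i : Fin M.n) : (Fin M.n → Pt d → Mat d) →ₗ[ℝ] Pt d :=
  LinearMap.pi fun r => M.flux i ∘ₗ
    { toFun := fun τ i y => τ i y r
      map_add' := fun _ _ => rfl
      map_smul' := fun _ _ => rfl }

lemma stressFlux_apply (i : Fin M.n) (τ : Fin M.n → Pt d → Mat d) (r : Fin d) :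
    M.stressFlux i τ r = M.flux i fun i y => τ i y r := rfl

lemma matField_vert (τ : Fin M.n → Pt d → Mat d) (i : Fin M.n) (k : Fin (M.elem i).shape.nv) :
    M.matField τ i ((M.elem i).vert k) =
      ((M.elem i).J ((M.elem i).shape.refVert k))⁻¹ • M.stressAt i k τ :=
  (M.elem i).piolaMat_vert k (τ i)

lemma vecField_vert (ζ : Fin M.n → Pt d → Pt d) (i : Fin M.n) (k : Fin (M.elem i).shape.nv) :
    M.vecField ζ i ((M.elem i).vert k) =
      ((M.elem i).J ((M.elem i).shape.refVert k))⁻¹ • M.velocityAt i k ζ :=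
  (M.elem i).piola_vert k (ζ i)

/-- The factor `J⁻¹` of the Piola transformation cancels the Jacobian in the quadrature rule.
Pairings of a stress with another field thus carry only the weight of the reference element. -/
lemma quadr_matField (φ : Fin M.n → Pt d → Mat d) (τ : Fin M.n → Pt d → Mat d) :
    M.quadr frob φ (M.matField τ) = ∑ i, M.weight i *
      ∑ k, frob (φ i ((M.elem i).vert k)) (M.stressAt i k τ) := by
  refine Finset.sum_congr rfl fun i _ => congrArg _ (Finset.sum_congr rfl fun k _ => ?_)
  have hJ := (M.elem i).J_pos ((M.elem i).shape.refVert_mem k)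
  rw [matField_vert, frob_smul_right, mul_right_comm, inv_mul_cancel₀ hJ.ne', one_mul]

lemma quadr_matField_funField (σ ξ : Fin M.n → Pt d → Mat d) :
    M.quadr frob (M.matField σ) (M.funField ξ) = ∑ i, M.weight i *
      ∑ k, frob (M.stressAt i k σ) (M.rotationAt i k ξ) := by
  refine Finset.sum_congr rfl fun i _ => congrArg _ (Finset.sum_congr rfl fun k _ => ?_)
  have hJ := (M.elem i).J_pos ((M.elem i).shape.refVert_mem k)
  rw [matField_vert, frob_smul_left, mul_right_comm, inv_mul_cancel₀ hJ.ne', one_mul]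
  rw [show M.funField ξ i ((M.elem i).vert k) = M.rotationAt i k ξ from (M.elem i).push_vert k _]

lemma quadr_vecField (φ ζ : Fin M.n → Pt d → Pt d) :
    M.quadr (fun a b => a ⬝ᵥ b) φ (M.vecField ζ) = ∑ i, M.weight i *
      ∑ k, φ i ((M.elem i).vert k) ⬝ᵥ M.velocityAt i k ζ := by
  refine Finset.sum_congr rfl fun i _ => congrArg _ (Finset.sum_congr rfl fun k _ => ?_)
  have hJ := (M.elem i).J_pos ((M.elem i).shape.refVert_mem k)
  simp only [vecField_vert, dotProduct_smul, smul_eq_mul]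
  rw [mul_right_comm, inv_mul_cancel₀ hJ.ne', one_mul]

variable {M}

lemma funField_vector {v : Fin M.n → Pt d → Pt d} (hv : v ∈ M.Vh) (i : Fin M.n) (x : Pt d) :
    M.funField v i x = M.valueAt i v :=
  funext fun r => (M.elem i).push_of_mem_P0 (hv i r) x

lemma funField_scalar {w : Fin M.n → Pt d → ℝ} (hw : w ∈ M.Wh) (i : Fin M.n) (x : Pt d) :
    M.funField w i x = M.valueAt i w :=
  (M.elem i).push_of_mem_P0 (hw i) x

lemma integral_divg {Γ : BoundarySplit Ω} {ζ : Fin M.n → Pt d → Pt d} (hζ : ζ ∈ M.Zh Γ)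
    (i : Fin M.n) : ∫ x in (M.elem i).body, divg (M.vecField ζ i) x = M.flux i ζ := by
  rw [vecField, (M.elem i).integral_divg_piola (hζ.1 i), mul_comm]
  rfl

lemma l2_divg {Γ : BoundarySplit Ω} {ζ : Fin M.n → Pt d → Pt d} (hζ : ζ ∈ M.Zh Γ)
    {w : Fin M.n → Pt d → ℝ} (hw : w ∈ M.Wh) :
    M.l2 (M.funField w) (fun i => divg (M.vecField ζ i)) =
      ∑ i, M.valueAt i w * M.flux i ζ := by
  refine Finset.sum_congr rfl fun i _ => ?_
  simp only [funField_scalar hw]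
  rw [integral_const_mul, integral_divg hζ]

lemma l2v_divRow {Γ : BoundarySplit Ω} {τ : Fin M.n → Pt d → Mat d} (hτ : τ ∈ M.Xh Γ)
    {v : Fin M.n → Pt d → Pt d} (hv : v ∈ M.Vh) :
    M.l2v (M.funField v) (fun i => divRow (M.matField τ i)) =
      ∑ i, M.valueAt i v ⬝ᵥ M.stressFlux i τ := by
  refine Finset.sum_congr rfl fun i _ => ?_
  simp only [funField_vector hv, dotProduct]
  rw [integral_finsetSum]
  · refine Finset.sum_congr rfl fun r _ => ?_
    rw [integral_const_mul, stressFlux_apply, ← integral_divg (M.mem_Xh_iff.1 hτ r)]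
    rfl
  · intro r _
    exact ((M.elem i).integrableOn_divg_piola (hτ.1 i r)).const_mul _

lemma l2_comm (φ ψ : Fin M.n → Pt d → ℝ) : M.l2 φ ψ = M.l2 ψ φ := by
  simp only [l2, mul_comm]

lemma l2v_comm (φ ψ : Fin M.n → Pt d → Pt d) : M.l2v φ ψ = M.l2v ψ φ := by
  simp only [l2v, dotProduct_comm]

/-- A closed element may reach beyond `Ω`, but its interior lies in `Ω` and the rest is null. -/
lemma integrableOn_body (hΩ : interior (closure Ω) = Ω) {g : Pt d → ℝ}
    (hg : MemLp g 2 (volume.restrict Ω)) (i : Fin M.n) : IntegrableOn g (M.elem i).body := by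
  have h1 : MemLp g 2 (volume.restrict (interior (M.elem i).body)) :=
    hg.mono_measure (Measure.restrict_mono (M.interior_body_subset hΩ i) le_rfl)
  have h2 : volume (M.elem i).body < ⊤ := (M.elem i).isCompact_body.measure_lt_top
  have : IsFiniteMeasure (volume.restrict (interior (M.elem i).body)) :=
    ⟨by rw [Measure.restrict_apply_univ]; exact (measure_mono interior_subset).trans_lt h2⟩
  have h3 : IntegrableOn g (interior (M.elem i).body) := h1.integrable (by norm_num)
  refine h3.congr_set_ae ?_
  exact ae_eq_set.2 ⟨(M.elem i).volume_body_diff_interior,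
    by simp [Set.sdiff_eq_empty.2 (interior_subset (s := (M.elem i).body))]⟩

lemma l2v_source (hΩ : interior (closure Ω) = Ω) {f : Pt d → Pt d}
    (hf : MemLp f 2 (volume.restrict Ω)) {v : Fin M.n → Pt d → Pt d} (hv : v ∈ M.Vh) :
    M.l2v (fun _ => f) (M.funField v) =
      ∑ i, (fun r => ∫ x in (M.elem i).body, f x r) ⬝ᵥ M.valueAt i v := by
  refine Finset.sum_congr rfl fun i _ => ?_
  simp only [funField_vector hv, dotProduct]
  rw [integral_finsetSum]
  · exact Finset.sum_congr rfl fun r _ => integral_mul_const _ _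
  · intro r _
    exact (integrableOn_body hΩ (memLp_apply hf r) i).mul_const _

lemma l2_source (q : Pt d → ℝ) {w : Fin M.n → Pt d → ℝ} (hw : w ∈ M.Wh) :
    M.l2 (fun _ => q) (M.funField w) = ∑ i, (∫ x in (M.elem i).body, q x) * M.valueAt i w := by
  refine Finset.sum_congr rfl fun i _ => ?_
  simp only [funField_scalar hw]
  rw [integral_mul_const]

/-! ### Testing with corner functions. -/

section Relations

variable {n : ℕ} {Ω : Set (Pt (n + 1))} {M : Mesh Ω}

lemma flux_single_corner {i : Fin M.n} {f k} (hk : k ∈ (M.elem i).shape.facet f) (j : Fin M.n) :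
    M.flux j (Pi.single i ((M.elem i).shape.corner f k)) = if j = i then -cornerMass n else 0 := by
  change volume.real (M.elem j).shape.ref * Shape.dv (n + 1)
    ((Pi.single i ((M.elem i).shape.corner f k) : Fin M.n → Pt (n + 1) → Pt (n + 1)) j) = _
  split_ifs with h
  · subst h
    rw [Pi.single_eq_same, mul_comm, (M.elem j).dv_corner hk]
  · rw [Pi.single_eq_of_ne h, map_zero, mul_zero]

lemma velocityAt_single_corner_ne {i j : Fin M.n} (h : j ≠ i) (f k l) :
    M.velocityAt j l (Pi.single i ((M.elem i).shape.corner f k)) = 0 := by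
  change fderiv ℝ (M.elem j).map _
    ((Pi.single i ((M.elem i).shape.corner f k) : Fin M.n → Pt (n + 1) → Pt (n + 1)) j _) = 0
  rw [Pi.single_eq_of_ne h, Pi.zero_apply, map_zero]

lemma velocityAt_single_corner {i : Fin M.n} {f k} (hk : k ∈ (M.elem i).shape.facet f) (l) :
    M.velocityAt i l (Pi.single i ((M.elem i).shape.corner f k)) =
      if l = k then (M.elem i).vert ((M.elem i).shape.opp f k) - (M.elem i).vert k else 0 := by
  change fderiv ℝ (M.elem i).map _
    ((Pi.single i ((M.elem i).shape.corner f k) : Fin M.n → Pt (n + 1) → Pt (n + 1)) i _) = _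
  rw [Pi.single_eq_same, Shape.corner_refVert _ hk]
  split_ifs with h
  · subst h
    exact (M.elem i).fderiv_opp hk
  · exact map_zero _

/-- A solution of the homogeneous first equation with vanishing strain satisfies the relations
which characterize the kernel. -/
theorem kernel_of_equation (hΩ : interior (closure Ω) = Ω) {Γ : BoundarySplit Ω}
    {u : Fin M.n → Pt (n + 1) → Pt (n + 1)} {γ : Fin M.n → Pt (n + 1) → Mat (n + 1)}
    (hγ : γ ∈ M.Qh)
    (h : ∀ τ ∈ M.Xh Γ, ∑ i, M.valueAt i u ⬝ᵥ M.stressFlux i τ + ∑ i, M.weight i *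
      ∑ k, frob (M.rotationAt i k γ) (M.stressAt i k τ) = 0) :
    M.Kernel Γ (cornerMass n) M.weight (fun i => M.valueAt i u) (fun i k => M.rotationAt i k γ) := by
  -- Testing with the stress `c ⊗ ψ` gives `c · L ψ`. As `c` is arbitrary, the matrix-valued problem
  -- becomes the vector equation `L ψ = 0` for scalar-type test functions `ψ`.
  let L : (Fin M.n → Pt (n + 1) → Pt (n + 1)) → Pt (n + 1) := fun ψ =>
    ∑ i, (M.flux i ψ • M.valueAt i u + M.weight i •
      ∑ k, (M.rotationAt i k γ).mulVec (M.velocityAt i k ψ))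
  have hL : ∀ ψ ∈ M.Zh Γ, L ψ = 0 := by
    intro ψ hψ
    have key : ∀ c, c ⬝ᵥ L ψ = 0 := by
      intro c
      rw [← h _ (outer_mem_Xh hψ c), ← Finset.sum_add_distrib]
      simp only [L, dotProduct_sum, dotProduct_add, dotProduct_smul, smul_eq_mul]
      refine Finset.sum_congr rfl fun i _ => congrArg₂ (· + ·) ?_ ?_
      · rw [dotProduct_comm]
        simp only [dotProduct, Finset.mul_sum]
        refine Finset.sum_congr rfl fun r _ => ?_
        have : M.stressFlux i (fun i y => Matrix.of fun r => c r • ψ i y) r = c r * M.flux i ψ :=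
          (M.flux i).map_smul (c r) ψ
        rw [this]; ring
      · congr 1
        refine Finset.sum_congr rfl fun k _ => ?_
        rw [← frob_outer]
        congr 1
        ext r s
        exact (congrFun ((M.velocityAt i k).map_smul (c r) ψ) s).symm
    funext r
    have := key (Pi.single r 1)
    rwa [single_dotProduct, one_mul] at this
  have hsingle : ∀ {i f k}, k ∈ (M.elem i).shape.facet f →
      L (Pi.single i ((M.elem i).shape.corner f k)) = -(cornerMass n • M.valueAt i u) +
        M.weight i • (M.rotationAt i k γ).mulVec
          ((M.elem i).vert ((M.elem i).shape.opp f k) - (M.elem i).vert k) := by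
    intro i f k hk
    simp only [L]
    rw [Finset.sum_eq_single i]
    · rw [flux_single_corner hk, if_pos rfl, neg_smul, Finset.sum_eq_single k]
      · rw [velocityAt_single_corner hk, if_pos rfl]
      · intro l _ hl
        rw [velocityAt_single_corner hk, if_neg hl, Matrix.mulVec_zero]
      · simp
    · intro j _ hj
      rw [flux_single_corner hk, if_neg hj, zero_smul, zero_add]
      simp only [velocityAt_single_corner_ne hj, Matrix.mulVec_zero, Finset.sum_const_zero,
        smul_zero]
    · simp
  have hsub : ∀ ψ ψ', L (ψ - ψ') = L ψ - L ψ' := by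
    intro ψ ψ'
    simp only [L, map_sub, Matrix.mulVec_sub, Finset.sum_sub_distrib, smul_sub, sub_smul,
      Finset.sum_add_distrib]
    abel
  refine ⟨cornerMass_pos, M.weight_pos, fun i k => hγ.2.1 i _, ?_, ?_, ?_⟩
  · intro i f j f' hs k hk l _ hkl
    exact hs.rotation_eq n.succ_pos hΩ hγ hk hkl
  · intro i f hf k hk
    have h1 := hL _ (M.corner_mem_Zh hΩ Γ hk hf)
    rw [hsingle hk, neg_add_eq_zero] at h1
    exact h1
  · intro i f j f' hs k hk l hl hkl
    have h1 := hL _ (hs.corner_sub_mem_Zh hΩ Γ hk hl hkl)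
    have hγ' : M.rotationAt i k γ = M.rotationAt j l γ := hs.rotation_eq n.succ_pos hΩ hγ hk hkl
    rw [hsub, hsingle hk, hsingle hl, ← hγ'] at h1
    rw [Matrix.mulVec_sub, Matrix.mulVec_smul, Matrix.mulVec_smul, smul_sub, ← sub_eq_zero, ← h1]
    abel

/-- The discrete divergence is onto. -/
theorem pressure_eq_zero (hn : 1 ≤ n) (hΩo : IsOpen Ω) (hΩc : IsConnected Ω)
    (hΩ : interior (closure Ω) = Ω) {Γ : BoundarySplit Ω} (hM : M.Resolves Γ) {p : Fin M.n → ℝ}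
    (h : ∀ ζ ∈ M.Zh Γ, ∑ i, p i * M.flux i ζ = 0) (i : Fin M.n) : p i = 0 := by
  have hm := cornerMass_pos (n := n)
  have hsum : ∀ {i f k}, k ∈ (M.elem i).shape.facet f →
      ∑ j, p j * M.flux j (Pi.single i ((M.elem i).shape.corner f k)) = -(p i * cornerMass n) := by
    intro i f k hk
    simp only [flux_single_corner hk, mul_ite, mul_zero, mul_neg, Finset.sum_ite_eq',
      Finset.mem_univ, if_true]
  obtain ⟨i₀, f₀, hf₀⟩ := exists_dirichlet_facet (by omega) hΩo hΩ hM
  -- The difference of two corner functions has opposite fluxes in the two neighbours and none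
  -- elsewhere, so `p` is the same on both. A corner function of a Dirichlet facet has flux in one
  -- element only, where `p` must vanish.
  refine shared_induction n.succ_pos hΩo hΩc (P := fun i => p i = 0) ?_ (i₀ := i₀) ?_ i
  · intro i f j f' hs hi
    obtain ⟨k, hk⟩ := facet_nonempty n.succ_pos (M.elem i).shape f
    obtain ⟨l, hl, hkl⟩ := hs.exists_vert hk
    have h1 := h _ (hs.corner_sub_mem_Zh hΩ Γ hk hl hkl)
    simp only [map_sub, mul_sub, Finset.sum_sub_distrib] at h1
    rw [hsum hk, hsum hl, hi] at h1
    have h2 : p j * cornerMass n = 0 := by linarith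
    exact (mul_eq_zero.1 h2).resolve_right hm.ne'
  · obtain ⟨k, hk⟩ := facet_nonempty n.succ_pos (M.elem i₀).shape f₀
    have h1 := h _ (M.corner_mem_Zh hΩ Γ hk hf₀)
    rw [hsum hk, neg_eq_zero] at h1
    exact (mul_eq_zero.1 h1).resolve_right hm.ne'

end Relations

end Mesh

/-! ### One time step as a linear system. -/

namespace Mesh

variable {d : ℕ} {Ω : Set (Pt d)} (M : Mesh Ω)

/-- Tuples of families of reference functions. -/
abbrev Tuple : Type := (Fin M.n → Pt d → Mat d) × (Fin M.n → Pt d → Pt d) ×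
  (Fin M.n → Pt d → Mat d) × (Fin M.n → Pt d → Pt d) × (Fin M.n → Pt d → ℝ)

variable {M}

def State.toTuple (s : M.State) : M.Tuple := (s.σ, s.u, s.γ, s.z, s.p)

def stressPart : M.Tuple →ₗ[ℝ] Fin M.n → Pt d → Mat d := LinearMap.fst _ _ _
def displacementPart : M.Tuple →ₗ[ℝ] Fin M.n → Pt d → Pt d :=
  LinearMap.fst _ _ _ ∘ₗ LinearMap.snd _ _ _
def rotationPart : M.Tuple →ₗ[ℝ] Fin M.n → Pt d → Mat d :=
  LinearMap.fst _ _ _ ∘ₗ LinearMap.snd _ _ _ ∘ₗ LinearMap.snd _ _ _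
def velocityPart : M.Tuple →ₗ[ℝ] Fin M.n → Pt d → Pt d :=
  LinearMap.fst _ _ _ ∘ₗ LinearMap.snd _ _ _ ∘ₗ LinearMap.snd _ _ _ ∘ₗ LinearMap.snd _ _ _
def pressurePart : M.Tuple →ₗ[ℝ] Fin M.n → Pt d → ℝ :=
  LinearMap.snd _ _ _ ∘ₗ LinearMap.snd _ _ _ ∘ₗ LinearMap.snd _ _ _ ∘ₗ LinearMap.snd _ _ _

namespace Material

variable (D : M.Material)

/-- Value of `σ_h + α p_h I` at a vertex. -/
def loadAt (i : Fin M.n) (k : Fin (M.elem i).shape.nv) : M.Tuple →ₗ[ℝ] Mat d :=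
  ((M.elem i).J ((M.elem i).shape.refVert k))⁻¹ • M.stressAt i k ∘ₗ stressPart +
    (D.α • LinearMap.toSpanSingleton ℝ (Mat d) 1) ∘ₗ M.valueAt i ∘ₗ pressurePart

/-- Value of `A (σ_h + α p_h I)` at a vertex. -/
def strainAt (i : Fin M.n) (k : Fin (M.elem i).shape.nv) : M.Tuple →ₗ[ℝ] Mat d :=
  D.A i ((M.elem i).vert k) ∘ₗ D.loadAt i k

lemma loadAt_apply (i : Fin M.n) (k : Fin (M.elem i).shape.nv) (s : M.Tuple) :
    D.loadAt i k s = ((M.elem i).J ((M.elem i).shape.refVert k))⁻¹ •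
      M.stressAt i k (stressPart s) + (D.α * M.valueAt i (pressurePart s)) • (1 : Mat d) := by
  simp [loadAt, mul_smul]

lemma strain_vert {s : M.State} (hp : s.p ∈ M.Wh) (i : Fin M.n) (k : Fin (M.elem i).shape.nv) :
    D.strain s i ((M.elem i).vert k) = D.strainAt i k s.toTuple := by
  rw [strain, matField_vert, funField_scalar hp]
  exact congrArg _ (D.loadAt_apply i k s.toTuple).symm

/-- The first equation. -/
def constitutiveForm : M.Tuple →ₗ[ℝ] (Fin M.n → Pt d → Mat d) →ₗ[ℝ] ℝ :=
  ∑ i, M.weight i • ∑ k, frobB.compl₁₂ (D.strainAt i k) (M.stressAt i k) +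
  ∑ i, (dotProductBilin ℝ ℝ).compl₁₂ (M.valueAt i ∘ₗ displacementPart) (M.stressFlux i) +
  ∑ i, M.weight i • ∑ k, frobB.compl₁₂ (M.rotationAt i k ∘ₗ rotationPart) (M.stressAt i k)

lemma constitutiveForm_apply (s : M.Tuple) (τ : Fin M.n → Pt d → Mat d) :
    D.constitutiveForm s τ = ∑ i, M.weight i * ∑ k, frob (D.strainAt i k s) (M.stressAt i k τ) +
      ∑ i, M.valueAt i (displacementPart s) ⬝ᵥ M.stressFlux i τ +
      ∑ i, M.weight i * ∑ k, frob (M.rotationAt i k (rotationPart s)) (M.stressAt i k τ) := by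
  simp [constitutiveForm, LinearMap.sum_apply]

end Material

/-- The second equation. -/
def momentumForm : M.Tuple →ₗ[ℝ] (Fin M.n → Pt d → Pt d) →ₗ[ℝ] ℝ :=
  -∑ i, (dotProductBilin ℝ ℝ).compl₁₂ (M.stressFlux i ∘ₗ stressPart) (M.valueAt i)

lemma momentumForm_apply (s : M.Tuple) (v : Fin M.n → Pt d → Pt d) :
    momentumForm s v = -∑ i, M.stressFlux i (stressPart s) ⬝ᵥ M.valueAt i v := by
  simp [momentumForm, LinearMap.sum_apply]

/-- The third equation. -/
def symmetryForm : M.Tuple →ₗ[ℝ] (Fin M.n → Pt d → Mat d) →ₗ[ℝ] ℝ :=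
  ∑ i, M.weight i • ∑ k, frobB.compl₁₂ (M.stressAt i k ∘ₗ stressPart) (M.rotationAt i k)

lemma symmetryForm_apply (s : M.Tuple) (ξ : Fin M.n → Pt d → Mat d) :
    symmetryForm s ξ = ∑ i, M.weight i *
      ∑ k, frob (M.stressAt i k (stressPart s)) (M.rotationAt i k ξ) := by
  simp [symmetryForm, LinearMap.sum_apply]

namespace Material

variable (D : M.Material)

/-- The fourth equation. -/
def darcyForm : M.Tuple →ₗ[ℝ] (Fin M.n → Pt d → Pt d) →ₗ[ℝ] ℝ :=
  ∑ i, M.weight i • ∑ k, ((M.elem i).J ((M.elem i).shape.refVert k))⁻¹ •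
      (dotProductBilin ℝ ℝ).compl₁₂ (Matrix.mulVecLin (D.K i ((M.elem i).vert k))⁻¹ ∘ₗ
        M.velocityAt i k ∘ₗ velocityPart) (M.velocityAt i k) -
    ∑ i, (LinearMap.mul ℝ ℝ).compl₁₂ (M.valueAt i ∘ₗ pressurePart) (M.flux i)

lemma darcyForm_apply (s : M.Tuple) (ζ : Fin M.n → Pt d → Pt d) :
    D.darcyForm s ζ = ∑ i, M.weight i * ∑ k, ((M.elem i).J ((M.elem i).shape.refVert k))⁻¹ *
      ((D.K i ((M.elem i).vert k))⁻¹.mulVec (M.velocityAt i k (velocityPart s)) ⬝ᵥ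
        M.velocityAt i k ζ) -
      ∑ i, M.valueAt i (pressurePart s) * M.flux i ζ := by
  simp [darcyForm, LinearMap.sum_apply]

/-- The terms under the time derivative in the fifth equation. -/
def storageForm (Δt : ℝ) : M.Tuple →ₗ[ℝ] (Fin M.n → Pt d → ℝ) →ₗ[ℝ] ℝ :=
  ∑ i, (D.c₀ / Δt * volume.real (M.elem i).body) •
      (LinearMap.mul ℝ ℝ).compl₁₂ (M.valueAt i ∘ₗ pressurePart) (M.valueAt i) +
    (D.α / Δt) • ∑ i, M.weight i • ∑ k, (M.elem i).J ((M.elem i).shape.refVert k) •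
      frobB.compl₁₂ (D.strainAt i k) (LinearMap.toSpanSingleton ℝ (Mat d) 1 ∘ₗ M.valueAt i)

lemma storageForm_apply (Δt : ℝ) (s : M.Tuple) (w : Fin M.n → Pt d → ℝ) :
    D.storageForm Δt s w = ∑ i, D.c₀ / Δt * volume.real (M.elem i).body *
        (M.valueAt i (pressurePart s) * M.valueAt i w) +
      D.α / Δt * ∑ i, M.weight i * ∑ k, (M.elem i).J ((M.elem i).shape.refVert k) *
        frob (D.strainAt i k s) (M.valueAt i w • (1 : Mat d)) := by
  simp [storageForm, LinearMap.sum_apply, frob_smul_right]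

/-- The fifth equation. -/
def massForm (Δt : ℝ) : M.Tuple →ₗ[ℝ] (Fin M.n → Pt d → ℝ) →ₗ[ℝ] ℝ :=
  D.storageForm Δt + ∑ i, (LinearMap.mul ℝ ℝ).compl₁₂ (M.flux i ∘ₗ velocityPart) (M.valueAt i)

lemma massForm_apply (Δt : ℝ) (s : M.Tuple) (w : Fin M.n → Pt d → ℝ) :
    D.massForm Δt s w = D.storageForm Δt s w +
      ∑ i, M.flux i (velocityPart s) * M.valueAt i w := by
  simp [massForm, LinearMap.sum_apply]

end Material

/-- The load of the second equation. -/
def momentumLoad (f : Pt d → Pt d) : (Fin M.n → Pt d → Pt d) →ₗ[ℝ] ℝ :=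
  ∑ i, dotProductBilin ℝ ℝ (fun r => ∫ x in (M.elem i).body, f x r) ∘ₗ M.valueAt i

lemma momentumLoad_apply (f : Pt d → Pt d) (v : Fin M.n → Pt d → Pt d) :
    momentumLoad f v = ∑ i, (fun r => ∫ x in (M.elem i).body, f x r) ⬝ᵥ M.valueAt i v := by
  simp [momentumLoad, LinearMap.sum_apply]

/-- The source term of the fifth equation. -/
def massLoad (q : Pt d → ℝ) : (Fin M.n → Pt d → ℝ) →ₗ[ℝ] ℝ :=
  ∑ i, (∫ x in (M.elem i).body, q x) • M.valueAt i

lemma massLoad_apply (q : Pt d → ℝ) (w : Fin M.n → Pt d → ℝ) :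
    massLoad q w = ∑ i, (∫ x in (M.elem i).body, q x) * M.valueAt i w := by
  simp [massLoad, LinearMap.sum_apply]

namespace Material

variable (D : M.Material)

/-- On admissible states all integrals and quadrature sums reduce to vertex values, fluxes and cell
constants. The previous state enters only through the storage term, as a load. -/
lemma step_iff (hΩ : interior (closure Ω) = Ω) {disp pres : BoundarySplit Ω} (Δt : ℝ)
    {f : Pt d → Pt d} {q : Pt d → ℝ} (hf : MemLp f 2 (volume.restrict Ω)) {s' s : M.State}
    (hs' : M.Admissible disp pres s') (hs : M.Admissible disp pres s) :
    D.Step disp pres Δt f q s' s ↔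
      (∀ τ ∈ M.Xh disp, D.constitutiveForm s.toTuple τ = 0) ∧
      (∀ v ∈ M.Vh, momentumForm s.toTuple v = momentumLoad f v) ∧
      (∀ ξ ∈ M.Qh, symmetryForm s.toTuple ξ = 0) ∧
      (∀ ζ ∈ M.Zh pres, D.darcyForm s.toTuple ζ = 0) ∧
      ∀ w ∈ M.Wh, D.massForm Δt s.toTuple w =
        D.storageForm Δt s'.toTuple w + massLoad q w := by
  obtain ⟨hσ, hu, hγ, hz, hp⟩ := hs
  have hp' := hs'.2.2.2.2
  refine and_congr (forall₂_congr fun τ hτ => ?_) (and_congr (forall₂_congr fun v hv => ?_)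
    (and_congr (forall₂_congr fun ξ hξ => ?_) (and_congr (forall₂_congr fun ζ hζ => ?_)
      (forall₂_congr fun w hw => ?_))))
  · rw [quadr_matField, quadr_matField, l2v_divRow hτ hu, constitutiveForm_apply]
    simp only [D.strain_vert hp]
    have : ∀ i k, M.funField s.γ i ((M.elem i).vert k) =
        M.rotationAt i k (rotationPart s.toTuple) := fun i k => (M.elem i).push_vert k _
    simp only [this]
    rfl
  · rw [l2v_comm, l2v_divRow hσ hv, l2v_source hΩ hf hv, momentumForm_apply, momentumLoad_apply]
    simp only [dotProduct_comm (M.valueAt _ v) (M.stressFlux _ _)]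
    rfl
  · rw [quadr_matField_funField, symmetryForm_apply]
    rfl
  · rw [quadr_vecField, l2_divg hζ hp, darcyForm_apply]
    simp only [vecField_vert, Matrix.mulVec_smul, smul_dotProduct, smul_eq_mul]
    rfl
  · rw [l2_comm (fun i => divg (M.vecField s.z i)), l2_divg hz hw, l2_source q hw,
      massForm_apply, massLoad_apply]
    have e1 : ∀ i, ∫ x in (M.elem i).body, D.c₀ * ((M.funField s.p i x - M.funField s'.p i x) / Δt) *
        M.funField w i x = D.c₀ / Δt * volume.real (M.elem i).body *
          ((M.valueAt i s.p - M.valueAt i s'.p) * M.valueAt i w) := by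
      intro i
      simp only [funField_scalar hp, funField_scalar hp', funField_scalar hw]
      rw [setIntegral_const, smul_eq_mul]
      ring
    have e2 : M.quadr frob (fun i x => Δt⁻¹ • (D.strain s i x - D.strain s' i x))
        (fun i x => M.funField w i x • (1 : Mat d)) = Δt⁻¹ * (∑ i, M.weight i *
          ∑ k, (M.elem i).J ((M.elem i).shape.refVert k) *
            frob (D.strainAt i k s.toTuple - D.strainAt i k s'.toTuple)
              (M.valueAt i w • (1 : Mat d))) := by
      simp only [quadr, D.strain_vert hp, D.strain_vert hp', funField_scalar hw, frob_smul_left]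
      rw [Finset.mul_sum]
      refine Finset.sum_congr rfl fun i _ => ?_
      rw [mul_left_comm, Finset.mul_sum _ _ Δt⁻¹]
      refine congrArg _ (Finset.sum_congr rfl fun k _ => ?_)
      ring
    have e3 : M.l2 (fun i x => D.c₀ * ((M.funField s.p i x - M.funField s'.p i x) / Δt))
        (M.funField w) + D.α * M.quadr frob (fun i x => Δt⁻¹ • (D.strain s i x - D.strain s' i x))
          (fun i x => M.funField w i x • (1 : Mat d)) =
        D.storageForm Δt s.toTuple w - D.storageForm Δt s'.toTuple w := by
      rw [storageForm_apply, storageForm_apply, l2, e2]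
      simp only [e1, frob_sub_left, sub_mul, mul_sub, Finset.sum_sub_distrib]
      rw [div_eq_mul_inv]
      change _ = ∑ i, D.c₀ * Δt⁻¹ * volume.real (M.elem i).body * (M.valueAt i s.p * M.valueAt i w)
        + _ - (∑ i, D.c₀ * Δt⁻¹ * volume.real (M.elem i).body *
          (M.valueAt i s'.p * M.valueAt i w) + _)
      ring
    rw [e3]
    simp only [mul_comm (M.valueAt _ w) (M.flux _ _)]
    constructor <;> intro h <;> linarith [show ∑ i, M.flux i s.z * M.valueAt i w =
      ∑ i, M.flux i (velocityPart s.toTuple) * M.valueAt i w from rfl]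

end Material

end Mesh

/-! ### Unique solvability: energy argument, square system, time stepping. -/

namespace Mesh

variable {n : ℕ} {Ω : Set (Pt (n + 1))} {M : Mesh Ω}

lemma frob_comm {d : ℕ} (σ τ : Mat d) : frob σ τ = frob τ σ := by
  simp only [frob, mul_comm]

lemma sum_sum_eq_zero {m : ℕ} {v : Fin m → ℕ} {a : Fin m → ℝ} (ha : ∀ i, 0 < a i)
    {b : ∀ i, Fin (v i) → ℝ} (hb : ∀ i k, 0 ≤ b i k) (h : ∑ i, a i * ∑ k, b i k = 0) (i : Fin m)
    (k : Fin (v i)) : b i k = 0 := by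
  have h1 : ∀ i, 0 ≤ ∑ k, b i k := fun i => Finset.sum_nonneg fun k _ => hb i k
  have h2 := (Finset.sum_eq_zero_iff_of_nonneg fun i _ => mul_nonneg (ha i).le (h1 i)).1 h i
    (Finset.mem_univ i)
  have h3 := (mul_eq_zero.1 h2).resolve_left (ha i).ne'
  exact (Finset.sum_eq_zero_iff_of_nonneg fun k _ => hb i k).1 h3 k (Finset.mem_univ k)

lemma sum_sum_nonneg {m : ℕ} {v : Fin m → ℕ} {a : Fin m → ℝ} (ha : ∀ i, 0 < a i)
    {b : ∀ i, Fin (v i) → ℝ} (hb : ∀ i k, 0 ≤ b i k) : 0 ≤ ∑ i, a i * ∑ k, b i k :=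
  Finset.sum_nonneg fun i _ => mul_nonneg (ha i).le (Finset.sum_nonneg fun k _ => hb i k)

/-- The derivative of the element map is invertible at the vertices, so the reference field vanishes
there, and unisolvence applies. -/
lemma velocity_eq_zero {d : ℕ} {Ω : Set (Pt d)} {M : Mesh Ω} {Γ : BoundarySplit Ω}
    {ζ : Fin M.n → Pt d → Pt d} (hζ : ζ ∈ M.Zh Γ) (h : ∀ i k, M.velocityAt i k ζ = 0) : ζ = 0 :=
  funext fun i => Shape.eq_zero_of_mem_bdm _ (hζ.1 i) fun k =>
    (M.elem i).fderiv_refVert_injective k ((h i k).trans (map_zero _).symm)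

lemma stress_eq_zero {d : ℕ} {Ω : Set (Pt d)} {M : Mesh Ω} {Γ : BoundarySplit Ω}
    {τ : Fin M.n → Pt d → Mat d} (hτ : τ ∈ M.Xh Γ) (h : ∀ i k, M.stressAt i k τ = 0) : τ = 0 := by
  have h1 : ∀ r, (fun i y => τ i y r) = 0 := fun r =>
    velocity_eq_zero (M.mem_Xh_iff.1 hτ r) fun i k => congrFun (h i k) r
  funext i y r
  exact congrFun (congrFun (h1 r) i) y

/-- The homogeneous system has only the trivial solution. -/
theorem Material.eq_zero_of_homogeneous (hn : 1 ≤ n) (hΩo : IsOpen Ω) (hΩc : IsConnected Ω)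
    (hΩ : interior (closure Ω) = Ω) {disp pres : BoundarySplit Ω} (hM : M.Resolves disp)
    (hM' : M.Resolves pres)
    (hker : ∀ u γ, M.Kernel disp (cornerMass n) M.weight u γ → ∀ i k, γ i k = 0)
    (D : M.Material) {Δt : ℝ} (hΔt : 0 < Δt) {s : M.Tuple} (hσ : stressPart s ∈ M.Xh disp)
    (hu : displacementPart s ∈ M.Vh) (hγ : rotationPart s ∈ M.Qh)
    (hz : velocityPart s ∈ M.Zh pres) (hp : pressurePart s ∈ M.Wh)
    (h1 : ∀ τ ∈ M.Xh disp, D.constitutiveForm s τ = 0) (h2 : ∀ v ∈ M.Vh, momentumForm s v = 0)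
    (h3 : ∀ ξ ∈ M.Qh, symmetryForm s ξ = 0) (h4 : ∀ ζ ∈ M.Zh pres, D.darcyForm s ζ = 0)
    (h5 : ∀ w ∈ M.Wh, D.massForm Δt s w = 0) : s = 0 := by
  have hJ : ∀ i k, 0 < (M.elem i).J ((M.elem i).shape.refVert k) := fun i k =>
    (M.elem i).J_pos ((M.elem i).shape.refVert_mem k)
  have hA : ∀ i k τ, τ ≠ 0 → 0 < frob (D.A i ((M.elem i).vert k) τ) τ := fun i k =>
    D.posA i _ ((M.elem i).vert_mem_body k)
  have hK : ∀ i k v, v ≠ 0 → 0 < (D.K i ((M.elem i).vert k))⁻¹.mulVec v ⬝ᵥ v := fun i k v hv => by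
    have := (D.posK i _ ((M.elem i).vert_mem_body k)).inv.dotProduct_mulVec_pos hv
    rwa [star_trivial, dotProduct_comm] at this
  have hA0 : ∀ i k, 0 ≤ (M.elem i).J ((M.elem i).shape.refVert k) *
      frob (D.strainAt i k s) (D.loadAt i k s) := fun i k => by
    refine mul_nonneg (hJ i k).le ?_
    by_cases h0 : D.loadAt i k s = 0
    · rw [h0]; simp [frob]
    · exact (hA i k _ h0).le
  have hK0 : ∀ i k, 0 ≤ ((M.elem i).J ((M.elem i).shape.refVert k))⁻¹ *
      ((D.K i ((M.elem i).vert k))⁻¹.mulVec (M.velocityAt i k (velocityPart s)) ⬝ᵥ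
        M.velocityAt i k (velocityPart s)) := fun i k => by
    refine mul_nonneg (inv_pos.2 (hJ i k)).le ?_
    by_cases h0 : M.velocityAt i k (velocityPart s) = 0
    · rw [h0, dotProduct_zero]
    · exact (hK i k _ h0).le
  have e1 := h1 _ hσ
  have e2 := h2 _ hu
  have e3 := h3 _ hγ
  have e4 := h4 _ hz
  have e5 := h5 _ hp
  rw [D.constitutiveForm_apply] at e1
  rw [momentumForm_apply, neg_eq_zero] at e2
  rw [symmetryForm_apply] at e3
  rw [D.darcyForm_apply] at e4
  rw [D.massForm_apply, D.storageForm_apply] at e5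
  simp only [dotProduct_comm (M.stressFlux _ _)] at e2
  simp only [frob_comm (M.stressAt _ _ _)] at e3
  rw [e2, e3, add_zero, add_zero] at e1
  -- The load is `J⁻¹ σ + α p I`, so `σ` is `J` times the load minus `α p I`. This splits the first
  -- equation into an energy and the coupling term of the fifth.
  have hid : ∀ i k, frob (D.strainAt i k s) (M.stressAt i k (stressPart s)) =
      (M.elem i).J ((M.elem i).shape.refVert k) * frob (D.strainAt i k s) (D.loadAt i k s) -
      D.α * ((M.elem i).J ((M.elem i).shape.refVert k) *
        frob (D.strainAt i k s) (M.valueAt i (pressurePart s) • (1 : Mat (n + 1)))) := by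
    intro i k
    rw [D.loadAt_apply, frob_add_right, frob_smul_right, mul_smul, frob_smul_right]
    field_simp [(hJ i k).ne']
    ring
  simp only [hid, Finset.sum_sub_distrib, mul_sub, ← Finset.mul_sum] at e1
  simp only [mul_left_comm _ D.α, ← Finset.mul_sum] at e1
  have e6 : ∑ i, M.flux i (velocityPart s) * M.valueAt i (pressurePart s) =
      ∑ i, M.valueAt i (pressurePart s) * M.flux i (velocityPart s) := by
    simp only [mul_comm]
  rw [e6] at e5
  have p1 := sum_sum_nonneg M.weight_pos hA0
  have p2 := sum_sum_nonneg M.weight_pos hK0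
  have p3 : 0 ≤ ∑ i, D.c₀ / Δt * volume.real (M.elem i).body *
      (M.valueAt i (pressurePart s) * M.valueAt i (pressurePart s)) :=
    Finset.sum_nonneg fun i _ => mul_nonneg (mul_nonneg (div_nonneg D.c₀_nonneg hΔt.le)
      measureReal_nonneg) (mul_self_nonneg _)
  -- `e1` identifies the coupling term with the energy of the load and `e4` the flux term with the
  -- energy of the velocity. So `e5` says that a sum of three nonnegative terms is zero.
  rw [div_mul_eq_mul_div, ← sub_eq_zero.1 e1] at e5
  have p4 := div_nonneg p1 hΔt.le
  have z1 := (div_eq_zero_iff.1 (le_antisymm (by linarith) p4)).resolve_right hΔt.ne'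
  have z2 := le_antisymm (by linarith) p2
  have hload : ∀ i k, D.loadAt i k s = 0 := fun i k => by
    by_contra h0
    have := (mul_eq_zero.1 (sum_sum_eq_zero M.weight_pos hA0 z1 i k)).resolve_left (hJ i k).ne'
    exact (hA i k _ h0).ne' this
  have hvel : ∀ i k, M.velocityAt i k (velocityPart s) = 0 := fun i k => by
    by_contra h0
    have := (mul_eq_zero.1 (sum_sum_eq_zero M.weight_pos hK0 z2 i k)).resolve_left
      (inv_ne_zero (hJ i k).ne')
    exact (hK i k _ h0).ne' this
  have hz0 := velocity_eq_zero hz hvel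
  -- The storage term gives no control of the pressure if `c₀ = 0`. Instead, with zero velocity the
  -- fourth equation makes the pressure orthogonal to all discrete divergences.
  have hp0 : ∀ i, M.valueAt i (pressurePart s) = 0 := by
    refine pressure_eq_zero (p := fun i => M.valueAt i (pressurePart s)) hn hΩo hΩc hΩ hM'
      fun ζ hζ => ?_
    have := h4 ζ hζ
    rw [D.darcyForm_apply] at this
    simpa [hvel] using this
  have hσ0 : stressPart s = 0 := by
    refine stress_eq_zero hσ fun i k => ?_
    have := hload i k
    rw [D.loadAt_apply, hp0, mul_zero, zero_smul, add_zero] at this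
    exact (smul_eq_zero.1 this).resolve_left (inv_ne_zero (hJ i k).ne')
  -- With zero strain the first equation is the homogeneous problem for displacement and rotation.
  have hkernel := kernel_of_equation hΩ hγ (u := displacementPart s) (fun τ hτ => by
    have := h1 τ hτ
    rw [D.constitutiveForm_apply] at this
    have hs : ∀ i k, D.strainAt i k s = 0 := fun i k => by
      rw [Material.strainAt, LinearMap.comp_apply, hload, map_zero]
    simpa [hs, frob] using this)
  have hγ0 := hker _ _ hkernel
  have hu0 := hkernel.u_eq_zero (by omega) hΩo hΩc hΩ hM hγ0
  have hγ' : rotationPart s = 0 := by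
    funext i y r c
    exact congrFun (Shape.eq_zero_of_mem_rot _ (hγ.1 i r c) fun k =>
      congrFun (congrFun (hγ0 i k) r) c) y
  have hu' : displacementPart s = 0 := by
    funext i y r
    obtain ⟨a, ha⟩ := exists_of_mem_P0 (hu i r)
    exact (ha y).trans ((ha 0).symm.trans (congrFun (hu0 i) r))
  have hp' : pressurePart s = 0 := by
    funext i y
    obtain ⟨a, ha⟩ := exists_of_mem_P0 (hp i)
    exact (ha y).trans ((ha 0).symm.trans (hp0 i))
  exact Prod.ext hσ0 (Prod.ext hu' (Prod.ext hγ' (Prod.ext hz0 hp')))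

/-- The system is square, because each equation is tested with the space of one of the unknowns and
a space has the dimension of its dual. -/
lemma surjective_of_injective_dual {V₁ V₂ V₃ V₄ V₅ : Type*} [AddCommGroup V₁] [Module ℝ V₁]
    [FiniteDimensional ℝ V₁] [AddCommGroup V₂] [Module ℝ V₂] [FiniteDimensional ℝ V₂]
    [AddCommGroup V₃] [Module ℝ V₃] [FiniteDimensional ℝ V₃] [AddCommGroup V₄] [Module ℝ V₄]
    [FiniteDimensional ℝ V₄] [AddCommGroup V₅] [Module ℝ V₅] [FiniteDimensional ℝ V₅]
    (F : (V₁ × V₂ × V₃ × V₄ × V₅) →ₗ[ℝ] (Module.Dual ℝ V₁ × Module.Dual ℝ V₂ × Module.Dual ℝ V₃ ×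
      Module.Dual ℝ V₄ × Module.Dual ℝ V₅)) (hF : Function.Injective F) :
    Function.Surjective F := by
  refine (LinearMap.injective_iff_surjective_of_finrank_eq_finrank ?_).1 hF
  simp only [Module.finrank_prod, Subspace.dual_finrank_eq]

/-- One step of the scheme is uniquely solvable. -/
theorem Material.existsUnique_step (hn : 1 ≤ n) (hΩo : IsOpen Ω) (hΩc : IsConnected Ω)
    (hΩ : interior (closure Ω) = Ω) {disp pres : BoundarySplit Ω} (hM : M.Resolves disp)
    (hM' : M.Resolves pres)
    (hker : ∀ u γ, M.Kernel disp (cornerMass n) M.weight u γ → ∀ i k, γ i k = 0)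
    (D : M.Material) {Δt : ℝ} (hΔt : 0 < Δt) {f : Pt (n + 1) → Pt (n + 1)} {q : Pt (n + 1) → ℝ}
    (hf : MemLp f 2 (volume.restrict Ω)) {s' : M.State} (hs' : M.Admissible disp pres s') :
    ∃! s, M.Admissible disp pres s ∧ D.Step disp pres Δt f q s' s := by
  let ι : (M.stress disp × M.displacement × M.rotation × M.velocity pres × M.pressure) →ₗ[ℝ]
      M.Tuple := (M.stress disp).subtype.prodMap (M.displacement.subtype.prodMap
        (M.rotation.subtype.prodMap ((M.velocity pres).subtype.prodMap M.pressure.subtype)))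
  let F : (M.stress disp × M.displacement × M.rotation × M.velocity pres × M.pressure) →ₗ[ℝ]
      (Module.Dual ℝ (M.stress disp) × Module.Dual ℝ M.displacement × Module.Dual ℝ M.rotation ×
        Module.Dual ℝ (M.velocity pres) × Module.Dual ℝ M.pressure) :=
    ((D.constitutiveForm ∘ₗ ι).compl₂ (M.stress disp).subtype).prod
      (((momentumForm ∘ₗ ι).compl₂ M.displacement.subtype).prod
        (((symmetryForm ∘ₗ ι).compl₂ M.rotation.subtype).prod
          (((D.darcyForm ∘ₗ ι).compl₂ (M.velocity pres).subtype).prod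
            ((D.massForm Δt ∘ₗ ι).compl₂ M.pressure.subtype))))
  have hinj : Function.Injective F := by
    refine (injective_iff_map_eq_zero F).2 fun w hw => ?_
    have g1 : (F w).1 = 0 := by rw [hw]; rfl
    have g2 : (F w).2.1 = 0 := by rw [hw]; rfl
    have g3 : (F w).2.2.1 = 0 := by rw [hw]; rfl
    have g4 : (F w).2.2.2.1 = 0 := by rw [hw]; rfl
    have g5 : (F w).2.2.2.2 = 0 := by rw [hw]; rfl
    have h0 : ι w = 0 := D.eq_zero_of_homogeneous hn hΩo hΩc hΩ hM hM' hker hΔt (s := ι w)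
      w.1.2 w.2.1.2 w.2.2.1.2 w.2.2.2.1.2 w.2.2.2.2.2
      (fun τ hτ => LinearMap.congr_fun g1 ⟨τ, hτ⟩) (fun v hv => LinearMap.congr_fun g2 ⟨v, hv⟩)
      (fun ξ hξ => LinearMap.congr_fun g3 ⟨ξ, hξ⟩) (fun ζ hζ => LinearMap.congr_fun g4 ⟨ζ, hζ⟩)
      (fun p hp => LinearMap.congr_fun g5 ⟨p, hp⟩)
    exact Prod.ext (Subtype.ext (congrArg (·.1) h0)) (Prod.ext (Subtype.ext (congrArg (·.2.1) h0))
      (Prod.ext (Subtype.ext (congrArg (·.2.2.1) h0)) (Prod.ext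
        (Subtype.ext (congrArg (·.2.2.2.1) h0)) (Subtype.ext (congrArg (·.2.2.2.2) h0)))))
  have hsurj : Function.Surjective F := surjective_of_injective_dual F hinj
  -- The right-hand side has entries only in the second and the fifth equation: the body force, and
  -- the source together with the storage of the previous state.
  obtain ⟨w, hw⟩ := hsurj (0, momentumLoad f ∘ₗ M.displacement.subtype, 0, 0,
    (D.storageForm Δt s'.toTuple + massLoad q) ∘ₗ M.pressure.subtype)
  have hadm : M.Admissible disp pres ⟨w.1, w.2.1, w.2.2.1, w.2.2.2.1, w.2.2.2.2⟩ :=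
    ⟨w.1.2, w.2.1.2, w.2.2.1.2, w.2.2.2.1.2, w.2.2.2.2.2⟩
  have hstep := (D.step_iff hΩ Δt hf (q := q) hs' hadm).2
    ⟨fun τ hτ => LinearMap.congr_fun (congrArg (·.1) hw) ⟨τ, hτ⟩,
      fun v hv => LinearMap.congr_fun (congrArg (·.2.1) hw) ⟨v, hv⟩,
      fun ξ hξ => LinearMap.congr_fun (congrArg (·.2.2.1) hw) ⟨ξ, hξ⟩,
      fun ζ hζ => LinearMap.congr_fun (congrArg (·.2.2.2.1) hw) ⟨ζ, hζ⟩,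
      fun p hp => LinearMap.congr_fun (congrArg (·.2.2.2.2) hw) ⟨p, hp⟩⟩
  refine ⟨_, ⟨hadm, hstep⟩, ?_⟩
  rintro s ⟨hs, hst⟩
  set s₁ : M.State := ⟨w.1, w.2.1, w.2.2.1, w.2.2.2.1, w.2.2.2.2⟩
  obtain ⟨a1, a2, a3, a4, a5⟩ := (D.step_iff hΩ Δt hf hs' hs).1 hst
  obtain ⟨b1, b2, b3, b4, b5⟩ := (D.step_iff hΩ Δt hf hs' hadm).1 hstep
  -- The loads of two solutions agree, so their difference solves the homogeneous system.
  have h0 : s.toTuple - s₁.toTuple = 0 := by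
    refine D.eq_zero_of_homogeneous hn hΩo hΩc hΩ hM hM' hker hΔt
      ((M.stress disp).sub_mem hs.1 hadm.1) (M.displacement.sub_mem hs.2.1 hadm.2.1)
      (M.rotation.sub_mem hs.2.2.1 hadm.2.2.1) ((M.velocity pres).sub_mem hs.2.2.2.1 hadm.2.2.2.1)
      (M.pressure.sub_mem hs.2.2.2.2 hadm.2.2.2.2) ?_ ?_ ?_ ?_ ?_
    · intro τ hτ; rw [map_sub, LinearMap.sub_apply, a1 τ hτ, b1 τ hτ, sub_zero]
    · intro v hv; rw [map_sub, LinearMap.sub_apply, a2 v hv, b2 v hv, sub_self]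
    · intro ξ hξ; rw [map_sub, LinearMap.sub_apply, a3 ξ hξ, b3 ξ hξ, sub_zero]
    · intro ζ hζ; rw [map_sub, LinearMap.sub_apply, a4 ζ hζ, b4 ζ hζ, sub_zero]
    · intro p hp; rw [map_sub, LinearMap.sub_apply, a5 p hp, b5 p hp, sub_self]
  have h1 := sub_eq_zero.1 h0
  exact State.ext (congrArg (·.1) h1) (congrArg (·.2.1) h1) (congrArg (·.2.2.1) h1)
    (congrArg (·.2.2.2.1) h1) (congrArg (·.2.2.2.2) h1)

/-- A sequence of uniquely solvable steps. -/
lemma existsUnique_sequence {α : Type*} {N : ℕ} {P : α → Prop} {R : Fin N → α → α → Prop}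
    (h : ∀ n s', P s' → ∃! s, P s ∧ R n s' s) {s₀ : α} (h₀ : P s₀) :
    ∃! s : Fin (N + 1) → α, s 0 = s₀ ∧ ∀ n : Fin N, P (s n.succ) ∧ R n (s n.castSucc) (s n.succ) := by
  choose next hnext huniq using fun (n : Fin N) (s' : {s // P s}) => h n s'.1 s'.2
  let s : Fin (N + 1) → {s // P s} := fun n =>
    Fin.induction (motive := fun _ => {s // P s}) ⟨s₀, h₀⟩
      (fun n s' => ⟨next n s', (hnext n s').1⟩) n
  have hs0 : s 0 = ⟨s₀, h₀⟩ := rfl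
  have hs : ∀ n : Fin N, (s n.succ).1 = next n (s n.castSucc) := fun n => by
    simp only [s, Fin.induction_succ]
  refine ⟨fun n => (s n).1, ⟨congrArg _ hs0, fun n => ⟨(s n.succ).2, ?_⟩⟩, ?_⟩
  · simp only [hs]; exact (hnext n (s n.castSucc)).2
  · rintro s' ⟨h1, h2⟩
    funext n
    induction n using Fin.induction with
    | zero => rw [h1, hs0]
    | succ n ih =>
      rw [hs]
      refine huniq n (s n.castSucc) _ ⟨(h2 n).1, ?_⟩
      rw [← ih]
      exact (h2 n).2

/-- The scheme is uniquely solvable if the discrete kernel is trivial. -/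
theorem Material.existsUnique_steps (hn : 1 ≤ n) (hΩo : IsOpen Ω) (hΩc : IsConnected Ω)
    (hΩ : interior (closure Ω) = Ω) {disp pres : BoundarySplit Ω} (hM : M.Resolves disp)
    (hM' : M.Resolves pres)
    (hker : ∀ u γ, M.Kernel disp (cornerMass n) M.weight u γ → ∀ i k, γ i k = 0)
    (D : M.Material) (T : ℝ) (f : ℝ → Pt (n + 1) → Pt (n + 1)) (q : ℝ → Pt (n + 1) → ℝ)
    (hf : ∀ s ∈ Set.Icc 0 T, MemLp (f s) 2 (volume.restrict Ω)) {N : ℕ} {t : Fin (N + 1) → ℝ}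
    (ht : StrictMono t) (h0 : t 0 = 0) (hT : t (Fin.last N) = T) {s₀ : M.State}
    (hs₀ : M.Admissible disp pres s₀) : ∃! s : Fin (N + 1) → M.State, s 0 = s₀ ∧
      ∀ n : Fin N, M.Admissible disp pres (s n.succ) ∧
        D.Step disp pres (t n.succ - t n.castSucc) (f (t n.succ)) (q (t n.succ))
          (s n.castSucc) (s n.succ) := by
  refine existsUnique_sequence (P := M.Admissible disp pres) (fun k s' hs' => ?_) hs₀
  refine D.existsUnique_step hn hΩo hΩc hΩ hM hM' hker
    (sub_pos.2 (ht k.castSucc_lt_succ)) (hf _ ⟨?_, ?_⟩) hs'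
  · rw [← h0]; exact ht.monotone (Fin.zero_le _)
  · rw [← hT]; exact ht.monotone (Fin.le_last _)

end Mesh

end MSMFE

end

theorem lemma7p1 (d : ℕ) (hd : d = 2 ∨ d = 3)
    (Ω : Set (MSMFE.Pt d)) (hΩ_open : IsOpen Ω) (hΩ_conn : IsConnected Ω)
    (hΩ_bdd : Bornology.IsBounded Ω) (hΩ_reg : interior (closure Ω) = Ω)
    (disp : MSMFE.BoundarySplit Ω) (κ : ℝ) (hκ : 0 < κ) :
    ∃ h₀ : ℝ, 0 < h₀ ∧
      ∀ (pres : MSMFE.BoundarySplit Ω) (M : MSMFE.Mesh Ω),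
        M.ShapeRegular κ → M.Resolves disp → M.Resolves pres →
        M.AtMostOneNeumannFacet disp →
        (M.IsSimplicial ∨ M.size ≤ h₀) →
        ∀ (D : M.Material) (T : ℝ) (f : ℝ → MSMFE.Pt d → MSMFE.Pt d) (q : ℝ → MSMFE.Pt d → ℝ),
          (∀ s ∈ Set.Icc 0 T, MeasureTheory.MemLp (f s) 2 (MeasureTheory.volume.restrict Ω)) →
          (∀ s ∈ Set.Icc 0 T, MeasureTheory.MemLp (q s) 2 (MeasureTheory.volume.restrict Ω)) →
          ∀ (N : ℕ) (t : Fin (N + 1) → ℝ), StrictMono t → t 0 = 0 → t (Fin.last N) = T →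
          ∀ s₀ : M.State, M.Admissible disp pres s₀ →
            ∃! s : Fin (N + 1) → M.State,
              s 0 = s₀ ∧
              ∀ n : Fin N, M.Admissible disp pres (s n.succ) ∧
                D.Step disp pres (t n.succ - t n.castSucc) (f (t n.succ)) (q (t n.succ))
                  (s n.castSucc) (s n.succ) := by
  rcases hd with rfl | rfl
  · obtain ⟨h₀, hh₀, H⟩ := MSMFE.Mesh.exists_size_kernel_eq_zero hΩ_open hΩ_conn hΩ_reg disp hκ
    refine ⟨h₀, hh₀, fun pres M hreg hM hM' hN hmesh D T f q hf _ N t ht h0 hT s₀ hs₀ => ?_⟩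
    refine MSMFE.Mesh.Material.existsUnique_steps (n := 1) le_rfl hΩ_open hΩ_conn hΩ_reg hM hM'
      (fun u γ hker => ?_) D T f q hf ht h0 hT hs₀
    rcases hmesh with hs | hs
    · exact hker.eq_zero_of_simplicial hΩ_open hΩ_conn hΩ_reg hM hN hs
    · exact H M hreg hM hN hs _ _ _ _ hker
  -- In space all elements are tetrahedra, so any positive number serves as `h₀`. The quadrature
  -- weights are then all equal (`hq`), as the argument with axial vectors requires.
  · refine ⟨1, one_pos, fun pres M _ hM hM' hN _ D T f q hf _ N t ht h0 hT s₀ hs₀ => ?_⟩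
    have hq : ∀ (s s' : MSMFE.Shape 3), MeasureTheory.volume.real s.ref / (s.nv : ℝ) =
        MeasureTheory.volume.real s'.ref / (s'.nv : ℝ) := by
      intro s s'
      cases s
      cases s'
      rfl
    exact MSMFE.Mesh.Material.existsUnique_steps (n := 2) one_le_two hΩ_open hΩ_conn hΩ_reg hM hM'
      (fun u γ hker => hker.eq_zero_of_tetrahedral (fun i j => hq _ _) hΩ_open hΩ_conn hΩ_reg hM hN)
      D T f q hf ht h0 hT hs₀
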